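/- **Graphs.** Consider finite directed graphs with black and white vertices in which every vertex has exactly one outgoing edge and $n\ge 0$ ordered incoming edges ($n\geq 3$ for white vertices; the valency is $n+1$), loops being allowed. There are incoming and outgoing legs (edges with one free end, the other end being a vertex), and each of the two kinds is labelled by consecutive integers. An *$\mathcal A$-graph* is such a graph in which no edge joins a univalent black vertex to a black vertex. An orientation is a numbering of the vertices, up to renumberings that induce an even permutation of the black vertices. Let $\mathcal G^k_{p,q}$ be the real vector space spanned by oriented $\mathcal A$-graphs with $k$ black vertices, any number of white vertices, $p$ incoming and $q$ outgoing legs, modulo isomorphism and the relations: $(\Gamma,-or)=-(\Gamma,or)$; the order of the edges coming into a black vertex is inessential; the incoming edges $1,\dots ,n$ of a white vertex obey (S1) antisymmetry in $n-1,n$; (S2) the sum over cyclic permutations of $n-2,n-1,n$ is zero; (S3) for $n\ge4$ the sum over cyclic permutations of $n-3,n-1,n$ is zero; (S4) total symmetry in $1,\dots ,n-3$. **Differential.** Write $Q_n$ and $R_n$ for a black and a white vertex with $n$ incoming edges. The operator $\partial:\mathcal G^k_{p,q}\to\mathcal G^{k+1}_{p,q}$ is $\partial\Gamma=\sum_v\Gamma_v$,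 where $v$ is made the first vertex and then replaced by $\partial v$, the new vertices coming first in the numbering; graphs that are not $\mathcal A$-graphs are dropped. Here, with subscripts in parentheses giving the numbering, - $\partial Q_0=\partial Q_2=0$; - $\partial Q_1$ is the string of two bivalent black vertices, numbered along the direction of the edges, minus $\tfrac12R_3(X,Q_{0(2)},Q_{0(1)})$; - for $n\ge3$, $\partial Q_n=\sum_{I'\sqcup I''=\{1,\dots,n\},\,|I'|>0,\,|I''|>1}Q_{(1)}(X_{I'},Q_{(2)}(X_{I''}))$; - $\partial R_n=R_{n+1}(Q_0,X_1,\dots,X_n)-Q_1(R_n(X_1,\dots,X_n))+\sum_kR_n(\dots,Q_1(X_k),\dots)+C_n$, where in each of the first three terms the black vertex is counted first. The $C_n$ $(n\ge3)$ are linear combinations of connected graphs with $n$ incoming legs, one outgoing leg, one black vertex and at least two white vertices, which have the symmetries (S1)–(S4) in the incoming legs and are such that $\partial^2=0$; they are otherwise arbitrary. **The subcomplex.** Let $\bar{\mathcal G}^{(4)}$ be spanned by all connected $\mathcal A$-graphs other than the following: (1) the single univalent black vertex; (2) graphs composed of bivalent black vertices and of "bivalent white vertices", i.e. white vertices with three incoming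 edges exactly two of which come from univalent black vertices; (3) graphs all of whose vertices are black of valency $\geq3$. **Theorem 2.** The operator $\partial$ is well defined, $\bar{\mathcal G}^{(4)}$ is a subcomplex, and it is acyclic: for all $p,q,k\ge 0$, every $x\in\bar{\mathcal G}^{(4)}$ of degree $k$, with $p$ incoming and $q$ outgoing legs, such that $\partial x=0$ is of the form $x=\partial y$ with $y\in\bar{\mathcal G}^{(4)}$ of degree $k-1$ and with the same legs (so $x=0$ if $k=0$). -/

import Mathlib

namespace GraphComplex

noncomputable section

/-- Raw combinatorial data of a directed graph with black and white vertices, `p` incoming legs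
and `q` outgoing legs, both labelled. Every vertex has exactly one outgoing edge and `ar v` ordered
incoming edges. `inp v i` says where the `i`-th incoming edge of `v` comes from: from the output of
a vertex (loops are allowed) or from an incoming leg. `out j` is the vertex whose outgoing edge is
the `j`-th outgoing leg. `pos` numbers the vertices. -/
structure Diagram (p q : ℕ) : Type 1 where
  V : Type
  [fintypeV : Fintype V]
  pos : V → ℕ
  black : V → Bool
  ar : V → ℕ
  inp : (v : V) → Fin (ar v) → V ⊕ Fin p
  out : Fin q → V

attribute [instance] Diagram.fintypeV

namespace Diagram

variable {p q n : ℕ}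

/-- For every end (an input slot of a vertex, or an outgoing leg) the beginning of the edge
that arrives there. -/
def feed (Γ : Diagram p q) : (Σ v : Γ.V, Fin (Γ.ar v)) ⊕ Fin q → Γ.V ⊕ Fin p :=
  Sum.elim (fun s => Γ.inp s.1 s.2) (fun j => Sum.inl (Γ.out j))

/-- A univalent black vertex: no incoming edge, one outgoing edge. -/
def IsUnivalentBlack (Γ : Diagram p q) (v : Γ.V) : Prop := Γ.black v = true ∧ Γ.ar v = 0

/-- The admissible graphs: edges match the beginnings with the ends bijectively, the vertices are
numbered without repetition, white vertices have at least three incoming edges, and no edge joins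
a univalent black vertex with a black vertex. -/
structure IsAGraph (Γ : Diagram p q) : Prop where
  feed_bijective : Function.Bijective Γ.feed
  pos_injective : Function.Injective Γ.pos
  three_le_ar : ∀ v, Γ.black v = false → 3 ≤ Γ.ar v
  not_black : ∀ (v : Γ.V) (i : Fin (Γ.ar v)) (u : Γ.V),
    Γ.inp v i = Sum.inl u → Γ.IsUnivalentBlack u → Γ.black v = false

/-- Connected graphs (in particular, there is at least one vertex). -/
def Connected (Γ : Diagram p q) : Prop :=
  (SimpleGraph.fromRel fun u w : Γ.V => ∃ i, Γ.inp w i = Sum.inl u).Connected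

/-- The number of black vertices. -/
def numBlack (Γ : Diagram p q) : ℕ := Nat.card {v : Γ.V // Γ.black v = true}

/-- The number of white vertices. -/
def numWhite (Γ : Diagram p q) : ℕ := Nat.card {v : Γ.V // Γ.black v = false}

/-! ### Isomorphisms, orientation and the symmetries of the vertices -/

/-- An isomorphism of graphs. It may permute the incoming edges of black vertices,
but keeps the order of the incoming edges of white ones. Labels of legs are preserved. It need not
be compatible with the numbering of the vertices. -/
structure Iso (Γ Γ' : Diagram p q) where
  toEquiv : Γ.V ≃ Γ'.V
  black_eq : ∀ v, Γ'.black (toEquiv v) = Γ.black v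
  slots : ∀ v, Fin (Γ.ar v) ≃ Fin (Γ'.ar (toEquiv v))
  slots_white : ∀ v, Γ.black v = false → ∀ i, (slots v i : ℕ) = i
  inp_eq : ∀ v i, Γ'.inp (toEquiv v) (slots v i) = Sum.map toEquiv id (Γ.inp v i)
  out_eq : ∀ j, Γ'.out j = toEquiv (Γ.out j)

/-- The sign by which an isomorphism changes the orientation: the parity of the number of pairs of
black vertices whose order is reversed. -/
def Iso.sign {Γ Γ' : Diagram p q} (e : Iso Γ Γ') : ℝ :=
  (-1) ^ Nat.card {x : Γ.V × Γ.V // Γ.black x.1 = true ∧ Γ.black x.2 = true ∧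
    Γ.pos x.1 < Γ.pos x.2 ∧ Γ'.pos (e.toEquiv x.2) < Γ'.pos (e.toEquiv x.1)}

open Classical in
/-- Permute the incoming edges of the vertex `v`: the new `i`-th incoming edge is the old
`σ i`-th one. -/
def permute (Γ : Diagram p q) (v : Γ.V) (σ : Equiv.Perm (Fin (Γ.ar v))) : Diagram p q where
  V := Γ.V
  pos := Γ.pos
  black := Γ.black
  ar := Γ.ar
  inp := Function.update Γ.inp v (Γ.inp v ∘ σ)
  out := Γ.out

/-- Relabel the incoming legs: the leg `l` becomes the leg `σ l`. -/
def relabel (σ : Equiv.Perm (Fin p)) (Γ : Diagram p q) : Diagram p q where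
  V := Γ.V
  pos := Γ.pos
  black := Γ.black
  ar := Γ.ar
  inp := fun v i => Sum.map id σ (Γ.inp v i)
  out := Γ.out

end Diagram

/-- The sum of the three cyclic permutations of the places `a`, `b`, `c`. -/
def cyclicSum {n : ℕ} (a b c : Fin n) : Equiv.Perm (Fin n) →₀ ℝ :=
  Finsupp.single 1 1 + Finsupp.single (Equiv.swap a b * Equiv.swap b c) 1
    + Finsupp.single (Equiv.swap b c * Equiv.swap a b) 1

/-- The linear relations between the permutations of the arguments `X₁, …, Xₙ` of the tensor `Rₙ`
(the argument `X_m` has index `m - 1`): antisymmetry in the last two arguments, the first Bianchi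
identity in the last three, for `n ≥ 4` the second Bianchi identity in `X_{n-3}`, `X_{n-1}`, `Xₙ`,
and the total symmetry in `X₁, …, X_{n-3}`. -/
inductive WhiteSymmetry (n : ℕ) : (Equiv.Perm (Fin n) →₀ ℝ) → Prop
  | antisymm (b c : Fin n) (hb : (b : ℕ) + 2 = n) (hc : (c : ℕ) + 1 = n) :
      WhiteSymmetry n (Finsupp.single 1 1 + Finsupp.single (Equiv.swap b c) 1)
  | bianchi₁ (a b c : Fin n) (ha : (a : ℕ) + 3 = n) (hb : (b : ℕ) + 2 = n)
      (hc : (c : ℕ) + 1 = n) : WhiteSymmetry n (cyclicSum a b c)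
  | bianchi₂ (a b c : Fin n) (ha : (a : ℕ) + 4 = n) (hb : (b : ℕ) + 2 = n)
      (hc : (c : ℕ) + 1 = n) : WhiteSymmetry n (cyclicSum a b c)
  | symm (i j : Fin n) (hi : (i : ℕ) + 4 ≤ n) (hj : (j : ℕ) + 4 ≤ n) :
      WhiteSymmetry n (Finsupp.single 1 1 - Finsupp.single (Equiv.swap i j) 1)

open Diagram

/-- The relations. Diagrams that are not admissible are dropped; an isomorphism multiplies by its
sign (this comprises the change of orientation and the total symmetry of the black vertices); the
incoming edges of a white vertex obey the symmetries of the tensors `Rₙ`. -/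
def relations (p q : ℕ) : Submodule ℝ (Diagram p q →₀ ℝ) :=
  Submodule.span ℝ
    ({x | ∃ Γ : Diagram p q, ¬ Γ.IsAGraph ∧ x = Finsupp.single Γ 1} ∪
     {x | ∃ (Γ Γ' : Diagram p q) (e : Iso Γ Γ'), Γ.IsAGraph ∧ Γ'.IsAGraph ∧
        x = Finsupp.single Γ' 1 - Finsupp.single Γ e.sign} ∪
     {x | ∃ (Γ : Diagram p q) (v : Γ.V) (c : Equiv.Perm (Fin (Γ.ar v)) →₀ ℝ),
        Γ.IsAGraph ∧ Γ.black v = false ∧ WhiteSymmetry (Γ.ar v) c ∧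
        x = c.sum fun σ t => Finsupp.single (Γ.permute v σ) t})

/-- The space of graphs with `p` incoming and `q` outgoing legs: the real vector space spanned by
the admissible graphs, modulo the relations. -/
abbrev Space (p q : ℕ) : Type 1 := (Diagram p q →₀ ℝ) ⧸ relations p q

/-- The class of a graph. -/
def cls {p q : ℕ} (Γ : Diagram p q) : Space p q := (relations p q).mkQ (Finsupp.single Γ 1)

/-! ### The coboundary operator -/

namespace Diagram

variable {p q n : ℕ}

open Classical in
/-- Replace the vertex `v` of `Γ` by the graph `g`: the legs of `g` are glued to the edges of `v`.
The vertices of `g` come first in the numbering, then the other vertices of `Γ`. -/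
def subst (Γ : Diagram p q) (v : Γ.V) (g : Diagram (Γ.ar v) 1) : Diagram p q :=
  -- the new vertex at which an old vertex output begins
  let vert : Γ.V → g.V ⊕ {u : Γ.V // u ≠ v} := fun u =>
    if h : u = v then Sum.inl (g.out 0) else Sum.inr ⟨u, h⟩
  { V := g.V ⊕ {u : Γ.V // u ≠ v}
    pos := Sum.elim g.pos fun u => Finset.univ.sup g.pos + 1 + Γ.pos u
    black := Sum.elim g.black fun u => Γ.black u
    ar := Sum.elim g.ar fun u => Γ.ar u
    inp := fun x => match x with
      | Sum.inl y => fun i =>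
          Sum.elim (fun z => Sum.inl (Sum.inl z)) (fun l => Sum.map vert id (Γ.inp v l)) (g.inp y i)
      | Sum.inr u => fun i => Sum.map vert id (Γ.inp u i)
    out := fun j => vert (Γ.out j) }

/-- The sign of the reordering that makes `v` the first vertex. -/
def frontSign (Γ : Diagram p q) (v : Γ.V) : ℝ :=
  if Γ.black v = true then
    (-1) ^ Nat.card {u : Γ.V // Γ.black u = true ∧ Γ.pos u < Γ.pos v}
  else 1

end Diagram

/-- A string of two bivalent black vertices, numbered along the direction of the edges. -/
def blackString : Diagram 1 1 where
  V := Fin 2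
  pos := fun v => v
  black := fun _ => true
  ar := fun _ => 1
  inp := ![fun _ => Sum.inr 0, fun _ => Sum.inl 0]
  out := fun _ => 1

/-- The graph of `R₃(X, Q, Q)`: the white vertex is number three (here `2`), the second argument is
the black vertex number two (here `1`), the third one the black vertex number one (here `0`). -/
def curvatureGraph : Diagram 1 1 where
  V := Fin 3
  pos := fun v => v
  black := ![true, true, false]
  ar := ![0, 0, 3]
  inp := fun v => match v with
    | 0 => Fin.elim0
    | 1 => Fin.elim0
    | 2 => ![Sum.inr 0, Sum.inl 1, Sum.inl 0]
  out := fun _ => 2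

/-- Two black vertices. The lower one (`false`, the first in the order) has the outgoing leg,
and its incoming edges are the legs not in `I` and the edge from the upper one (`true`, the second
in the order), whose incoming edges are the legs in `I`. -/
def blackSplit (n : ℕ) (I : Finset (Fin n)) : Diagram n 1 where
  V := Bool
  pos := fun v => if v then 1 else 0
  black := fun _ => true
  ar := fun v => match v with
    | false => Iᶜ.card + 1
    | true => I.card
  inp := fun v => match v with
    | false => Fin.snoc (α := fun _ => Bool ⊕ Fin n)
        (fun i => Sum.inr (Iᶜ.orderEmbOfFin rfl i)) (Sum.inl true)
    | true => fun i => Sum.inr (I.orderEmbOfFin rfl i)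
  out := fun _ => false

/-- `R_{n+1}(Q, X₁, …, Xₙ)`: a univalent black vertex (`false`, the first in the order) is attached
to the first input of a white vertex. -/
def whiteQ (n : ℕ) : Diagram n 1 where
  V := Bool
  pos := fun v => if v then 1 else 0
  black := fun v => !v
  ar := fun v => match v with
    | false => 0
    | true => n + 1
  inp := fun v => match v with
    | false => Fin.elim0
    | true => Fin.cons (α := fun _ => Bool ⊕ Fin n) (Sum.inl false) (fun i => Sum.inr i)
  out := fun _ => true

/-- `Q₁(Rₙ(X₁, …, Xₙ))`: a bivalent black vertex (`true`) on the outgoing edge of a white one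
(`false`). -/
def whiteOut (n : ℕ) : Diagram n 1 where
  V := Bool
  pos := fun v => if v then 1 else 0
  black := fun v => v
  ar := fun v => match v with
    | false => n
    | true => 1
  inp := fun v => match v with
    | false => fun i => Sum.inr i
    | true => fun _ => Sum.inl false
  out := fun _ => true

/-- `Rₙ(…, Q₁(X_k), …)`: a bivalent black vertex (`false`) on the `k`-th incoming edge of a white
one (`true`). -/
def whiteIn (n : ℕ) (k : Fin n) : Diagram n 1 where
  V := Bool
  pos := fun v => if v then 1 else 0
  black := fun v => !v
  ar := fun v => match v with
    | false => 1
    | true => n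
  inp := fun v => match v with
    | false => fun _ => Sum.inr k
    | true => fun i => if i = k then Sum.inl false else Sum.inr i
  out := fun _ => true

/-- The action of the coboundary operator on a vertex, as a combination of graphs with `n` incoming
legs and one outgoing leg; `C n` is the combination of graphs with two or more white vertices that
enters the image of the white vertex with `n` incoming edges. -/
def vertexDiff (C : (n : ℕ) → Diagram n 1 →₀ ℝ) : (black : Bool) → (n : ℕ) → Diagram n 1 →₀ ℝ
  | true, 0 => 0
  | true, 1 => Finsupp.single blackString 1 - Finsupp.single curvatureGraph (1 / 2)
  | true, 2 => 0
  | true, n + 3 =>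
      ∑ I : Finset (Fin (n + 3)) with 2 ≤ I.card ∧ 1 ≤ Iᶜ.card,
        Finsupp.single (blackSplit (n + 3) I) 1
  | false, n =>
      Finsupp.single (whiteQ n) 1 - Finsupp.single (whiteOut n) 1
        + ∑ k : Fin n, Finsupp.single (whiteIn n k) 1 + C n

open Classical in
/-- `Γ ↦ ∑ v, Γ_v`, where `Γ_v` arises from the admissible graph `Γ` by replacing the vertex `v`,
once it has been made the first one, by its image under `vertexDiff`. -/
def graphDiff (C : (n : ℕ) → Diagram n 1 →₀ ℝ) (p q : ℕ) :
    (Diagram p q →₀ ℝ) →ₗ[ℝ] (Diagram p q →₀ ℝ) :=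
  Finsupp.linearCombination ℝ fun Γ =>
    if Γ.IsAGraph then
      ∑ v : Γ.V, Γ.frontSign v • (vertexDiff C (Γ.black v) (Γ.ar v)).mapDomain (Γ.subst v)
    else 0

/-- The requirements on the terms `C n` in the image of the white vertices: they are combinations
of connected graphs with one black and at least two white vertices, they have the symmetries of
`Rₙ` in the incoming legs, and the resulting operator squares to zero on graphs. -/
structure IsCompletion (C : (n : ℕ) → Diagram n 1 →₀ ℝ) : Prop where
  supported : ∀ n, 3 ≤ n → ∀ g ∈ (C n).support,
    g.IsAGraph ∧ g.Connected ∧ g.numBlack = 1 ∧ 2 ≤ g.numWhite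
  symmetric : ∀ n, 3 ≤ n → ∀ c : Equiv.Perm (Fin n) →₀ ℝ, WhiteSymmetry n c →
    (c.sum fun σ t => t • (C n).mapDomain (Diagram.relabel σ)) ∈ relations n 1
  sq_zero : ∀ (p q : ℕ) (Γ : Diagram p q), Γ.IsAGraph →
    graphDiff C p q (graphDiff C p q (Finsupp.single Γ 1)) ∈ relations p q

/-! ### The four types of connected graphs -/

namespace Diagram

variable {p q : ℕ}

/-- Only univalent black vertices; a connected such graph is a single vertex with its leg. -/
def IsType1 (Γ : Diagram p q) : Prop := ∀ v, Γ.IsUnivalentBlack v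

/-- Composed of bivalent black vertices and of "bivalent white vertices", that is, white vertices
with three incoming edges of which exactly two come from univalent black vertices. -/
def IsType2 (Γ : Diagram p q) : Prop :=
  ¬ Γ.IsType1 ∧ ∀ v,
    (Γ.black v = true ∧ Γ.ar v = 1) ∨ Γ.IsUnivalentBlack v ∨
    (Γ.black v = false ∧ Γ.ar v = 3 ∧
      Nat.card {i : Fin (Γ.ar v) // ∃ u, Γ.inp v i = Sum.inl u ∧ Γ.IsUnivalentBlack u} = 2)

/-- Only black vertices of valency at least three (at least two incoming edges). -/
def IsType3 (Γ : Diagram p q) : Prop := ∀ v, Γ.black v = true ∧ 2 ≤ Γ.ar v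

/-- All other graphs. -/
def IsType4 (Γ : Diagram p q) : Prop := ¬ Γ.IsType1 ∧ ¬ Γ.IsType2 ∧ ¬ Γ.IsType3

end Diagram

/-- The degree `k` part, with `p` incoming and `q` outgoing legs, of the fourth summand of the
connected graph complex. -/
def G4 (p q k : ℕ) : Submodule ℝ (Space p q) :=
  Submodule.span ℝ
    {x | ∃ Γ : Diagram p q, Γ.IsAGraph ∧ Γ.Connected ∧ Γ.numBlack = k ∧ Γ.IsType4 ∧ x = cls Γ}

end

end GraphComplex

/-!
# Acyclicity of the complex of graphs of the fourth type

**The differential.** `d` is defined on graphs and descends to `Space` because it respects every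
relation: isomorphic graphs have isomorphic images up to the sign of the renumbering (`invSign`),
and the image of a white vertex has the symmetries of a white vertex. The result is `dSpace`. That
the square is zero is part of what is required of the completion `C`.

**The leading part.** The number of vertices that are not univalent black (`Diagram.numCore`) never
decreases under `d`. The only terms that keep it fixed (`leading`) come from the summand
`R_{n+1}(Q_0, X_1, …, X_n)` in the image of a white vertex and the summand
`-1/2 R_3(X, Q_0, Q_0)` in the image of a bivalent black one; that is, `d` attaches one more
univalent black vertex to a white or bivalent black vertex. So a graph is described by its
`Skeleton`, which remains when the univalent black vertices are deleted, and a `Marking`, which says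
where these are attached and which three slots of each white vertex come last. The leading part
changes only the marking.

**The homotopy.** Let `R c a b` be the class of a graph as a function of the last three slots of a
white vertex. The relations (S1)–(S4) say that `R c a b = E b c - E a c` for a symmetric function `E`
of two slots (`exists_potential`). This makes it possible to delete a univalent black vertex `u`
at a white vertex with at least two other slots not fed by univalent black vertices: the function
`R` of the remaining slots is extended to `u` by letting `E i u` be the mean value of `E i j`, where
`j ≠ i` runs over those other slots (`extendBy`). A white vertex with three slots, two of them fed
by univalent black vertices, is mapped to a bivalent black vertex. The sum over all
univalent black vertices, with signs, is `hSpace`. Three univalent black vertices at a white vertex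
make the class zero (`Marking.cls_eq_zero_of_three`), and so only a few cases remain to be compared.
The outcome is `Marking.Good.homotopy`: modulo graphs with more vertices, `dH + Hd` multiplies a graph
by the number of its white and bivalent black vertices.

**Conclusion.** Up to graphs whose class is zero, the graphs of the fourth type are the connected
ones that have a white or bivalent black vertex and a vertex for which the number of incoming edges
not coming from univalent black vertices differs from one (`Diagram.Mixed`, `G4_eq`). The former
property makes the eigenvalue positive. Both properties are preserved by `d`; for the latter this
follows by counting edges. On graphs with `s` vertices the product of `dH + Hd - j` for
`1 ≤ j ≤ s` is zero modulo graphs with more vertices, whereas on cycles it is a nonzero number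
modulo boundaries. Hence every cycle is, modulo boundaries, a cycle in the next step of the
filtration, and in a given degree the filtration is finite (`numCore_le`).
-/

-- Makes the vertex types and the input slots of these graphs visible to instance search and to `simp`.
attribute [reducible] GraphComplex.Diagram.subst GraphComplex.Diagram.permute
  GraphComplex.Diagram.relabel GraphComplex.blackString GraphComplex.curvatureGraph
  GraphComplex.blackSplit GraphComplex.whiteQ GraphComplex.whiteOut GraphComplex.whiteIn

namespace GraphComplex

open Diagram

noncomputable section

/-! ### Signs of reorderings -/

open Classical in
/-- The sign of the passage from the order of `s` given by `f` to the one given by `g`: the parity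
of the number of inverted pairs. -/
def invSign {α : Type*} (s : Finset α) (f g : α → ℤ) : ℝ :=
  ∏ x ∈ s, ∏ y ∈ s, if f x < f y ∧ g y < g x then -1 else 1

open Classical in
/-- The sign of moving `x` before all elements of `s`, in the order given by `f`. -/
def toFront {α : Type*} (s : Finset α) (f : α → ℤ) (x : α) : ℝ :=
  ∏ y ∈ s, if f y < f x then -1 else 1

section Signs

variable {α β : Type*} {s t : Finset α} {f g h : α → ℤ}

theorem prod_ite_neg_one (s : Finset α) (P : α → Prop) [DecidablePred P] :
    (∏ x ∈ s, if P x then (-1 : ℝ) else 1) = (-1) ^ (s.filter P).card := by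
  rw [Finset.prod_ite, Finset.prod_const, Finset.prod_const_one, mul_one]

theorem toFront_mul_self (s : Finset α) (f : α → ℤ) (x : α) :
    toFront s f x * toFront s f x = 1 := by
  classical
  rw [toFront, ← Finset.prod_mul_distrib]
  exact Finset.prod_eq_one fun y _ => by split_ifs <;> norm_num

theorem invSign_mul_self (s : Finset α) (f g : α → ℤ) : invSign s f g * invSign s f g = 1 := by
  classical
  simp only [invSign, ← Finset.prod_mul_distrib]
  exact Finset.prod_eq_one fun y _ => Finset.prod_eq_one fun y _ => by split_ifs <;> norm_num

theorem invSign_self (s : Finset α) (f : α → ℤ) : invSign s f f = 1 := by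
  classical
  refine Finset.prod_eq_one fun x _ => Finset.prod_eq_one fun y _ => if_neg fun hh => ?_
  omega

theorem invSign_congr {f' g' : α → ℤ} (hf : ∀ y ∈ s, f y = f' y) (hg : ∀ y ∈ s, g y = g' y) :
    invSign s f g = invSign s f' g' := by
  classical
  exact Finset.prod_congr rfl fun x hx => Finset.prod_congr rfl fun y hy => by
    rw [hf y hy, hf x hx, hg x hx, hg y hy]

theorem invSign_insert [DecidableEq α] {x : α} (hx : x ∉ s)
    (hf : Set.InjOn f (insert x s : Finset α)) (hg : Set.InjOn g (insert x s : Finset α)) :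
    invSign (insert x s) f g = toFront s f x * toFront s g x * invSign s f g := by
  classical
  have h1 : ∀ F : α → α → ℝ, F x x = 1 → ∏ a ∈ insert x s, ∏ b ∈ insert x s, F a b
      = (∏ b ∈ s, F x b * F b x) * ∏ a ∈ s, ∏ b ∈ s, F a b := by
    intro F hF
    simp only [Finset.prod_insert hx, Finset.prod_mul_distrib, hF, one_mul, mul_assoc]
  rw [invSign, h1 (fun a b => if f a < f b ∧ g b < g a then -1 else 1) (by simp), invSign, toFront,
    toFront]
  refine congrArg₂ (fun a b : ℝ => a * b) ?_ rfl
  rw [← Finset.prod_mul_distrib]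
  refine Finset.prod_congr rfl fun y hy => ?_
  have hxy : x ≠ y := fun e => hx (e ▸ hy)
  have hf' : f x ≠ f y := fun e => hxy (hf (by simp) (by simp [hy]) e)
  have hg' : g x ≠ g y := fun e => hxy (hg (by simp) (by simp [hy]) e)
  rcases lt_or_gt_of_ne hf' with h1 | h1 <;> rcases lt_or_gt_of_ne hg' with h2 | h2 <;>
    simp [h1, h2, not_lt.mpr h1.le, not_lt.mpr h2.le]

theorem invSign_erase [DecidableEq α] {x : α} (hx : x ∈ s)
    (hf : Set.InjOn f s) (hg : Set.InjOn g s) :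
    invSign s f g = toFront (s.erase x) f x * toFront (s.erase x) g x
      * invSign (s.erase x) f g := by
  have := invSign_insert (s := s.erase x) (f := f) (g := g) (x := x) (by simp)
    (by rwa [Finset.insert_erase hx]) (by rwa [Finset.insert_erase hx])
  rwa [Finset.insert_erase hx] at this

theorem invSign_trans (hf : Set.InjOn f s) (hg : Set.InjOn g s) (hh : Set.InjOn h s) :
    invSign s f g * invSign s g h = invSign s f h := by
  classical
  induction s using Finset.induction_on with
  | empty => simp [invSign]
  | insert x s hx ih =>
    have sub : (s : Set α) ⊆ (insert x s : Finset α) := by simp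
    rw [invSign_insert hx hf hg, invSign_insert hx hg hh, invSign_insert hx hf hh,
      ← ih (hf.mono sub) (hg.mono sub) (hh.mono sub)]
    linear_combination (toFront s f x * toFront s h x * invSign s f g * invSign s g h) *
      toFront_mul_self s g x

theorem invSign_comm (hf : Set.InjOn f s) (hg : Set.InjOn g s) :
    invSign s f g = invSign s g f := by
  have h1 := invSign_trans hf hg hf
  rw [invSign_self] at h1
  have h2 := invSign_mul_self s f g
  calc invSign s f g = invSign s f g * (invSign s f g * invSign s g f) := by rw [h1, mul_one]
    _ = _ := by rw [← mul_assoc, h2, one_mul]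

theorem invSign_image [DecidableEq α] {r : Finset β} {e : β → α} (he : Set.InjOn e r)
    (f g : α → ℤ) : invSign (r.image e) f g = invSign r (f ∘ e) (g ∘ e) := by
  classical
  rw [invSign, Finset.prod_image he]
  exact Finset.prod_congr rfl fun x _ => by rw [Finset.prod_image he]; rfl

theorem toFront_image [DecidableEq α] {r : Finset β} {e : β → α} (he : Set.InjOn e r)
    (f : α → ℤ) (x : β) : toFront (r.image e) f (e x) = toFront r (f ∘ e) x := by
  classical
  rw [toFront, Finset.prod_image he]
  rfl

/-- If `s` precedes `t` in both orders, no pair with one element in each is inverted. -/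
theorem invSign_union [DecidableEq α] (hd : Disjoint s t) (hf : ∀ x ∈ s, ∀ y ∈ t, f x < f y)
    (hg : ∀ x ∈ s, ∀ y ∈ t, g x < g y) :
    invSign (s ∪ t) f g = invSign s f g * invSign t f g := by
  classical
  have h0 : ∀ x ∈ s, ∀ y ∈ t, (if f x < f y ∧ g y < g x then (-1 : ℝ) else 1) = 1 :=
    fun x hx y hy => if_neg fun h => by have := hg x hx y hy; omega
  have h1 : ∀ x ∈ s, ∀ y ∈ t, (if f y < f x ∧ g x < g y then (-1 : ℝ) else 1) = 1 :=
    fun x hx y hy => if_neg fun h => by have := hf x hx y hy; omega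
  rw [invSign, Finset.prod_union hd]
  congr 1
  · refine Finset.prod_congr rfl fun x hx => ?_
    rw [Finset.prod_union hd, Finset.prod_eq_one (h0 x hx), mul_one]
  · refine Finset.prod_congr rfl fun x hx => ?_
    rw [Finset.prod_union hd, Finset.prod_eq_one fun y hy => h1 y hy x hx, one_mul]

theorem invSign_mono_left {f' : α → ℤ} (h : ∀ x ∈ s, ∀ y ∈ s, f x < f y ↔ f' x < f' y) :
    invSign s f g = invSign s f' g := by
  classical
  exact Finset.prod_congr rfl fun x hx => Finset.prod_congr rfl fun y hy => by simp only [h x hx y hy]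

theorem invSign_mono_right {g' : α → ℤ} (h : ∀ x ∈ s, ∀ y ∈ s, g x < g y ↔ g' x < g' y) :
    invSign s f g = invSign s f g' := by
  classical
  exact Finset.prod_congr rfl fun x hx => Finset.prod_congr rfl fun y hy => by simp only [h y hy x hx]

end Signs

namespace Diagram

variable {p q n : ℕ}

open Classical in
/-- The black vertices. -/
def blacks (Γ : Diagram p q) : Finset Γ.V := Finset.univ.filter fun v => Γ.black v = true

theorem mem_blacks {Γ : Diagram p q} {v : Γ.V} : v ∈ Γ.blacks ↔ Γ.black v = true := by
  simp [blacks]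

/-- The numbering, with integral values. -/
def zpos (Γ : Diagram p q) (v : Γ.V) : ℤ := Γ.pos v

theorem numBlack_eq_card (Γ : Diagram p q) : Γ.numBlack = Γ.blacks.card := by
  classical
  rw [numBlack, Nat.card_eq_fintype_card, Fintype.card_subtype, blacks]

theorem Iso.sign_eq {Γ Γ' : Diagram p q} (e : Iso Γ Γ') :
    e.sign = invSign Γ.blacks Γ.zpos (fun v => Γ'.zpos (e.toEquiv v)) := by
  classical
  rw [Iso.sign, Nat.card_eq_fintype_card, Fintype.card_subtype, invSign, ← Finset.prod_product',
    prod_ite_neg_one]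
  congr 2
  ext ⟨x, y⟩
  simp [mem_blacks, zpos, and_assoc]

open Classical in
theorem frontSign_eq (Γ : Diagram p q) (v : Γ.V) :
    Γ.frontSign v = if Γ.black v = true then toFront (Γ.blacks.erase v) Γ.zpos v else 1 := by
  rw [frontSign]
  split_ifs with h
  · rw [Nat.card_eq_fintype_card, Fintype.card_subtype, toFront, prod_ite_neg_one]
    congr 2
    ext x
    simp only [Finset.mem_filter, Finset.mem_univ, true_and, Finset.mem_erase, mem_blacks, zpos,
      Nat.cast_lt]
    constructor
    · rintro ⟨h1, h2⟩
      exact ⟨⟨fun e => by simp [e] at h2, h1⟩, h2⟩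
    · rintro ⟨⟨_, h1⟩, h2⟩
      exact ⟨h1, h2⟩
  · rfl

theorem IsAGraph.zpos_injective {Γ : Diagram p q} (h : Γ.IsAGraph) :
    Function.Injective Γ.zpos := fun _ _ e => h.pos_injective (Int.ofNat_inj.mp e)

end Diagram

end

noncomputable section

/-! ### Isomorphisms up to the order of the incoming edges -/

namespace Diagram

variable {p q n m : ℕ}

/-- An isomorphism of graphs that may permute the incoming edges of all vertices. -/
structure LooseIso (Γ Γ' : Diagram p q) where
  toEquiv : Γ.V ≃ Γ'.V
  black_eq : ∀ v, Γ'.black (toEquiv v) = Γ.black v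
  slots : ∀ v, Fin (Γ.ar v) ≃ Fin (Γ'.ar (toEquiv v))
  inp_eq : ∀ v i, Γ'.inp (toEquiv v) (slots v i) = Sum.map toEquiv id (Γ.inp v i)
  out_eq : ∀ j, Γ'.out j = toEquiv (Γ.out j)

/-- Forget that the order of the incoming edges of white vertices is preserved. -/
def Iso.toLoose {Γ Γ' : Diagram p q} (e : Iso Γ Γ') : LooseIso Γ Γ' :=
  { e with }

namespace LooseIso

variable {Γ Γ' : Diagram p q} (e : LooseIso Γ Γ')
include e

theorem ar_eq (v : Γ.V) : Γ'.ar (e.toEquiv v) = Γ.ar v := by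
  simpa using (Fintype.card_congr (e.slots v)).symm

theorem feed_bijective_iff :
    Function.Bijective Γ'.feed ↔ Function.Bijective Γ.feed := by
  have h : Γ'.feed ∘ (Equiv.sumCongr (Equiv.sigmaCongr e.toEquiv e.slots) (Equiv.refl (Fin q)))
      = (Equiv.sumCongr e.toEquiv (Equiv.refl (Fin p))) ∘ Γ.feed := by
    funext x
    rcases x with ⟨v, i⟩ | j
    · simp only [feed, Function.comp, Equiv.sumCongr_apply, Sum.map_inl, Sum.elim_inl]
      exact e.inp_eq v i
    · simp [feed, e.out_eq]
  rw [← Equiv.bijective_comp (Equiv.sumCongr (Equiv.sigmaCongr e.toEquiv e.slots)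
    (Equiv.refl (Fin q))), h, Equiv.comp_bijective]

theorem isUnivalentBlack_iff (v : Γ.V) :
    Γ'.IsUnivalentBlack (e.toEquiv v) ↔ Γ.IsUnivalentBlack v := by
  rw [IsUnivalentBlack, IsUnivalentBlack, e.black_eq, e.ar_eq]

theorem inp_eq_inl_iff {v u : Γ.V} {i : Fin (Γ.ar v)} :
    Γ'.inp (e.toEquiv v) (e.slots v i) = Sum.inl (e.toEquiv u) ↔ Γ.inp v i = Sum.inl u := by
  rw [e.inp_eq]
  cases h : Γ.inp v i <;> simp

theorem isAGraph_iff (hp : Function.Injective Γ.pos) (hp' : Function.Injective Γ'.pos) :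
    Γ'.IsAGraph ↔ Γ.IsAGraph := by
  constructor
  · intro h
    refine ⟨e.feed_bijective_iff.mp h.1, hp, fun v hv => ?_, fun v i u hu hb => ?_⟩
    · rw [← e.ar_eq]
      exact h.3 _ (by rw [e.black_eq, hv])
    · rw [← e.black_eq]
      exact h.4 _ (e.slots v i) _ (e.inp_eq_inl_iff.mpr hu) ((e.isUnivalentBlack_iff u).mpr hb)
  · intro h
    refine ⟨e.feed_bijective_iff.mpr h.1, hp', fun v' hv => ?_, fun v' i' u' hu hb => ?_⟩
    · obtain ⟨v, rfl⟩ := e.toEquiv.surjective v'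
      rw [e.ar_eq]
      exact h.3 _ (by rw [← e.black_eq, hv])
    · obtain ⟨v, rfl⟩ := e.toEquiv.surjective v'
      obtain ⟨u, rfl⟩ := e.toEquiv.surjective u'
      obtain ⟨i, rfl⟩ := (e.slots v).surjective i'
      rw [e.black_eq]
      exact h.4 _ i _ (e.inp_eq_inl_iff.mp hu) ((e.isUnivalentBlack_iff u).mp hb)

end LooseIso

open Classical in
theorem permute_inp_self (Γ : Diagram p q) (v : Γ.V) (σ : Equiv.Perm (Fin (Γ.ar v)))
    (i : Fin (Γ.ar v)) : (Γ.permute v σ).inp v i = Γ.inp v (σ i) := by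
  simp [permute]

theorem permute_inp_ne (Γ : Diagram p q) (v : Γ.V) (σ : Equiv.Perm (Fin (Γ.ar v)))
    {w : Γ.V} (h : w ≠ v) : (Γ.permute v σ).inp w = Γ.inp w := by
  simp [permute, h]

theorem permute_one (Γ : Diagram p q) (v : Γ.V) : Γ.permute v 1 = Γ := by
  simp [permute]

open Classical in
theorem permute_permute (Γ : Diagram p q) (v : Γ.V) (σ τ : Equiv.Perm (Fin (Γ.ar v))) :
    (Γ.permute v σ).permute v τ = Γ.permute v (σ * τ) := by
  have h : Function.update (Function.update Γ.inp v (Γ.inp v ∘ σ)) v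
      (Function.update Γ.inp v (Γ.inp v ∘ σ) v ∘ τ) = Function.update Γ.inp v (Γ.inp v ∘ ⇑(σ * τ)) := by
    rw [Function.update_idem, Function.update_self]
    rfl
  exact congrArg (fun f => ({ Γ with inp := f } : Diagram p q)) h

open Classical in
/-- Permuting incoming edges is a loose isomorphism. -/
def permuteLoose (Γ : Diagram p q) (v : Γ.V) (σ : Equiv.Perm (Fin (Γ.ar v))) :
    LooseIso (Γ.permute v σ) Γ where
  toEquiv := Equiv.refl _
  black_eq _ := rfl
  slots := Function.update (fun w => Equiv.refl (Fin (Γ.ar w))) v σ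
  inp_eq := by
    change ∀ (w : Γ.V) (i : Fin (Γ.ar w)),
      Γ.inp w (Function.update (fun w => Equiv.refl (Fin (Γ.ar w))) v σ w i)
        = Sum.map id id ((Γ.permute v σ).inp w i)
    intro w i
    rw [Sum.map_id_id]
    by_cases h : w = v
    · subst h
      rw [Function.update_self]
      exact (permute_inp_self _ _ _ _).symm
    · rw [Function.update_of_ne h]
      exact congrFun (permute_inp_ne _ _ _ h).symm i
  out_eq _ := rfl

theorem permute_isAGraph (Γ : Diagram p q) (v : Γ.V) (σ : Equiv.Perm (Fin (Γ.ar v))) :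
    (Γ.permute v σ).IsAGraph ↔ Γ.IsAGraph := by
  constructor
  · exact fun h => ((Γ.permuteLoose v σ).isAGraph_iff h.2 h.2).mpr h
  · exact fun h => ((Γ.permuteLoose v σ).isAGraph_iff h.2 h.2).mp h

end Diagram

variable {p q n m : ℕ}

/-! ### Classes of graphs -/

theorem mkQ_single (Γ : Diagram p q) (t : ℝ) :
    (relations p q).mkQ (Finsupp.single Γ t) = t • cls Γ := by
  rw [cls, ← map_smul, Finsupp.smul_single, smul_eq_mul, mul_one]

theorem mkQ_eq (x : Diagram p q →₀ ℝ) :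
    (relations p q).mkQ x = Finsupp.linearCombination ℝ cls x := by
  induction x using Finsupp.induction_linear with
  | zero => simp
  | add x y hx hy => rw [map_add, map_add, hx, hy]
  | single Γ t => rw [mkQ_single, Finsupp.linearCombination_single]

theorem cls_eq_zero {Γ : Diagram p q} (h : ¬ Γ.IsAGraph) : cls Γ = 0 :=
  (Submodule.Quotient.mk_eq_zero _).mpr
    (Submodule.subset_span (Or.inl (Or.inl ⟨Γ, h, rfl⟩)))

theorem cls_iso {Γ Γ' : Diagram p q} (e : Iso Γ Γ') (hp : Function.Injective Γ.pos)
    (hp' : Function.Injective Γ'.pos) : cls Γ' = e.sign • cls Γ := by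
  by_cases h : Γ.IsAGraph
  · have h' := (e.toLoose.isAGraph_iff hp hp').mpr h
    rw [← sub_eq_zero, ← mkQ_single, cls, ← map_sub]
    exact (Submodule.Quotient.mk_eq_zero _).mpr
      (Submodule.subset_span (Or.inl (Or.inr ⟨Γ, Γ', e, h, h', rfl⟩)))
  · have h' : ¬ Γ'.IsAGraph := fun h' => h ((e.toLoose.isAGraph_iff hp hp').mp h')
    rw [cls_eq_zero h, cls_eq_zero h', smul_zero]

theorem cls_permute {Γ : Diagram p q} {v : Γ.V} (hv : Γ.black v = false)
    {c : Equiv.Perm (Fin (Γ.ar v)) →₀ ℝ} (hc : WhiteSymmetry (Γ.ar v) c) :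
    (c.sum fun σ t => t • cls (Γ.permute v σ)) = 0 := by
  by_cases h : Γ.IsAGraph
  · have := (Submodule.Quotient.mk_eq_zero (relations p q)).mpr
      (Submodule.subset_span (Or.inr ⟨Γ, v, c, h, hv, hc, rfl⟩))
    rw [← this]
    change _ = (relations p q).mkQ _
    rw [Finsupp.sum, Finsupp.sum, map_sum]
    exact Finset.sum_congr rfl fun σ _ => by rw [mkQ_single]
  · refine Finset.sum_eq_zero fun σ _ => ?_
    dsimp only
    rw [cls_eq_zero (fun h' => h ((Γ.permute_isAGraph v σ).mp h')), smul_zero]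

/-- Linear maps out of the space of graphs. -/
theorem relations_le_ker {M : Type*} [AddCommGroup M] [Module ℝ M] (F : Diagram p q → M)
    (h0 : ∀ Γ, ¬ Γ.IsAGraph → F Γ = 0)
    (h1 : ∀ (Γ Γ' : Diagram p q) (e : Iso Γ Γ'), Γ.IsAGraph → Γ'.IsAGraph →
      F Γ' = e.sign • F Γ)
    (h2 : ∀ (Γ : Diagram p q) (v : Γ.V) (c : Equiv.Perm (Fin (Γ.ar v)) →₀ ℝ), Γ.IsAGraph →
      Γ.black v = false → WhiteSymmetry (Γ.ar v) c →
      (c.sum fun σ t => t • F (Γ.permute v σ)) = 0) :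
    relations p q ≤ LinearMap.ker (Finsupp.linearCombination ℝ F) := by
  refine Submodule.span_le.mpr ?_
  rintro x ((⟨Γ, h, rfl⟩ | ⟨Γ, Γ', e, h, h', rfl⟩) | ⟨Γ, v, c, h, hv, hc, rfl⟩)
  · simp [h0 Γ h]
  · simp [h1 Γ Γ' e h h']
  · rw [SetLike.mem_coe, LinearMap.mem_ker, ← h2 Γ v c h hv hc, Finsupp.sum, map_sum, Finsupp.sum]
    exact Finset.sum_congr rfl fun σ _ => by rw [Finsupp.linearCombination_single]


/-! ### Replacing a vertex -/

namespace Diagram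

variable {p q n m : ℕ}

/-- Relabel the incoming legs along a bijection. -/
@[reducible] def relabelE (σ : Fin n ≃ Fin m) (g : Diagram n q) : Diagram m q where
  V := g.V
  pos := g.pos
  black := g.black
  ar := g.ar
  inp := fun v i => Sum.map id σ (g.inp v i)
  out := g.out

open Classical in
/-- The new beginning of an edge that began at the vertex `u` before the vertex `v` was replaced. -/
def vert (Γ : Diagram p q) (v : Γ.V) (g : Diagram (Γ.ar v) 1) (u : Γ.V) :
    g.V ⊕ {u : Γ.V // u ≠ v} :=
  if h : u = v then Sum.inl (g.out 0) else Sum.inr ⟨u, h⟩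

section Subst

variable (Γ : Diagram p q) (v : Γ.V) (g : Diagram (Γ.ar v) 1)

theorem vert_self : Γ.vert v g v = Sum.inl (g.out 0) := by simp [vert]

theorem vert_ne {u : Γ.V} (h : u ≠ v) : Γ.vert v g u = Sum.inr ⟨u, h⟩ := by simp [vert, h]

/-- Where the edges inside the inserted graph `g`, and those glued to its legs, begin. -/
def glue (s : g.V ⊕ Fin (Γ.ar v)) : (g.V ⊕ {u : Γ.V // u ≠ v}) ⊕ Fin p :=
  Sum.elim (fun z => Sum.inl (Sum.inl z)) (fun l => Sum.map (Γ.vert v g) id (Γ.inp v l)) s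

theorem subst_out (j : Fin q) : (Γ.subst v g).out j = Γ.vert v g (Γ.out j) := rfl

theorem subst_zpos_inl (y : g.V) : (Γ.subst v g).zpos (Sum.inl y) = g.zpos y := rfl

theorem subst_zpos_inr (u : {u : Γ.V // u ≠ v}) : (Γ.subst v g).zpos (Sum.inr u)
    = (Finset.univ.sup g.pos + 1 : ℕ) + Γ.zpos u := by
  change ((Finset.univ.sup g.pos + 1 + Γ.pos u : ℕ) : ℤ) = _
  push_cast
  rfl

theorem subst_zpos_lt (y : g.V) (u : {u : Γ.V // u ≠ v}) :
    (Γ.subst v g).zpos (Sum.inl y) < (Γ.subst v g).zpos (Sum.inr u) := by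
  have h : g.pos y ≤ Finset.univ.sup g.pos := Finset.le_sup (f := g.pos) (Finset.mem_univ y)
  rw [subst_zpos_inl, subst_zpos_inr, zpos, zpos]
  push_cast
  omega

variable {Γ v g} in
theorem subst_pos_injective (hΓ : Function.Injective Γ.pos) (hg : Function.Injective g.pos) :
    Function.Injective (Γ.subst v g).pos := by
  have key : Function.Injective (Γ.subst v g).zpos := by
    rintro (y | u) (y' | u') h
    · rw [subst_zpos_inl, subst_zpos_inl] at h
      rw [hg (Int.ofNat_inj.mp h)]
    · exact absurd h (subst_zpos_lt Γ v g y u').ne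
    · exact absurd h (subst_zpos_lt Γ v g y' u).ne'
    · rw [subst_zpos_inr, subst_zpos_inr] at h
      rw [Subtype.ext (hΓ (Int.ofNat_inj.mp (add_left_cancel h)))]
  exact fun a b h => key (by rw [zpos, zpos, h])

open Classical in
theorem subst_blacks : (Γ.subst v g).blacks
    = (g.blacks.image Sum.inl : Finset (g.V ⊕ {u : Γ.V // u ≠ v}))
      ∪ ((Finset.univ.filter fun u : {u : Γ.V // u ≠ v} => Γ.black u = true).image Sum.inr) := by
  ext x
  rw [mem_blacks]
  rcases x with y | u
  · simp [mem_blacks, subst]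
  · simp [subst]

open Classical in
theorem blacks_erase_eq : Γ.blacks.erase v
    = (Finset.univ.filter fun u : {u : Γ.V // u ≠ v} => Γ.black u = true).image Subtype.val := by
  ext x
  simp [mem_blacks, and_comm]

open Classical in
/-- The sign of a reordering after a replacement: the new vertices come first in both orders. -/
theorem invSign_subst (F : g.V ⊕ {u : Γ.V // u ≠ v} → ℤ) (H : Γ.V → ℤ)
    (h1 : ∀ y u, F (Sum.inl y) < F (Sum.inr u))
    (h2 : ∀ u u' : {u : Γ.V // u ≠ v}, F (Sum.inr u) < F (Sum.inr u') ↔ H u < H u') :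
    invSign (Γ.subst v g).blacks (Γ.subst v g).zpos F
      = invSign g.blacks g.zpos (fun y => F (Sum.inl y))
        * invSign (Γ.blacks.erase v) Γ.zpos H := by
  rw [subst_blacks]
  erw [invSign_union]
  · rw [blacks_erase_eq]
    erw [invSign_image Sum.inl_injective.injOn, invSign_image Sum.inr_injective.injOn,
      invSign_image Subtype.val_injective.injOn]
    congr 1
    rw [invSign_mono_left (f' := Γ.zpos ∘ Subtype.val), invSign_mono_right (g' := H ∘ Subtype.val)]
    · exact fun x _ y _ => h2 x y
    · intro x _ y _
      erw [Function.comp, Function.comp, subst_zpos_inr, subst_zpos_inr]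
      exact add_lt_add_iff_left _
  · rw [Finset.disjoint_left]
    simp
  · intro x hx y hy
    obtain ⟨x, _, rfl⟩ := Finset.mem_image.mp hx
    obtain ⟨y, _, rfl⟩ := Finset.mem_image.mp hy
    exact subst_zpos_lt _ _ _ _ _
  · intro x hx y hy
    obtain ⟨x, _, rfl⟩ := Finset.mem_image.mp hx
    obtain ⟨y, _, rfl⟩ := Finset.mem_image.mp hy
    exact h1 _ _

/-- An isomorphism of the graphs put in the place of a vertex. -/
def substIsoRight {g' : Diagram (Γ.ar v) 1} (f : Iso g g') :
    Iso (Γ.subst v g) (Γ.subst v g') where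
  toEquiv := Equiv.sumCongr f.toEquiv (Equiv.refl _)
  black_eq := by
    rintro (y | u)
    · exact f.black_eq y
    · rfl
  slots := fun x => match x with
    | Sum.inl y => f.slots y
    | Sum.inr u => Equiv.refl (Fin (Γ.ar u))
  slots_white := by
    rintro (y | u) h i
    · exact f.slots_white y h i
    · rfl
  inp_eq := by
    have hv : ∀ s : Γ.V ⊕ Fin p, Sum.map (Γ.vert v g') id s
        = Sum.map (Equiv.sumCongr f.toEquiv (Equiv.refl {u : Γ.V // u ≠ v})) id
          (Sum.map (Γ.vert v g) id s) := by
      rintro (u | l)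
      · by_cases h : u = v
        · subst h
          simp [vert_self, f.out_eq]
        · simp [vert_ne _ _ _ h]
      · rfl
    rintro (y | u) i
    · refine (congrArg (Γ.glue v g') (f.inp_eq y i)).trans ?_
      change _ = Sum.map _ id (Γ.glue v g (g.inp y i))
      generalize g.inp y i = s
      cases s with
      | inl z => rfl
      | inr l => exact hv _
    · exact hv _
  out_eq := by
    intro j
    rw [subst_out, subst_out]
    by_cases h : Γ.out j = v
    · rw [h, vert_self, vert_self, f.out_eq]
      rfl
    · rw [vert_ne _ _ _ h, vert_ne _ _ _ h]
      rfl

theorem substIsoRight_sign {g' : Diagram (Γ.ar v) 1} (f : Iso g g') :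
    (Γ.substIsoRight v g f).sign = f.sign := by
  rw [Iso.sign_eq, invSign_subst Γ v g _ Γ.zpos, f.sign_eq, invSign_self, mul_one]
  · rfl
  · exact fun y u => subst_zpos_lt Γ v g' (f.toEquiv y) u
  · intro u u'
    change (Γ.subst v g').zpos (Sum.inr u) < (Γ.subst v g').zpos (Sum.inr u') ↔ _
    rw [subst_zpos_inr, subst_zpos_inr, add_lt_add_iff_left]

/-- An isomorphism induces one of the graphs in which corresponding vertices are replaced. -/
def substIsoLeft {Γ' : Diagram p q} (e : Iso Γ Γ') :
    Iso (Γ.subst v g) (Γ'.subst (e.toEquiv v) (g.relabelE (e.slots v))) where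
  toEquiv := Equiv.sumCongr (Equiv.refl _)
    (e.toEquiv.subtypeEquiv fun u => (e.toEquiv.injective.ne_iff (x := u) (y := v)).symm)
  black_eq := by
    rintro (y | u)
    · rfl
    · exact e.black_eq u
  slots := fun x => match x with
    | Sum.inl y => Equiv.refl (Fin (g.ar y))
    | Sum.inr u => e.slots u
  slots_white := by
    rintro (y | u) h i
    · rfl
    · exact e.slots_white u h i
  inp_eq := by
    have hv : ∀ s : Γ.V ⊕ Fin p,
        Sum.map (Γ'.vert (e.toEquiv v) (g.relabelE (e.slots v))) id (Sum.map e.toEquiv id s)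
        = Sum.map (Equiv.sumCongr (Equiv.refl g.V) (e.toEquiv.subtypeEquiv fun u =>
          (e.toEquiv.injective.ne_iff (x := u) (y := v)).symm)) id
          (Sum.map (Γ.vert v g) id s) := by
      rintro (u | l)
      · by_cases h : u = v
        · subst h
          simp only [Sum.map_inl, vert_self]
          rfl
        · simp only [Sum.map_inl, vert_ne _ _ _ h]
          rw [vert_ne _ _ _ (e.toEquiv.injective.ne h)]
          rfl
      · rfl
    rintro (y | u) i
    · change Γ'.glue _ (g.relabelE (e.slots v)) (Sum.map id (e.slots v) (g.inp y i))
        = Sum.map _ id (Γ.glue v g (g.inp y i))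
      generalize g.inp y i = s
      cases s with
      | inl z => rfl
      | inr l => exact (congrArg (Sum.map (Γ'.vert (e.toEquiv v) (g.relabelE (e.slots v))) id)
          (e.inp_eq v l)).trans (hv _)
    · exact (congrArg (Sum.map (Γ'.vert (e.toEquiv v) (g.relabelE (e.slots v))) id)
          (e.inp_eq u i)).trans (hv _)
  out_eq := by
    intro j
    rw [subst_out, subst_out, e.out_eq]
    by_cases h : Γ.out j = v
    · rw [h, vert_self, vert_self]
      rfl
    · rw [vert_ne _ _ _ h, vert_ne _ _ _ (e.toEquiv.injective.ne h)]
      rfl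

theorem frontSign_mul_self : Γ.frontSign v * Γ.frontSign v = 1 := by
  rw [frontSign_eq]
  split_ifs
  · exact toFront_mul_self _ _ _
  · norm_num

variable {Γ} in
theorem Iso.sign_eq_erase {Γ' : Diagram p q} (e : Iso Γ Γ') (hΓ : Function.Injective Γ.pos)
    (hΓ' : Function.Injective Γ'.pos) [DecidableEq Γ.V] :
    e.sign = Γ.frontSign v * Γ'.frontSign (e.toEquiv v)
      * invSign (Γ.blacks.erase v) Γ.zpos (fun v => Γ'.zpos (e.toEquiv v)) := by
  classical
  have i1 : Function.Injective Γ.zpos := fun _ _ h => hΓ (Int.ofNat_inj.mp h)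
  have i2 : Function.Injective Γ'.zpos := fun _ _ h => hΓ' (Int.ofNat_inj.mp h)
  rw [e.sign_eq, frontSign_eq, frontSign_eq, e.black_eq]
  by_cases hv : Γ.black v = true
  · rw [if_pos hv, if_pos hv, invSign_erase (g := fun v => Γ'.zpos (e.toEquiv v))
      (mem_blacks.mpr hv) i1.injOn (i2.comp e.toEquiv.injective).injOn]
    congr 2
    · congr!
    · have : Γ'.blacks.erase (e.toEquiv v) = (Γ.blacks.erase v).image e.toEquiv := by
        ext x
        obtain ⟨x, rfl⟩ := e.toEquiv.surjective x
        simp [mem_blacks, e.black_eq]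
      rw [this, toFront_image e.toEquiv.injective.injOn]
      rfl
  · rw [if_neg hv, if_neg hv, Finset.erase_eq_of_notMem (fun h => hv (mem_blacks.mp h))]
    ring

theorem substIsoLeft_sign {Γ' : Diagram p q} (e : Iso Γ Γ') (hΓ : Function.Injective Γ.pos)
    (hΓ' : Function.Injective Γ'.pos) : (Γ.substIsoLeft v g e).sign
      = Γ.frontSign v * Γ'.frontSign (e.toEquiv v) * e.sign := by
  classical
  rw [e.sign_eq_erase v hΓ hΓ', Iso.sign_eq,
    invSign_subst Γ v g _ (fun v => Γ'.zpos (e.toEquiv v))]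
  · have h1 : invSign g.blacks g.zpos (fun y =>
        (Γ'.subst (e.toEquiv v) (g.relabelE (e.slots v))).zpos
          ((Γ.substIsoLeft v g e).toEquiv (Sum.inl y))) = 1 := invSign_self _ _
    rw [h1]
    linear_combination (-Γ'.frontSign (e.toEquiv v) * Γ'.frontSign (e.toEquiv v)
      * invSign (Γ.blacks.erase v) Γ.zpos (fun v => Γ'.zpos (e.toEquiv v)))
      * Γ.frontSign_mul_self v - invSign (Γ.blacks.erase v) Γ.zpos (fun v => Γ'.zpos (e.toEquiv v))
      * Γ'.frontSign_mul_self (e.toEquiv v)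
  · exact fun y u => subst_zpos_lt Γ' _ (g.relabelE (e.slots v)) y _
  · intro u u'
    change (Γ'.subst _ (g.relabelE (e.slots v))).zpos (Sum.inr _)
      < (Γ'.subst _ (g.relabelE (e.slots v))).zpos (Sum.inr _) ↔ _
    rw [subst_zpos_inr, subst_zpos_inr, add_lt_add_iff_left]
    rfl

theorem subst_permute_left (y : g.V) (σ : Equiv.Perm (Fin (g.ar y))) :
    Γ.subst v (g.permute y σ) = (Γ.subst v g).permute (Sum.inl y) σ := by
  have h : (Γ.subst v (g.permute y σ)).inp = ((Γ.subst v g).permute (Sum.inl y) σ).inp := by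
    funext x
    rcases x with z | u
    · change g.V at z
      by_cases hz : z = y
      · subst z
        funext i
        exact (congrArg (Γ.glue v g) (permute_inp_self g y σ i)).trans
          (permute_inp_self (Γ.subst v g) (Sum.inl y) σ i).symm
      · funext i
        exact (congrArg (Γ.glue v g) (congrFun (permute_inp_ne g y σ hz) i)).trans
          (congrFun (permute_inp_ne (Γ.subst v g) (Sum.inl y) σ
            (fun h => hz (Sum.inl_injective h))) i).symm
    · exact (permute_inp_ne (Γ.subst v g) (Sum.inl y) σ (w := Sum.inr u) (by simp)).symm
  exact congrArg (fun f => ({ Γ.subst v g with inp := f } : Diagram p q)) h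

theorem permute_subst_self (σ : Equiv.Perm (Fin (Γ.ar v))) :
    (Γ.permute v σ).subst v g = Γ.subst v (g.relabel σ) := by
  have h : ((Γ.permute v σ).subst v g).inp = (Γ.subst v (g.relabel σ)).inp := by
    funext x i
    rcases x with z | u
    · change (Γ.permute v σ).glue v g (g.inp z i) = Γ.glue v g (Sum.map id σ (g.inp z i))
      generalize g.inp z i = s
      cases s with
      | inl z => rfl
      | inr l => exact congrArg (Sum.map (Γ.vert v g) id) (permute_inp_self Γ v σ l)
    · exact congrArg (Sum.map (Γ.vert v g) id) (congrFun (permute_inp_ne Γ v σ u.2) i)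
  exact congrArg (fun f => ({ Γ.subst v g with inp := f } : Diagram p q)) h

theorem permute_subst_ne {w : Γ.V} (hw : w ≠ v) (σ : Equiv.Perm (Fin (Γ.ar w))) :
    (Γ.permute w σ).subst v g = (Γ.subst v g).permute (Sum.inr ⟨w, hw⟩) σ := by
  have h : ((Γ.permute w σ).subst v g).inp = ((Γ.subst v g).permute (Sum.inr ⟨w, hw⟩) σ).inp := by
    funext x
    rcases x with z | u
    · refine Eq.trans ?_ (permute_inp_ne (Γ.subst v g) (Sum.inr ⟨w, hw⟩) σ
        (w := Sum.inl z) (by simp)).symm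
      funext i
      change (Γ.permute w σ).glue v g (g.inp z i) = Γ.glue v g (g.inp z i)
      generalize g.inp z i = s
      cases s with
      | inl z => rfl
      | inr l =>
        exact congrArg (Sum.map (Γ.vert v g) id) (congrFun (permute_inp_ne Γ w σ hw.symm) l)
    · by_cases hu : u = ⟨w, hw⟩
      · subst hu
        funext i
        exact (congrArg (Sum.map (Γ.vert v g) id) (permute_inp_self Γ w σ i)).trans
          (permute_inp_self (Γ.subst v g) (Sum.inr ⟨w, hw⟩) σ i).symm
      · funext i
        exact (congrArg (Sum.map (Γ.vert v g) id)
          (congrFun (permute_inp_ne Γ w σ (fun h => hu (Subtype.ext h))) i)).trans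
          (congrFun (permute_inp_ne (Γ.subst v g) (Sum.inr ⟨w, hw⟩) σ
            (fun h => hu (Sum.inr_injective h))) i).symm
  exact congrArg (fun f => ({ Γ.subst v g with inp := f } : Diagram p q)) h

end Subst

end Diagram

end

noncomputable section

variable {p q n m : ℕ}

/-! ### The coboundary operator is well defined -/

/-- Replace the vertex `v` by a combination of graphs. -/
def substL (Γ : Diagram p q) (v : Γ.V) : (Diagram (Γ.ar v) 1 →₀ ℝ) →ₗ[ℝ] Space p q :=
  Finsupp.linearCombination ℝ fun g => cls (Γ.subst v g)

theorem substL_single (Γ : Diagram p q) (v : Γ.V) (g : Diagram (Γ.ar v) 1) (t : ℝ) :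
    substL Γ v (Finsupp.single g t) = t • cls (Γ.subst v g) := by
  rw [substL, Finsupp.linearCombination_single]

open Classical in
/-- The class of the coboundary of a graph. -/
def dGraph (C : (n : ℕ) → Diagram n 1 →₀ ℝ) (Γ : Diagram p q) : Space p q :=
  if Γ.IsAGraph then
    ∑ v : Γ.V, Γ.frontSign v • substL Γ v (vertexDiff C (Γ.black v) (Γ.ar v))
  else 0

theorem mkQ_graphDiff (C : (n : ℕ) → Diagram n 1 →₀ ℝ) (x : Diagram p q →₀ ℝ) :
    (relations p q).mkQ (graphDiff C p q x) = Finsupp.linearCombination ℝ (dGraph C) x := by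
  induction x using Finsupp.induction_linear with
  | zero => simp
  | add x y hx hy => rw [map_add, map_add, hx, hy, map_add]
  | single Γ t =>
    rw [graphDiff, Finsupp.linearCombination_single, Finsupp.linearCombination_single, dGraph,
      map_smul]
    congr 1
    split_ifs
    · rw [map_sum]
      refine Finset.sum_congr rfl fun v _ => ?_
      rw [map_smul, mkQ_eq, Finsupp.linearCombination_mapDomain]
      rfl
    · rw [map_zero]

section RelabelE

theorem relabelE_refl (g : Diagram n q) : g.relabelE (Equiv.refl (Fin n)) = g := by
  have h : (g.relabelE (Equiv.refl (Fin n))).inp = g.inp := by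
    funext v i
    change Sum.map id id (g.inp v i) = _
    rw [Sum.map_id_id]
    rfl
  exact congrArg (fun f => ({ g with inp := f } : Diagram n q)) h

end RelabelE

/-- Combinations of graphs that vanish by the action of isomorphisms. -/
def isoRelations (n q : ℕ) : Submodule ℝ (Diagram n q →₀ ℝ) :=
  Submodule.span ℝ {x | ∃ (g g' : Diagram n q) (e : Iso g g'), Function.Injective g.pos ∧
    Function.Injective g'.pos ∧ x = Finsupp.single g' 1 - Finsupp.single g e.sign}

theorem substL_isoRelations {Γ : Diagram p q} (hΓ : Function.Injective Γ.pos) (v : Γ.V)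
    {x : Diagram (Γ.ar v) 1 →₀ ℝ} (hx : x ∈ isoRelations (Γ.ar v) 1) : substL Γ v x = 0 := by
  rw [← LinearMap.mem_ker]
  revert x
  change isoRelations (Γ.ar v) 1 ≤ _
  refine Submodule.span_le.mpr ?_
  rintro _ ⟨g, g', e, hg, hg', rfl⟩
  rw [SetLike.mem_coe, LinearMap.mem_ker, map_sub, substL_single, substL_single, one_smul,
    cls_iso (Γ.substIsoRight v g e) (subst_pos_injective hΓ hg) (subst_pos_injective hΓ hg'),
    substIsoRight_sign, sub_self]

/-- Extend a bijection so that it maps the last element to the last one. -/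
def snocEquiv (f : Fin n ≃ Fin m) : Fin (n + 1) ≃ Fin (m + 1) :=
  (finSuccEquivLast.trans f.optionCongr).trans finSuccEquivLast.symm

theorem snocEquiv_last (f : Fin n ≃ Fin m) : snocEquiv f (Fin.last n) = Fin.last m := by
  simp [snocEquiv]

theorem snocEquiv_castSucc (f : Fin n ≃ Fin m) (i : Fin n) :
    snocEquiv f i.castSucc = (f i).castSucc := by
  simp [snocEquiv]

/-- A permutation that maps `J` to `J'`, in terms of the positions in the increasing
enumerations. -/
def rankEquiv (σ : Equiv.Perm (Fin n)) (J J' : Finset (Fin n)) (h : ∀ x, x ∈ J ↔ σ x ∈ J') :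
    Fin J'.card ≃ Fin J.card :=
  (J'.orderIsoOfFin rfl).toEquiv.trans
    ((σ.subtypeEquiv (p := (· ∈ J)) (q := (· ∈ J')) h).symm.trans
      (J.orderIsoOfFin rfl).symm.toEquiv)

theorem orderEmb_rankEquiv (σ : Equiv.Perm (Fin n)) (J J' : Finset (Fin n))
    (h : ∀ x, x ∈ J ↔ σ x ∈ J') (i : Fin J'.card) :
    σ (J.orderEmbOfFin rfl (rankEquiv σ J J' h i)) = J'.orderEmbOfFin rfl i := by
  have : J.orderIsoOfFin rfl (rankEquiv σ J J' h i)
      = (σ.subtypeEquiv (p := (· ∈ J)) (q := (· ∈ J')) h).symm (J'.orderIsoOfFin rfl i) := by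
    simp [rankEquiv]
  rw [← Finset.coe_orderIsoOfFin_apply, this]
  simp

/-- The graph `blackSplit n I` with relabelled legs. -/
def blackSplitIso (n : ℕ) (I : Finset (Fin n)) (σ : Equiv.Perm (Fin n)) :
    Iso (blackSplit n (I.map σ.toEmbedding)) ((blackSplit n I).relabel σ) where
  toEquiv := Equiv.refl Bool
  black_eq := fun _ => rfl
  slots := fun v => match v with
    | false => snocEquiv (rankEquiv σ Iᶜ _ (by simp))
    | true => rankEquiv σ I _ (by simp)
  slots_white := fun v h => by simp at h
  inp_eq := by
    have key : ∀ (J J' : Finset (Fin n)) (h : ∀ x, x ∈ J ↔ σ x ∈ J') (i : Fin (J'.card + 1)),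
        Sum.map id σ (Fin.snoc (α := fun _ => Bool ⊕ Fin n)
          (fun i => Sum.inr (J.orderEmbOfFin rfl i)) (Sum.inl true) (snocEquiv (rankEquiv σ J J' h) i))
        = Sum.map id id (Fin.snoc (α := fun _ => Bool ⊕ Fin n)
          (fun i => Sum.inr (J'.orderEmbOfFin rfl i)) (Sum.inl true) i) := by
      intro J J' h i
      induction i using Fin.lastCases with
      | last => simp [snocEquiv_last]
      | cast i => simp [snocEquiv_castSucc, orderEmb_rankEquiv]
    rintro (_ | _) i
    · exact key _ _ (by simp) i
    · exact congrArg Sum.inr (orderEmb_rankEquiv σ I _ (by simp) i)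
  out_eq := fun _ => rfl

theorem blackSplit_pos_injective (n : ℕ) (I : Finset (Fin n)) :
    Function.Injective (blackSplit n I).pos := by
  intro a b h
  cases a <;> cases b <;> simp_all [blackSplit]

/-- The image of a black vertex is symmetric in the incoming legs. -/
theorem vertexDiff_black_relabel (C : (n : ℕ) → Diagram n 1 →₀ ℝ) :
    ∀ (n : ℕ) (σ : Equiv.Perm (Fin n)),
      (vertexDiff C true n).mapDomain (relabel σ) - vertexDiff C true n ∈ isoRelations n 1
  | 0, σ => by simp [vertexDiff]
  | 1, σ => by
    have h : (relabel σ : Diagram 1 1 → Diagram 1 1) = id := by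
      funext g
      rw [Subsingleton.elim σ (Equiv.refl _)]
      exact relabelE_refl g
    rw [h, Finsupp.mapDomain_id, sub_self]
    exact zero_mem _
  | 2, σ => by simp [vertexDiff]
  | n + 3, σ => by
    have h : ∑ I : Finset (Fin (n + 3)) with 2 ≤ I.card ∧ 1 ≤ Iᶜ.card,
        Finsupp.single (blackSplit (n + 3) I) (1 : ℝ)
        = ∑ I : Finset (Fin (n + 3)) with 2 ≤ I.card ∧ 1 ≤ Iᶜ.card,
        Finsupp.single (blackSplit (n + 3) (I.map σ.toEmbedding)) (1 : ℝ) := by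
      refine (Finset.sum_bij (fun I _ => I.map σ.toEmbedding) ?_ ?_ ?_ ?_).symm
      · intro I hI
        simp only [Finset.mem_filter, Finset.mem_univ, true_and, Finset.card_compl,
          Finset.card_map] at hI ⊢
        exact hI
      · exact fun I _ J _ h => Finset.map_injective _ h
      · intro J hJ
        refine ⟨J.map σ.symm.toEmbedding, ?_, ?_⟩
        · simp only [Finset.mem_filter, Finset.mem_univ, true_and, Finset.card_compl,
            Finset.card_map] at hJ ⊢
          exact hJ
        · ext x
          simp
      · exact fun _ _ => rfl
    refine (congrArg (· ∈ isoRelations (n + 3) 1) ((congrArg₂ (· - ·)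
      Finsupp.mapDomain_finsetSum h).trans (Finset.sum_sub_distrib _ _).symm)).mpr ?_
    refine Submodule.sum_mem _ fun I _ => ?_
    rw [Finsupp.mapDomain_single]
    refine Submodule.subset_span ⟨blackSplit (n + 3) (I.map σ.toEmbedding),
      (blackSplit (n + 3) I).relabel σ, blackSplitIso (n + 3) I σ, blackSplit_pos_injective _ _,
      blackSplit_pos_injective (n + 3) I, ?_⟩
    have hs : (blackSplitIso (n + 3) I σ).sign = 1 := by
      rw [Iso.sign_eq]
      exact invSign_self _ _
    rw [hs]

theorem substL_vertexDiff_relabel (C : (n : ℕ) → Diagram n 1 →₀ ℝ) {Γ : Diagram p q}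
    (hΓ : Function.Injective Γ.pos) (v : Γ.V) (σ : Fin n ≃ Fin (Γ.ar v))
    (hσ : Γ.black v = false → ∀ i, (σ i : ℕ) = i) :
    substL Γ v ((vertexDiff C (Γ.black v) n).mapDomain (relabelE σ))
      = substL Γ v (vertexDiff C (Γ.black v) (Γ.ar v)) := by
  obtain rfl : n = Γ.ar v := by simpa using Fintype.card_congr σ
  cases hb : Γ.black v with
  | true =>
    rw [← sub_eq_zero, ← map_sub]
    exact substL_isoRelations hΓ v (vertexDiff_black_relabel C _ σ)
  | false =>
    obtain rfl : σ = Equiv.refl _ := Equiv.ext fun i => Fin.ext (hσ hb i)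
    have h : (relabelE (Equiv.refl _) : Diagram (Γ.ar v) 1 → Diagram (Γ.ar v) 1) = id :=
      funext relabelE_refl
    rw [h, Finsupp.mapDomain_id]

theorem dGraph_iso (C : (n : ℕ) → Diagram n 1 →₀ ℝ) {Γ Γ' : Diagram p q} (e : Iso Γ Γ')
    (h : Γ.IsAGraph) (h' : Γ'.IsAGraph) : dGraph C Γ' = e.sign • dGraph C Γ := by
  rw [dGraph, if_pos h', dGraph, if_pos h, Finset.smul_sum, ← Equiv.sum_comp e.toEquiv]
  refine Finset.sum_congr rfl fun v _ => ?_
  rw [← substL_vertexDiff_relabel C h'.2 (e.toEquiv v) (e.slots v)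
    (fun hb => e.slots_white v (by rw [← e.black_eq, hb])), e.black_eq]
  generalize vertexDiff C (Γ.black v) (Γ.ar v) = x
  induction x using Finsupp.induction_linear with
  | zero => simp
  | add x y hx hy =>
    rw [Finsupp.mapDomain_add, map_add, smul_add, hx, hy, map_add, smul_add, smul_add]
  | single g t =>
    rw [Finsupp.mapDomain_single, substL_single, substL_single]
    by_cases hg : Function.Injective g.pos
    · rw [cls_iso (Γ.substIsoLeft v g e) (subst_pos_injective h.2 hg)
        (subst_pos_injective h'.2 hg), substIsoLeft_sign _ _ _ _ h.2 h'.2, smul_smul, smul_smul,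
        smul_smul, smul_smul]
      congr 1
      linear_combination (t * Γ.frontSign v * e.sign) * Γ'.frontSign_mul_self (e.toEquiv v)
    · rw [cls_eq_zero, cls_eq_zero]
      · simp
      · exact fun hA => hg fun a b hab => Sum.inl_injective (hA.2 (a₁ := Sum.inl a)
          (a₂ := Sum.inl b) hab)
      · exact fun hA => hg fun a b hab => Sum.inl_injective (hA.2 (a₁ := Sum.inl a)
          (a₂ := Sum.inl b) hab)

/-! ### The symmetries of the image of a white vertex -/

theorem relabel_isAGraph {g : Diagram n q} (h : g.IsAGraph) (σ : Equiv.Perm (Fin n)) :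
    (g.relabel σ).IsAGraph := by
  refine ⟨?_, h.2, h.3, fun v i u hu hb => h.4 v i u ?_ hb⟩
  · have e : (g.relabel σ).feed = (Equiv.sumCongr (Equiv.refl g.V) σ) ∘ g.feed := by
      funext x
      rcases x with x | j <;> rfl
    rw [e, Equiv.comp_bijective]
    exact h.1
  · change Sum.map id σ (g.inp v i) = _ at hu
    cases hh : g.inp v i with
    | inl z => simpa [hh] using hu
    | inr l => simp [hh] at hu

theorem substL_relations {Γ : Diagram p q} (hΓ : Function.Injective Γ.pos) (v : Γ.V)
    {x : Diagram (Γ.ar v) 1 →₀ ℝ} (hx : x ∈ relations (Γ.ar v) 1)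
    (hA : ∀ g ∈ x.support, g.IsAGraph) : substL Γ v x = 0 := by
  classical
  have h := relations_le_ker (p := Γ.ar v) (q := 1)
    (fun g => if g.IsAGraph then cls (Γ.subst v g) else 0) (fun g hg => if_neg hg)
    (fun g g' e hg hg' => by
      rw [if_pos hg, if_pos hg', cls_iso (Γ.substIsoRight v g e) (subst_pos_injective hΓ hg.2)
        (subst_pos_injective hΓ hg'.2), substIsoRight_sign])
    (fun g y c hg hy hc => by
      rw [← cls_permute (Γ := Γ.subst v g) (v := Sum.inl y) hy hc]
      refine Finset.sum_congr rfl fun σ _ => ?_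
      dsimp only
      rw [if_pos ((permute_isAGraph g y σ).mpr hg)]
      exact congrArg (c σ • ·) (congrArg cls (subst_permute_left Γ v g y σ))) hx
  rw [LinearMap.mem_ker] at h
  rw [← h, substL, Finsupp.linearCombination_apply, Finsupp.linearCombination_apply]
  exact Finset.sum_congr rfl fun g hg => by
    dsimp only
    rw [if_pos (hA g hg)]

theorem substL_permute_self (Γ : Diagram p q) (v : Γ.V) (σ : Equiv.Perm (Fin (Γ.ar v)))
    (x : Diagram (Γ.ar v) 1 →₀ ℝ) :
    substL (Γ.permute v σ) v x = substL Γ v (x.mapDomain (relabel σ)) := by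
  rw [substL, substL, Finsupp.linearCombination_mapDomain]
  congr 2
  funext g
  exact congrArg cls (permute_subst_self Γ v g σ)

theorem substL_permute_ne {Γ : Diagram p q} {v w : Γ.V} (hvw : v ≠ w) (hv : Γ.black v = false)
    {c : Equiv.Perm (Fin (Γ.ar v)) →₀ ℝ} (hc : WhiteSymmetry (Γ.ar v) c)
    (x : Diagram (Γ.ar w) 1 →₀ ℝ) :
    (c.sum fun σ t => t • substL (Γ.permute v σ) w x) = 0 := by
  induction x using Finsupp.induction_linear with
  | zero => exact Finset.sum_eq_zero fun σ _ =>
      (congrArg (c σ • ·) (map_zero (substL (Γ.permute v σ) w))).trans (smul_zero _)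
  | add x y hx hy =>
    rw [← add_zero (0 : Space p q), ← hx]
    nth_rewrite 2 [hx]
    rw [← hy, ← Finsupp.sum_add]
    exact Finset.sum_congr rfl fun σ _ =>
      (congrArg (c σ • ·) (map_add (substL (Γ.permute v σ) w) x y)).trans (smul_add _ _ _)
  | single g s =>
    have h := cls_permute (Γ := Γ.subst w g) (v := Sum.inr ⟨v, hvw⟩) hv hc
    refine (Finset.sum_congr rfl fun σ _ => ?_).trans
      (Finset.smul_sum.symm.trans ((congrArg (s • ·) h).trans (smul_zero s)))
    refine (congrArg (c σ • ·) (substL_single (Γ.permute v σ) w g s)).trans ?_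
    rw [smul_comm]
    exact congrArg (fun x => s • c σ • x) (congrArg cls (permute_subst_ne Γ w g hvw σ))

/-- Extend a permutation by a fixed element in front. -/
def consPerm (σ : Equiv.Perm (Fin n)) : Equiv.Perm (Fin (n + 1)) :=
  Equiv.Perm.decomposeFin.symm (0, σ)

theorem consPerm_zero (σ : Equiv.Perm (Fin n)) : consPerm σ 0 = 0 := by
  simp [consPerm]

theorem consPerm_succ (σ : Equiv.Perm (Fin n)) (i : Fin n) : consPerm σ i.succ = (σ i).succ := by
  simp [consPerm]

theorem consPerm_one : consPerm (1 : Equiv.Perm (Fin n)) = 1 := by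
  ext i
  refine Fin.cases ?_ (fun i => ?_) i
  · rw [consPerm_zero]; rfl
  · rw [consPerm_succ]; rfl

theorem consPerm_mul (σ τ : Equiv.Perm (Fin n)) :
    consPerm (σ * τ) = consPerm σ * consPerm τ := by
  ext i
  refine Fin.cases ?_ (fun i => ?_) i
  · simp only [Equiv.Perm.mul_apply, consPerm_zero]
  · simp only [Equiv.Perm.mul_apply, consPerm_succ]

theorem consPerm_swap (i j : Fin n) :
    consPerm (Equiv.swap i j) = Equiv.swap i.succ j.succ := by
  ext k
  refine Fin.cases ?_ (fun k => ?_) k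
  · rw [consPerm_zero, Equiv.swap_apply_of_ne_of_ne] <;> exact (Fin.succ_ne_zero _).symm
  · rw [consPerm_succ, Equiv.swap_apply_def, Equiv.swap_apply_def]
    simp only [Fin.succ_inj]
    split_ifs <;> rfl

theorem WhiteSymmetry.consPerm {c : Equiv.Perm (Fin n) →₀ ℝ} (hc : WhiteSymmetry n c) :
    WhiteSymmetry (n + 1) (c.mapDomain consPerm) := by
  have hcyc : ∀ a b c : Fin n, (cyclicSum a b c).mapDomain GraphComplex.consPerm
      = cyclicSum a.succ b.succ c.succ := by
    intro a b c
    rw [cyclicSum, Finsupp.mapDomain_add, Finsupp.mapDomain_add, Finsupp.mapDomain_single,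
      Finsupp.mapDomain_single, Finsupp.mapDomain_single, consPerm_one, consPerm_mul, consPerm_mul,
      consPerm_swap, consPerm_swap, cyclicSum]
  cases hc with
  | antisymm b c hb hc =>
    rw [Finsupp.mapDomain_add, Finsupp.mapDomain_single, Finsupp.mapDomain_single, consPerm_one,
      consPerm_swap]
    exact .antisymm _ _ (by simp; omega) (by simp; omega)
  | bianchi₁ a b c ha hb hc =>
    rw [hcyc]
    exact .bianchi₁ _ _ _ (by simp; omega) (by simp; omega) (by simp; omega)
  | bianchi₂ a b c ha hb hc =>
    rw [hcyc]
    exact .bianchi₂ _ _ _ (by simp; omega) (by simp; omega) (by simp; omega)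
  | symm i j hi hj =>
    rw [sub_eq_add_neg, ← Finsupp.single_neg, Finsupp.mapDomain_add, Finsupp.mapDomain_single,
      Finsupp.mapDomain_single, consPerm_one, consPerm_swap, Finsupp.single_neg, ← sub_eq_add_neg]
    exact .symm _ _ (by simp; omega) (by simp; omega)

theorem relabel_whiteQ (σ : Equiv.Perm (Fin n)) :
    (whiteQ n).relabel σ = (whiteQ n).permute true (consPerm σ) := by
  have h : ((whiteQ n).relabel σ).inp = ((whiteQ n).permute true (consPerm σ)).inp := by
    funext v
    cases v with
    | false =>
      funext i
      exact Fin.elim0 i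
    | true =>
      funext i
      refine Eq.trans ?_ (permute_inp_self (whiteQ n) true (consPerm σ) i).symm
      change Fin (n + 1) at i
      refine Fin.cases ?_ (fun i => ?_) i
      · exact (congrArg ((whiteQ n).inp true) (consPerm_zero σ)).symm
      · exact (congrArg ((whiteQ n).inp true) (consPerm_succ σ i)).symm
  exact congrArg (fun f => ({ whiteQ n with inp := f } : Diagram n 1)) h

theorem relabel_whiteOut (σ : Equiv.Perm (Fin n)) :
    (whiteOut n).relabel σ = (whiteOut n).permute false σ := by
  have h : ((whiteOut n).relabel σ).inp = ((whiteOut n).permute false σ).inp := by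
    funext v
    cases v with
    | false =>
      funext i
      exact (permute_inp_self (whiteOut n) false σ i).symm
    | true => exact (permute_inp_ne (whiteOut n) false σ (w := true) Bool.false_ne_true.symm).symm
  exact congrArg (fun f => ({ whiteOut n with inp := f } : Diagram n 1)) h

theorem relabel_whiteIn (σ : Equiv.Perm (Fin n)) (k : Fin n) :
    (whiteIn n k).relabel σ = (whiteIn n (σ k)).permute true σ := by
  have h : ((whiteIn n k).relabel σ).inp = ((whiteIn n (σ k)).permute true σ).inp := by
    funext v
    cases v with
    | false => exact (permute_inp_ne (whiteIn n (σ k)) true σ (w := false) Bool.false_ne_true).symm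
    | true =>
      funext i
      refine Eq.trans ?_ (permute_inp_self (whiteIn n (σ k)) true σ i).symm
      change Fin n at i
      change Sum.map id σ (if i = k then Sum.inl false else Sum.inr i)
        = if σ i = σ k then Sum.inl false else Sum.inr (σ i)
      by_cases h : i = k
      · subst h; simp
      · simp [h]
  exact congrArg (fun f => ({ whiteIn n (σ k) with inp := f } : Diagram n 1)) h

/-- The image of a white vertex has the symmetries of a white vertex in the incoming legs. -/
theorem substL_white_symmetry {C : (n : ℕ) → Diagram n 1 →₀ ℝ} (hC : IsCompletion C)
    {Γ : Diagram p q} (hΓ : Γ.IsAGraph) {v : Γ.V} (hv : Γ.black v = false)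
    {c : Equiv.Perm (Fin (Γ.ar v)) →₀ ℝ} (hc : WhiteSymmetry (Γ.ar v) c) :
    (c.sum fun σ t => t • substL Γ v ((vertexDiff C false (Γ.ar v)).mapDomain (relabel σ))) = 0 := by
  have h3 := hΓ.3 v hv
  have hQ : (c.sum fun σ t => t • cls (Γ.subst v ((whiteQ (Γ.ar v)).relabel σ))) = 0 := by
    have h := cls_permute (Γ := Γ.subst v (whiteQ (Γ.ar v))) (v := Sum.inl true) rfl hc.consPerm
    have h' := (Finsupp.sum_mapDomain_index (f := consPerm) (s := c)
      (h := fun σ t => t • cls ((Γ.subst v (whiteQ (Γ.ar v))).permute (Sum.inl true) σ))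
      (fun _ => zero_smul ℝ _) (fun _ _ _ => add_smul (R := ℝ) _ _ _)).symm.trans h
    refine (Finset.sum_congr rfl fun σ _ => ?_).trans h'
    exact congrArg (c σ • ·) (congrArg cls ((congrArg (Γ.subst v) (relabel_whiteQ σ)).trans
      (subst_permute_left _ _ _ _ _)))
  have hO : (c.sum fun σ t => t • cls (Γ.subst v ((whiteOut (Γ.ar v)).relabel σ))) = 0 := by
    rw [← cls_permute (Γ := Γ.subst v (whiteOut (Γ.ar v))) (v := Sum.inl false) rfl hc]
    refine Finset.sum_congr rfl fun σ _ => ?_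
    dsimp only
    rw [relabel_whiteOut]
    exact congrArg (c σ • ·) (congrArg cls (subst_permute_left _ _ _ _ _))
  have hI : (c.sum fun σ t => t • ∑ k, cls (Γ.subst v ((whiteIn (Γ.ar v) k).relabel σ))) = 0 := by
    have : ∀ k, (c.sum fun σ t => t • cls (Γ.subst v ((whiteIn (Γ.ar v) k).permute true σ))) = 0 := by
      intro k
      rw [← cls_permute (Γ := Γ.subst v (whiteIn (Γ.ar v) k)) (v := Sum.inl true) rfl hc]
      refine Finset.sum_congr rfl fun σ _ => ?_
      exact congrArg (c σ • ·) (congrArg cls (subst_permute_left _ _ _ _ _))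
    refine Eq.trans ?_ (Finset.sum_eq_zero fun k (_ : k ∈ Finset.univ) => this k)
    simp only [Finsupp.sum]
    rw [Finset.sum_comm]
    refine Finset.sum_congr rfl fun σ _ => ?_
    rw [Finset.smul_sum, ← Equiv.sum_comp σ (fun k =>
      c σ • cls (Γ.subst v ((whiteIn (Γ.ar v) k).permute true σ)))]
    exact Finset.sum_congr rfl fun k _ => by rw [relabel_whiteIn]
  have hCn : (c.sum fun σ t => t • substL Γ v ((C (Γ.ar v)).mapDomain (relabel σ))) = 0 := by
    rw [← substL_relations hΓ.2 v (hC.symmetric _ h3 c hc), Finsupp.sum, Finsupp.sum, map_sum]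
    · exact Finset.sum_congr rfl fun σ _ => by rw [map_smul]
    · classical
      intro g hg
      obtain ⟨σ, _, hσ⟩ := Finset.mem_biUnion.mp (Finsupp.support_finsetSum hg)
      obtain ⟨g', hg', rfl⟩ := Finset.mem_image.mp
        (Finsupp.mapDomain_support (Finsupp.support_smul hσ))
      exact relabel_isAGraph (hC.supported _ h3 g' hg').1 σ
  have hsum : ∀ σ, substL Γ v ((vertexDiff C false (Γ.ar v)).mapDomain (relabel σ))
      = cls (Γ.subst v ((whiteQ (Γ.ar v)).relabel σ))
        - cls (Γ.subst v ((whiteOut (Γ.ar v)).relabel σ))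
        + ∑ k, cls (Γ.subst v ((whiteIn (Γ.ar v) k).relabel σ))
        + substL Γ v ((C (Γ.ar v)).mapDomain (relabel σ)) := by
    intro σ
    rw [vertexDiff, Finsupp.mapDomain_add, Finsupp.mapDomain_add, sub_eq_add_neg,
      ← Finsupp.single_neg, Finsupp.mapDomain_add, Finsupp.mapDomain_single,
      Finsupp.mapDomain_single, Finsupp.mapDomain_finsetSum, map_add, map_add, map_add, map_sum,
      substL_single, substL_single, one_smul, neg_smul, one_smul, ← sub_eq_add_neg]
    congr 2
    exact Finset.sum_congr rfl fun k _ => by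
      rw [Finsupp.mapDomain_single, substL_single, one_smul]
  simp only [hsum, smul_add, smul_sub, Finsupp.sum_add, Finsupp.sum_sub, hQ, hO, hI, hCn]
  simp

theorem dGraph_permute {C : (n : ℕ) → Diagram n 1 →₀ ℝ} (hC : IsCompletion C)
    {Γ : Diagram p q} (hΓ : Γ.IsAGraph) {v : Γ.V} (hv : Γ.black v = false)
    {c : Equiv.Perm (Fin (Γ.ar v)) →₀ ℝ} (hc : WhiteSymmetry (Γ.ar v) c) :
    (c.sum fun σ t => t • dGraph C (Γ.permute v σ)) = 0 := by
  have hw : ∀ w : Γ.V, (c.sum fun σ t => t • Γ.frontSign w •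
      substL (Γ.permute v σ) w (vertexDiff C (Γ.black w) (Γ.ar w))) = 0 := by
    intro w
    have hw : (c.sum fun σ t => t •
        substL (Γ.permute v σ) w (vertexDiff C (Γ.black w) (Γ.ar w))) = 0 := by
      by_cases hvw : v = w
      · subst hvw
        rw [← substL_white_symmetry hC hΓ hv hc, hv]
        exact Finset.sum_congr rfl fun σ _ => by
          dsimp only
          rw [← substL_permute_self]
      · exact substL_permute_ne hvw hv hc _
    rw [← smul_zero (Γ.frontSign w), ← hw, Finsupp.smul_sum]
    exact Finset.sum_congr rfl fun σ _ => smul_comm _ _ _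
  refine Eq.trans ?_ (Finset.sum_eq_zero fun w (_ : w ∈ Finset.univ) => hw w)
  simp only [Finsupp.sum]
  rw [Finset.sum_comm]
  refine Finset.sum_congr rfl fun σ _ => ?_
  rw [← Finset.smul_sum, dGraph, if_pos ((permute_isAGraph Γ v σ).mpr hΓ)]
  rfl

/-- The coboundary operator on the space of graphs. -/
def dSpace {C : (n : ℕ) → Diagram n 1 →₀ ℝ} (hC : IsCompletion C) (p q : ℕ) :
    Space p q →ₗ[ℝ] Space p q :=
  (relations p q).liftQ (Finsupp.linearCombination ℝ (dGraph C))
    (relations_le_ker _ (fun _ h => if_neg h) (fun _ _ e h h' => dGraph_iso C e h h')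
      (fun _ _ _ h hv hc => dGraph_permute hC h hv hc))

theorem dSpace_cls {C : (n : ℕ) → Diagram n 1 →₀ ℝ} (hC : IsCompletion C) (Γ : Diagram p q) :
    dSpace hC p q (cls Γ) = dGraph C Γ := by
  rw [cls, Submodule.mkQ_apply, dSpace, Submodule.liftQ_apply, Finsupp.linearCombination_single,
    one_smul]

theorem dSpace_mkQ {C : (n : ℕ) → Diagram n 1 →₀ ℝ} (hC : IsCompletion C)
    (x : Diagram p q →₀ ℝ) :
    dSpace hC p q ((relations p q).mkQ x) = (relations p q).mkQ (graphDiff C p q x) := by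
  rw [mkQ_graphDiff, Submodule.mkQ_apply, dSpace, Submodule.liftQ_apply]

theorem dSpace_comp {C : (n : ℕ) → Diagram n 1 →₀ ℝ} (hC : IsCompletion C) (p q : ℕ) :
    dSpace hC p q ∘ₗ dSpace hC p q = 0 := by
  refine LinearMap.ext fun x => ?_
  obtain ⟨x, rfl⟩ := Submodule.mkQ_surjective _ x
  rw [LinearMap.comp_apply, dSpace_mkQ, dSpace_mkQ, LinearMap.zero_apply]
  induction x using Finsupp.induction_linear with
  | zero => simp
  | add x y hx hy => rw [map_add, map_add, map_add, hx, hy, add_zero]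
  | single Γ t =>
    by_cases h : Γ.IsAGraph
    · rw [← mul_one t, ← smul_eq_mul, ← Finsupp.smul_single, map_smul, map_smul, map_smul]
      exact (congrArg (t • ·) ((Submodule.Quotient.mk_eq_zero (relations p q)).mpr
        (hC.sq_zero p q Γ h))).trans (smul_zero _)
    · have : graphDiff C p q (Finsupp.single Γ t) = 0 := by
        rw [graphDiff, Finsupp.linearCombination_single, if_neg h, smul_zero]
      rw [this, map_zero, map_zero]

/-! ### Only the last three incoming edges of a white vertex matter -/

theorem sum_single_add_single {M : Type*} [AddCommGroup M] [Module ℝ M] {ι : Type*} (i j : ι)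
    (F : ι → M) (s t : ℝ) : ((Finsupp.single i s + Finsupp.single j t).sum fun k u => u • F k)
      = s • F i + t • F j := by
  classical
  rw [Finsupp.sum_add_index' (h := fun k u => u • F k) (fun _ => zero_smul ℝ _) (fun _ _ _ => add_smul (R := ℝ) _ _ _),
    Finsupp.sum_single_index (h := fun k u => u • F k) (zero_smul ℝ _),
    Finsupp.sum_single_index (h := fun k u => u • F k) (zero_smul ℝ _)]

theorem cls_permute_swap {Γ : Diagram p q} {v : Γ.V} (hv : Γ.black v = false)
    (i j : Fin (Γ.ar v)) (hi : (i : ℕ) + 4 ≤ Γ.ar v) (hj : (j : ℕ) + 4 ≤ Γ.ar v) :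
    cls (Γ.permute v (Equiv.swap i j)) = cls Γ := by
  have h := cls_permute hv (WhiteSymmetry.symm i j hi hj)
  rw [sub_eq_add_neg, ← Finsupp.single_neg,
    sum_single_add_single (F := fun σ => cls (Γ.permute v σ)), permute_one, one_smul, neg_smul,
    one_smul, ← sub_eq_add_neg, sub_eq_zero] at h
  exact h.symm

theorem cls_permute_white (k : ℕ) : ∀ (Γ : Diagram p q) (v : Γ.V) (τ : Equiv.Perm (Fin (Γ.ar v))),
    Γ.black v = false → (∀ i : Fin (Γ.ar v), Γ.ar v ≤ (i : ℕ) + 3 → τ i = i) → τ.support.card ≤ k →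
      cls (Γ.permute v τ) = cls Γ := by
  induction k with
  | zero =>
    intro Γ v τ _ _ h
    have : τ = 1 := Equiv.Perm.card_support_eq_zero.mp (Nat.le_zero.mp h)
    rw [this, permute_one]
  | succ k ih =>
    intro Γ v τ hv hτ h
    by_cases h1 : τ = 1
    · rw [h1, permute_one]
    obtain ⟨i, hi⟩ : ∃ i, τ i ≠ i := by
      by_contra hcon
      push Not at hcon
      exact h1 (Equiv.ext hcon)
    have hi4 : (i : ℕ) + 4 ≤ Γ.ar v := by
      by_contra hcon
      exact hi (hτ i (by omega))
    have hj4 : (τ i : ℕ) + 4 ≤ Γ.ar v := by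
      by_contra hcon
      exact hi (τ.injective (hτ (τ i) (by omega)))
    have hd : τ = Equiv.swap i (τ i) * (Equiv.swap i (τ i) * τ) := by
      rw [← mul_assoc, Equiv.swap_mul_self, one_mul]
    have hlt := Equiv.Perm.card_support_swap_mul hi
    rw [hd, ← permute_permute]
    refine (ih (Γ.permute v (Equiv.swap i (τ i))) v (Equiv.swap i (τ i) * τ) hv ?_ ?_).trans
      (cls_permute_swap hv _ _ hi4 hj4)
    · intro j hj
      change Γ.ar v ≤ (j : ℕ) + 3 at hj
      rw [Equiv.Perm.mul_apply, hτ j hj, Equiv.swap_apply_of_ne_of_ne]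
      · intro hji
        rw [hji] at hj
        omega
      · intro hji
        rw [hji] at hj
        omega
    · omega

theorem cls_permute_black {Γ : Diagram p q} (hΓ : Function.Injective Γ.pos) (v : Γ.V)
    (τ : Equiv.Perm (Fin (Γ.ar v))) (hv : Γ.black v = true) : cls (Γ.permute v τ) = cls Γ := by
  classical
  let e : Iso (Γ.permute v τ) Γ :=
    { Γ.permuteLoose v τ with
      slots_white := by
        change ∀ w : Γ.V, Γ.black w = false → ∀ i,
          (Function.update (fun w => Equiv.refl (Fin (Γ.ar w))) v τ w i : ℕ) = i
        intro w hw i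
        rw [Function.update_of_ne]
        · rfl
        · rintro rfl
          rw [hv] at hw
          exact Bool.noConfusion hw }
  have hs : e.sign = 1 := by
    rw [Iso.sign_eq]
    exact invSign_self _ _
  rw [cls_iso e hΓ hΓ, hs, one_smul]

open Classical in
/-- Permute the incoming edges of the vertices in `s`. -/
@[reducible] def permuteOn (Γ : Diagram p q) (τ : ∀ v, Equiv.Perm (Fin (Γ.ar v)))
    (s : Finset Γ.V) : Diagram p q :=
  { Γ with inp := fun v => if v ∈ s then Γ.inp v ∘ τ v else Γ.inp v }

theorem cls_permuteOn {Γ : Diagram p q} (hΓ : Function.Injective Γ.pos)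
    (τ : ∀ v, Equiv.Perm (Fin (Γ.ar v)))
    (hτ : ∀ v, Γ.black v = false → ∀ i : Fin (Γ.ar v), Γ.ar v ≤ (i : ℕ) + 3 → τ v i = i) (s : Finset Γ.V) :
    cls (permuteOn Γ τ s) = cls Γ := by
  classical
  induction s using Finset.induction_on with
  | empty =>
    congr 1
  | insert w s hw ih =>
    have h : permuteOn Γ τ (insert w s) = (permuteOn Γ τ s).permute w (τ w) := by
      have h : (permuteOn Γ τ (insert w s)).inp = ((permuteOn Γ τ s).permute w (τ w)).inp := by
        funext v
        change Γ.V at v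
        by_cases hv : v = w
        · subst hv
          funext i
          rw [permute_inp_self]
          simp [hw]
        · refine Eq.trans ?_ (permute_inp_ne (permuteOn Γ τ s) w (τ w) hv).symm
          simp [hv]
      exact congrArg (fun f => ({ Γ with inp := f } : Diagram p q)) h
    rw [h, ← ih]
    cases hb : Γ.black w with
    | true => exact cls_permute_black (Γ := permuteOn Γ τ s) hΓ w (τ w) hb
    | false => exact cls_permute_white _ (permuteOn Γ τ s) w (τ w) hb (hτ w hb) le_rfl

/-- The class of a graph is determined up to sign by a loose isomorphism that preserves the last
three incoming edges of all white vertices. -/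
theorem cls_looseIso {Γ Γ' : Diagram p q} (e : LooseIso Γ Γ') (hΓ : Function.Injective Γ.pos)
    (hΓ' : Function.Injective Γ'.pos)
    (he : ∀ v, Γ.black v = false → ∀ i : Fin (Γ.ar v), Γ.ar v ≤ (i : ℕ) + 3 → (e.slots v i : ℕ) = i) :
    cls Γ' = invSign Γ.blacks Γ.zpos (fun v => Γ'.zpos (e.toEquiv v)) • cls Γ := by
  classical
  let τ : ∀ v, Equiv.Perm (Fin (Γ.ar v)) := fun v =>
    ((e.slots v).trans (finCongr (e.ar_eq v))).symm
  let f : Iso (permuteOn Γ τ Finset.univ) Γ' :=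
    { toEquiv := e.toEquiv
      black_eq := e.black_eq
      slots := fun v => finCongr (e.ar_eq v).symm
      slots_white := fun _ _ _ => rfl
      inp_eq := by
        change ∀ (v : Γ.V) (i : Fin (Γ.ar v)), Γ'.inp (e.toEquiv v) (finCongr (e.ar_eq v).symm i)
          = Sum.map e.toEquiv id ((if v ∈ Finset.univ then Γ.inp v ∘ τ v else Γ.inp v) i)
        intro v i
        rw [if_pos (Finset.mem_univ v), Function.comp_apply, ← e.inp_eq]
        congr 1
        simp [τ]
      out_eq := e.out_eq }
  rw [← cls_permuteOn hΓ τ ?_ Finset.univ, cls_iso f hΓ hΓ', f.sign_eq]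
  · rfl
  · intro v hv i hi
    rw [Equiv.symm_apply_eq]
    ext
    simp [he v hv i hi]

/-! ### Graphs without their univalent black vertices -/

/-- What remains of a graph when the univalent black vertices are deleted: the other vertices, the
input slots that are not fed by univalent black vertices, and the edges. The vertices with
`black v = true` are the black ones with at least two incoming edges; `pos` numbers them. The other
vertices are the white ones and the bivalent black ones. -/
structure Skeleton (p q : ℕ) : Type 1 where
  V : Type
  [fintypeV : Fintype V]
  S : Type
  [fintypeS : Fintype S]
  tgt : S → V
  src : S → V ⊕ Fin p
  out : Fin q → V
  black : V → Bool
  pos : V → ℤ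

attribute [instance] Skeleton.fintypeV Skeleton.fintypeS

/-- The data that make a graph of a skeleton. The univalent black vertices are labelled by integers
(which also give their place in the orientation), `att τ` is the white vertex to which the one
labelled `τ` is attached, or `none` if this label is not in use. A bivalent black vertex
is represented by a vertex with a label attached to it, which stands for the vertex itself.
For a white vertex `mark` gives its last three input slots; it is `none` for black vertices. -/
@[ext]
structure Marking (K : Skeleton p q) where
  att : ℤ → Option K.V
  mark : K.V → Option ((K.S ⊕ ℤ) × (K.S ⊕ ℤ) × (K.S ⊕ ℤ))

variable {K : Skeleton p q}

/-- The input slots of the vertex `y`, those fed by univalent black vertices being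
represented by the labels of these. -/
def Marking.IsAt (st : Marking K) (y : K.V) (l : K.S ⊕ ℤ) : Prop :=
  Sum.elim (fun z => K.tgt z = y) (fun τ => st.att τ = some y) l

/-- The requirements on a skeleton with a marking to describe an admissible graph. -/
structure Marking.Good (st : Marking K) : Prop where
  feed : Function.Bijective (Sum.elim K.src (fun j => Sum.inl (K.out j)) :
    K.S ⊕ Fin q → K.V ⊕ Fin p)
  pos_inj : ∀ y y', K.black y = true → K.black y' = true → K.pos y = K.pos y' → y = y'
  finite : {τ | st.att τ ≠ none}.Finite
  pos_ne : ∀ y τ, K.black y = true → st.att τ ≠ none → τ ≠ K.pos y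
  black_mark : ∀ y, K.black y = true → st.mark y = none
  black_slots : ∀ y, K.black y = true → ∃ z z', z ≠ z' ∧ K.tgt z = y ∧ K.tgt z' = y
  black_att : ∀ y τ, K.black y = true → st.att τ ≠ some y
  q_slot : ∀ y, K.black y = false → st.mark y = none → ∃ z, ∀ z', K.tgt z' = y ↔ z' = z
  q_att : ∀ y, K.black y = false → st.mark y = none → ∃ τ, ∀ τ', st.att τ' = some y ↔ τ' = τ
  mark_at : ∀ y c a b, st.mark y = some (c, a, b) →
    st.IsAt y c ∧ st.IsAt y a ∧ st.IsAt y b ∧ c ≠ a ∧ c ≠ b ∧ a ≠ b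

/-- The graph `Γ` is described by the skeleton `K` with the marking `st`. Here `t` gives the labels
of all black vertices, and `lab` the names of the input slots. -/
structure Pres (Γ : Diagram p q) (K : Skeleton p q) (st : Marking K) where
  v : K.V → Γ.V
  t : Γ.V → ℤ
  lab : ∀ x, Fin (Γ.ar x) → K.S ⊕ ℤ
  v_inj : Function.Injective v
  v_range : ∀ x, (∃ y, v y = x) ↔ ¬ Γ.IsUnivalentBlack x
  t_inj : ∀ x x', Γ.black x = true → Γ.black x' = true → t x = t x' → x = x'
  t_att : ∀ τ, st.att τ ≠ none ↔ ∃ x, Γ.black x = true ∧ Γ.ar x ≤ 1 ∧ t x = τ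
  t_black : ∀ y, K.black y = true → t (v y) = K.pos y
  black_iff : ∀ y, K.black y = true ↔ Γ.black (v y) = true ∧ 2 ≤ Γ.ar (v y)
  mark_iff : ∀ y, st.mark y = none ↔ Γ.black (v y) = true
  att_one : ∀ y, Γ.black (v y) = true → Γ.ar (v y) = 1 → st.att (t (v y)) = some y
  lab_inl : ∀ y i z, lab (v y) i = Sum.inl z →
    K.tgt z = y ∧ Γ.inp (v y) i = Sum.map v id (K.src z)
  lab_inr : ∀ y i τ, lab (v y) i = Sum.inr τ → Γ.black (v y) = false ∧ st.att τ = some y ∧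
    ∃ x, Γ.IsUnivalentBlack x ∧ Γ.inp (v y) i = Sum.inl x ∧ t x = τ
  lab_inj : ∀ y, Function.Injective (lab (v y))
  surj_inl : ∀ y z, K.tgt z = y → ∃ i, lab (v y) i = Sum.inl z
  surj_inr : ∀ y τ, Γ.black (v y) = false → st.att τ = some y → ∃ i, lab (v y) i = Sum.inr τ
  mark_eq : ∀ y c a b, st.mark y = some (c, a, b) → ∀ i : Fin (Γ.ar (v y)),
    ((i : ℕ) + 3 = Γ.ar (v y) → lab (v y) i = c) ∧ ((i : ℕ) + 2 = Γ.ar (v y) → lab (v y) i = a) ∧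
    ((i : ℕ) + 1 = Γ.ar (v y) → lab (v y) i = b)
  out_eq : ∀ j, Γ.out j = v (K.out j)

namespace Pres

variable {Γ Γ' : Diagram p q} {st : Marking K}

/-- The sign that compares the numbering of the vertices of `Γ` with their labels. -/
def sgn (P : Pres Γ K st) : ℝ := invSign Γ.blacks Γ.zpos P.t

theorem sgn_mul_self (P : Pres Γ K st) : P.sgn * P.sgn = 1 := invSign_mul_self _ _ _

theorem not_univ (P : Pres Γ K st) (y : K.V) : ¬ Γ.IsUnivalentBlack (P.v y) :=
  (P.v_range _).mp ⟨y, rfl⟩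

theorem t_injOn (P : Pres Γ K st) : Set.InjOn P.t Γ.blacks := fun x hx x' hx' h =>
  P.t_inj x x' (mem_blacks.mp hx) (mem_blacks.mp hx') h

theorem q_iff (P : Pres Γ K st) (y : K.V) :
    (K.black y = false ∧ st.mark y = none) ↔ (Γ.black (P.v y) = true ∧ Γ.ar (P.v y) = 1) := by
  have h1 := P.black_iff y
  have h2 := P.not_univ y
  rw [IsUnivalentBlack] at h2
  rw [P.mark_iff]
  constructor
  · rintro ⟨h3, h4⟩
    rw [h3] at h1
    simp only [h4, true_and, Bool.false_eq_true, false_iff] at h1 h2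
    exact ⟨h4, by omega⟩
  · rintro ⟨h3, h4⟩
    refine ⟨?_, h3⟩
    rw [h3, h4] at h1
    simpa using h1

/-- Corresponding vertices of two graphs with the same description. -/
def Rel (P : Pres Γ K st) (P' : Pres Γ' K st) (x : Γ.V) (x' : Γ'.V) : Prop :=
  (∃ y, P.v y = x ∧ P'.v y = x') ∨
    (Γ.IsUnivalentBlack x ∧ Γ'.IsUnivalentBlack x' ∧ P.t x = P'.t x')

variable (hst : st.Good) (P : Pres Γ K st) (P' : Pres Γ' K st)

theorem Rel.symm {P : Pres Γ K st} {P' : Pres Γ' K st} {x : Γ.V} {x' : Γ'.V}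
    (h : Rel P P' x x') : Rel P' P x' x := by
  rcases h with ⟨y, h1, h2⟩ | ⟨h1, h2, h3⟩
  · exact Or.inl ⟨y, h2, h1⟩
  · exact Or.inr ⟨h2, h1, h3.symm⟩

theorem Rel.unique {P : Pres Γ K st} {P' : Pres Γ' K st} {x : Γ.V} {x' x'' : Γ'.V}
    (h : Rel P P' x x') (h' : Rel P P' x x'') : x' = x'' := by
  rcases h with ⟨y, h1, h2⟩ | ⟨h1, h2, h3⟩ <;> rcases h' with ⟨y', h1', h2'⟩ | ⟨h1', h2', h3'⟩
  · rw [← h2, ← h2', P.v_inj (h1.trans h1'.symm)]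
  · exact absurd h1' (h1 ▸ P.not_univ y)
  · exact absurd h1 (h1' ▸ P.not_univ y')
  · exact P'.t_inj _ _ h2.1 h2'.1 (h3.symm.trans h3')

include hst in
theorem exists_rel (x : Γ.V) : ∃ x', Rel P P' x x' := by
  by_cases hx : Γ.IsUnivalentBlack x
  · have h1 : st.att (P.t x) ≠ none := (P.t_att _).mpr ⟨x, hx.1, by rw [hx.2]; omega, rfl⟩
    obtain ⟨x', hb, ha, ht⟩ := (P'.t_att _).mp h1
    refine ⟨x', Or.inr ⟨hx, ?_, ht.symm⟩⟩
    by_contra hx'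
    obtain ⟨y, rfl⟩ := (P'.v_range x').mpr hx'
    have ha1 : Γ'.ar (P'.v y) = 1 := by
      have : Γ'.ar (P'.v y) ≠ 0 := fun h => hx' ⟨hb, h⟩
      omega
    obtain ⟨hq1, hq2⟩ := (P'.q_iff y).mpr ⟨hb, ha1⟩
    obtain ⟨h3, h4⟩ := (P.q_iff y).mp ⟨hq1, hq2⟩
    obtain ⟨τ, hτ⟩ := hst.q_att y hq1 hq2
    have h5 := (hτ _).mp (P.att_one y h3 h4)
    have h6 := (hτ _).mp (P'.att_one y hb ha1)
    have h7 := P.t_inj _ _ h3 hx.1 (h5.trans (h6.symm.trans ht))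
    exact P.not_univ y (h7 ▸ hx)
  · obtain ⟨y, rfl⟩ := (P.v_range x).mpr hx
    exact ⟨P'.v y, Or.inl ⟨y, rfl, rfl⟩⟩

theorem Rel.black_eq {P : Pres Γ K st} {P' : Pres Γ' K st} {x : Γ.V} {x' : Γ'.V}
    (h : Rel P P' x x') : Γ'.black x' = Γ.black x := by
  rcases h with ⟨y, rfl, rfl⟩ | ⟨h1, h2, h3⟩
  · rw [Bool.eq_iff_iff, ← P.mark_iff, ← P'.mark_iff]
  · rw [h1.1, h2.1]

include hst in
theorem Rel.t_eq {P : Pres Γ K st} {P' : Pres Γ' K st} {x : Γ.V} {x' : Γ'.V}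
    (h : Rel P P' x x') (hb : Γ.black x = true) : P'.t x' = P.t x := by
  rcases h with ⟨y, rfl, rfl⟩ | ⟨h1, h2, h3⟩
  · cases hy : K.black y with
    | true => rw [P.t_black y hy, P'.t_black y hy]
    | false =>
      have hm := (P.mark_iff y).mpr hb
      obtain ⟨h1, h2⟩ := (P.q_iff y).mp ⟨hy, hm⟩
      obtain ⟨h3, h4⟩ := (P'.q_iff y).mp ⟨hy, hm⟩
      obtain ⟨τ, hτ⟩ := hst.q_att y hy hm
      rw [(hτ _).mp (P.att_one y h1 h2), (hτ _).mp (P'.att_one y h3 h4)]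
  · exact h3.symm

theorem exists_lab (y : K.V) (i : Fin (Γ.ar (P.v y))) : ∃ i', P'.lab (P'.v y) i' = P.lab (P.v y) i := by
  cases h : P.lab (P.v y) i with
  | inl z => exact P'.surj_inl y z (P.lab_inl y i z h).1
  | inr τ =>
    obtain ⟨h1, h2, -⟩ := P.lab_inr y i τ h
    refine P'.surj_inr y τ ?_ h2
    rw [← h1, Rel.black_eq (P := P) (P' := P') (Or.inl ⟨y, rfl, rfl⟩)]

theorem exists_slots (y : K.V) : ∃ σ : Fin (Γ.ar (P.v y)) ≃ Fin (Γ'.ar (P'.v y)),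
    ∀ i, P'.lab (P'.v y) (σ i) = P.lab (P.v y) i := by
  choose f hf using exists_lab P P' y
  choose g hg using exists_lab P' P y
  exact ⟨⟨f, g, fun i => P.lab_inj y (by rw [hg, hf]), fun i => P'.lab_inj y (by rw [hf, hg])⟩, hf⟩

theorem exists_slots_rel {x : Γ.V} {x' : Γ'.V} (h : Rel P P' x x') :
    ∃ σ : Fin (Γ.ar x) ≃ Fin (Γ'.ar x'),
      (∀ i, Sum.LiftRel (Rel P P') Eq (Γ.inp x i) (Γ'.inp x' (σ i))) ∧
      (Γ.black x = false → ∀ i : Fin (Γ.ar x), Γ.ar x ≤ (i : ℕ) + 3 → (σ i : ℕ) = i) := by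
  rcases h with ⟨y, rfl, rfl⟩ | ⟨h1, h2, h3⟩
  · obtain ⟨σ, hσ⟩ := exists_slots P P' y
    refine ⟨σ, fun i => ?_, fun hb i hi => ?_⟩
    · cases h : P.lab (P.v y) i with
      | inl z =>
        rw [(P.lab_inl y i z h).2, (P'.lab_inl y (σ i) z ((hσ i).trans h)).2]
        cases K.src z with
        | inl u => exact Sum.LiftRel.inl (Or.inl ⟨u, rfl, rfl⟩)
        | inr l => exact Sum.LiftRel.inr rfl
      | inr τ =>
        obtain ⟨-, -, x, hx, hi, ht⟩ := P.lab_inr y i τ h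
        obtain ⟨-, -, x', hx', hi', ht'⟩ := P'.lab_inr y (σ i) τ ((hσ i).trans h)
        rw [hi, hi']
        exact Sum.LiftRel.inl (Or.inr ⟨hx, hx', ht.trans ht'.symm⟩)
    · have har : Γ'.ar (P'.v y) = Γ.ar (P.v y) := by simpa using (Fintype.card_congr σ).symm
      have hm : st.mark y ≠ none := fun h => by
        rw [(P.mark_iff y).mp h] at hb
        exact Bool.noConfusion hb
      obtain ⟨⟨c, a, b⟩, hm⟩ := Option.ne_none_iff_exists'.mp hm
      obtain ⟨h1, h2, h3⟩ := P.mark_eq y c a b hm i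
      obtain ⟨h1', h2', h3'⟩ := P'.mark_eq y c a b hm ⟨i, by rw [har]; exact i.2⟩
      dsimp only at h1' h2' h3'
      have key : σ i = ⟨i, by rw [har]; exact i.2⟩ := by
        apply P'.lab_inj y
        rw [hσ]
        have := i.2
        obtain h | h | h : (i : ℕ) + 3 = Γ.ar (P.v y) ∨ (i : ℕ) + 2 = Γ.ar (P.v y) ∨
          (i : ℕ) + 1 = Γ.ar (P.v y) := by omega
        · rw [h1 h, h1' (by omega)]
        · rw [h2 h, h2' (by omega)]
        · rw [h3 h, h3' (by omega)]
      rw [key]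
  · refine ⟨finCongr (by rw [h1.2, h2.2]), fun i => ?_, fun hb => ?_⟩
    · exact Fin.elim0 (h1.2 ▸ i)
    · rw [h1.1] at hb
      exact Bool.noConfusion hb

include hst in
/-- Two graphs with the same description are loosely isomorphic. -/
theorem exists_looseIso : ∃ e : LooseIso Γ Γ', (∀ x, Rel P P' x (e.toEquiv x)) ∧
    ∀ x, Γ.black x = false → ∀ i : Fin (Γ.ar x), Γ.ar x ≤ (i : ℕ) + 3 → (e.slots x i : ℕ) = i := by
  choose F hF using exists_rel hst P P'
  choose G hG using exists_rel hst P' P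
  choose σ hσ using fun x => exists_slots_rel P P' (hF x)
  refine ⟨⟨⟨F, G, fun x => ((hG (F x)).unique (hF x).symm), fun x => ((hF (G x)).unique (hG x).symm)⟩,
    fun x => (hF x).black_eq, σ, fun x i => ?_, fun j => ?_⟩, hF, fun x hb i hi => (hσ x).2 hb i hi⟩
  · have := (hσ x).1 i
    change Γ'.inp (F x) (σ x i) = Sum.map F id (Γ.inp x i)
    revert this
    generalize Γ.inp x i = s
    generalize Γ'.inp (F x) (σ x i) = s'
    intro this
    cases this with
    | inl h => exact congrArg Sum.inl (h.unique (hF _))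
    | inr h => exact congrArg Sum.inr h.symm
  · rw [P'.out_eq]
    refine Rel.unique (Or.inl ⟨K.out j, (P.out_eq j).symm, rfl⟩) (hF _)

include hst in
/-- The class of a graph, with the sign that compares numbering and labels, is determined by the
description. -/
theorem sgn_smul_cls (hΓ : Function.Injective Γ.pos) (hΓ' : Function.Injective Γ'.pos) :
    P'.sgn • cls Γ' = P.sgn • cls Γ := by
  classical
  obtain ⟨e, h1, h2⟩ := exists_looseIso hst P P'
  have i1 : Function.Injective Γ.zpos := fun _ _ h => hΓ (Int.ofNat_inj.mp h)
  have i2 : Function.Injective Γ'.zpos := fun _ _ h => hΓ' (Int.ofNat_inj.mp h)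
  have hb : Γ'.blacks = Γ.blacks.image e.toEquiv := by
    ext x
    obtain ⟨x, rfl⟩ := e.toEquiv.surjective x
    simp [mem_blacks, e.black_eq]
  have hs : P'.sgn = invSign Γ.blacks (fun x => Γ'.zpos (e.toEquiv x)) P.t := by
    rw [sgn, hb, invSign_image e.toEquiv.injective.injOn]
    exact invSign_congr (fun _ _ => rfl) (fun x hx => (h1 x).t_eq hst (mem_blacks.mp hx))
  rw [cls_looseIso e hΓ hΓ' h2, smul_smul, hs, mul_comm, sgn,
    ← invSign_trans i1.injOn (i2.comp e.toEquiv.injective).injOn P.t_injOn]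
  rfl

end Pres

end

noncomputable section

variable {p q n m : ℕ} {K : Skeleton p q} {st : Marking K}

/-! ### Graphs with a given description -/

namespace Marking

/-- The univalent black vertices of the graph described by a marking: the labels attached to
white vertices. -/
abbrev Theta (st : Marking K) : Type := {τ : ℤ // ∃ y m, st.att τ = some y ∧ st.mark y = some m}

open Classical in
/-- The graph with the marking `st` whose vertex `y` has the input slots `g y`. -/
abbrev toDiagram (st : Marking K) [Fintype st.Theta] (N : K.V → ℕ)
    (g : ∀ y, Fin (N y) → K.S ⊕ ℤ) : Diagram p q where
  V := K.V ⊕ st.Theta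
  pos := fun x => Fintype.equivFin (K.V ⊕ st.Theta) x
  black := Sum.elim (fun y => (st.mark y).isNone) (fun _ => true)
  ar := Sum.elim N (fun _ => 0)
  inp := fun x => match x with
    | Sum.inl y => fun i => Sum.elim (fun z => Sum.map Sum.inl id (K.src z))
        (fun τ => Sum.inl (if h : _ then Sum.inr ⟨τ, h⟩ else Sum.inl y)) (g y i)
    | Sum.inr _ => Fin.elim0
  out := fun j => Sum.inl (K.out j)

theorem Good.exists_slots (hst : st.Good) (y : K.V) :
    ∃ (N : ℕ) (g : Fin N → K.S ⊕ ℤ), Function.Injective g ∧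
      (∀ l, (∃ i, g i = l) ↔ st.IsAt y l ∧ ∀ τ, l = Sum.inr τ → st.mark y ≠ none) ∧
      ∀ c a b, st.mark y = some (c, a, b) → 3 ≤ N ∧ ∀ i : Fin N,
        ((i : ℕ) + 3 = N → g i = c) ∧ ((i : ℕ) + 2 = N → g i = a) ∧ ((i : ℕ) + 1 = N → g i = b) := by
  classical
  have hfin : {l : K.S ⊕ ℤ | st.IsAt y l ∧ ∀ τ, l = Sum.inr τ → st.mark y ≠ none}.Finite := by
    refine ((Set.finite_range Sum.inl).union (hst.finite.image Sum.inr)).subset ?_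
    rintro (z | τ) ⟨h, -⟩
    · exact Or.inl ⟨z, rfl⟩
    · refine Or.inr ⟨τ, ?_, rfl⟩
      have h' : st.att τ = some y := h
      simp [h']
  set t := hfin.toFinset with ht
  have hmem : ∀ l, l ∈ t ↔ st.IsAt y l ∧ ∀ τ, l = Sum.inr τ → st.mark y ≠ none := by simp [ht]
  cases hm : st.mark y with
  | none =>
    refine ⟨t.card, fun i => (t.equivFin.symm i : K.S ⊕ ℤ),
      Subtype.val_injective.comp t.equivFin.symm.injective, fun l => ?_, by simp⟩
    have hmem' := hmem l
    rw [hm] at hmem'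
    rw [← hmem']
    constructor
    · rintro ⟨i, rfl⟩
      exact (t.equivFin.symm i).2
    · exact fun h => ⟨t.equivFin ⟨l, h⟩, by simp⟩
  | some m =>
    obtain ⟨c, a, b⟩ := m
    obtain ⟨hc, ha, hb, hca, hcb, hab⟩ := hst.mark_at y c a b hm
    have h3 : ∀ l, st.IsAt y l → l ∈ t := fun l hl => (hmem l).mpr ⟨hl, by simp [hm]⟩
    have hsub : ({c, a, b} : Finset (K.S ⊕ ℤ)) ⊆ t := by
      intro l hl
      simp only [Finset.mem_insert, Finset.mem_singleton] at hl
      rcases hl with rfl | rfl | rfl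
      exacts [h3 _ hc, h3 _ ha, h3 _ hb]
    have hcard : 3 ≤ t.card := by
      rw [← Finset.card_eq_three.mpr ⟨c, a, b, hca, hcb, hab, rfl⟩]
      exact Finset.card_le_card hsub
    obtain ⟨g, hg⟩ := Finset.exists_equiv_extend_of_card_eq (α := Fin t.card) (t := t) (by simp)
      (s := Finset.univ.filter fun i : Fin t.card => t.card ≤ (i : ℕ) + 3)
      (f := fun i => if (i : ℕ) + 3 = t.card then c else if (i : ℕ) + 2 = t.card then a else b)
      (by
        intro l hl
        obtain ⟨i, -, rfl⟩ := Finset.mem_image.mp hl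
        split_ifs
        exacts [h3 _ hc, h3 _ ha, h3 _ hb])
      (by
        intro i hi j hj h
        have hi' := (Finset.mem_filter.mp hi).2
        have hj' := (Finset.mem_filter.mp hj).2
        have := i.2
        have := j.2
        ext
        dsimp only at h
        split_ifs at h <;> first | omega | (exfalso; first | exact hca h | exact hca h.symm | exact hcb h | exact hcb h.symm | exact hab h | exact hab h.symm))
    refine ⟨t.card, fun i => (g i : K.S ⊕ ℤ), Subtype.val_injective.comp g.injective,
      fun l => ?_, fun c' a' b' h => ?_⟩
    · have hmem' := hmem l
      rw [hm] at hmem'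
      rw [← hmem']
      constructor
      · rintro ⟨i, rfl⟩
        exact (g i).2
      · exact fun h => ⟨g.symm ⟨l, h⟩, by simp⟩
    · simp only [Option.some.injEq, Prod.mk.injEq] at h
      obtain ⟨rfl, rfl, rfl⟩ := h
      refine ⟨hcard, fun i => ⟨fun hi => ?_, fun hi => ?_, fun hi => ?_⟩⟩
      · refine (hg i (by simp; omega)).trans ?_
        rw [ if_pos hi]
      · refine (hg i (by simp; omega)).trans ?_
        rw [ if_neg (by omega), if_pos hi]
      · refine (hg i (by simp; omega)).trans ?_
        rw [ if_neg (by omega), if_neg (by omega)]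

theorem Good.exists_pres (hst : st.Good) :
    ∃ Γ : Diagram p q, Γ.IsAGraph ∧ Nonempty (Pres Γ K st) := by
  classical
  have hΘ : Finite st.Theta := by
    refine (hst.finite.subset ?_ : {τ | ∃ y m, st.att τ = some y ∧ st.mark y = some m}.Finite)
    rintro τ ⟨y, m, h, -⟩
    simp [h]
  have : Fintype st.Theta := Fintype.ofFinite _
  choose N g hinj hrange hmark using hst.exists_slots
  have hq : ∀ y, ∃ τ, K.black y = false → st.mark y = none → ∀ τ', st.att τ' = some y ↔ τ' = τ := by
    intro y
    by_cases h : K.black y = false ∧ st.mark y = none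
    · obtain ⟨τ, hτ⟩ := hst.q_att y h.1 h.2
      exact ⟨τ, fun _ _ => hτ⟩
    · exact ⟨0, fun h1 h2 => absurd ⟨h1, h2⟩ h⟩
  choose qlab hqlab using hq
  have hN2 : ∀ y, K.black y = true → 2 ≤ N y := by
    intro y hy
    obtain ⟨z, z', hne, hz, hz'⟩ := hst.black_slots y hy
    obtain ⟨i, hi⟩ := (hrange y (Sum.inl z)).mpr ⟨hz, by simp⟩
    obtain ⟨j, hj⟩ := (hrange y (Sum.inl z')).mpr ⟨hz', by simp⟩
    have : i ≠ j := by
      rintro rfl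
      exact hne (Sum.inl_injective (hi.symm.trans hj))
    by_contra h
    exact this (Fin.ext (by omega))
  have hmem : ∀ y i, st.IsAt y (g y i) ∧ ∀ τ, g y i = Sum.inr τ → st.mark y ≠ none :=
    fun y i => (hrange y _).mp ⟨i, rfl⟩
  have hN1 : ∀ y, K.black y = false → st.mark y = none → N y = 1 := by
    intro y hy hm
    obtain ⟨z, hz⟩ := hst.q_slot y hy hm
    have h1 : ∀ i, g y i = Sum.inl z := by
      intro i
      obtain ⟨h2, h3⟩ := hmem y i
      cases h : g y i with
      | inl z' =>
        rw [h] at h2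
        rw [(hz z').mp h2]
      | inr τ => exact absurd hm (h3 τ h)
    obtain ⟨i, -⟩ := (hrange y (Sum.inl z)).mpr ⟨(hz z).mpr rfl, by simp⟩
    have h2 := i.2
    by_contra h
    have := hinj y ((h1 ⟨0, by omega⟩).trans (h1 ⟨1, by omega⟩).symm)
    simp at this
  have hNpos : ∀ y, st.mark y = none → N y ≠ 0 := by
    intro y hm
    cases hy : K.black y with
    | true => have := hN2 y hy; omega
    | false => rw [hN1 y hy hm]; omega
  have hN3 : ∀ y, st.mark y ≠ none → 3 ≤ N y := by
    intro y hm
    obtain ⟨⟨c, a, b⟩, h⟩ := Option.ne_none_iff_exists'.mp hm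
    exact (hmark y c a b h).1
  have hT : ∀ y i τ, g y i = Sum.inr τ → ∃ y m, st.att τ = some y ∧ st.mark y = some m := by
    intro y i τ h
    obtain ⟨h2, h3⟩ := hmem y i
    obtain ⟨m, hm⟩ := Option.ne_none_iff_exists'.mp (h3 τ h)
    rw [h] at h2
    exact ⟨y, m, h2, hm⟩
  have hin_inl : ∀ y i z, g y i = Sum.inl z →
      (st.toDiagram N g).inp (Sum.inl y) i = Sum.map Sum.inl id (K.src z) := by
    intro y i z h
    simp [h]
  have hin_inr : ∀ y i τ (h : g y i = Sum.inr τ),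
      (st.toDiagram N g).inp (Sum.inl y) i = Sum.inl (Sum.inr ⟨τ, hT y i τ h⟩) := by
    intro y i τ h
    change Sum.elim _ _ (g y i) = _
    rw [h, Sum.elim_inr, dif_pos (hT y i τ h)]
  have huniv : ∀ x, (st.toDiagram N g).IsUnivalentBlack x ↔ ∃ τ, x = Sum.inr τ := by
    rintro (y | τ)
    · simp only [IsUnivalentBlack, reduceCtorEq, exists_false, iff_false, not_and, Sum.elim_inl,
        Option.isNone_iff_eq_none]
      exact fun h => hNpos y h
    · simp [IsUnivalentBlack]
  refine ⟨st.toDiagram N g, ?_, ⟨?_⟩⟩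
  · refine ⟨⟨?_, ?_⟩, fun x x' h => ?_, ?_, ?_⟩
    · have key : ∀ e : (Σ x : (st.toDiagram N g).V, Fin ((st.toDiagram N g).ar x)) ⊕ Fin q,
          (∃ y i τ, e = Sum.inl ⟨Sum.inl y, i⟩ ∧ ∃ h : g y i = Sum.inr τ,
            (st.toDiagram N g).feed e = Sum.inl (Sum.inr ⟨τ, hT y i τ h⟩)) ∨
          ∃ s : K.S ⊕ Fin q, (st.toDiagram N g).feed e =
              Sum.map Sum.inl id (Sum.elim K.src (fun j => Sum.inl (K.out j)) s) ∧
            ((∃ y i z, e = Sum.inl ⟨Sum.inl y, i⟩ ∧ g y i = Sum.inl z ∧ s = Sum.inl z) ∨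
              ∃ j, e = Sum.inr j ∧ s = Sum.inr j) := by
        rintro (⟨y | τ, i⟩ | j)
        · cases h : g y i with
          | inl z => exact Or.inr ⟨Sum.inl z, hin_inl y i z h, Or.inl ⟨y, i, z, rfl, h, rfl⟩⟩
          | inr τ => exact Or.inl ⟨y, i, τ, rfl, h, hin_inr y i τ h⟩
        · exact Fin.elim0 i
        · exact Or.inr ⟨Sum.inr j, rfl, Or.inr ⟨j, rfl, rfl⟩⟩
      have hmapinj : Function.Injective
          (Sum.map Sum.inl id : K.V ⊕ Fin p → (K.V ⊕ st.Theta) ⊕ Fin p) :=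
        Sum.map_injective.mpr ⟨Sum.inl_injective, Function.injective_id⟩
      have hne : ∀ (s : K.V ⊕ Fin p) (τ : st.Theta),
          (Sum.map Sum.inl id s : (K.V ⊕ st.Theta) ⊕ Fin p) ≠ Sum.inl (Sum.inr τ) := by
        rintro (y | l) τ <;> simp
      intro e e' hee
      rcases key e with ⟨y, i, τ, rfl, h, h1⟩ | ⟨s, h1, h2⟩ <;>
        rcases key e' with ⟨y', i', τ', rfl, h', h1'⟩ | ⟨s', h1', h2'⟩
      · rw [h1, h1'] at hee
        have h3 : τ = τ' := by simpa using hee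
        subst h3
        have e1 := (hmem y i).1
        have e2 := (hmem y' i').1
        rw [h] at e1
        rw [h'] at e2
        have h4 : y = y' := Option.some_injective _ ((Eq.symm e1).trans e2)
        subst h4
        rw [hinj y (h.trans h'.symm)]
      · rw [h1, h1'] at hee
        exact absurd hee.symm (hne _ _)
      · rw [h1, h1'] at hee
        exact absurd hee (hne _ _)
      · rw [h1, h1'] at hee
        have h3 := hst.feed.1 (hmapinj hee)
        subst h3
        rcases h2 with ⟨y, i, z, rfl, h, rfl⟩ | ⟨j, rfl, rfl⟩ <;>
          rcases h2' with ⟨y', i', z', rfl, h', h5⟩ | ⟨j', rfl, h5⟩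
        · have h6 := Sum.inl_injective h5
          subst h6
          have e1 := (hmem y i).1
          have e2 := (hmem y' i').1
          rw [h] at e1
          rw [h'] at e2
          have h4 : y = y' := (Eq.symm e1).trans e2
          subst h4
          rw [hinj y (h.trans h'.symm)]
        · cases h5
        · cases h5
        · rw [Sum.inr_injective h5]
    · have hK : ∀ s : K.V ⊕ Fin p, ∃ e, (st.toDiagram N g).feed e = Sum.map Sum.inl id s := by
        intro s
        obtain ⟨z | j, hs⟩ := hst.feed.2 s
        · obtain ⟨i, hi⟩ := (hrange (K.tgt z) (Sum.inl z)).mpr ⟨rfl, by simp⟩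
          exact ⟨Sum.inl ⟨Sum.inl (K.tgt z), i⟩, (hin_inl _ _ _ hi).trans (by rw [← hs]; rfl)⟩
        · exact ⟨Sum.inr j, by rw [← hs]; rfl⟩
      rintro ((y | ⟨τ, y, m, h1, h2⟩) | l)
      · exact hK (Sum.inl y)
      · obtain ⟨i, hi⟩ := (hrange y (Sum.inr τ)).mpr ⟨h1, by simp [h2]⟩
        exact ⟨Sum.inl ⟨Sum.inl y, i⟩, hin_inr _ _ _ hi⟩
      · exact hK (Sum.inr l)
    · exact (Fintype.equivFin _).injective (Fin.ext h)
    · rintro (y | τ) h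
      · refine hN3 y fun h' => ?_
        simp [h'] at h
      · simp at h
    · rintro (y | τ) i u hi hu
      · obtain ⟨τ, rfl⟩ := (huniv u).mp hu
        cases h : g y i with
        | inl z =>
          rw [hin_inl y i z h] at hi
          cases hs : K.src z <;> simp [hs] at hi
        | inr τ' =>
          have := (hmem y i).2 τ' h
          exact Option.isNone_eq_false_iff.mpr (Option.isSome_iff_ne_none.mpr this)
      · exact Fin.elim0 i
  · exact
    { v := Sum.inl
      t := Sum.elim (fun y => if K.black y then K.pos y else qlab y) Subtype.val
      lab := fun x => match x with
        | Sum.inl y => g y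
        | Sum.inr _ => Fin.elim0
      v_inj := Sum.inl_injective
      v_range := by
        intro x
        rw [huniv]
        rcases x with y | τ <;> simp
      t_inj := by
        have hval : ∀ y, st.mark y = none → K.black y = false → st.att (qlab y) = some y :=
          fun y h1 h2 => (hqlab y h2 h1 _).mpr rfl
        have hcross : ∀ y (τ : st.Theta), st.mark y = none →
            (if K.black y then K.pos y else qlab y) ≠ (τ : ℤ) := by
          rintro y ⟨τ, y', m, h1, h2⟩ h3 h4
          cases hy : K.black y with
          | true =>
            rw [hy, if_pos rfl] at h4
            exact hst.pos_ne y τ hy (by simp [h1]) h4.symm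
          | false =>
            rw [hy, if_neg (by simp)] at h4
            have := hval y h3 hy
            rw [h4] at this
            change st.att τ = _ at this
            rw [h1] at this
            cases this
            rw [h2] at h3
            cases h3
        rintro (y | τ) (y' | τ') hb hb' ht
        · have h1 : st.mark y = none := by simpa using hb
          have h2 : st.mark y' = none := by simpa using hb'
          simp only [Sum.elim_inl] at ht
          congr 1
          cases hy : K.black y <;> cases hy' : K.black y' <;> simp [hy, hy'] at ht
          · have := hval y h1 hy
            rw [ht, hval y' h2 hy'] at this
            exact (Option.some_injective _ this).symm
          · exact absurd ht (hst.pos_ne y' _ hy' (by simp [hval y h1 hy]))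
          · exact absurd ht.symm (hst.pos_ne y _ hy (by simp [hval y' h2 hy']))
          · exact hst.pos_inj y y' hy hy' ht
        · exact absurd ht (hcross y τ' (by simpa using hb))
        · exact absurd ht.symm (hcross y' τ (by simpa using hb'))
        · rw [Subtype.ext ht]
      t_att := by
        intro τ
        constructor
        · intro h
          obtain ⟨y, hy⟩ := Option.ne_none_iff_exists'.mp h
          cases hm : st.mark y with
          | some m => exact ⟨Sum.inr ⟨τ, y, m, hy, hm⟩, rfl, by simp, rfl⟩
          | none =>
            have hb : K.black y = false := by
              cases hb : K.black y with
              | true => exact absurd hy (hst.black_att y τ hb)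
              | false => rfl
            refine ⟨Sum.inl y, by simp [hm], by simp [hN1 y hb hm], ?_⟩
            simp [hb, ← (hqlab y hb hm τ).mp hy]
        · rintro ⟨y | ⟨τ', y, m, h1, h2⟩, hb, ha, rfl⟩
          · have hm : st.mark y = none := by simpa using hb
            have hb' : K.black y = false := by
              cases hb : K.black y with
              | true =>
                have := hN2 y hb
                simp at ha
                omega
              | false => rfl
            simp [hb', (hqlab y hb' hm _).mpr rfl]
          · simp [h1]
      t_black := fun y hy => by simp [hy]
      black_iff := by
        intro y
        constructor
        · exact fun hy => ⟨by simp [hst.black_mark y hy], hN2 y hy⟩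
        · rintro ⟨h1, h2⟩
          cases hy : K.black y with
          | true => rfl
          | false =>
            have hm : st.mark y = none := by simpa using h1
            have := hN1 y hy hm
            simp at h2
            omega
      mark_iff := by simp
      att_one := by
        intro y hb ha
        have hm : st.mark y = none := by simpa using hb
        have hy : K.black y = false := by
          cases hy : K.black y with
          | true =>
            have := hN2 y hy
            simp at ha
            omega
          | false => rfl
        simp [hy, (hqlab y hy hm _).mpr rfl]
      lab_inl := by
        intro y i z h
        change g y i = _ at h
        have := (hmem y i).1
        rw [h] at this
        exact ⟨this, hin_inl y i z h⟩
      lab_inr := by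
        intro y i τ h
        change g y i = _ at h
        have h1 := (hmem y i).1
        rw [h] at h1
        have h2 := (hmem y i).2 τ h
        exact ⟨Option.isNone_eq_false_iff.mpr (Option.isSome_iff_ne_none.mpr h2), h1, _, (huniv _).mpr ⟨_, rfl⟩, hin_inr y i τ h, rfl⟩
      lab_inj := hinj
      surj_inl := fun y z h => (hrange y (Sum.inl z)).mpr ⟨h, by simp⟩
      surj_inr := by
        intro y τ hb h
        refine (hrange y (Sum.inr τ)).mpr ⟨h, fun _ _ hm => ?_⟩
        simp [hm] at hb
      mark_eq := fun y c a b h i => (hmark y c a b h).2 i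
      out_eq := fun _ => rfl }

end Marking

open Classical in
/-- The class of the graph described by a marking, oriented by the labels of its black vertices;
zero if there is no such graph. -/
def Marking.cls (st : Marking K) : Space p q :=
  if hst : st.Good then (Classical.choice hst.exists_pres.choose_spec.2).sgn •
    GraphComplex.cls hst.exists_pres.choose else 0

theorem Marking.cls_of_not_good (h : ¬ st.Good) : st.cls = 0 := dif_neg h

theorem Pres.cls_eq {Γ : Diagram p q} (P : Pres Γ K st) (hst : st.Good)
    (hΓ : Function.Injective Γ.pos) : st.cls = P.sgn • GraphComplex.cls Γ := by
  rw [Marking.cls, dif_pos hst]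
  exact Pres.sgn_smul_cls hst P _ hΓ hst.exists_pres.choose_spec.1.pos_injective

end

noncomputable section

variable {p q n m : ℕ}

/-! ### The description of a graph -/

namespace Diagram

/-- The input slot is not fed by a univalent black vertex. -/
def Thick (Γ : Diagram p q) (x : Γ.V) (i : Fin (Γ.ar x)) : Prop :=
  ∀ u, Γ.inp x i = Sum.inl u → ¬ Γ.IsUnivalentBlack u

/-- An admissible graph in which no outgoing leg starts at a univalent black vertex. Connected
admissible graphs that are not proper consist of a single univalent black vertex. -/
structure Proper (Γ : Diagram p q) : Prop where
  isAGraph : Γ.IsAGraph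
  out_not : ∀ j, ¬ Γ.IsUnivalentBlack (Γ.out j)

open Classical in
/-- The skeleton of a graph. -/
def skel (Γ : Diagram p q) (h : ∀ j, ¬ Γ.IsUnivalentBlack (Γ.out j)) : Skeleton p q where
  V := {x : Γ.V // ¬ Γ.IsUnivalentBlack x}
  fintypeV := Fintype.ofFinite _
  S := {s : Σ x : Γ.V, Fin (Γ.ar x) // Γ.Thick s.1 s.2}
  fintypeS := Fintype.ofFinite _
  tgt := fun s => ⟨s.1.1, fun h => Fin.elim0 (h.2 ▸ s.1.2)⟩
  src := fun s => Sum.elim (fun u => Sum.inl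
    (if h : ¬ Γ.IsUnivalentBlack u then ⟨u, h⟩ else ⟨s.1.1, fun h => Fin.elim0 (h.2 ▸ s.1.2)⟩))
    Sum.inr (Γ.inp s.1.1 s.1.2)
  out := fun j => ⟨Γ.out j, h j⟩
  black := fun x => decide (Γ.black x = true ∧ 2 ≤ Γ.ar x)
  pos := fun x => Γ.zpos x

variable {Γ : Diagram p q} (h : ∀ j, ¬ Γ.IsUnivalentBlack (Γ.out j))

theorem skel_src (s : (Γ.skel h).S) :
    Sum.map Subtype.val id ((Γ.skel h).src s) = Γ.inp s.1.1 s.1.2 := by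
  change Sum.map Subtype.val id (Sum.elim _ _ (Γ.inp s.1.1 s.1.2)) = _
  have hs := s.2
  rw [Thick] at hs
  cases hu : Γ.inp s.1.1 s.1.2 with
  | inl u => rw [Sum.elim_inl, dif_pos (hs u hu)]; rfl
  | inr l => rfl

/-- The vertex labelled `τ` is bivalent and equal to `y`, or univalent and attached to `y`. -/
def AttRel (Γ : Diagram p q) (τ : ℤ) (y : Γ.V) : Prop :=
  (Γ.black y = true ∧ Γ.ar y = 1 ∧ Γ.zpos y = τ) ∨
    ∃ u i, Γ.IsUnivalentBlack u ∧ Γ.inp y i = Sum.inl u ∧ Γ.zpos u = τ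

theorem AttRel.unique (hΓ : Γ.IsAGraph) {τ : ℤ} {y y' : Γ.V} (h1 : Γ.AttRel τ y)
    (h2 : Γ.AttRel τ y') : y = y' := by
  rcases h1 with ⟨h1, h2', h3⟩ | ⟨u, i, h1, h2', h3⟩ <;>
    rcases h2 with ⟨h4, h5, h6⟩ | ⟨u', i', h4, h5, h6⟩
  · exact hΓ.zpos_injective (h3.trans h6.symm)
  · have := hΓ.zpos_injective (h3.trans h6.symm)
    subst this
    rw [h4.2] at h2'
    omega
  · have := hΓ.zpos_injective (h3.trans h6.symm)
    subst this
    rw [h1.2] at h5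
    omega
  · have := hΓ.zpos_injective (h3.trans h6.symm)
    subst this
    have h7 : Γ.feed (Sum.inl ⟨y, i⟩) = Γ.feed (Sum.inl ⟨y', i'⟩) := h2'.trans h5.symm
    have := hΓ.feed_bijective.1 h7
    simp only [Sum.inl.injEq, Sigma.mk.injEq] at this
    exact this.1

theorem AttRel.not_univ {τ : ℤ} {y : Γ.V} (h1 : Γ.AttRel τ y) : ¬ Γ.IsUnivalentBlack y := by
  rintro ⟨h2, h3⟩
  rcases h1 with ⟨-, h4, -⟩ | ⟨u, i, -⟩
  · omega
  · exact Fin.elim0 (h3 ▸ i)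

open Classical in
/-- The name of an input slot in the description of a graph. -/
def slotName (Γ : Diagram p q) (h : ∀ j, ¬ Γ.IsUnivalentBlack (Γ.out j)) (x : Γ.V)
    (i : Fin (Γ.ar x)) : (Γ.skel h).S ⊕ ℤ :=
  if hi : Γ.Thick x i then Sum.inl ⟨⟨x, i⟩, hi⟩ else Sum.inr (Sum.elim Γ.zpos (fun _ => 0) (Γ.inp x i))

theorem slotName_of_thick {x : Γ.V} {i : Fin (Γ.ar x)} (hi : Γ.Thick x i) :
    Γ.slotName h x i = Sum.inl ⟨⟨x, i⟩, hi⟩ := dif_pos hi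

theorem slotName_of_univ {x u : Γ.V} {i : Fin (Γ.ar x)} (hu : Γ.IsUnivalentBlack u)
    (hi : Γ.inp x i = Sum.inl u) : Γ.slotName h x i = Sum.inr (Γ.zpos u) := by
  rw [slotName, dif_neg fun hh => hh u hi hu, hi]
  rfl

theorem slotName_eq_inl {x : Γ.V} {i : Fin (Γ.ar x)} {z : (Γ.skel h).S}
    (hz : Γ.slotName h x i = Sum.inl z) : z.1 = ⟨x, i⟩ := by
  rw [slotName] at hz
  split_ifs at hz
  rw [← Sum.inl_injective hz]

theorem slotName_eq_inr {x : Γ.V} {i : Fin (Γ.ar x)} {τ : ℤ}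
    (hz : Γ.slotName h x i = Sum.inr τ) :
    ∃ u, Γ.IsUnivalentBlack u ∧ Γ.inp x i = Sum.inl u ∧ Γ.zpos u = τ := by
  by_cases hi : Γ.Thick x i
  · rw [slotName_of_thick h hi] at hz
    cases hz
  · have hi' := hi
    rw [Thick] at hi'
    push Not at hi'
    obtain ⟨u, h1, h2⟩ := hi'
    rw [slotName_of_univ h h2 h1] at hz
    exact ⟨u, h2, h1, Sum.inr_injective hz⟩

theorem slotName_injective (hΓ : Γ.IsAGraph) (x : Γ.V) : Function.Injective (Γ.slotName h x) := by
  intro i j hij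
  cases hi : Γ.slotName h x i with
  | inl z =>
    have h1 := slotName_eq_inl h hi
    have h2 := slotName_eq_inl h (hij ▸ hi)
    rw [h1] at h2
    simpa using h2
  | inr τ =>
    obtain ⟨u, h1, h2, h3⟩ := slotName_eq_inr h hi
    obtain ⟨u', h1', h2', h3'⟩ := slotName_eq_inr h (hij ▸ hi)
    have := hΓ.zpos_injective (h3.trans h3'.symm)
    subst this
    have h7 : Γ.feed (Sum.inl ⟨x, i⟩) = Γ.feed (Sum.inl ⟨x, j⟩) := h2.trans h2'.symm
    have := hΓ.feed_bijective.1 h7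
    simpa using this

open Classical in
/-- The marking of the skeleton of a graph. -/
def skelMark (Γ : Diagram p q) (h : ∀ j, ¬ Γ.IsUnivalentBlack (Γ.out j)) : Marking (Γ.skel h) where
  att := fun τ => if hτ : ∃ y, Γ.AttRel τ y then some ⟨hτ.choose, hτ.choose_spec.not_univ⟩ else none
  mark := fun y => if hy : Γ.black y.1 = false ∧ 3 ≤ Γ.ar y.1 then
      some (Γ.slotName h y.1 ⟨Γ.ar y.1 - 3, by omega⟩, Γ.slotName h y.1 ⟨Γ.ar y.1 - 2, by omega⟩,
        Γ.slotName h y.1 ⟨Γ.ar y.1 - 1, by omega⟩)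
    else none

theorem skelMark_att_iff (hΓ : Γ.IsAGraph) (τ : ℤ) (y : (Γ.skel h).V) :
    (Γ.skelMark h).att τ = some y ↔ Γ.AttRel τ y.1 := by
  simp only [skelMark]
  split_ifs with hτ
  · constructor
    · intro h1
      rw [← Option.some_injective _ h1]
      exact hτ.choose_spec
    · intro h1
      exact congrArg some (Subtype.ext (hτ.choose_spec.unique hΓ h1))
  · simp only [false_iff]
    exact fun h1 => hτ ⟨_, h1⟩

theorem skelMark_att_ne_none (hΓ : Γ.IsAGraph) (τ : ℤ) :
    (Γ.skelMark h).att τ ≠ none ↔ ∃ y, Γ.AttRel τ y := by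
  rw [Option.ne_none_iff_exists']
  constructor
  · rintro ⟨y, hy⟩
    exact ⟨y.1, (skelMark_att_iff h hΓ τ y).mp hy⟩
  · rintro ⟨y, hy⟩
    exact ⟨⟨y, hy.not_univ⟩, (skelMark_att_iff h hΓ τ _).mpr hy⟩

theorem skelMark_mark_iff (hΓ : Γ.IsAGraph) (y : (Γ.skel h).V) :
    (Γ.skelMark h).mark y = none ↔ Γ.black y.1 = true := by
  simp only [skelMark]
  split_ifs with hy
  · simp [hy.1]
  · simp only [true_iff]
    cases hb : Γ.black y.1 with
    | true => rfl
    | false => exact absurd ⟨hb, hΓ.three_le_ar _ hb⟩ hy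

theorem skelMark_mark_eq {y : (Γ.skel h).V} {c a b : (Γ.skel h).S ⊕ ℤ}
    (hm : (Γ.skelMark h).mark y = some (c, a, b)) :
    Γ.black y.1 = false ∧ ∃ hy : 3 ≤ Γ.ar y.1, c = Γ.slotName h y.1 ⟨Γ.ar y.1 - 3, by omega⟩ ∧
      a = Γ.slotName h y.1 ⟨Γ.ar y.1 - 2, by omega⟩ ∧
      b = Γ.slotName h y.1 ⟨Γ.ar y.1 - 1, by omega⟩ := by
  simp only [skelMark] at hm
  split_ifs at hm with hy
  simp only [Option.some.injEq, Prod.mk.injEq] at hm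
  exact ⟨hy.1, hy.2, hm.1.symm, hm.2.1.symm, hm.2.2.symm⟩

theorem exists_attRel (hΓ : Γ.Proper) {u : Γ.V} (hu : Γ.IsUnivalentBlack u) :
    ∃ y i, Γ.inp y i = Sum.inl u := by
  obtain ⟨⟨y, i⟩ | j, hs⟩ := hΓ.isAGraph.feed_bijective.2 (Sum.inl u)
  · exact ⟨y, i, hs⟩
  · have : Γ.out j = u := Sum.inl_injective hs
    exact absurd hu (this ▸ hΓ.out_not j)

theorem skel_isAt {y : (Γ.skel h).V} (hΓ : Γ.IsAGraph) (i : Fin (Γ.ar y.1)) :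
    (Γ.skelMark h).IsAt y (Γ.slotName h y.1 i) := by
  cases hs : Γ.slotName h y.1 i with
  | inl z => exact Subtype.ext (congrArg Sigma.fst (slotName_eq_inl h hs))
  | inr τ =>
    obtain ⟨u, h1, h2, h3⟩ := slotName_eq_inr h hs
    exact (skelMark_att_iff h hΓ τ y).mpr (Or.inr ⟨u, i, h1, h2, h3⟩)

theorem skel_good (hΓ : Γ.Proper) : (Γ.skelMark h).Good := by
  have hA := hΓ.isAGraph
  have hblack : ∀ y : (Γ.skel h).V, (Γ.skel h).black y = true ↔ Γ.black y.1 = true ∧ 2 ≤ Γ.ar y.1 :=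
    fun y => decide_eq_true_iff
  have thick_of_black : ∀ x i, Γ.black x = true → Γ.Thick x i := by
    intro x i hx u hi hu
    have := hA.not_black x i u hi hu
    rw [hx] at this
    cases this
  have hq : ∀ y : (Γ.skel h).V, (Γ.skel h).black y = false → (Γ.skelMark h).mark y = none →
      Γ.black y.1 = true ∧ Γ.ar y.1 = 1 := by
    intro y hy hm
    have h1 := (skelMark_mark_iff h hA y).mp hm
    have h2 := y.2
    rw [IsUnivalentBlack] at h2
    have h3 := (hblack y).not.mp (by simp [hy])
    simp only [h1, true_and] at h2 h3
    exact ⟨h1, by omega⟩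
  refine ⟨⟨?_, ?_⟩, fun y y' _ _ hyy => Subtype.ext (hA.zpos_injective hyy), ?_, ?_, ?_, ?_, ?_, ?_,
    ?_, ?_⟩
  · rintro (z | j) (z' | j') hzz
    · have h1 : Sum.map Subtype.val id ((Γ.skel h).src z) =
        Sum.map Subtype.val id ((Γ.skel h).src z') := congrArg _ hzz
      rw [skel_src, skel_src] at h1
      have h2 : Γ.feed (Sum.inl ⟨z.1.1, z.1.2⟩) = Γ.feed (Sum.inl ⟨z'.1.1, z'.1.2⟩) := h1
      exact congrArg Sum.inl (Subtype.ext (Sum.inl_injective (hA.feed_bijective.1 h2)))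
    · have h1 : Sum.map Subtype.val id ((Γ.skel h).src z) = Sum.inl (Γ.out j') :=
        congrArg (Sum.map Subtype.val id) hzz
      rw [skel_src] at h1
      have h2 : Γ.feed (Sum.inl ⟨z.1.1, z.1.2⟩) = Γ.feed (Sum.inr j') := h1
      have := hA.feed_bijective.1 h2
      cases this
    · have h1 : Sum.map Subtype.val id ((Γ.skel h).src z') = Sum.inl (Γ.out j) :=
        congrArg (Sum.map Subtype.val id) hzz.symm
      rw [skel_src] at h1
      have h2 : Γ.feed (Sum.inl ⟨z'.1.1, z'.1.2⟩) = Γ.feed (Sum.inr j) := h1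
      have := hA.feed_bijective.1 h2
      cases this
    · have h2 : Γ.feed (Sum.inr j) = Γ.feed (Sum.inr j') :=
        congrArg (Sum.map Subtype.val id) hzz
      exact congrArg Sum.inr (Sum.inr_injective (hA.feed_bijective.1 h2))
  · intro s
    have hinj : Function.Injective (Sum.map Subtype.val id : (Γ.skel h).V ⊕ Fin p → Γ.V ⊕ Fin p) :=
      Sum.map_injective.mpr ⟨Subtype.val_injective, Function.injective_id⟩
    obtain ⟨⟨x, i⟩ | j, hs⟩ := hA.feed_bijective.2 (Sum.map Subtype.val id s)
    · have hi : Γ.Thick x i := by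
        intro u hu hu'
        have h1 : Sum.inl u = Sum.map Subtype.val id s := hu.symm.trans hs
        rcases s with s | s
        · exact s.2 (by rw [← Sum.inl_injective h1]; exact hu')
        · cases h1
      exact ⟨Sum.inl ⟨⟨x, i⟩, hi⟩, hinj ((skel_src h _).trans hs)⟩
    · exact ⟨Sum.inr j, hinj hs⟩
  · refine (Set.finite_range Γ.zpos).subset fun τ hτ => ?_
    obtain ⟨y, ⟨-, -, h1⟩ | ⟨u, i, -, -, h1⟩⟩ := (skelMark_att_ne_none h hA τ).mp hτ
    · exact ⟨y, h1⟩
    · exact ⟨u, h1⟩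
  · intro y τ hy hτ hyτ
    obtain ⟨y', ⟨-, h2, h1⟩ | ⟨u, i, h2, -, h1⟩⟩ := (skelMark_att_ne_none h hA τ).mp hτ
    · have h3 := hA.zpos_injective (h1.trans hyτ)
      have := ((hblack y).mp hy).2
      rw [← h3] at this
      omega
    · have h3 := hA.zpos_injective (h1.trans hyτ)
      exact y.2 (h3 ▸ h2)
  · exact fun y hy => (skelMark_mark_iff h hA y).mpr ((hblack y).mp hy).1
  · intro y hy
    obtain ⟨h1, h2⟩ := (hblack y).mp hy
    refine ⟨⟨⟨y.1, ⟨0, by omega⟩⟩, thick_of_black _ _ h1⟩, ⟨⟨y.1, ⟨1, by omega⟩⟩, thick_of_black _ _ h1⟩,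
      fun hh => ?_, rfl, rfl⟩
    have := congrArg Subtype.val hh
    simp at this
  · intro y τ hy hτ
    obtain ⟨h1, h2⟩ := (hblack y).mp hy
    rcases (skelMark_att_iff h hA τ y).mp hτ with ⟨-, h3, -⟩ | ⟨u, i, h3, h4, -⟩
    · omega
    · exact thick_of_black _ i h1 u h4 h3
  · intro y hy hm
    obtain ⟨h1, h2⟩ := hq y hy hm
    refine ⟨⟨⟨y.1, ⟨0, by omega⟩⟩, thick_of_black _ _ h1⟩, fun z' => ⟨?_, ?_⟩⟩
    · rintro rfl
      refine Subtype.ext (Sigma.ext rfl (heq_of_eq (Fin.ext ?_)))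
      have := z'.1.2.2
      change Γ.ar z'.1.1 = 1 at h2
      change (z'.1.2 : ℕ) = 0
      omega
    · rintro rfl
      rfl
  · intro y hy hm
    obtain ⟨h1, h2⟩ := hq y hy hm
    refine ⟨Γ.zpos y.1, fun τ' => (skelMark_att_iff h hA τ' y).trans ⟨?_, ?_⟩⟩
    · rintro (⟨-, -, h3⟩ | ⟨u, i, h3, h4, -⟩)
      · exact h3.symm
      · exact absurd h3 (thick_of_black _ i h1 u h4)
    · exact fun h3 => Or.inl ⟨h1, h2, h3.symm⟩
  · intro y c a b hm
    obtain ⟨h1, h2, rfl, rfl, rfl⟩ := skelMark_mark_eq h hm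
    refine ⟨skel_isAt h hA _, skel_isAt h hA _, skel_isAt h hA _, fun hh => ?_, fun hh => ?_,
      fun hh => ?_⟩ <;>
    · have := congrArg Fin.val (slotName_injective h hA y.1 hh)
      dsimp only at this
      omega

/-- A graph is described by its skeleton and its marking. -/
def skelPres (hΓ : Γ.Proper) : Pres Γ (Γ.skel h) (Γ.skelMark h) where
  v := Subtype.val
  t := Γ.zpos
  lab := Γ.slotName h
  v_inj := Subtype.val_injective
  v_range := fun x => ⟨fun ⟨y, hy⟩ => hy ▸ y.2, fun hx => ⟨⟨x, hx⟩, rfl⟩⟩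
  t_inj := fun _ _ _ _ h => hΓ.isAGraph.zpos_injective h
  t_att := by
    intro τ
    rw [skelMark_att_ne_none h hΓ.isAGraph]
    constructor
    · rintro ⟨y, ⟨h1, h2, h3⟩ | ⟨u, i, h1, h2, h3⟩⟩
      · exact ⟨y, h1, h2.le, h3⟩
      · exact ⟨u, h1.1, by rw [h1.2]; omega, h3⟩
    · rintro ⟨x, h1, h2, h3⟩
      by_cases hx : Γ.IsUnivalentBlack x
      · obtain ⟨y, i, hy⟩ := exists_attRel hΓ hx
        exact ⟨y, Or.inr ⟨x, i, hx, hy, h3⟩⟩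
      · have : Γ.ar x ≠ 0 := fun h4 => hx ⟨h1, h4⟩
        exact ⟨x, Or.inl ⟨h1, by omega, h3⟩⟩
  t_black := fun _ _ => rfl
  black_iff := fun _ => decide_eq_true_iff
  mark_iff := skelMark_mark_iff h hΓ.isAGraph
  att_one := fun y h1 h2 => (skelMark_att_iff h hΓ.isAGraph _ y).mpr (Or.inl ⟨h1, h2, rfl⟩)
  lab_inl := by
    intro y i z hz
    have h1 := slotName_eq_inl h hz
    refine ⟨Subtype.ext (congrArg Sigma.fst h1), ?_⟩
    exact (show Γ.inp y.1 i = Γ.inp z.1.1 z.1.2 by rw [h1]).trans (skel_src h z).symm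
  lab_inr := by
    intro y i τ hτ
    obtain ⟨u, h1, h2, h3⟩ := slotName_eq_inr h hτ
    exact ⟨hΓ.isAGraph.not_black _ _ _ h2 h1, (skelMark_att_iff h hΓ.isAGraph τ y).mpr
      (Or.inr ⟨u, i, h1, h2, h3⟩), u, h1, h2, h3⟩
  lab_inj := fun y => slotName_injective h hΓ.isAGraph y.1
  surj_inl := by
    rintro y z rfl
    exact ⟨z.1.2, slotName_of_thick h z.2⟩
  surj_inr := by
    intro y τ hb hτ
    rcases (skelMark_att_iff h hΓ.isAGraph τ y).mp hτ with ⟨h1, -⟩ | ⟨u, i, h1, h2, h3⟩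
    · rw [h1] at hb
      cases hb
    · exact ⟨i, (slotName_of_univ h h1 h2).trans (by rw [h3])⟩
  mark_eq := by
    intro y c a b hm i
    obtain ⟨h1, h2, rfl, rfl, rfl⟩ := skelMark_mark_eq h hm
    refine ⟨fun hi => ?_, fun hi => ?_, fun hi => ?_⟩ <;>
    · congr 1
      ext
      dsimp only
      omega
  out_eq := fun _ => rfl

theorem skelPres_sgn (hΓ : Γ.Proper) : (skelPres h hΓ).sgn = 1 := invSign_self _ _

theorem skelMark_cls (hΓ : Γ.Proper) : (Γ.skelMark h).cls = cls Γ := by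
  rw [(skelPres h hΓ).cls_eq (skel_good h hΓ) hΓ.isAGraph.pos_injective, skelPres_sgn, one_smul]

end Diagram

end

noncomputable section

variable {p q n m : ℕ} {K K' : Skeleton p q}

/-! ### Isomorphisms of skeletons -/

open Classical in
/-- The labels of the univalent and the bivalent black vertices. -/
def Marking.active (st : Marking K) : Finset ℤ :=
  if h : {τ | st.att τ ≠ none}.Finite then h.toFinset else ∅

open Classical in
/-- The labels of all black vertices. -/
def Marking.labels (st : Marking K) : Finset ℤ :=
  (Finset.univ.filter fun y => K.black y = true).image K.pos ∪ st.active

theorem Marking.Good.mem_active {st : Marking K} (h : st.Good) {τ : ℤ} :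
    τ ∈ st.active ↔ st.att τ ≠ none := by
  rw [Marking.active, dif_pos h.finite]
  simp

theorem Marking.Good.mem_labels {st : Marking K} (h : st.Good) {τ : ℤ} :
    τ ∈ st.labels ↔ (∃ y, K.black y = true ∧ K.pos y = τ) ∨ st.att τ ≠ none := by
  classical
  rw [Marking.labels, Finset.mem_union, h.mem_active]
  simp

theorem Pres.image_blacks {Γ : Diagram p q} {st : Marking K} (P : Pres Γ K st) (h : st.Good)
    [DecidableEq ℤ] : Γ.blacks.image P.t = st.labels := by
  ext τ
  rw [h.mem_labels, Finset.mem_image]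
  constructor
  · rintro ⟨x, hx, rfl⟩
    have hx' := mem_blacks.mp hx
    by_cases ha : Γ.ar x ≤ 1
    · exact Or.inr ((P.t_att _).mpr ⟨x, hx', ha, rfl⟩)
    · obtain ⟨y, rfl⟩ := (P.v_range x).mpr fun hu => ha (by rw [hu.2]; omega)
      have hy := (P.black_iff y).mpr ⟨hx', by omega⟩
      exact Or.inl ⟨y, hy, (P.t_black y hy).symm⟩
  · rintro (⟨y, hy, rfl⟩ | hτ)
    · exact ⟨P.v y, mem_blacks.mpr ((P.black_iff y).mp hy).1, P.t_black y hy⟩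
    · obtain ⟨x, hx, -, rfl⟩ := (P.t_att τ).mp hτ
      exact ⟨x, mem_blacks.mpr hx, rfl⟩

/-- An isomorphism of skeletons together with a change of labels. -/
structure SkelIso (K K' : Skeleton p q) where
  eV : K.V ≃ K'.V
  eS : K.S ≃ K'.S
  f : Equiv.Perm ℤ
  tgt_eq : ∀ z, K'.tgt (eS z) = eV (K.tgt z)
  src_eq : ∀ z, K'.src (eS z) = Sum.map eV id (K.src z)
  out_eq : ∀ j, K'.out j = eV (K.out j)
  black_eq : ∀ y, K'.black (eV y) = K.black y
  pos_eq : ∀ y, K.black y = true → K'.pos (eV y) = f (K.pos y)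

namespace SkelIso

/-- The map of input slots. -/
def slot (e : SkelIso K K') : K.S ⊕ ℤ ≃ K'.S ⊕ ℤ := Equiv.sumCongr e.eS e.f

/-- The image of a marking. -/
def map (e : SkelIso K K') (st : Marking K) : Marking K' where
  att := fun τ => (st.att (e.f.symm τ)).map e.eV
  mark := fun y => (st.mark (e.eV.symm y)).map fun m => (e.slot m.1, e.slot m.2.1, e.slot m.2.2)

/-- The inverse isomorphism. -/
def symm (e : SkelIso K K') : SkelIso K' K where
  eV := e.eV.symm
  eS := e.eS.symm
  f := e.f.symm
  tgt_eq := fun z => by rw [Equiv.eq_symm_apply, ← e.tgt_eq, Equiv.apply_symm_apply]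
  src_eq := fun z => by
    have h := e.src_eq (e.eS.symm z)
    rw [Equiv.apply_symm_apply] at h
    rw [h]
    cases K.src (e.eS.symm z) <;> simp
  out_eq := fun j => by rw [e.out_eq, Equiv.symm_apply_apply]
  black_eq := fun y => by rw [← e.black_eq, Equiv.apply_symm_apply]
  pos_eq := fun y hy => by
    rw [Equiv.eq_symm_apply, ← e.pos_eq, Equiv.apply_symm_apply]
    rwa [← e.black_eq, Equiv.apply_symm_apply]

variable (e : SkelIso K K') (st : Marking K)

theorem symm_map : e.symm.map (e.map st) = st := by
  ext τ x
  · simp [map, symm]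
  · simp only [map, symm, Equiv.symm_symm, Equiv.symm_apply_apply, Option.map_map, slot]
    cases st.mark τ <;> simp

theorem map_att_some (τ : ℤ) (y : K.V) :
    (e.map st).att (e.f τ) = some (e.eV y) ↔ st.att τ = some y := by
  simp [map]

theorem map_att_none (τ : ℤ) : (e.map st).att (e.f τ) = none ↔ st.att τ = none := by
  simp [map]

theorem map_mark (y : K.V) : (e.map st).mark (e.eV y) =
    (st.mark y).map fun m => (e.slot m.1, e.slot m.2.1, e.slot m.2.2) := by
  simp [map]

theorem map_mark_none (y : K.V) : (e.map st).mark (e.eV y) = none ↔ st.mark y = none := by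
  simp [map]

theorem map_isAt (y : K.V) (l : K.S ⊕ ℤ) : (e.map st).IsAt (e.eV y) (e.slot l) ↔ st.IsAt y l := by
  rcases l with z | τ
  · change K'.tgt (e.eS z) = e.eV y ↔ K.tgt z = y
    rw [e.tgt_eq, EmbeddingLike.apply_eq_iff_eq]
  · exact map_att_some e st τ y

variable {st}

theorem map_good (h : st.Good) : (e.map st).Good := by
  have hb : ∀ {y}, K'.black (e.eV y) = true → K.black y = true := fun {y} hy => by
    rwa [← e.black_eq]
  have hb' : ∀ {y}, K'.black (e.eV y) = false → K.black y = false := fun {y} hy => by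
    rwa [← e.black_eq]
  have hinj : Function.Injective (Sum.map e.eV id : K.V ⊕ Fin p → K'.V ⊕ Fin p) :=
    Sum.map_injective.mpr ⟨e.eV.injective, Function.injective_id⟩
  have hsurj : Function.Surjective (Sum.map e.eV id : K.V ⊕ Fin p → K'.V ⊕ Fin p) :=
    Sum.map_surjective.mpr ⟨e.eV.surjective, Function.surjective_id⟩
  have hfeed : (Sum.elim K'.src (fun j => Sum.inl (K'.out j)) : K'.S ⊕ Fin q → K'.V ⊕ Fin p) =
      Sum.map e.eV id ∘ Sum.elim K.src (fun j => Sum.inl (K.out j)) ∘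
        Sum.map e.eS.symm id := by
    funext s
    rcases s with z | j
    · obtain ⟨z, rfl⟩ := e.eS.surjective z
      simp [e.src_eq]
    · simp [e.out_eq]
  have hmap : Function.Bijective (Sum.map e.eS.symm id : K'.S ⊕ Fin q → K.S ⊕ Fin q) :=
    ⟨Sum.map_injective.mpr ⟨e.eS.symm.injective, Function.injective_id⟩,
      Sum.map_surjective.mpr ⟨e.eS.symm.surjective, Function.surjective_id⟩⟩
  constructor
  · rw [hfeed]
    exact Function.Bijective.comp ⟨hinj, hsurj⟩ (h.feed.comp hmap)
  · intro y y' hy hy' hyy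
    obtain ⟨y, rfl⟩ := e.eV.surjective y
    obtain ⟨y', rfl⟩ := e.eV.surjective y'
    rw [e.pos_eq y (hb hy), e.pos_eq y' (hb hy'), EmbeddingLike.apply_eq_iff_eq] at hyy
    rw [h.pos_inj y y' (hb hy) (hb hy') hyy]
  · refine (h.finite.image e.f).subset fun τ hτ => ?_
    obtain ⟨τ, rfl⟩ := e.f.surjective τ
    exact ⟨τ, (map_att_none e st τ).not.mp hτ, rfl⟩
  · intro y τ hy hτ
    obtain ⟨y, rfl⟩ := e.eV.surjective y
    obtain ⟨τ, rfl⟩ := e.f.surjective τ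
    rw [e.pos_eq y (hb hy), Ne, EmbeddingLike.apply_eq_iff_eq]
    exact h.pos_ne y τ (hb hy) ((map_att_none e st τ).not.mp hτ)
  · intro y hy
    obtain ⟨y, rfl⟩ := e.eV.surjective y
    exact (map_mark_none e st y).mpr (h.black_mark y (hb hy))
  · intro y hy
    obtain ⟨y, rfl⟩ := e.eV.surjective y
    obtain ⟨z, z', h1, h2, h3⟩ := h.black_slots y (hb hy)
    exact ⟨e.eS z, e.eS z', e.eS.injective.ne h1, by rw [e.tgt_eq, h2], by rw [e.tgt_eq, h3]⟩
  · intro y τ hy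
    obtain ⟨y, rfl⟩ := e.eV.surjective y
    obtain ⟨τ, rfl⟩ := e.f.surjective τ
    exact (map_att_some e st τ y).not.mpr (h.black_att y τ (hb hy))
  · intro y hy hm
    obtain ⟨y, rfl⟩ := e.eV.surjective y
    obtain ⟨z, hz⟩ := h.q_slot y (hb' hy) ((map_mark_none e st y).mp hm)
    refine ⟨e.eS z, fun z' => ?_⟩
    obtain ⟨z', rfl⟩ := e.eS.surjective z'
    rw [e.tgt_eq, EmbeddingLike.apply_eq_iff_eq, EmbeddingLike.apply_eq_iff_eq, hz]
  · intro y hy hm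
    obtain ⟨y, rfl⟩ := e.eV.surjective y
    obtain ⟨τ, hτ⟩ := h.q_att y (hb' hy) ((map_mark_none e st y).mp hm)
    refine ⟨e.f τ, fun τ' => ?_⟩
    obtain ⟨τ', rfl⟩ := e.f.surjective τ'
    rw [map_att_some, hτ, EmbeddingLike.apply_eq_iff_eq]
  · intro y c a b hm
    obtain ⟨y, rfl⟩ := e.eV.surjective y
    rw [map_mark] at hm
    obtain ⟨⟨c', a', b'⟩, h1, h2⟩ := Option.map_eq_some_iff.mp hm
    simp only [Prod.mk.injEq] at h2
    obtain ⟨rfl, rfl, rfl⟩ := h2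
    simp only [map_isAt, Ne, EmbeddingLike.apply_eq_iff_eq]
    exact h.mark_at y c' a' b' h1

theorem map_good_iff : (e.map st).Good ↔ st.Good :=
  ⟨fun h => by rw [← symm_map e st]; exact e.symm.map_good h, e.map_good⟩

theorem map_active : (e.map st).active = st.active.image e.f := by
  classical
  have himage : {τ | (e.map st).att τ ≠ none} = e.f '' {τ | st.att τ ≠ none} := by
    ext τ
    obtain ⟨τ, rfl⟩ := e.f.surjective τ
    simp [map_att_none]
  by_cases h : {τ | st.att τ ≠ none}.Finite
  · have h' : {τ | (e.map st).att τ ≠ none}.Finite := himage ▸ h.image _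
    ext τ
    rw [Marking.active, dif_pos h', Marking.active, dif_pos h, Set.Finite.mem_toFinset, himage]
    simp only [Finset.mem_image, Set.Finite.mem_toFinset, Set.mem_image]
  · have h' : ¬ {τ | (e.map st).att τ ≠ none}.Finite := by
      rw [himage]
      exact fun hh => h (hh.of_finite_image e.f.injective.injOn)
    rw [Marking.active, dif_neg h', Marking.active, dif_neg h, Finset.image_empty]

theorem map_labels : (e.map st).labels = st.labels.image e.f := by
  classical
  rw [Marking.labels, Marking.labels, Finset.image_union, map_active]
  congr 1
  ext τ
  simp only [Finset.mem_image, Finset.mem_filter, Finset.mem_univ, true_and, exists_exists_and_eq_and]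
  constructor
  · rintro ⟨y, hy, rfl⟩
    obtain ⟨y, rfl⟩ := e.eV.surjective y
    rw [e.black_eq] at hy
    exact ⟨y, hy, (e.pos_eq y hy).symm⟩
  · rintro ⟨y, hy, rfl⟩
    exact ⟨e.eV y, by rwa [e.black_eq], e.pos_eq y hy⟩

/-- A graph described by a marking is also described by isomorphic markings. -/
def mapPres {Γ : Diagram p q} (P : Pres Γ K st) : Pres Γ K' (e.map st) where
  v := fun y => P.v (e.eV.symm y)
  t := fun x => e.f (P.t x)
  lab := fun x i => e.slot (P.lab x i)
  v_inj := P.v_inj.comp e.eV.symm.injective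
  v_range := fun x => by
    rw [← P.v_range]
    exact ⟨fun ⟨y, hy⟩ => ⟨_, hy⟩, fun ⟨y, hy⟩ => ⟨e.eV y, by simpa using hy⟩⟩
  t_inj := fun x x' h h' hx => P.t_inj x x' h h' (e.f.injective hx)
  t_att := fun τ => by
    obtain ⟨τ, rfl⟩ := e.f.surjective τ
    simp only [Ne, map_att_none, EmbeddingLike.apply_eq_iff_eq]
    exact P.t_att τ
  t_black := fun y hy => by
    obtain ⟨y, rfl⟩ := e.eV.surjective y
    rw [e.black_eq] at hy
    rw [Equiv.symm_apply_apply, P.t_black y hy, e.pos_eq y hy]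
  black_iff := fun y => by
    obtain ⟨y, rfl⟩ := e.eV.surjective y
    rw [e.black_eq, Equiv.symm_apply_apply]
    exact P.black_iff y
  mark_iff := fun y => by
    obtain ⟨y, rfl⟩ := e.eV.surjective y
    rw [map_mark_none, Equiv.symm_apply_apply]
    exact P.mark_iff y
  att_one := fun y => by
    obtain ⟨y, rfl⟩ := e.eV.surjective y
    rw [Equiv.symm_apply_apply, map_att_some]
    exact P.att_one y
  lab_inl := fun y => by
    obtain ⟨y, rfl⟩ := e.eV.surjective y
    intro i z
    obtain ⟨z, rfl⟩ := e.eS.surjective z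
    intro h
    have h1 : P.lab _ i = Sum.inl z := e.slot.injective h
    revert i
    rw [Equiv.symm_apply_apply]
    intro i h h1
    obtain ⟨h2, h3⟩ := P.lab_inl y i z h1
    refine ⟨by rw [e.tgt_eq, h2], ?_⟩
    rw [h3, e.src_eq]
    cases K.src z <;> simp
  lab_inr := fun y => by
    obtain ⟨y, rfl⟩ := e.eV.surjective y
    intro i τ
    obtain ⟨τ, rfl⟩ := e.f.surjective τ
    intro h
    have h1 : P.lab _ i = Sum.inr τ := e.slot.injective h
    revert i
    rw [Equiv.symm_apply_apply, map_att_some]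
    intro i h h1
    obtain ⟨h2, h3, x, h4, h5, h6⟩ := P.lab_inr y i τ h1
    exact ⟨h2, h3, x, h4, h5, by rw [h6]⟩
  lab_inj := fun y => e.slot.injective.comp (P.lab_inj _)
  surj_inl := fun y => by
    obtain ⟨y, rfl⟩ := e.eV.surjective y
    intro z
    obtain ⟨z, rfl⟩ := e.eS.surjective z
    rw [e.tgt_eq, EmbeddingLike.apply_eq_iff_eq, Equiv.symm_apply_apply]
    intro h
    obtain ⟨i, hi⟩ := P.surj_inl y z h
    exact ⟨i, congrArg e.slot hi⟩
  surj_inr := fun y => by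
    obtain ⟨y, rfl⟩ := e.eV.surjective y
    intro τ
    obtain ⟨τ, rfl⟩ := e.f.surjective τ
    rw [map_att_some, Equiv.symm_apply_apply]
    intro hb h
    obtain ⟨i, hi⟩ := P.surj_inr y τ hb h
    exact ⟨i, congrArg e.slot hi⟩
  mark_eq := fun y => by
    obtain ⟨y, rfl⟩ := e.eV.surjective y
    intro c a b hm
    rw [map_mark] at hm
    obtain ⟨⟨c', a', b'⟩, h1, h2⟩ := Option.map_eq_some_iff.mp hm
    simp only [Prod.mk.injEq] at h2
    obtain ⟨rfl, rfl, rfl⟩ := h2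
    rw [Equiv.symm_apply_apply]
    simp only [EmbeddingLike.apply_eq_iff_eq]
    exact P.mark_eq y c' a' b' h1
  out_eq := fun j => by rw [e.out_eq, Equiv.symm_apply_apply, P.out_eq]

/-- Isomorphic markings have the same class up to the sign of the change of labels. -/
theorem map_cls : (e.map st).cls = invSign st.labels id e.f • st.cls := by
  classical
  by_cases h : st.Good
  · obtain ⟨Γ, hΓ, ⟨P⟩⟩ := h.exists_pres
    rw [P.cls_eq h hΓ.pos_injective, (e.mapPres P).cls_eq (e.map_good h) hΓ.pos_injective, smul_smul]
    congr 1
    have h1 : invSign st.labels id e.f = invSign Γ.blacks P.t (fun x => e.f (P.t x)) := by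
      rw [← P.image_blacks h, invSign_image P.t_injOn]
      rfl
    rw [h1, mul_comm]
    exact (invSign_trans hΓ.zpos_injective.injOn P.t_injOn
      (e.f.injective.comp_injOn P.t_injOn)).symm
  · rw [Marking.cls_of_not_good h, Marking.cls_of_not_good (e.map_good_iff.not.mpr h), smul_zero]

end SkelIso

/-- A change of labels without effect on those of the black vertices of valency at least three. -/
def relabelIso (K : Skeleton p q) (f : Equiv.Perm ℤ)
    (hf : ∀ y, K.black y = true → f (K.pos y) = K.pos y) : SkelIso K K where
  eV := Equiv.refl _
  eS := Equiv.refl _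
  f := f
  tgt_eq := fun _ => rfl
  src_eq := fun z => by
    change K.src z = _
    cases K.src z <;> rfl
  out_eq := fun _ => rfl
  black_eq := fun _ => rfl
  pos_eq := fun y hy => (hf y hy).symm

/-- An injective function on a finite set of integers extends to a permutation. -/
theorem exists_perm_extends {ι : Type*} (s : Finset ι) (f g : ι → ℤ) (hf : Set.InjOn f s)
    (hg : Set.InjOn g s) : ∃ F : Equiv.Perm ℤ, ∀ x ∈ s, F (f x) = g x := by
  classical
  set T := s.image f ∪ s.image g with hT
  obtain rfl | ⟨x₀, -⟩ := s.eq_empty_or_nonempty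
  · exact ⟨1, by simp⟩
  have hinv : ∀ n, ∃ x, n ∈ s.image f → x ∈ s ∧ f x = n := fun n => by
    by_cases h : n ∈ s.image f
    · obtain ⟨x, h1, h2⟩ := Finset.mem_image.mp h
      exact ⟨x, fun _ => ⟨h1, h2⟩⟩
    · exact ⟨x₀, fun h' => absurd h' h⟩
  choose r hr using hinv
  have hrf : ∀ x ∈ s, r (f x) = x := fun x hx => by
    have h1 := hr (f x) (Finset.mem_image_of_mem f hx)
    exact hf h1.1 hx h1.2
  obtain ⟨G, hG⟩ := Finset.exists_equiv_extend_of_card_eq (α := T) (t := T) (by simp)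
    (s := Finset.univ.filter fun n : T => (n : ℤ) ∈ s.image f) (f := fun n => g (r n))
    (by
      intro n hn
      obtain ⟨⟨k, hk⟩, h1, rfl⟩ := Finset.mem_image.mp hn
      have h2 := hr k (Finset.mem_filter.mp h1).2
      exact Finset.mem_union_right _ (Finset.mem_image_of_mem g h2.1))
    (by
      rintro ⟨k, hk⟩ h1 ⟨k', hk'⟩ h1' h
      have h2 := hr k (Finset.mem_filter.mp h1).2
      have h2' := hr k' (Finset.mem_filter.mp h1').2
      have h3 : r k = r k' := hg h2.1 h2'.1 h
      apply Subtype.ext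
      change k = k'
      rw [← h2.2, ← h2'.2, h3])
  refine ⟨Equiv.Perm.ofSubtype G, fun x hx => ?_⟩
  have hm : f x ∈ T := Finset.mem_union_left _ (Finset.mem_image_of_mem f hx)
  rw [Equiv.Perm.ofSubtype_apply_of_mem G hm, hG ⟨f x, hm⟩ (by simpa using ⟨x, hx, rfl⟩)]
  exact congrArg g (hrf x hx)

namespace Pres

variable {Γ : Diagram p q} {st : Marking K} {st' : Marking K'}

theorem univ_of_lab_inr (P : Pres Γ K st) {y : K.V} {i : Fin (Γ.ar (P.v y))} {τ : ℤ}
    (h : P.lab (P.v y) i = Sum.inr τ) : ¬ Γ.Thick (P.v y) i := by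
  obtain ⟨-, -, x, h1, h2, -⟩ := P.lab_inr y i τ h
  exact fun h3 => h3 x h2 h1

theorem thick_of_lab_inl (P : Pres Γ K st) {y : K.V} {i : Fin (Γ.ar (P.v y))} {z : K.S}
    (h : P.lab (P.v y) i = Sum.inl z) : Γ.Thick (P.v y) i := by
  intro u hu
  rw [(P.lab_inl y i z h).2] at hu
  rcases hs : K.src z with u' | l <;> rw [hs] at hu
  · exact (P.v_range u).mp ⟨u', Sum.inl_injective hu⟩
  · cases hu

/-- To which vertex a label is attached can be read off from the graph. -/
theorem att_iff (P : Pres Γ K st) (hst : st.Good) (τ : ℤ) (y : K.V) : st.att τ = some y ↔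
    ∃ x, Γ.black x = true ∧ P.t x = τ ∧ ((x = P.v y ∧ Γ.ar x = 1) ∨
      (Γ.IsUnivalentBlack x ∧ ∃ i, Γ.inp (P.v y) i = Sum.inl x)) := by
  constructor
  · intro h
    by_cases hb : Γ.black (P.v y) = true
    · have hy : K.black y = false := by
        cases hy : K.black y with
        | true => exact absurd h (hst.black_att y τ hy)
        | false => rfl
      have hm := (P.mark_iff y).mpr hb
      obtain ⟨h1, h2⟩ := (P.q_iff y).mp ⟨hy, hm⟩
      obtain ⟨τ', hτ'⟩ := hst.q_att y hy hm
      exact ⟨P.v y, h1, ((hτ' _).mp (P.att_one y h1 h2)).trans ((hτ' _).mp h).symm, Or.inl ⟨rfl, h2⟩⟩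
    · obtain ⟨i, hi⟩ := P.surj_inr y τ (by simpa using hb) h
      obtain ⟨-, -, x, h1, h2, h3⟩ := P.lab_inr y i τ hi
      exact ⟨x, h1.1, h3, Or.inr ⟨h1, i, h2⟩⟩
  · rintro ⟨x, hb, rfl, ⟨rfl, h1⟩ | ⟨h1, i, h2⟩⟩
    · exact P.att_one y hb h1
    · cases hl : P.lab (P.v y) i with
      | inl z => exact absurd h1 (P.thick_of_lab_inl hl x h2)
      | inr τ =>
        obtain ⟨-, h3, x', h4, h5, h6⟩ := P.lab_inr y i τ hl
        rw [h2] at h5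
        rw [Sum.inl_injective h5, h6]
        exact h3

theorem slot_unique (P : Pres Γ K st) {z : K.S} {x x' : Γ.V} {i : Fin (Γ.ar x)}
    {i' : Fin (Γ.ar x')} (hx : ¬ Γ.IsUnivalentBlack x) (hx' : ¬ Γ.IsUnivalentBlack x')
    (h : P.lab x i = Sum.inl z) (h' : P.lab x' i' = Sum.inl z) :
    (⟨x, i⟩ : Σ x, Fin (Γ.ar x)) = ⟨x', i'⟩ := by
  obtain ⟨y, rfl⟩ := (P.v_range _).mpr hx
  obtain ⟨y', rfl⟩ := (P.v_range _).mpr hx'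
  have h1 := (P.lab_inl y i z h).1
  have h2 := (P.lab_inl y' i' z h').1
  rw [h1] at h2
  subst h2
  rw [P.lab_inj y (h.trans h'.symm)]

theorem exists_corr (P : Pres Γ K st) (P' : Pres Γ K' st') (z : K.S) :
    ∃ z' : K'.S, ∀ x i, ¬ Γ.IsUnivalentBlack x → P.lab x i = Sum.inl z → P'.lab x i = Sum.inl z' := by
  obtain ⟨i, hi⟩ := P.surj_inl (K.tgt z) z rfl
  obtain ⟨y', hy'⟩ := (P'.v_range _).mpr (P.not_univ (K.tgt z))
  have h1 := P.thick_of_lab_inl hi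
  have h2 := P.not_univ (K.tgt z)
  generalize P.v (K.tgt z) = x at i hi h1 h2 hy'
  subst hy'
  cases hl : P'.lab (P'.v y') i with
  | inl z' =>
    refine ⟨z', fun x' i' hx' h => ?_⟩
    have := P.slot_unique h2 hx' hi h
    cases this
    exact hl
  | inr τ => exact absurd h1 (P'.univ_of_lab_inr hl)

/-- Two descriptions of a graph are isomorphic. -/
theorem exists_skelIso (P : Pres Γ K st) (P' : Pres Γ K' st') (hst : st.Good) (hst' : st'.Good)
    (hΓ : Γ.IsAGraph) :
    ∃ e : SkelIso K K', e.map st = st' ∧ ∀ x ∈ Γ.blacks, e.f (P.t x) = P'.t x := by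
  classical
  choose a ha using fun y => (P'.v_range _).mpr (P.not_univ y)
  choose b hb using fun y => (P.v_range _).mpr (P'.not_univ y)
  choose r hlabr using exists_corr P P'
  choose s hlabs using exists_corr P' P
  obtain ⟨F, hF⟩ := exists_perm_extends Γ.blacks P.t P'.t P.t_injOn P'.t_injOn
  have hsr : ∀ z, s (r z) = z := fun z => by
    obtain ⟨i, hi⟩ := P.surj_inl (K.tgt z) z rfl
    exact Sum.inl_injective ((hlabs _ _ _ (P.not_univ _)
      (hlabr _ _ _ (P.not_univ _) hi)).symm.trans hi)
  have hrs : ∀ z, r (s z) = z := fun z => by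
    obtain ⟨i, hi⟩ := P'.surj_inl (K'.tgt z) z rfl
    exact Sum.inl_injective ((hlabr _ _ _ (P'.not_univ _)
      (hlabs _ _ _ (P'.not_univ _) hi)).symm.trans hi)
  have hinj' : Function.Injective (Sum.map P'.v id : K'.V ⊕ Fin p → Γ.V ⊕ Fin p) :=
    Sum.map_injective.mpr ⟨P'.v_inj, Function.injective_id⟩
  have hblack : ∀ y, K'.black (a y) = K.black y := fun y => by
    rw [Bool.eq_iff_iff, P.black_iff, P'.black_iff, ha]
  let e : SkelIso K K' :=
    { eV := ⟨a, b, fun y => P.v_inj (by rw [hb, ha]), fun y => P'.v_inj (by rw [ha, hb])⟩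
      eS := ⟨r, s, hsr, hrs⟩
      f := F
      tgt_eq := fun z => by
        obtain ⟨i, hi⟩ := P.surj_inl _ z rfl
        have h1 := hlabr _ _ _ (P.not_univ _) hi
        have h2 := ha (K.tgt z)
        change K'.tgt (r z) = a (K.tgt z)
        generalize P.v (K.tgt z) = x at *
        subst h2
        exact (P'.lab_inl _ _ _ h1).1
      src_eq := fun z => by
        obtain ⟨i, hi⟩ := P.surj_inl _ z rfl
        have h1 := hlabr _ _ _ (P.not_univ _) hi
        have h2 := ha (K.tgt z)
        have h3 := (P.lab_inl _ _ _ hi).2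
        apply hinj'
        change Sum.map P'.v id (K'.src (r z)) = Sum.map P'.v id (Sum.map a id (K.src z))
        have h4 : Sum.map P'.v id (Sum.map a id (K.src z)) = Sum.map P.v id (K.src z) := by
          cases K.src z <;> simp [ha]
        rw [h4, ← h3]
        generalize P.v (K.tgt z) = x at *
        subst h2
        exact (P'.lab_inl _ _ _ h1).2.symm
      out_eq := fun j => P'.v_inj (by
        change _ = P'.v (a (K.out j))
        rw [ha, ← P.out_eq, ← P'.out_eq])
      black_eq := hblack
      pos_eq := fun y hy => by
        change K'.pos (a y) = F (K.pos y)
        rw [← P'.t_black (a y) (by rw [hblack, hy]), ← P.t_black y hy, ha,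
          hF _ (mem_blacks.mpr ((P.black_iff y).mp hy).1)] }
  refine ⟨e, ?_, hF⟩
  have hslot : ∀ y i, P'.lab (P.v y) i = e.slot (P.lab (P.v y) i) := by
    intro y i
    cases hl : P.lab (P.v y) i with
    | inl z => exact hlabr _ _ _ (P.not_univ y) hl
    | inr τ =>
      obtain ⟨-, -, x, h1, h2, h3⟩ := P.lab_inr y i τ hl
      have h4 := P.univ_of_lab_inr hl
      have h5 := ha y
      change _ = Sum.inr (F τ)
      rw [← h3, hF x (mem_blacks.mpr h1.1)]
      clear h3 hl
      generalize P.v y = x at *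
      subst h5
      cases hl' : P'.lab _ i with
      | inl z => exact absurd (P'.thick_of_lab_inl hl') h4
      | inr τ' =>
        obtain ⟨-, -, x', h1', h2', h3'⟩ := P'.lab_inr _ i τ' hl'
        rw [h2] at h2'
        rw [Sum.inl_injective h2', h3']
  have hatt : ∀ τ y, st'.att (F τ) = some (a y) ↔ st.att τ = some y := by
    intro τ y
    rw [P.att_iff hst, P'.att_iff hst', ha]
    refine exists_congr fun x => and_congr_right fun hx => and_congr_left fun _ => ?_
    rw [← hF x (mem_blacks.mpr hx), EmbeddingLike.apply_eq_iff_eq]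
  have hmap : ∀ τ y, (e.map st).att (F τ) = some (a y) ↔ st.att τ = some y :=
    fun τ y => e.map_att_some st τ y
  ext1
  · funext τ'
    obtain ⟨τ, rfl⟩ := F.surjective τ'
    refine Option.ext fun y' => ?_
    obtain ⟨y, rfl⟩ := e.eV.surjective y'
    exact (hmap τ y).trans (hatt τ y).symm
  · funext y'
    obtain ⟨y, rfl⟩ := e.eV.surjective y'
    rw [e.map_mark]
    cases hm : st.mark y with
    | none =>
      refine Eq.symm ((P'.mark_iff _).mpr ?_)
      change Γ.black (P'.v (a y)) = true
      rw [ha]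
      exact (P.mark_iff y).mp hm
    | some m =>
      have hw : Γ.black (P.v y) = false := by
        cases hw : Γ.black (P.v y) with
        | false => rfl
        | true =>
          rw [(P.mark_iff y).mpr hw] at hm
          cases hm
      have h3 := hΓ.three_le_ar _ hw
      have hm' : st'.mark (a y) ≠ none := fun h => by
        have := (P'.mark_iff _).mp h
        rw [ha, hw] at this
        cases this
      obtain ⟨⟨c', a', b'⟩, hm'⟩ := Option.ne_none_iff_exists'.mp hm'
      obtain ⟨c, a₁, b₁⟩ := m
      have h5 := fun i => P.mark_eq y c a₁ b₁ hm i
      have h6 := fun i => P'.mark_eq _ c' a' b' hm' i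
      have h7 := hslot y
      rw [ha] at h6
      rw [Option.map_some]
      refine Eq.trans ?_ hm'.symm
      congr 1
      refine Prod.ext ?_ (Prod.ext ?_ ?_)
      · change e.slot c = c'
        rw [← (h5 ⟨Γ.ar (P.v y) - 3, by omega⟩).1 (by dsimp only; omega), ← h7,
          (h6 ⟨Γ.ar (P.v y) - 3, by omega⟩).1 (by dsimp only; omega)]
      · change e.slot a₁ = a'
        rw [← (h5 ⟨Γ.ar (P.v y) - 2, by omega⟩).2.1 (by dsimp only; omega), ← h7,
          (h6 ⟨Γ.ar (P.v y) - 2, by omega⟩).2.1 (by dsimp only; omega)]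
      · change e.slot b₁ = b'
        rw [← (h5 ⟨Γ.ar (P.v y) - 1, by omega⟩).2.2 (by dsimp only; omega), ← h7,
          (h6 ⟨Γ.ar (P.v y) - 1, by omega⟩).2.2 (by dsimp only; omega)]

end Pres

/-! ### Potentials -/

section Potential

variable {X M : Type*} [AddCommGroup M] {L : Set X} {R R' : X → X → X → M}

/-- A function `E` of pairs of slots is a potential for the function `R` of the last three slots of
a white vertex. -/
structure IsPotential (L : Set X) (R : X → X → X → M) (E : X → X → M) : Prop where
  symm : ∀ i ∈ L, ∀ j ∈ L, E i j = E j i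
  eq : ∀ c ∈ L, ∀ a ∈ L, ∀ b ∈ L, c ≠ a → c ≠ b → R c a b = E b c - E a c

/-- The symmetries of white vertices amount to the existence of a potential. -/
theorem exists_potential (h0 : ∀ c ∈ L, ∀ a ∈ L, c ≠ a → R c a a = 0)
    (h1 : ∀ c ∈ L, ∀ a ∈ L, ∀ b ∈ L, c ≠ a → c ≠ b → a ≠ b → R c a b + R c b a = 0)
    (h2 : ∀ c ∈ L, ∀ a ∈ L, ∀ b ∈ L, c ≠ a → c ≠ b → a ≠ b → R c a b + R a b c + R b c a = 0)
    (h3 : ∀ c ∈ L, ∀ a ∈ L, ∀ b ∈ L, ∀ o ∈ L, c ≠ a → c ≠ b → a ≠ b → c ≠ o → a ≠ o → b ≠ o →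
      R c a b + R c b o + R c o a = 0) : ∃ E, IsPotential L R E := by
  classical
  by_cases hL : L.Nontrivial
  swap
  · refine ⟨fun _ _ => 0, fun _ _ _ _ => rfl, fun c hc a ha _ _ hca => ?_⟩
    exact absurd ⟨c, hc, a, ha, hca⟩ hL
  obtain ⟨o, ho, o', ho', hoo⟩ := hL
  have hd : ∀ c ∈ L, ∀ a ∈ L, ∀ b ∈ L, ∀ u ∈ L, c ≠ a → c ≠ b → c ≠ u →
      R c a b = R c u b - R c u a := by
    intro c hc a ha b hb u hu hca hcb hcu
    by_cases hab : a = b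
    · subst hab
      rw [h0 c hc a ha hca, sub_self]
    by_cases hau : a = u
    · subst hau
      rw [h0 c hc a ha hca, sub_zero]
    by_cases hbu : b = u
    · subst hbu
      rw [h0 c hc b hb hcb, zero_sub, eq_neg_iff_add_eq_zero]
      exact h1 c hc a ha b hb hca hcb hab
    · have e1 := h3 c hc a ha b hb u hu hca hcb hab hcu hau hbu
      have e2 := h1 c hc b hb u hu hcb hcu hbu
      linear_combination (norm := module) e1 - e2
  refine ⟨fun i j => if j = o then R o o' i else R j o i + R o o' j, ?_, ?_⟩
  · intro i hi j hj
    by_cases hij : i = j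
    · rw [hij]
    by_cases hio : i = o
    · subst hio
      rw [if_neg (Ne.symm hij), if_pos rfl, h0 j hj i hi (Ne.symm hij), zero_add]
    by_cases hjo : j = o
    · subst hjo
      rw [if_pos rfl, if_neg hij, h0 i hi j hj hij, zero_add]
    · rw [if_neg hjo, if_neg hio]
      have e1 := hd o ho i hi j hj o' ho' (Ne.symm hio) (Ne.symm hjo) hoo
      have e2 := h2 j hj o ho i hi hjo (Ne.symm hij) (Ne.symm hio)
      have e3 := h1 i hi j hj o ho hij hio hjo
      linear_combination (norm := module) e2 - e3 - e1
  · intro c hc a ha b hb hca hcb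
    by_cases hco : c = o
    · subst hco
      rw [if_pos rfl, if_pos rfl]
      exact hd c hc a ha b hb o' ho' hca hcb hoo
    · rw [if_neg hco, if_neg hco, hd c hc a ha b hb o ho hca hcb hco]
      abel

theorem IsPotential.sum {ι : Type*} {R : ι → X → X → X → M} (s : Finset ι) {E : ι → X → X → M}
    (h : ∀ i ∈ s, IsPotential L (R i) (E i)) :
    IsPotential L (fun c a b => ∑ i ∈ s, R i c a b) (fun x y => ∑ i ∈ s, E i x y) where
  symm := fun x hx y hy => Finset.sum_congr rfl fun i hi => (h i hi).symm x hx y hy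
  eq := fun c hc a ha b hb h1 h2 => by
    rw [← Finset.sum_sub_distrib]
    exact Finset.sum_congr rfl fun i hi => (h i hi).eq c hc a ha b hb h1 h2

theorem IsPotential.add {E E' : X → X → M} (h : IsPotential L R E) (h' : IsPotential L R' E') :
    IsPotential L (fun c a b => R c a b + R' c a b) (fun x y => E x y + E' x y) where
  symm := fun x hx y hy => by rw [h.symm x hx y hy, h'.symm x hx y hy]
  eq := fun c hc a ha b hb h1 h2 => by
    rw [h.eq c hc a ha b hb h1 h2, h'.eq c hc a ha b hb h1 h2]
    abel

theorem IsPotential.zero : IsPotential L (fun _ _ _ => (0 : M)) (fun _ _ => 0) where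
  symm := fun _ _ _ _ => rfl
  eq := fun _ _ _ _ _ _ _ _ => (sub_self _).symm

variable [Module ℝ M]

theorem IsPotential.smul (t : ℝ) {E : X → X → M} (h : IsPotential L R E) :
    IsPotential L (fun c a b => t • R c a b) (fun x y => t • E x y) where
  symm := fun x hx y hy => by rw [h.symm x hx y hy]
  eq := fun c hc a ha b hb h1 h2 => by rw [h.eq c hc a ha b hb h1 h2, smul_sub]

/-- A function with a potential satisfies the relations of white vertices. -/
theorem IsPotential.whiteSymmetry {E : X → X → M} (h : IsPotential L R E) {name : Fin n → X}
    (hinj : Function.Injective name) (hL : ∀ i, name i ∈ L) {c : Equiv.Perm (Fin n) →₀ ℝ}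
    (hc : WhiteSymmetry n c) (x y z : Fin n) (hx : (x : ℕ) + 3 = n) (hy : (y : ℕ) + 2 = n)
    (hz : (z : ℕ) + 1 = n) :
    c.sum (fun σ t => t • R (name (σ x)) (name (σ y)) (name (σ z))) = 0 := by
  have hxy : x ≠ y := fun e => by rw [e] at hx; omega
  have hxz : x ≠ z := fun e => by rw [e] at hx; omega
  have hyz : y ≠ z := fun e => by rw [e] at hy; omega
  have hR : ∀ i j k : Fin n, i ≠ j → i ≠ k → R (name i) (name j) (name k) =
      E (name k) (name i) - E (name j) (name i) := fun i j k h1 h2 =>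
    h.eq _ (hL i) _ (hL j) _ (hL k) (hinj.ne h1) (hinj.ne h2)
  have hS : ∀ i j : Fin n, E (name i) (name j) = E (name j) (name i) := fun i j =>
    h.symm _ (hL i) _ (hL j)
  have hcyc : ∀ i j k : Fin n, ∀ f : Equiv.Perm (Fin n) → M,
      (cyclicSum i j k).sum (fun σ t => t • f σ) =
        f 1 + f (Equiv.swap i j * Equiv.swap j k) + f (Equiv.swap j k * Equiv.swap i j) := by
    intro i j k f
    rw [cyclicSum, Finsupp.sum_add_index' (by simp) (by simp [add_smul]),
      Finsupp.sum_add_index' (by simp) (by simp [add_smul])]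
    simp
  cases hc with
  | antisymm b c hb hc =>
    obtain rfl : b = y := Fin.ext (by omega)
    obtain rfl : c = z := Fin.ext (by omega)
    rw [sum_single_add_single]
    simp only [Equiv.Perm.one_apply, Equiv.swap_apply_left, Equiv.swap_apply_right,
      Equiv.swap_apply_of_ne_of_ne hxy hxz, one_smul]
    rw [hR _ _ _ hxy hxz, hR _ _ _ hxz hxy]
    abel
  | bianchi₁ a b c ha hb hc =>
    obtain rfl : a = x := Fin.ext (by omega)
    obtain rfl : b = y := Fin.ext (by omega)
    obtain rfl : c = z := Fin.ext (by omega)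
    rw [hcyc]
    simp only [Equiv.Perm.one_apply, Equiv.Perm.mul_apply, Equiv.swap_apply_left,
      Equiv.swap_apply_right, Equiv.swap_apply_of_ne_of_ne hxy hxz,
      Equiv.swap_apply_of_ne_of_ne hxz.symm hyz.symm]
    rw [hR _ _ _ hxy hxz, hR _ _ _ hyz hxy.symm, hR _ _ _ hxz.symm hyz.symm, hS a b, hS a c,
      hS b c]
    abel
  | bianchi₂ a b c ha hb hc =>
    obtain rfl : b = y := Fin.ext (by omega)
    obtain rfl : c = z := Fin.ext (by omega)
    have hxa : x ≠ a := fun e => by rw [e] at hx; omega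
    have hay : a ≠ b := fun e => by rw [e] at ha; omega
    have haz : a ≠ c := fun e => by rw [e] at ha; omega
    rw [hcyc]
    simp only [Equiv.Perm.one_apply, Equiv.Perm.mul_apply, Equiv.swap_apply_left,
      Equiv.swap_apply_right, Equiv.swap_apply_of_ne_of_ne hxy hxz,
      Equiv.swap_apply_of_ne_of_ne hxa hxy, Equiv.swap_apply_of_ne_of_ne haz.symm hyz.symm,
      Equiv.swap_apply_of_ne_of_ne hay haz]
    rw [hR _ _ _ hxy hxz, hR _ _ _ hxz hxa, hR _ _ _ hxa hxy]
    abel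
  | symm i j hi hj =>
    have h1 : ∀ w : Fin n, n ≤ (w : ℕ) + 3 → Equiv.swap i j w = w := fun w hw =>
      Equiv.swap_apply_of_ne_of_ne (fun e => by rw [← e] at hi; omega)
        (fun e => by rw [← e] at hj; omega)
    rw [Finsupp.sum_sub_index (by simp [sub_smul])]
    simp [h1 x (by omega), h1 y (by omega), h1 z (by omega)]

end Potential

namespace Marking

open Classical in
/-- Change the distinguished slots at a vertex. -/
def setMark (st : Marking K) (y : K.V) (m : Option ((K.S ⊕ ℤ) × (K.S ⊕ ℤ) × (K.S ⊕ ℤ))) :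
    Marking K where
  att := st.att
  mark := Function.update st.mark y m

variable {st st' : Marking K}

theorem setMark_self (st : Marking K) (y : K.V) : st.setMark y (st.mark y) = st := by
  classical
  ext1
  · rfl
  · exact Function.update_eq_self y st.mark

theorem setMark_mark_self (st : Marking K) (y : K.V) (m) : (st.setMark y m).mark y = m := by
  simp [setMark]

theorem setMark_mark_ne (st : Marking K) {y y' : K.V} (h : y' ≠ y) (m) :
    (st.setMark y m).mark y' = st.mark y' := by
  simp [setMark, h]

theorem setMark_setMark (st : Marking K) (y : K.V) (m m') :
    (st.setMark y m).setMark y m' = st.setMark y m' := by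
  simp [setMark]

open Classical in
theorem setMark_comm (st : Marking K) {y y' : K.V} (h : y ≠ y') (m m') :
    (st.setMark y m).setMark y' m' = (st.setMark y' m').setMark y m := by
  simp only [setMark, Function.update_comm h]

/-- Whether a marking is good does not depend on the choice of the distinguished slots. -/
theorem Good.setMark {y : K.V} {m} (h : (st.setMark y (some m)).Good) {c a b : K.S ⊕ ℤ}
    (hc : st.IsAt y c) (ha : st.IsAt y a) (hb : st.IsAt y b) (hca : c ≠ a) (hcb : c ≠ b)
    (hab : a ≠ b) : (st.setMark y (some (c, a, b))).Good where
  feed := h.feed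
  pos_inj := h.pos_inj
  finite := h.finite
  pos_ne := h.pos_ne
  black_mark := fun y' hy' => by
    have h1 := h.black_mark y' hy'
    by_cases e : y' = y
    · subst e
      simp [setMark_mark_self] at h1
    · rwa [setMark_mark_ne _ e] at h1 ⊢
  black_slots := h.black_slots
  black_att := h.black_att
  q_slot := fun y' hy' hm => by
    by_cases e : y' = y
    · subst e
      simp [setMark_mark_self] at hm
    · rw [setMark_mark_ne _ e] at hm
      exact h.q_slot y' hy' (by rwa [setMark_mark_ne _ e])
  q_att := fun y' hy' hm => by
    by_cases e : y' = y
    · subst e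
      simp [setMark_mark_self] at hm
    · rw [setMark_mark_ne _ e] at hm
      exact h.q_att y' hy' (by rwa [setMark_mark_ne _ e])
  mark_at := fun y' c' a' b' hm => by
    by_cases e : y' = y
    · subst e
      simp only [setMark_mark_self, Option.some.injEq, Prod.mk.injEq] at hm
      obtain ⟨rfl, rfl, rfl⟩ := hm
      exact ⟨hc, ha, hb, hca, hcb, hab⟩
    · rw [setMark_mark_ne _ e] at hm
      exact h.mark_at y' c' a' b' (by rwa [setMark_mark_ne _ e])

end Marking

namespace Pres

variable {Γ : Diagram p q} {st : Marking K}

open Classical in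
/-- The description of the graph obtained by permuting the slots of a white vertex. -/
def permute (P : Pres Γ K st) (y : K.V) (hw : Γ.black (P.v y) = false)
    (σ : Equiv.Perm (Fin (Γ.ar (P.v y)))) (c a b : K.S ⊕ ℤ)
    (hm : ∀ i : Fin (Γ.ar (P.v y)), ((i : ℕ) + 3 = Γ.ar (P.v y) → P.lab (P.v y) (σ i) = c) ∧
      ((i : ℕ) + 2 = Γ.ar (P.v y) → P.lab (P.v y) (σ i) = a) ∧
      ((i : ℕ) + 1 = Γ.ar (P.v y) → P.lab (P.v y) (σ i) = b)) :
    Pres (Γ.permute (P.v y) σ) K (st.setMark y (some (c, a, b))) :=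
  let lab' : ∀ x, Fin (Γ.ar x) → K.S ⊕ ℤ := Function.update P.lab (P.v y) (P.lab (P.v y) ∘ σ)
  have hlab : ∀ y', ∃ τ : Equiv.Perm (Fin (Γ.ar (P.v y'))),
      ∀ i, lab' (P.v y') i = P.lab (P.v y') (τ i) ∧
        (Γ.permute (P.v y) σ).inp (P.v y') i = Γ.inp (P.v y') (τ i) := by
    intro y'
    by_cases e : y' = y
    · subst e
      exact ⟨σ, fun i => ⟨by simp [lab'], permute_inp_self Γ (P.v y') σ i⟩⟩
    · have e' : P.v y' ≠ P.v y := P.v_inj.ne e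
      exact ⟨1, fun i => ⟨by simp [lab', e'],
        congrFun (permute_inp_ne Γ (P.v y) σ e') i⟩⟩
  { v := P.v
    t := P.t
    lab := lab'
    v_inj := P.v_inj
    v_range := P.v_range
    t_inj := P.t_inj
    t_att := P.t_att
    t_black := P.t_black
    black_iff := P.black_iff
    mark_iff := fun y' => by
      by_cases e : y' = y
      · subst e
        rw [Marking.setMark_mark_self]
        simp [hw]
      · rw [Marking.setMark_mark_ne _ e]
        exact P.mark_iff y'
    att_one := P.att_one
    lab_inl := fun y' i z h => by
      obtain ⟨τ, hτ⟩ := hlab y'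
      rw [(hτ i).1] at h
      rw [(hτ i).2]
      exact P.lab_inl y' _ z h
    lab_inr := fun y' i t h => by
      obtain ⟨τ, hτ⟩ := hlab y'
      rw [(hτ i).1] at h
      rw [(hτ i).2]
      exact P.lab_inr y' _ t h
    lab_inj := fun y' i j h => by
      obtain ⟨τ, hτ⟩ := hlab y'
      rw [(hτ i).1, (hτ j).1] at h
      exact τ.injective (P.lab_inj y' h)
    surj_inl := fun y' z h => by
      obtain ⟨τ, hτ⟩ := hlab y'
      obtain ⟨i, hi⟩ := P.surj_inl y' z h
      exact ⟨τ.symm i, by rw [(hτ _).1, Equiv.apply_symm_apply, hi]⟩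
    surj_inr := fun y' t hb h => by
      obtain ⟨τ, hτ⟩ := hlab y'
      obtain ⟨i, hi⟩ := P.surj_inr y' t hb h
      exact ⟨τ.symm i, by rw [(hτ _).1, Equiv.apply_symm_apply, hi]⟩
    mark_eq := fun y' c' a' b' h i => by
      by_cases e : y' = y
      · subst e
        simp only [Marking.setMark_mark_self, Option.some.injEq, Prod.mk.injEq] at h
        obtain ⟨rfl, rfl, rfl⟩ := h
        have e1 : lab' (P.v y') i = P.lab (P.v y') (σ i) := by simp [lab']
        rw [e1]
        exact hm i
      · rw [Marking.setMark_mark_ne _ e] at h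
        have e' : P.v y' ≠ P.v y := P.v_inj.ne e
        have e1 : lab' (P.v y') i = P.lab (P.v y') i := by simp [lab', e']
        rw [e1]
        exact P.mark_eq y' c' a' b' h i
    out_eq := P.out_eq }

end Pres

namespace Marking

theorem Good.exists_permute {st : Marking K} {y : K.V} {m} (h : (st.setMark y (some m)).Good) :
    ∃ (N : ℕ) (name : Fin N → K.S ⊕ ℤ) (F : Equiv.Perm (Fin N) → Space p q), 3 ≤ N ∧
      Function.Injective name ∧ (∀ l, st.IsAt y l ↔ ∃ i, name i = l) ∧
      (∀ σ c, WhiteSymmetry N c → c.sum (fun τ t => t • F (σ * τ)) = 0) ∧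
      ∀ σ (x y' z : Fin N), (x : ℕ) + 3 = N → (y' : ℕ) + 2 = N → (z : ℕ) + 1 = N →
        F σ = (st.setMark y (some (name (σ x), name (σ y'), name (σ z)))).cls := by
  obtain ⟨Γ, hΓ, ⟨P⟩⟩ := h.exists_pres
  have hw : Γ.black (P.v y) = false := by
    cases hw : Γ.black (P.v y) with
    | false => rfl
    | true =>
      have := (P.mark_iff y).mpr hw
      rw [setMark_mark_self] at this
      cases this
  have hat : ∀ l, st.IsAt y l ↔ ∃ i, P.lab (P.v y) i = l := by
    rintro (z | τ)
    · exact ⟨P.surj_inl y z, fun ⟨i, hi⟩ => (P.lab_inl y i z hi).1⟩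
    · exact ⟨P.surj_inr y τ hw, fun ⟨i, hi⟩ => (P.lab_inr y i τ hi).2.1⟩
  refine ⟨Γ.ar (P.v y), P.lab (P.v y), fun σ => P.sgn • GraphComplex.cls (Γ.permute (P.v y) σ),
    hΓ.three_le_ar _ hw, P.lab_inj y, hat, fun σ c hc => ?_, fun σ x y' z hx hy hz => ?_⟩
  · have h1 := cls_permute (Γ := Γ.permute (P.v y) σ) (v := P.v y) hw hc
    have h2 : ∀ τ, GraphComplex.cls ((Γ.permute (P.v y) σ).permute (P.v y) τ) =
        GraphComplex.cls (Γ.permute (P.v y) (σ * τ)) := fun τ => by rw [permute_permute]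
    simp only [smul_comm _ P.sgn]
    rw [Finsupp.sum, ← Finset.smul_sum]
    rw [Finsupp.sum] at h1
    rw [← Finset.sum_congr rfl fun τ _ => congrArg (c τ • ·) (h2 τ), h1, smul_zero]
  · have hinj := (P.lab_inj y).comp σ.injective
    have hg := h.setMark (c := P.lab (P.v y) (σ x)) (a := P.lab (P.v y) (σ y'))
      (b := P.lab (P.v y) (σ z)) ((hat _).mpr ⟨_, rfl⟩) ((hat _).mpr ⟨_, rfl⟩) ((hat _).mpr ⟨_, rfl⟩)
      (fun e => by have := hinj e; rw [this] at hx; omega)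
      (fun e => by have := hinj e; rw [this] at hx; omega)
      (fun e => by have := hinj e; rw [this] at hy; omega)
    have e := setMark_setMark st y (some m)
      (some (P.lab (P.v y) (σ x), P.lab (P.v y) (σ y'), P.lab (P.v y) (σ z)))
    exact ((P.permute y hw σ _ _ _ fun i =>
      ⟨fun hi => congrArg (fun i => P.lab (P.v y) (σ i)) (Fin.ext (by omega : (i : ℕ) = x)),
        fun hi => congrArg (fun i => P.lab (P.v y) (σ i)) (Fin.ext (by omega : (i : ℕ) = y')),
        fun hi => congrArg (fun i => P.lab (P.v y) (σ i)) (Fin.ext (by omega : (i : ℕ) = z))⟩).cls_eq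
          (by rw [e]; exact hg) hΓ.pos_injective).symm.trans (congrArg Marking.cls e)

theorem exists_perm_apply {k : ℕ} (f g : Fin k → Fin n) (hf : Function.Injective f)
    (hg : Function.Injective g) : ∃ σ : Equiv.Perm (Fin n), ∀ i, σ (f i) = g i := by
  classical
  obtain ⟨G, hG⟩ := Finset.exists_equiv_extend_of_card_eq (α := Fin n)
    (t := (Finset.univ : Finset (Fin n))) (by simp)
    (s := Finset.univ.image f) (f := Function.extend f g id) (Finset.subset_univ _)
    (by
      intro a ha b hb hab
      obtain ⟨a, -, rfl⟩ := Finset.mem_image.mp ha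
      obtain ⟨b, -, rfl⟩ := Finset.mem_image.mp hb
      rw [hf.extend_apply, hf.extend_apply] at hab
      rw [hg hab])
  refine ⟨G.trans (Equiv.subtypeUnivEquiv (by simp)), fun i => ?_⟩
  change (G (f i) : Fin n) = g i
  rw [hG _ (Finset.mem_image_of_mem f (Finset.mem_univ i)), hf.extend_apply]

theorem setMark_cls_eq_zero {st : Marking K} {y : K.V} {c a b : K.S ⊕ ℤ}
    (h : ¬ (st.IsAt y c ∧ st.IsAt y a ∧ st.IsAt y b ∧ c ≠ a ∧ c ≠ b ∧ a ≠ b)) :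
    (st.setMark y (some (c, a, b))).cls = 0 :=
  cls_of_not_good fun hg => h (hg.mark_at y c a b (setMark_mark_self st y _))

/-- The symmetries of white vertices, as the existence of a potential. -/
theorem exists_setMark_potential (st : Marking K) (y : K.V) :
    ∃ E, IsPotential {l | st.IsAt y l} (fun c a b => (st.setMark y (some (c, a, b))).cls) E := by
  by_cases hg : ∃ m, (st.setMark y (some m)).Good
  swap
  · push Not at hg
    have h0 : (fun c a b => (st.setMark y (some (c, a, b))).cls) = fun _ _ _ => 0 := by
      funext c a b
      exact cls_of_not_good (hg _)
    rw [h0]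
    exact ⟨_, IsPotential.zero⟩
  obtain ⟨m, hm⟩ := hg
  obtain ⟨N, name, F, hN, hinj, hat, hF, hFc⟩ := hm.exists_permute
  have hcyc : ∀ i j k : Fin N, ∀ f : Equiv.Perm (Fin N) → Space p q,
      (cyclicSum i j k).sum (fun σ t => t • f σ) =
        f 1 + f (Equiv.swap i j * Equiv.swap j k) + f (Equiv.swap j k * Equiv.swap i j) := by
    intro i j k f
    rw [cyclicSum, Finsupp.sum_add_index' (by simp) (by simp [add_smul]),
      Finsupp.sum_add_index' (by simp) (by simp [add_smul])]
    simp
  let x : Fin N := ⟨N - 3, by omega⟩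
  let y' : Fin N := ⟨N - 2, by omega⟩
  let z : Fin N := ⟨N - 1, by omega⟩
  have hx : (x : ℕ) + 3 = N := by simp only [x]; omega
  have hy : (y' : ℕ) + 2 = N := by simp only [y']; omega
  have hz : (z : ℕ) + 1 = N := by simp only [z]; omega
  have hxy : x ≠ y' := fun e => by rw [e] at hx; omega
  have hxz : x ≠ z := fun e => by rw [e] at hx; omega
  have hyz : y' ≠ z := fun e => by rw [e] at hy; omega
  have hFc' := fun σ => hFc σ x y' z hx hy hz
  have hext : ∀ i j k : Fin N, i ≠ j → i ≠ k → j ≠ k →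
      ∃ σ : Equiv.Perm (Fin N), σ x = i ∧ σ y' = j ∧ σ z = k := by
    intro i j k h1 h2 h3
    obtain ⟨σ, hσ⟩ := exists_perm_apply ![x, y', z] ![i, j, k]
      (by
        intro a b hab
        fin_cases a <;> fin_cases b <;> simp [hxy, hxz, hyz, hxy.symm, hxz.symm, hyz.symm] at hab ⊢)
      (by
        intro a b hab
        fin_cases a <;> fin_cases b <;> simp [h1, h2, h3, h1.symm, h2.symm, h3.symm] at hab ⊢)
    exact ⟨σ, hσ 0, hσ 1, hσ 2⟩
  refine exists_potential ?_ ?_ ?_ ?_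
  · exact fun c _ a _ _ => setMark_cls_eq_zero fun h => h.2.2.2.2.2 rfl
  · intro c hc a ha b hb hca hcb hab
    obtain ⟨c, rfl⟩ := (hat c).mp hc
    obtain ⟨a, rfl⟩ := (hat a).mp ha
    obtain ⟨b, rfl⟩ := (hat b).mp hb
    obtain ⟨σ, rfl, rfl, rfl⟩ := hext c a b (fun e => hca (by rw [e])) (fun e => hcb (by rw [e]))
      (fun e => hab (by rw [e]))
    have h := hF σ _ (WhiteSymmetry.antisymm y' z hy hz)
    rw [sum_single_add_single, hFc', hFc'] at h
    simpa only [Equiv.Perm.mul_apply, Equiv.Perm.one_apply, Equiv.swap_apply_left,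
      Equiv.swap_apply_right, Equiv.swap_apply_of_ne_of_ne hxy hxz, one_smul] using h
  · intro c hc a ha b hb hca hcb hab
    obtain ⟨c, rfl⟩ := (hat c).mp hc
    obtain ⟨a, rfl⟩ := (hat a).mp ha
    obtain ⟨b, rfl⟩ := (hat b).mp hb
    obtain ⟨σ, rfl, rfl, rfl⟩ := hext c a b (fun e => hca (by rw [e])) (fun e => hcb (by rw [e]))
      (fun e => hab (by rw [e]))
    have h := hF σ _ (WhiteSymmetry.bianchi₁ x y' z hx hy hz)
    rw [hcyc, hFc', hFc', hFc'] at h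
    simpa only [Equiv.Perm.mul_apply, Equiv.Perm.one_apply, Equiv.swap_apply_left,
      Equiv.swap_apply_right, Equiv.swap_apply_of_ne_of_ne hxy hxz,
      Equiv.swap_apply_of_ne_of_ne hxz.symm hyz.symm] using h
  · intro c hc a ha b hb o ho hca hcb hab hco hao hbo
    obtain ⟨c, rfl⟩ := (hat c).mp hc
    obtain ⟨a, rfl⟩ := (hat a).mp ha
    obtain ⟨b, rfl⟩ := (hat b).mp hb
    obtain ⟨o, rfl⟩ := (hat o).mp ho
    have ne : ∀ {i j}, name i ≠ name j → i ≠ j := fun h e => h (by rw [e])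
    have hN4 : 4 ≤ N := by
      have h4 : ({c, a, b, o} : Finset (Fin N)).card = 4 := by
        rw [Finset.card_insert_of_notMem (by simp [ne hca, ne hcb, ne hco]),
          Finset.card_insert_of_notMem (by simp [ne hab, ne hao]),
          Finset.card_insert_of_notMem (by simp [ne hbo]), Finset.card_singleton]
      have := Finset.card_le_univ ({c, a, b, o} : Finset (Fin N))
      rw [h4, Fintype.card_fin] at this
      exact this
    let w : Fin N := ⟨N - 4, by omega⟩
    have hw : (w : ℕ) + 4 = N := by simp only [w]; omega
    have hwx : w ≠ x := fun e => by rw [e] at hw; omega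
    have hwy : w ≠ y' := fun e => by rw [e] at hw; omega
    have hwz : w ≠ z := fun e => by rw [e] at hw; omega
    obtain ⟨σ, hσ⟩ := exists_perm_apply ![x, y', z, w] ![c, a, b, o]
      (by
        intro a b hab
        fin_cases a <;> fin_cases b <;> simp [hxy, hxz, hyz, hxy.symm, hxz.symm, hyz.symm, hwx,
          hwy, hwz, hwx.symm, hwy.symm, hwz.symm] at hab ⊢)
      (by
        intro i j hij
        fin_cases i <;> fin_cases j <;> simp [ne hca, ne hcb, ne hab, ne hco, ne hao, ne hbo,
          (ne hca).symm, (ne hcb).symm, (ne hab).symm, (ne hco).symm, (ne hao).symm,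
          (ne hbo).symm] at hij ⊢)
    have s1 : σ x = c := hσ 0
    have s2 : σ y' = a := hσ 1
    have s3 : σ z = b := hσ 2
    have s4 : σ w = o := hσ 3
    have h := hF σ _ (WhiteSymmetry.bianchi₂ w y' z hw hy hz)
    rw [hcyc, hFc', hFc', hFc'] at h
    simpa only [Equiv.Perm.mul_apply, Equiv.Perm.one_apply, Equiv.swap_apply_left,
      Equiv.swap_apply_right, Equiv.swap_apply_of_ne_of_ne hxy hxz,
      Equiv.swap_apply_of_ne_of_ne hwx.symm hxy, Equiv.swap_apply_of_ne_of_ne hwz.symm hyz.symm,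
      Equiv.swap_apply_of_ne_of_ne hwy hwz, s1, s2, s3, s4] using h

end Marking

/-! ### The homotopy -/

section Extension

variable {X X' M : Type*} [AddCommGroup M] [Module ℝ M]

/-- The mean value. -/
def avg (J : Finset X) (F : X → M) : M := (J.card : ℝ)⁻¹ • ∑ j ∈ J, F j

theorem avg_congr {J : Finset X} {F G : X → M} (h : ∀ j ∈ J, F j = G j) : avg J F = avg J G := by
  rw [avg, avg, Finset.sum_congr rfl h]

theorem avg_sub_const {J : Finset X} (hJ : J.Nonempty) (F : X → M) (x : M) :
    avg J (fun j => F j - x) = avg J F - x := by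
  have h : (J.card : ℝ) ≠ 0 := by exact_mod_cast hJ.card_pos.ne'
  rw [avg, avg, Finset.sum_sub_distrib, smul_sub, Finset.sum_const, ← Nat.cast_smul_eq_nsmul ℝ,
    smul_smul, inv_mul_cancel₀ h, one_smul]

open Classical in
/-- The extension of a function `D` of the last three slots, with potential `E`, to one more
slot `u`. Its potential has the mean value of the `E i j`, `j ∈ J`, as value at `i`, `u`. -/
def extendBy (J : Finset X) (u : X) (D : X → X → X → M) (c a b : X) : M :=
  if a = b then 0
  else if b = u then avg (J.erase c) (fun j => D c a j)
  else if a = u then -avg (J.erase c) (fun j => D c b j)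
  else if c = u then avg (J.erase b) (fun j => D b a j) - avg (J.erase a) (fun j => D a b j)
  else D c a b

theorem extendBy_potential {L : Set X} {J : Finset X} {u : X} {D : X → X → X → M} {E : X → X → M}
    (h : IsPotential L D E) (hJ : 2 ≤ J.card) (hJL : ∀ j ∈ J, j ∈ L) (hu : u ∉ L) :
    ∃ E', IsPotential (insert u L) (extendBy J u D) E' := by
  classical
  have hne : ∀ i, (J.erase i).Nonempty := fun i => by
    rw [← Finset.card_pos]
    have := Finset.pred_card_le_card_erase (s := J) (a := i)
    omega
  have hJu : ∀ {i}, i ∈ L → i ≠ u := fun hi e => hu (e ▸ hi)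
  have hD : ∀ c ∈ L, ∀ a ∈ L, c ≠ a → avg (J.erase c) (fun j => D c a j) =
      avg (J.erase c) (fun j => E c j) - E a c := by
    intro c hc a ha hca
    rw [← avg_sub_const (hne c)]
    refine avg_congr fun j hj => ?_
    have hj' := Finset.mem_erase.mp hj
    rw [h.eq c hc a ha j (hJL j hj'.2) hca hj'.1.symm, h.symm j (hJL j hj'.2) c hc]
  refine ⟨fun i j => if i = u then (if j = u then 0 else avg (J.erase j) (E j))
    else if j = u then avg (J.erase i) (E i) else E i j, ?_, ?_⟩
  · rintro i hi j hj
    by_cases h1 : i = u <;> by_cases h2 : j = u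
    · simp [h1, h2]
    · simp [h1, h2]
    · simp [h1, h2]
    · simp only [h1, h2, if_false]
      exact h.symm i (hi.resolve_left h1) j (hj.resolve_left h2)
  · intro c hc a ha b hb hca hcb
    rw [extendBy]
    by_cases hab : a = b
    · rw [if_pos hab, hab, sub_self]
    rw [if_neg hab]
    by_cases h1 : b = u
    · have hc' := hc.resolve_left fun e => hcb (e.trans h1.symm)
      have ha' := ha.resolve_left fun e => hab (e.trans h1.symm)
      simp only [h1, hJu hc', hJu ha', if_true, if_false]
      exact hD c hc' a ha' hca
    have hb' := hb.resolve_left h1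
    by_cases h2 : a = u
    · have hc' := hc.resolve_left fun e => hca (e.trans h2.symm)
      simp only [h1, h2, hJu hc', if_true, if_false]
      rw [hD c hc' b hb' hcb, neg_sub]
    have ha' := ha.resolve_left h2
    by_cases h3 : c = u
    · simp only [h1, h2, h3, if_true, if_false]
      rw [hD b hb' a ha' (Ne.symm hab), hD a ha' b hb' hab, h.symm a ha' b hb']
      abel
    · simp only [h1, h2, h3, if_false]
      exact h.eq c (hc.resolve_left h3) a ha' b hb' hca hcb

theorem extendBy_map (e : X ↪ X') (J : Finset X) (u : X) (D : X → X → X → M)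
    (D' : X' → X' → X' → M) (t : ℝ) (hD : ∀ c a b, D' (e c) (e a) (e b) = t • D c a b) (c a b : X) :
    extendBy (J.map e) (e u) D' (e c) (e a) (e b) = t • extendBy J u D c a b := by
  classical
  have havg : ∀ i k, avg ((J.map e).erase (e i)) (fun j => D' (e i) (e k) j) =
      t • avg (J.erase i) (fun j => D i k j) := by
    intro i k
    rw [← Finset.map_erase, avg, avg, Finset.sum_map, Finset.card_map, smul_comm t]
    exact congrArg _ ((Finset.sum_congr rfl fun j _ => hD i k j).trans Finset.smul_sum.symm)
  rw [extendBy, extendBy]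
  simp only [EmbeddingLike.apply_eq_iff_eq, havg, hD]
  split_ifs
  · rw [smul_zero]
  · rfl
  · rw [smul_neg]
  · rw [smul_sub]
  · rfl

/-- The values of `extendBy` are linear combinations of values of `D`. -/
theorem extendBy_induction {ι : Type*} {P : (ι → M) → Prop} (hz : P fun _ => 0)
    (hs : ∀ F, ∀ t : ℝ, P F → P fun i => t • F i) (ha : ∀ F G, P F → P G → P fun i => F i + G i)
    (J : Finset X) (u : X) (D : ι → X → X → X → M) (hD : ∀ c a b, P fun i => D i c a b)
    (c a b : X) : P fun i => extendBy J u (D i) c a b := by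
  classical
  have hsum : ∀ (s : Finset X) (F : X → ι → M), (∀ j, P (F j)) → P fun i => ∑ j ∈ s, F j i := by
    intro s F hF
    induction s using Finset.induction_on with
    | empty => simpa using hz
    | insert j s hj ih =>
      simp only [Finset.sum_insert hj]
      exact ha _ _ (hF j) ih
  have havg : ∀ (s : Finset X) (c a : X), P fun i => avg s fun j => D i c a j := fun s c a =>
    hs _ _ (hsum s (fun j i => D i c a j) fun j => hD c a j)
  have hneg : ∀ F, P F → P fun i => -F i := fun F hF => by
    simpa using hs F (-1) hF
  simp only [extendBy]
  split_ifs
  · exact hz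
  · exact havg _ c a
  · exact hneg _ (havg _ c b)
  · simp only [sub_eq_add_neg]
    exact ha _ _ (havg _ b a) (hneg _ (havg _ a b))
  · exact hD c a b

end Extension

open Classical in
/-- The slots at a vertex that are not fed by univalent black vertices. -/
def Skeleton.slotsAt (K : Skeleton p q) (y : K.V) : Finset K.S :=
  Finset.univ.filter fun z => K.tgt z = y

theorem Skeleton.mem_slotsAt {y : K.V} {z : K.S} : z ∈ K.slotsAt y ↔ K.tgt z = y := by
  simp [Skeleton.slotsAt]

/-- The same slots as input slots. -/
def Skeleton.base (K : Skeleton p q) (y : K.V) : Finset (K.S ⊕ ℤ) :=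
  (K.slotsAt y).map Function.Embedding.inl

namespace Marking

open Classical in
/-- Remove the univalent black vertex labelled `τ`. -/
def del (st : Marking K) (τ : ℤ) : Marking K where
  att := Function.update st.att τ none
  mark := st.mark

open Classical in
/-- The removal of the univalent black vertex labelled `τ` from the white vertex `y`, whose last
three slots are `c`, `a`, `b`. If only one other slot of `y` is not fed by a univalent black vertex
then `y` becomes a bivalent black vertex (this gives a good marking only if `y` has three slots). -/
def hatAt {M : Type*} [AddCommGroup M] [Module ℝ M] (st : Marking K) (Φ : Marking K → M) (τ : ℤ)
    (y : K.V) (c a b : K.S ⊕ ℤ) : M :=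
  if 2 ≤ (K.slotsAt y).card then
    extendBy (K.base y) (Sum.inr τ) (fun c a b => Φ ((st.del τ).setMark y (some (c, a, b)))) c a b
  else ((if a = Sum.inr τ then 1 else 0) - (if b = Sum.inr τ then 1 else 0) : ℝ) •
    Φ ((st.del τ).setMark y none)

/-- The combination of markings that arises from the removal of the univalent black vertex labelled
`τ`, with `Φ` applied to them. -/
def hatWith {M : Type*} [AddCommGroup M] [Module ℝ M] (st : Marking K) (Φ : Marking K → M)
    (τ : ℤ) : M :=
  match st.att τ with
  | none => 0
  | some y => match st.mark y with
    | none => 0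
    | some (c, a, b) => st.hatAt Φ τ y c a b

/-- The removal of the univalent black vertex labelled `τ`. -/
def hat (st : Marking K) (τ : ℤ) : Space p q := st.hatWith cls τ

/-- The homotopy: remove the univalent black vertices, once they have been made the first vertex. -/
def hnet (st : Marking K) : Space p q := ∑ τ ∈ st.active, toFront st.labels id τ • st.hat τ

variable {st : Marking K} {M : Type*} [AddCommGroup M] [Module ℝ M]

theorem hatWith_of_none {Φ : Marking K → M} {τ : ℤ} (h : st.att τ = none) :
    st.hatWith Φ τ = 0 := by
  rw [hatWith, h]

theorem hatWith_of_mark_none {Φ : Marking K → M} {τ : ℤ} {y : K.V} (h : st.att τ = some y)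
    (hm : st.mark y = none) : st.hatWith Φ τ = 0 := by
  simp only [hatWith, h, hm]

theorem hatWith_of_some {Φ : Marking K → M} {τ : ℤ} {y : K.V} {c a b : K.S ⊕ ℤ}
    (h : st.att τ = some y) (hm : st.mark y = some (c, a, b)) :
    st.hatWith Φ τ = st.hatAt Φ τ y c a b := by
  simp only [hatWith, h, hm]

theorem hat_of_none {τ : ℤ} (h : st.att τ = none) : st.hat τ = 0 := hatWith_of_none h

theorem hat_of_mark_none {τ : ℤ} {y : K.V} (h : st.att τ = some y) (hm : st.mark y = none) :
    st.hat τ = 0 := hatWith_of_mark_none h hm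

theorem hat_of_some {τ : ℤ} {y : K.V} {c a b : K.S ⊕ ℤ} (h : st.att τ = some y)
    (hm : st.mark y = some (c, a, b)) : st.hat τ = st.hatAt cls τ y c a b := hatWith_of_some h hm

theorem del_att_self (st : Marking K) (τ : ℤ) : (st.del τ).att τ = none := by simp [del]

theorem del_att_ne (st : Marking K) {τ τ' : ℤ} (h : τ' ≠ τ) : (st.del τ).att τ' = st.att τ' := by
  simp [del, h]

theorem setMark_labels (st : Marking K) (y : K.V) (m) : (st.setMark y m).labels = st.labels := rfl

theorem setMark_del (st : Marking K) (y : K.V) (m) (τ : ℤ) :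
    (st.setMark y m).del τ = (st.del τ).setMark y m := rfl

theorem del_active (hfin : {τ | st.att τ ≠ none}.Finite) (τ : ℤ) :
    (st.del τ).active = st.active.erase τ := by
  have hset : {τ' | (st.del τ).att τ' ≠ none} = {τ' | st.att τ' ≠ none} \ {τ} := by
    ext τ'
    by_cases e : τ' = τ
    · simp [e, del_att_self]
    · simp [e, del_att_ne st e]
  have hfin' : {τ' | (st.del τ).att τ' ≠ none}.Finite := by
    rw [hset]
    exact hfin.sdiff
  ext τ'
  rw [active, dif_pos hfin', active, dif_pos hfin]
  simp only [Set.Finite.mem_toFinset, Finset.mem_erase]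
  by_cases e : τ' = τ
  · simp [e, del_att_self]
  · simp [e, del_att_ne st e]

theorem Good.del_labels (h : st.Good) {τ : ℤ} (hτ : st.att τ ≠ none) :
    (st.del τ).labels = st.labels.erase τ := by
  classical
  rw [labels, labels, del_active h.finite, Finset.erase_union_distrib, Finset.erase_eq_of_notMem
    (s := Finset.image _ _)]
  simp only [Finset.mem_image, Finset.mem_filter, Finset.mem_univ, true_and, not_exists, not_and]
  exact fun y hy e => h.pos_ne y τ hy hτ e.symm

end Marking

theorem toFront_erase (s : Finset ℤ) (f : ℤ → ℤ) (τ : ℤ) :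
    toFront (s.erase τ) f τ = toFront s f τ := by
  classical
  by_cases h : τ ∈ s
  · rw [toFront, toFront, ← Finset.mul_prod_erase s _ h, if_neg (lt_irrefl _), one_mul]
  · rw [Finset.erase_eq_of_notMem h]

namespace SkelIso

variable (e : SkelIso K K') {st : Marking K}

theorem map_del (τ : ℤ) : e.map (st.del τ) = (e.map st).del (e.f τ) := by
  ext1
  · funext τ'
    obtain ⟨τ', rfl⟩ := e.f.surjective τ'
    by_cases h : τ' = τ
    · subst h
      rw [Marking.del_att_self, map_att_none, Marking.del_att_self]
    · rw [Marking.del_att_ne _ (e.f.injective.ne h)]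
      simp [map, Marking.del_att_ne _ h]
  · rfl

theorem map_setMark (y : K.V) (m : Option ((K.S ⊕ ℤ) × (K.S ⊕ ℤ) × (K.S ⊕ ℤ))) :
    e.map (st.setMark y m) = (e.map st).setMark (e.eV y)
      (m.map fun m => (e.slot m.1, e.slot m.2.1, e.slot m.2.2)) := by
  ext1
  · rfl
  · funext y'
    obtain ⟨y', rfl⟩ := e.eV.surjective y'
    rw [map_mark]
    by_cases h : y' = y
    · subst h
      rw [Marking.setMark_mark_self, Marking.setMark_mark_self]
    · rw [Marking.setMark_mark_ne _ h, Marking.setMark_mark_ne _ (e.eV.injective.ne h), map_mark]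

theorem slotsAt_map (y : K.V) : K'.slotsAt (e.eV y) = (K.slotsAt y).map e.eS.toEmbedding := by
  ext z
  obtain ⟨z, rfl⟩ := e.eS.surjective z
  simp [Skeleton.mem_slotsAt, e.tgt_eq]

theorem base_map (y : K.V) : K'.base (e.eV y) = (K.base y).map e.slot.toEmbedding := by
  rw [Skeleton.base, Skeleton.base, slotsAt_map, Finset.map_map, Finset.map_map]
  rfl

theorem map_hat (hst : st.Good) {τ : ℤ} (hτ : st.att τ ≠ none) :
    (e.map st).hat (e.f τ) = invSign (st.labels.erase τ) id e.f • st.hat τ := by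
  classical
  obtain ⟨y, hy⟩ := Option.ne_none_iff_exists'.mp hτ
  have hy' := (e.map_att_some st τ y).mpr hy
  cases hm : st.mark y with
  | none =>
    rw [Marking.hat_of_mark_none hy hm, Marking.hat_of_mark_none hy' (by rw [map_mark, hm]; rfl),
      smul_zero]
  | some m =>
    obtain ⟨c, a, b⟩ := m
    rw [Marking.hat_of_some hy hm, Marking.hat_of_some hy' (by rw [map_mark, hm]; rfl),
      Marking.hatAt, Marking.hatAt, slotsAt_map, Finset.card_map, base_map]
    by_cases h2 : 2 ≤ (K.slotsAt y).card
    · rw [if_pos h2, if_pos h2]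
      refine extendBy_map e.slot.toEmbedding (K.base y) (Sum.inr τ) _ _ _ (fun c a b => ?_) c a b
      have h3 := e.map_setMark (st := st.del τ) y (some (c, a, b))
      rw [map_del] at h3
      change (((e.map st).del (e.f τ)).setMark (e.eV y) (some (e.slot c, e.slot a, e.slot b))).cls = _
      rw [← hst.del_labels hτ, ← Marking.setMark_labels (st.del τ) y (some (c, a, b)), ← map_cls, h3]
      rfl
    · rw [if_neg h2, if_neg h2]
      have h3 := e.map_setMark (st := st.del τ) y none
      rw [map_del, Option.map_none] at h3
      have ha : ∀ l, e.slot l = Sum.inr (e.f τ) ↔ l = Sum.inr τ := fun l => by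
        rw [← e.slot.apply_eq_iff_eq (x := l)]
        rfl
      dsimp only
      rw [← h3, map_cls, Marking.setMark_labels, hst.del_labels hτ, smul_comm]
      simp only [ha]

theorem map_hnet (hst : st.Good) : (e.map st).hnet = invSign st.labels id e.f • st.hnet := by
  classical
  rw [Marking.hnet, Marking.hnet, map_active, map_labels, Finset.sum_image e.f.injective.injOn,
    Finset.smul_sum]
  refine Finset.sum_congr rfl fun τ hτ => ?_
  have hτ' := hst.mem_active.mp hτ
  have hl : τ ∈ st.labels := hst.mem_labels.mpr (Or.inr hτ')
  rw [map_hat e hst hτ', toFront_image e.f.injective.injOn, smul_smul, smul_smul,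
    invSign_erase hl Function.injective_id.injOn e.f.injective.injOn, toFront_erase, toFront_erase]
  congr 1
  have h1 := toFront_mul_self st.labels id τ
  change toFront st.labels e.f τ * _ = _
  linear_combination (-toFront st.labels e.f τ * invSign (st.labels.erase τ) id e.f) * h1

end SkelIso

namespace Marking

variable {st : Marking K}

/-- The homotopy is compatible with the symmetries of white vertices. -/
theorem exists_hnet_potential (st : Marking K) (y : K.V) :
    ∃ E, IsPotential {l | st.IsAt y l} (fun c a b => (st.setMark y (some (c, a, b))).hnet) E := by
  classical
  have key : ∀ τ, ∃ E, IsPotential {l | st.IsAt y l}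
      (fun c a b => (st.setMark y (some (c, a, b))).hat τ) E := by
    intro τ
    cases hτ : st.att τ with
    | none =>
      have : (fun c a b => (st.setMark y (some (c, a, b))).hat τ) = fun _ _ _ => 0 := by
        funext c a b
        exact hat_of_none hτ
      rw [this]
      exact ⟨_, IsPotential.zero⟩
    | some y' =>
      by_cases e : y' = y
      · subst e
        have hL : {l | st.IsAt y' l} = insert (Sum.inr τ) {l | (st.del τ).IsAt y' l} := by
          ext l
          rcases l with z | τ'
          · simp [IsAt]
          · by_cases e : τ' = τ
            · subst e
              simp [IsAt, hτ]
            · simp [IsAt, e, del_att_ne st e]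
        have hfun : (fun c a b => (st.setMark y' (some (c, a, b))).hat τ) =
            fun c a b => st.hatAt cls τ y' c a b := by
          funext c a b
          rw [hat_of_some (st := st.setMark y' (some (c, a, b))) hτ (setMark_mark_self st y' _), hatAt,
            hatAt, setMark_del]
          simp only [setMark_setMark]
        rw [hfun]
        by_cases h2 : 2 ≤ (K.slotsAt y').card
        · obtain ⟨E, hE⟩ := exists_setMark_potential (st.del τ) y'
          rw [hL]
          obtain ⟨E', hE'⟩ := extendBy_potential (u := Sum.inr τ) (J := K.base y') hE
            (by rwa [Skeleton.base, Finset.card_map])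
            (by
              intro j hj
              obtain ⟨z, hz, rfl⟩ := Finset.mem_map.mp hj
              exact Skeleton.mem_slotsAt.mp hz)
            (by simp [IsAt, del_att_self])
          refine ⟨E', ?_⟩
          simp only [hatAt, h2, if_true]
          exact hE'
        · simp only [hatAt, h2, if_false]
          refine ⟨fun i j => (-(if i = Sum.inr τ ∨ j = Sum.inr τ then 1 else 0) : ℝ) •
            ((st.del τ).setMark y' none).cls, fun i _ j _ => by simp only [or_comm],
            fun c _ a _ b _ hca hcb => ?_⟩
          rw [← sub_smul]
          congr 1
          by_cases hc : c = Sum.inr τ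
          · subst hc
            simp [hca.symm, hcb.symm]
          · simp only [hc, or_false]
            ring
      · cases hm : st.mark y' with
        | none =>
          have : (fun c a b => (st.setMark y (some (c, a, b))).hat τ) = fun _ _ _ => 0 := by
            funext c a b
            exact hat_of_mark_none (y := y') hτ (by rw [setMark_mark_ne _ e, hm])
          rw [this]
          exact ⟨_, IsPotential.zero⟩
        | some m' =>
          obtain ⟨c', a', b'⟩ := m'
          have hL : {l | st.IsAt y l} = {l | (st.del τ).IsAt y l} := by
            ext l
            rcases l with z | τ'
            · simp [IsAt]
            · by_cases e' : τ' = τ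
              · subst e'
                simp [IsAt, hτ, del_att_self, e]
              · simp [IsAt, del_att_ne st e']
          have hfun : (fun c a b => (st.setMark y (some (c, a, b))).hat τ) =
              fun c a b => (st.setMark y (some (c, a, b))).hatAt cls τ y' c' a' b' := by
            funext c a b
            exact hat_of_some (y := y') hτ (by rw [setMark_mark_ne _ e, hm])
          rw [hfun, hL]
          have hcomm : ∀ m m', (((st.setMark y m).del τ).setMark y' m') =
              ((st.del τ).setMark y' m').setMark y m := fun m m' => by
            rw [setMark_del, setMark_comm _ (Ne.symm e)]
          have hD : ∀ m', ∃ E, IsPotential {l | (st.del τ).IsAt y l} (fun c a b =>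
              (((st.setMark y (some (c, a, b))).del τ).setMark y' m').cls) E := by
            intro m'
            simp only [hcomm]
            exact exists_setMark_potential ((st.del τ).setMark y' m') y
          simp only [hatAt]
          by_cases h2 : 2 ≤ (K.slotsAt y').card
          · simp only [h2, if_true]
            refine extendBy_induction (ι := (K.S ⊕ ℤ) × (K.S ⊕ ℤ) × (K.S ⊕ ℤ))
              (P := fun F => ∃ E, IsPotential {l | (st.del τ).IsAt y l}
                (fun c a b => F (c, a, b)) E) ⟨_, IsPotential.zero⟩ ?_ ?_ _ _
              (fun i c a b => (((st.setMark y (some i)).del τ).setMark y' (some (c, a, b))).cls)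
              (fun c a b => hD (some (c, a, b))) c' a' b'
            · rintro F t ⟨E, hE⟩
              exact ⟨_, hE.smul t⟩
            · rintro F G ⟨E, hE⟩ ⟨E', hE'⟩
              exact ⟨_, hE.add hE'⟩
          · simp only [h2, if_false]
            obtain ⟨E, hE⟩ := hD none
            exact ⟨_, hE.smul _⟩
  choose E hE using key
  exact ⟨_, IsPotential.sum st.active fun τ _ => (hE τ).smul (toFront st.labels id τ)⟩

end Marking

/-- Isomorphic graphs have the same description. -/
theorem Pres.exists_of_iso {Γ Γ' : Diagram p q} {st : Marking K} (P : Pres Γ K st)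
    (e : Iso Γ Γ') : ∃ P' : Pres Γ' K st, ∀ x, P'.t (e.toEquiv x) = P.t x := by
  have hlab : ∀ x', ∃ L : Fin (Γ'.ar x') → K.S ⊕ ℤ, ∀ x (i : Fin (Γ.ar x)) (i' : Fin (Γ'.ar x')),
      (⟨e.toEquiv x, e.slots x i⟩ : Σ x', Fin (Γ'.ar x')) = ⟨x', i'⟩ → L i' = P.lab x i := by
    intro x'
    obtain ⟨x₀, rfl⟩ := e.toEquiv.surjective x'
    refine ⟨fun i' => P.lab x₀ ((e.slots x₀).symm i'), fun x i i' h => ?_⟩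
    simp only [Sigma.mk.injEq, EmbeddingLike.apply_eq_iff_eq] at h
    obtain ⟨rfl, h⟩ := h
    rw [← eq_of_heq h]
    change P.lab x ((e.slots x).symm (e.slots x i)) = _
    rw [Equiv.symm_apply_apply]
  choose lab' hlab' using hlab
  have hl : ∀ x i, lab' (e.toEquiv x) (e.slots x i) = P.lab x i := fun x i => hlab' _ x i _ rfl
  have har : ∀ x, Γ'.ar (e.toEquiv x) = Γ.ar x := fun x => by
    simpa using (Fintype.card_congr (e.slots x)).symm
  have huniv : ∀ x, Γ'.IsUnivalentBlack (e.toEquiv x) ↔ Γ.IsUnivalentBlack x := fun x => by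
    rw [IsUnivalentBlack, IsUnivalentBlack, e.black_eq, har]
  refine ⟨{
    v := fun y => e.toEquiv (P.v y)
    t := fun x => P.t (e.toEquiv.symm x)
    lab := lab'
    v_inj := e.toEquiv.injective.comp P.v_inj
    v_range := fun x => ?_
    t_inj := fun x x' h h' hx => ?_
    t_att := fun τ => ?_
    t_black := fun y hy => by rw [Equiv.symm_apply_apply, P.t_black y hy]
    black_iff := fun y => by rw [e.black_eq, har, P.black_iff]
    mark_iff := fun y => by rw [e.black_eq, P.mark_iff]
    att_one := fun y => by
      rw [e.black_eq, har, Equiv.symm_apply_apply]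
      exact P.att_one y
    lab_inl := fun y i' z h => ?_
    lab_inr := fun y i' τ h => ?_
    lab_inj := fun y i j h => ?_
    surj_inl := fun y z h => ?_
    surj_inr := fun y τ hb h => ?_
    mark_eq := fun y c a b h i' => ?_
    out_eq := fun j => by rw [e.out_eq, P.out_eq] }, fun x => by simp⟩
  · obtain ⟨x, rfl⟩ := e.toEquiv.surjective x
    simp only [EmbeddingLike.apply_eq_iff_eq, huniv, P.v_range]
  · obtain ⟨x, rfl⟩ := e.toEquiv.surjective x
    obtain ⟨x', rfl⟩ := e.toEquiv.surjective x'
    rw [e.black_eq] at h h'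
    simp only [Equiv.symm_apply_apply] at hx
    rw [P.t_inj x x' h h' hx]
  · rw [P.t_att]
    constructor
    · rintro ⟨x, h1, h2, h3⟩
      exact ⟨e.toEquiv x, by rwa [e.black_eq], by rwa [har], by rwa [Equiv.symm_apply_apply]⟩
    · rintro ⟨x, h1, h2, h3⟩
      obtain ⟨x, rfl⟩ := e.toEquiv.surjective x
      rw [e.black_eq] at h1
      rw [har] at h2
      rw [Equiv.symm_apply_apply] at h3
      exact ⟨x, h1, h2, h3⟩
  · obtain ⟨i, rfl⟩ := (e.slots _).surjective i'
    rw [hl] at h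
    obtain ⟨h1, h2⟩ := P.lab_inl y i z h
    refine ⟨h1, ?_⟩
    rw [e.inp_eq, h2]
    cases K.src z <;> rfl
  · obtain ⟨i, rfl⟩ := (e.slots _).surjective i'
    rw [hl] at h
    obtain ⟨h1, h2, x, h3, h4, h5⟩ := P.lab_inr y i τ h
    refine ⟨by rw [e.black_eq, h1], h2, e.toEquiv x, (huniv x).mpr h3, ?_, by
      rwa [Equiv.symm_apply_apply]⟩
    rw [e.inp_eq, h4]
    rfl
  · obtain ⟨i, rfl⟩ := (e.slots _).surjective i
    obtain ⟨j, rfl⟩ := (e.slots _).surjective j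
    rw [hl, hl] at h
    rw [P.lab_inj y h]
  · obtain ⟨i, hi⟩ := P.surj_inl y z h
    exact ⟨e.slots _ i, by rw [hl, hi]⟩
  · rw [e.black_eq] at hb
    obtain ⟨i, hi⟩ := P.surj_inr y τ hb h
    exact ⟨e.slots _ i, by rw [hl, hi]⟩
  · obtain ⟨i, rfl⟩ := (e.slots _).surjective i'
    have hw : Γ.black (P.v y) = false := by
      cases hw : Γ.black (P.v y) with
      | false => rfl
      | true =>
        rw [(P.mark_iff y).mpr hw] at h
        cases h
    rw [hl, e.slots_white _ hw, har]
    exact P.mark_eq y c a b h i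

open Classical in
/-- The homotopy on graphs. -/
def hGraph (Γ : Diagram p q) : Space p q :=
  if h : Γ.Proper then (Γ.skelMark h.out_not).hnet else 0

theorem Pres.proper {Γ : Diagram p q} {st : Marking K} (P : Pres Γ K st) (h : Γ.IsAGraph) :
    Γ.Proper := ⟨h, fun j => by rw [P.out_eq]; exact P.not_univ _⟩

theorem Pres.hGraph_eq {Γ : Diagram p q} {st : Marking K} (P : Pres Γ K st) (hst : st.Good)
    (h : Γ.IsAGraph) : hGraph Γ = P.sgn • st.hnet := by
  classical
  have hp := P.proper h
  rw [hGraph, dif_pos hp]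
  have P₀ := skelPres hp.out_not hp
  have hg := skel_good hp.out_not hp
  obtain ⟨e, rfl, he⟩ := Pres.exists_skelIso (skelPres hp.out_not hp) P hg hst h
  have h1 : invSign (Γ.skelMark hp.out_not).labels id e.f = P.sgn := by
    rw [← (skelPres hp.out_not hp).image_blacks hg,
      invSign_image (skelPres hp.out_not hp).t_injOn]
    exact invSign_congr (fun _ _ => rfl) he
  rw [e.map_hnet hg, h1, smul_smul, P.sgn_mul_self, one_smul]

theorem hGraph_iso {Γ Γ' : Diagram p q} (e : Iso Γ Γ') (h : Γ.IsAGraph) (h' : Γ'.IsAGraph) :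
    hGraph Γ' = e.sign • hGraph Γ := by
  classical
  have huniv : ∀ x, Γ'.IsUnivalentBlack (e.toEquiv x) ↔ Γ.IsUnivalentBlack x :=
    fun x => e.toLoose.isUnivalentBlack_iff x
  by_cases hp : Γ.Proper
  · obtain ⟨P', hP'⟩ := (skelPres hp.out_not hp).exists_of_iso e
    have hg := skel_good hp.out_not hp
    rw [P'.hGraph_eq hg h', hGraph, dif_pos hp]
    congr 1
    have hb : Γ'.blacks = Γ.blacks.image e.toEquiv := by
      ext x
      obtain ⟨x, rfl⟩ := e.toEquiv.surjective x
      simp [mem_blacks, e.black_eq]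
    rw [Pres.sgn, hb, invSign_image e.toEquiv.injective.injOn, e.sign_eq]
    refine Eq.trans (invSign_congr (fun _ _ => rfl) fun x _ => hP' x) ?_
    exact invSign_comm (h'.zpos_injective.comp e.toEquiv.injective).injOn h.zpos_injective.injOn
  · have hp' : ¬ Γ'.Proper := fun hh => hp ⟨h, fun j hj => hh.out_not j (by
      rw [e.out_eq]
      exact (huniv _).mpr hj)⟩
    rw [hGraph, hGraph, dif_neg hp, dif_neg hp', smul_zero]

theorem hGraph_permute (Γ : Diagram p q) (v : Γ.V) (c : Equiv.Perm (Fin (Γ.ar v)) →₀ ℝ)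
    (h : Γ.IsAGraph) (hv : Γ.black v = false) (hc : WhiteSymmetry (Γ.ar v) c) :
    (c.sum fun σ t => t • hGraph (Γ.permute v σ)) = 0 := by
  by_cases hp : Γ.Proper
  swap
  · refine Finset.sum_eq_zero fun σ _ => ?_
    have : ¬ (Γ.permute v σ).Proper := fun hh => hp ⟨h, hh.out_not⟩
    dsimp only
    rw [hGraph, dif_neg this, smul_zero]
  let P := skelPres hp.out_not hp
  have hg := skel_good hp.out_not hp
  obtain ⟨y, rfl⟩ := (P.v_range v).mpr fun hu => by rw [hu.1] at hv; cases hv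
  have h3 := h.three_le_ar _ hv
  let st := Γ.skelMark hp.out_not
  let name := P.lab (P.v y)
  let i₁ : Fin (Γ.ar (P.v y)) := ⟨Γ.ar (P.v y) - 3, by omega⟩
  let i₂ : Fin (Γ.ar (P.v y)) := ⟨Γ.ar (P.v y) - 2, by omega⟩
  let i₃ : Fin (Γ.ar (P.v y)) := ⟨Γ.ar (P.v y) - 1, by omega⟩
  have e₁ : (i₁ : ℕ) + 3 = Γ.ar (P.v y) := by simp only [i₁]; omega
  have e₂ : (i₂ : ℕ) + 2 = Γ.ar (P.v y) := by simp only [i₂]; omega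
  have e₃ : (i₃ : ℕ) + 1 = Γ.ar (P.v y) := by simp only [i₃]; omega
  have hat : ∀ i, st.IsAt y (name i) := fun i => by
    cases hi : name i with
    | inl z => exact (P.lab_inl y i z hi).1
    | inr τ => exact (P.lab_inr y i τ hi).2.1
  have hmark : ∃ m, st.mark y = some m := by
    refine Option.ne_none_iff_exists'.mp fun hm => ?_
    have := (P.mark_iff y).mp hm
    rw [hv] at this
    cases this
  obtain ⟨m, hm⟩ := hmark
  have hg' : (st.setMark y (some m)).Good := by
    rw [← hm, Marking.setMark_self]
    exact hg
  have hF : ∀ σ, hGraph (Γ.permute (P.v y) σ) =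
      (st.setMark y (some (name (σ i₁), name (σ i₂), name (σ i₃)))).hnet := by
    intro σ
    have hinj := (P.lab_inj y).comp σ.injective
    have hgσ := hg'.setMark (hat (σ i₁)) (hat (σ i₂)) (hat (σ i₃))
      (fun e => by have := hinj e; rw [this] at e₁; omega)
      (fun e => by have := hinj e; rw [this] at e₁; omega)
      (fun e => by have := hinj e; rw [this] at e₂; omega)
    have key := (P.permute y hv σ (name (σ i₁)) (name (σ i₂)) (name (σ i₃)) fun i =>
      ⟨fun hi => congrArg (fun i => P.lab (P.v y) (σ i)) (Fin.ext (by omega : (i : ℕ) = i₁)),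
        fun hi => congrArg (fun i => P.lab (P.v y) (σ i)) (Fin.ext (by omega : (i : ℕ) = i₂)),
        fun hi => congrArg (fun i => P.lab (P.v y) (σ i)) (Fin.ext (by omega : (i : ℕ) = i₃))⟩).hGraph_eq
      hgσ ((permute_isAGraph Γ _ σ).mpr h)
    rw [key]
    refine (congrArg (· • _) ?_).trans (one_smul ℝ _)
    exact skelPres_sgn hp.out_not hp
  obtain ⟨E, hE⟩ := Marking.exists_hnet_potential st y
  rw [← hE.whiteSymmetry (P.lab_inj y) hat hc i₁ i₂ i₃ e₁ e₂ e₃]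
  exact Finset.sum_congr rfl fun σ _ => by dsimp only; rw [hF]

/-- The homotopy on the space of graphs. -/
def hSpace (p q : ℕ) : Space p q →ₗ[ℝ] Space p q :=
  (relations p q).liftQ (Finsupp.linearCombination ℝ hGraph)
    (relations_le_ker hGraph (fun _ h => dif_neg fun hp => h hp.isAGraph)
      (fun _ _ e h h' => hGraph_iso e h h') hGraph_permute)

theorem hSpace_cls (Γ : Diagram p q) : hSpace p q (cls Γ) = hGraph Γ := by
  change Finsupp.linearCombination ℝ hGraph (Finsupp.single Γ 1) = _
  rw [Finsupp.linearCombination_single, one_smul]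

theorem Marking.Good.hSpace_cls {st : Marking K} (h : st.Good) : hSpace p q st.cls = st.hnet := by
  obtain ⟨Γ, hΓ, ⟨P⟩⟩ := h.exists_pres
  rw [P.cls_eq h hΓ.pos_injective, map_smul, GraphComplex.hSpace_cls, P.hGraph_eq h hΓ, smul_smul,
    P.sgn_mul_self, one_smul]

/-! ### Adding univalent black vertices and changing labels -/

namespace Marking

variable {st : Marking K}

/-- The label `z` is not in use and precedes all labels in use. -/
structure Fresh (st : Marking K) (z : ℤ) : Prop where
  lt_pos : ∀ y, K.black y = true → z < K.pos y
  lt_att : ∀ τ, st.att τ ≠ none → z < τ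
  mark_ne : ∀ y c a b, st.mark y = some (c, a, b) → c ≠ Sum.inr z ∧ a ≠ Sum.inr z ∧ b ≠ Sum.inr z

theorem Fresh.att_eq {z : ℤ} (h : st.Fresh z) : st.att z = none := by
  by_contra hz
  exact lt_irrefl _ (h.lt_att z hz)

theorem Good.exists_fresh (h : st.Good) : ∃ z, st.Fresh z := by
  classical
  obtain ⟨z, hz⟩ := (st.labels : Set ℤ).toFinite.bddBelow
  have h1 : ∀ τ ∈ st.labels, z - 1 < τ := fun τ hτ => by
    have : z ≤ τ := hz hτ
    omega
  have h2 : ∀ τ, st.att τ ≠ none → z - 1 < τ := fun τ hτ => h1 τ (h.mem_labels.mpr (Or.inr hτ))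
  have h3 : ∀ y l, st.IsAt y l → l ≠ Sum.inr (z - 1) := by
    rintro y l hl rfl
    have h4 : st.att (z - 1) = some y := hl
    exact lt_irrefl _ (h2 _ (by simp [h4]))
  exact ⟨z - 1, fun y hy => h1 _ (h.mem_labels.mpr (Or.inl ⟨y, hy, rfl⟩)), h2,
    fun y c a b hm => ⟨h3 y c (h.mark_at y c a b hm).1, h3 y a (h.mark_at y c a b hm).2.1,
      h3 y b (h.mark_at y c a b hm).2.2.1⟩⟩

open Classical in
/-- Attach a univalent black vertex labelled `z` to `y`, with `m` as last three slots of `y`. -/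
def ins (st : Marking K) (y : K.V) (z : ℤ) (m : (K.S ⊕ ℤ) × (K.S ⊕ ℤ) × (K.S ⊕ ℤ)) : Marking K where
  att := Function.update st.att z (some y)
  mark := Function.update st.mark y (some m)

theorem ins_att_self (st : Marking K) (y : K.V) (z : ℤ) (m) :
    (st.ins y z m).att z = some y := by simp [ins]

theorem ins_att_ne (st : Marking K) (y : K.V) {z τ : ℤ} (h : τ ≠ z) (m) :
    (st.ins y z m).att τ = st.att τ := by simp [ins, h]

theorem ins_mark_self (st : Marking K) (y : K.V) (z : ℤ) (m) :
    (st.ins y z m).mark y = some m := by simp [ins]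

theorem ins_mark_ne (st : Marking K) {y y' : K.V} (h : y' ≠ y) (z : ℤ) (m) :
    (st.ins y z m).mark y' = st.mark y' := by simp [ins, h]

/-- The bivalent black vertex `y` has the slot `x` and the label `τ`. -/
def QAt (st : Marking K) (y : K.V) (x : K.S) (τ : ℤ) : Prop :=
  (∀ z', K.tgt z' = y ↔ z' = x) ∧ ∀ τ', st.att τ' = some y ↔ τ' = τ

/-- The term of the differential of a white vertex `y` in which a univalent black vertex is attached
to it, and that of the differential of a bivalent black vertex in which it becomes a white one with
two univalent black vertices attached to it: the last three slots `m` of `y` after this,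
and the coefficient `t`. -/
inductive InsMark (st : Marking K) (y : K.V) (z : ℤ) :
    (K.S ⊕ ℤ) × (K.S ⊕ ℤ) × (K.S ⊕ ℤ) → ℝ → Prop
  | white (m : (K.S ⊕ ℤ) × (K.S ⊕ ℤ) × (K.S ⊕ ℤ)) (h : st.mark y = some m) : InsMark st y z m 1
  | black (x : K.S) (τ : ℤ) (h : st.mark y = none) (hq : st.QAt y x τ) :
      InsMark st y z (Sum.inl x, Sum.inr z, Sum.inr τ) (1 / 2)

theorem InsMark.unique {y : K.V} {z : ℤ} {m m'} {t t' : ℝ} (h : st.InsMark y z m t)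
    (h' : st.InsMark y z m' t') : m = m' ∧ t = t' := by
  cases h with
  | white m h => cases h' with
    | white m' h' =>
      rw [h] at h'
      exact ⟨Option.some_injective _ h', rfl⟩
    | black x τ h' hq => rw [h] at h'; cases h'
  | black x τ h hq => cases h' with
    | white m' h' => rw [h] at h'; cases h'
    | black x' τ' h' hq' =>
      have h1 := (hq.1 x').mp ((hq'.1 x').mpr rfl)
      have h2 := (hq.2 τ').mp ((hq'.2 τ').mpr rfl)
      subst h1 h2
      exact ⟨rfl, rfl⟩

theorem ins_good_iff {y : K.V} {z : ℤ} {m} {t : ℝ} (hf : st.Fresh z) (hy : K.black y = false)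
    (hm : st.InsMark y z m t) : (st.ins y z m).Good ↔ st.Good := by
  have hz := hf.att_eq
  have hatt : ∀ τ y', y' ≠ y → ((st.ins y z m).att τ = some y' ↔ st.att τ = some y') := by
    intro τ y' hy'
    by_cases e : τ = z
    · subst e
      simp [ins_att_self, hz, hy'.symm]
    · rw [ins_att_ne st y e]
  have hat : ∀ y' l, l ≠ Sum.inr z → ((st.ins y z m).IsAt y' l ↔ st.IsAt y' l) := by
    rintro y' (x | τ) hl
    · exact Iff.rfl
    · change (st.ins y z m).att τ = some y' ↔ _
      rw [ins_att_ne st y fun e => hl (by rw [e])]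
      exact Iff.rfl
  have hfin : {τ | (st.ins y z m).att τ ≠ none} = insert z {τ | st.att τ ≠ none} := by
    ext τ
    by_cases e : τ = z
    · simp [e, ins_att_self]
    · simp [e, ins_att_ne st y e]
  have hne : ∀ {y'}, K.black y' = true → y' ≠ y := fun {y'} h e => by
    rw [e, hy] at h
    cases h
  constructor
  · intro h
    refine ⟨h.feed, h.pos_inj, h.finite.subset (by rw [hfin]; exact Set.subset_insert _ _),
      fun y' τ hy' hτ e => (h.pos_ne y' τ hy') (?_) e,
      fun y' hy' => ?_, h.black_slots, fun y' τ hy' hτ => ?_, fun y' hy' hm' => ?_,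
      fun y' hy' hm' => ?_, fun y' c a b hm' => ?_⟩
    · have : τ ≠ z := fun e => hτ (e ▸ hz)
      rwa [ins_att_ne st y this]
    · have := h.black_mark y' hy'
      rwa [ins_mark_ne st (hne hy')] at this
    · exact h.black_att y' τ hy' ((hatt τ y' (hne hy')).mpr hτ)
    · by_cases e : y' = y
      · subst e
        cases hm with
        | white m hm => rw [hm] at hm'; cases hm'
        | black x τ hm hq => exact ⟨x, hq.1⟩
      · exact h.q_slot y' hy' (by rwa [ins_mark_ne st e])
    · by_cases e : y' = y
      · subst e
        cases hm with
        | white m hm => rw [hm] at hm'; cases hm'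
        | black x τ hm hq => exact ⟨τ, hq.2⟩
      · obtain ⟨τ, hτ⟩ := h.q_att y' hy' (by rwa [ins_mark_ne st e])
        exact ⟨τ, fun τ' => (hatt τ' y' e).symm.trans (hτ τ')⟩
    · obtain ⟨n1, n2, n3⟩ := hf.mark_ne y' c a b hm'
      rw [← hat y' c n1, ← hat y' a n2, ← hat y' b n3]
      apply h.mark_at y' c a b
      by_cases e : y' = y
      · subst e
        rw [ins_mark_self]
        cases hm with
        | white m hm => rw [← hm, hm']
        | black x τ hm hq => rw [hm] at hm'; cases hm'
      · rwa [ins_mark_ne st e]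
  · intro h
    refine ⟨h.feed, h.pos_inj, by rw [hfin]; exact h.finite.insert z, fun y' τ hy' hτ e => ?_,
      fun y' hy' => ?_, h.black_slots, fun y' τ hy' hτ => ?_, fun y' hy' hm' => ?_,
      fun y' hy' hm' => ?_, fun y' c a b hm' => ?_⟩
    · by_cases e' : τ = z
      · have := hf.lt_pos y' hy'
        omega
      · rw [ins_att_ne st y e'] at hτ
        exact h.pos_ne y' τ hy' hτ e
    · rw [ins_mark_ne st (hne hy')]
      exact h.black_mark y' hy'
    · exact h.black_att y' τ hy' ((hatt τ y' (hne hy')).mp hτ)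
    · have e : y' ≠ y := fun e => by
        rw [e, ins_mark_self] at hm'
        cases hm'
      rw [ins_mark_ne st e] at hm'
      exact h.q_slot y' hy' hm'
    · have e : y' ≠ y := fun e => by
        rw [e, ins_mark_self] at hm'
        cases hm'
      rw [ins_mark_ne st e] at hm'
      obtain ⟨τ, hτ⟩ := h.q_att y' hy' hm'
      exact ⟨τ, fun τ' => (hatt τ' y' e).trans (hτ τ')⟩
    · by_cases e : y' = y
      · subst e
        rw [ins_mark_self] at hm'
        have hm'' := Option.some_injective _ hm'
        subst hm''
        cases hm with
        | white m hm =>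
          obtain ⟨n1, n2, n3⟩ := hf.mark_ne y' c a b hm
          rw [hat y' c n1, hat y' a n2, hat y' b n3]
          exact h.mark_at y' c a b hm
        | black x τ hm hq =>
          have hτ := (hq.2 τ).mpr rfl
          have hzτ : z ≠ τ := fun e => by rw [← e, hz] at hτ; cases hτ
          refine ⟨(hq.1 x).mpr rfl, ins_att_self _ _ _ _, ?_, by simp, by simp, by simpa using hzτ⟩
          exact (ins_att_ne st y' hzτ.symm _).trans hτ
      · rw [ins_mark_ne st e] at hm'
        obtain ⟨n1, n2, n3⟩ := hf.mark_ne y' c a b hm'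
        rw [hat y' c n1, hat y' a n2, hat y' b n3]
        exact h.mark_at y' c a b hm'

theorem ins_active (hfin : {τ | st.att τ ≠ none}.Finite) (y : K.V) (z : ℤ) (m) :
    (st.ins y z m).active = insert z st.active := by
  have hset : {τ | (st.ins y z m).att τ ≠ none} = insert z {τ | st.att τ ≠ none} := by
    ext τ
    by_cases e : τ = z
    · simp [e, ins_att_self]
    · simp [e, ins_att_ne st y e]
  have hfin' : {τ | (st.ins y z m).att τ ≠ none}.Finite := by
    rw [hset]
    exact hfin.insert z
  ext τ
  rw [active, dif_pos hfin', active, dif_pos hfin]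
  simp only [Set.Finite.mem_toFinset, Finset.mem_insert]
  rw [hset]
  rfl

theorem ins_labels (hfin : {τ | st.att τ ≠ none}.Finite) (y : K.V) (z : ℤ) (m) :
    (st.ins y z m).labels = insert z st.labels := by
  classical
  rw [labels, labels, ins_active hfin, Finset.union_insert]

theorem Fresh.lt_labels {z : ℤ} (hf : st.Fresh z) (h : st.Good) {τ : ℤ} (hτ : τ ∈ st.labels) :
    z < τ := by
  rcases h.mem_labels.mp hτ with ⟨y, hy, rfl⟩ | h1
  · exact hf.lt_pos y hy
  · exact hf.lt_att τ h1

theorem Fresh.hnet_ins {z : ℤ} {y : K.V} {m} (hf : st.Fresh z) (h : st.Good) :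
    (st.ins y z m).hnet = (st.ins y z m).hat z -
      ∑ τ ∈ st.active, toFront st.labels id τ • (st.ins y z m).hat τ := by
  classical
  have hzL : z ∉ st.labels := fun hz => lt_irrefl _ (hf.lt_labels h hz)
  have hza : z ∉ st.active := fun hz => by
    have := h.mem_active.mp hz
    exact this hf.att_eq
  rw [hnet, ins_active h.finite, ins_labels h.finite, Finset.sum_insert hza, sub_eq_add_neg,
    ← Finset.sum_neg_distrib]
  congr 1
  · rw [toFront, Finset.prod_eq_one, one_smul]
    intro τ hτ
    rcases Finset.mem_insert.mp hτ with rfl | hτ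
    · simp
    · simp only [id, if_neg (not_lt.mpr (hf.lt_labels h hτ).le)]
  · refine Finset.sum_congr rfl fun τ hτ => ?_
    have := hf.lt_labels h (h.mem_labels.mpr (Or.inr (h.mem_active.mp hτ)))
    rw [← neg_smul]
    congr 1
    rw [toFront, Finset.prod_insert hzL, id, id, if_pos this, neg_one_mul]
    rfl

end Marking

theorem invSign_fresh {L : Finset ℤ} {τ z : ℤ} (hτ : τ ∈ L) (hz : ∀ x ∈ L, z < x) :
    invSign L id (Equiv.swap τ z) = toFront L id τ := by
  classical
  have hne : ∀ x ∈ L.erase τ, Equiv.swap τ z x = x := fun x hx =>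
    Equiv.swap_apply_of_ne_of_ne (Finset.mem_erase.mp hx).1
      (fun e => by have := hz x (Finset.mem_erase.mp hx).2; omega)
  rw [invSign_erase hτ Function.injective_id.injOn (Equiv.swap τ z).injective.injOn, toFront_erase,
    invSign_congr (f' := id) (g' := id) (fun _ _ => rfl) hne, invSign_self, mul_one]
  have : toFront (L.erase τ) (Equiv.swap τ z) τ = 1 := by
    refine Finset.prod_eq_one fun x hx => if_neg ?_
    rw [hne x hx, Equiv.swap_apply_left]
    have := hz x (Finset.mem_erase.mp hx).2
    omega
  rw [this, mul_one]

theorem invSign_swap {L : Finset ℤ} {τ τ' : ℤ} (hτ : τ ∈ L) (hτ' : τ' ∈ L) (h : τ ≠ τ') :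
    invSign L id (Equiv.swap τ τ') = -1 := by
  classical
  have inj : ∀ s : Finset ℤ, Set.InjOn (Equiv.swap τ τ') s := fun s =>
    (Equiv.swap τ τ').injective.injOn
  have hmem : τ' ∈ L.erase τ := Finset.mem_erase.mpr ⟨h.symm, hτ'⟩
  have hne : ∀ x ∈ (L.erase τ).erase τ', Equiv.swap τ τ' x = x := fun x hx => by
    obtain ⟨h1, h2⟩ := Finset.mem_erase.mp hx
    exact Equiv.swap_apply_of_ne_of_ne (Finset.mem_erase.mp h2).1 h1
  have hL : L.erase τ = insert τ' ((L.erase τ).erase τ') := (Finset.insert_erase hmem).symm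
  have hn : τ' ∉ (L.erase τ).erase τ' := Finset.notMem_erase _ _
  rw [invSign_erase hτ Function.injective_id.injOn (inj _),
    invSign_erase hmem Function.injective_id.injOn (inj _),
    invSign_congr (f' := id) (g' := id) (fun _ _ => rfl) hne, invSign_self, mul_one]
  have h1 : toFront (L.erase τ) (Equiv.swap τ τ') τ =
      (if τ < τ' then -1 else 1) * toFront ((L.erase τ).erase τ') id τ' := by
    conv_lhs => rw [hL]
    rw [toFront, Finset.prod_insert hn, Equiv.swap_apply_right, Equiv.swap_apply_left]
    congr 1
    exact Finset.prod_congr rfl fun x hx => by rw [hne x hx]; rfl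
  have h2 : toFront (L.erase τ) id τ =
      (if τ' < τ then -1 else 1) * toFront ((L.erase τ).erase τ') id τ := by
    conv_lhs => rw [hL]
    rw [toFront, Finset.prod_insert hn]
    rfl
  have h3 : toFront ((L.erase τ).erase τ') (Equiv.swap τ τ') τ' =
      toFront ((L.erase τ).erase τ') id τ := by
    rw [toFront, Equiv.swap_apply_right]
    exact Finset.prod_congr rfl fun x hx => by rw [hne x hx]; rfl
  rw [h1, h2, h3]
  have e1 := toFront_mul_self ((L.erase τ).erase τ') id τ
  have e2 := toFront_mul_self ((L.erase τ).erase τ') id τ'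
  have e3 : (if τ < τ' then (-1 : ℝ) else 1) * (if τ' < τ then (-1 : ℝ) else 1) = -1 := by
    rcases lt_or_gt_of_ne h with h' | h'
    · simp [h', not_lt.mpr h'.le]
    · simp [h', not_lt.mpr h'.le]
  generalize toFront ((L.erase τ).erase τ') id τ = A at *
  generalize toFront ((L.erase τ).erase τ') id τ' = B at *
  generalize (if τ < τ' then (-1 : ℝ) else 1) = X at *
  generalize (if τ' < τ then (-1 : ℝ) else 1) = Y at *
  linear_combination X * Y * B * B * e1 + X * Y * e2 + e3

namespace Marking

variable {st : Marking K}

/-- Exchange of two labels in the names of slots. -/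
def swapName (τ τ' : ℤ) : K.S ⊕ ℤ → K.S ⊕ ℤ := Sum.map id (Equiv.swap τ τ')

theorem swapName_of_ne {τ τ' : ℤ} {l : K.S ⊕ ℤ} (h : l ≠ Sum.inr τ) (h' : l ≠ Sum.inr τ') :
    swapName τ τ' l = l := by
  rcases l with z | x
  · rfl
  · exact congrArg Sum.inr (Equiv.swap_apply_of_ne_of_ne (fun e => h (by rw [e]))
      (fun e => h' (by rw [e])))

theorem isAt_unique {y y' : K.V} {l : K.S ⊕ ℤ} (h : st.IsAt y l) (h' : st.IsAt y' l) : y = y' := by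
  rcases l with z | τ
  · exact (show K.tgt z = y from h).symm.trans h'
  · exact Option.some_injective _ ((show st.att τ = some y from h).symm.trans h')

/-- Exchanging two labels at the same vertex reverses the orientation. -/
theorem Good.cls_swap (h : st.Good) {y : K.V} {τ τ' : ℤ} (hτ : st.att τ = some y)
    (hτ' : st.att τ' = some y) (hne : τ ≠ τ') {c a b : K.S ⊕ ℤ} (hm : st.mark y = some (c, a, b)) :
    (st.setMark y (some (swapName τ τ' c, swapName τ τ' a, swapName τ τ' b))).cls = -st.cls := by
  classical
  have hpos : ∀ y', K.black y' = true → Equiv.swap τ τ' (K.pos y') = K.pos y' := fun y' hy' =>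
    Equiv.swap_apply_of_ne_of_ne (h.pos_ne y' τ hy' (by simp [hτ])).symm
      (h.pos_ne y' τ' hy' (by simp [hτ'])).symm
  let e := relabelIso K (Equiv.swap τ τ') hpos
  have hmap : e.map st = st.setMark y (some (swapName τ τ' c, swapName τ τ' a, swapName τ τ' b)) := by
    ext1
    · funext x
      change (st.att ((Equiv.swap τ τ').symm x)).map _ = st.att x
      rw [Equiv.symm_swap]
      by_cases h1 : x = τ
      · rw [h1, Equiv.swap_apply_left, hτ, hτ']
        rfl
      by_cases h2 : x = τ'
      · rw [h2, Equiv.swap_apply_right, hτ, hτ']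
        rfl
      rw [Equiv.swap_apply_of_ne_of_ne h1 h2]
      cases st.att x <;> rfl
    · funext y'
      change (st.mark y').map _ = _
      by_cases hy : y' = y
      · rw [hy, setMark_mark_self, hm]
        rfl
      · rw [setMark_mark_ne _ hy]
        cases hm' : st.mark y' with
        | none => rfl
        | some m =>
          obtain ⟨c', a', b'⟩ := m
          obtain ⟨h1, h2, h3, -⟩ := h.mark_at y' c' a' b' hm'
          have key : ∀ l, st.IsAt y' l → e.slot l = l := fun l hl =>
            swapName_of_ne (fun e => hy (isAt_unique (l := Sum.inr τ) (e ▸ hl) hτ))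
              (fun e => hy (isAt_unique (l := Sum.inr τ') (e ▸ hl) hτ'))
          rw [Option.map_some, key c' h1, key a' h2, key b' h3]
  have h1 := e.map_cls (st := st)
  have h2 : invSign st.labels id e.f = -1 := invSign_swap (h.mem_labels.mpr (Or.inr (by simp [hτ])))
    (h.mem_labels.mpr (Or.inr (by simp [hτ']))) hne
  rw [← hmap, h1, h2, neg_one_smul]

/-- Giving a univalent or bivalent black vertex a label that precedes all others. -/
theorem Good.cls_relabel (h : st.Good) {y : K.V} {τ z : ℤ} (hτ : st.att τ = some y)
    (hf : st.Fresh z) {st' : Marking K} (hz' : st'.att z = some y) (hτ' : st'.att τ = none)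
    (hatt : ∀ x, x ≠ τ → x ≠ z → st'.att x = st.att x) (hmark : ∀ y', y' ≠ y → st'.mark y' = st.mark y')
    (hy : st'.mark y = (st.mark y).map fun m => (swapName τ z m.1, swapName τ z m.2.1,
      swapName τ z m.2.2)) :
    st'.cls = toFront st.labels id τ • st.cls := by
  classical
  have hz := hf.att_eq
  have hpos : ∀ y', K.black y' = true → Equiv.swap τ z (K.pos y') = K.pos y' := fun y' hy' =>
    Equiv.swap_apply_of_ne_of_ne (h.pos_ne y' τ hy' (by simp [hτ])).symm
      (hf.lt_pos y' hy').ne'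
  let e := relabelIso K (Equiv.swap τ z) hpos
  have hmap : e.map st = st' := by
    ext1
    · funext x
      change (st.att ((Equiv.swap τ z).symm x)).map _ = st'.att x
      rw [Equiv.symm_swap]
      by_cases h1 : x = τ
      · rw [h1, Equiv.swap_apply_left, hτ', hz]
        rfl
      by_cases h2 : x = z
      · rw [h2, Equiv.swap_apply_right, hτ, hz']
        rfl
      rw [Equiv.swap_apply_of_ne_of_ne h1 h2, hatt x h1 h2]
      cases st.att x <;> rfl
    · funext y'
      change (st.mark y').map _ = _
      by_cases hyy : y' = y
      · rw [hyy, hy]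
        rfl
      · rw [hmark y' hyy]
        cases hm' : st.mark y' with
        | none => rfl
        | some m =>
          obtain ⟨c', a', b'⟩ := m
          obtain ⟨h1, h2, h3, -⟩ := h.mark_at y' c' a' b' hm'
          obtain ⟨n1, n2, n3⟩ := hf.mark_ne y' c' a' b' hm'
          have key : ∀ l, st.IsAt y' l → l ≠ Sum.inr z → e.slot l = l := fun l hl hn =>
            swapName_of_ne (fun e => hyy (isAt_unique (l := Sum.inr τ) (e ▸ hl) hτ)) hn
          rw [Option.map_some, key c' h1 n1, key a' h2 n2, key b' h3 n3]
  have h1 := e.map_cls (st := st)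
  have h2 : invSign st.labels id e.f = toFront st.labels id τ :=
    invSign_fresh (h.mem_labels.mpr (Or.inr (by simp [hτ]))) fun x hx => hf.lt_labels h hx
  rw [← hmap, h1, h2]

/-- A graph with three univalent black vertices attached to the same white one is zero. -/
theorem cls_eq_zero_of_three {y : K.V} {τ₁ τ₂ τ₃ : ℤ} (h₁ : st.att τ₁ = some y)
    (h₂ : st.att τ₂ = some y) (h₃ : st.att τ₃ = some y) (h12 : τ₁ ≠ τ₂) (h13 : τ₁ ≠ τ₃)
    (h23 : τ₂ ≠ τ₃) {m} (hm : st.mark y = some m) : st.cls = 0 := by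
  by_cases hg : st.Good
  swap
  · exact cls_of_not_good hg
  obtain ⟨E, hE⟩ := exists_setMark_potential st y
  have hgm : (st.setMark y (some m)).Good := by
    rw [← hm, setMark_self]
    exact hg
  -- for each exchange of labels, `E` plus its image is constant
  have key : ∀ τ τ', st.att τ = some y → st.att τ' = some y → τ ≠ τ' → ∀ c a b, st.IsAt y c →
      st.IsAt y a → st.IsAt y b → c ≠ a → c ≠ b → a ≠ b →
      E (swapName τ τ' b) (swapName τ τ' c) + E b c =
        E (swapName τ τ' a) (swapName τ τ' c) + E a c := by
    intro τ τ' hτ hτ' hne c a b hc ha hb hca hcb hab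
    have h1 := (hgm.setMark hc ha hb hca hcb hab).cls_swap (τ := τ) (τ' := τ') hτ hτ' hne
      (setMark_mark_self st y _)
    rw [setMark_setMark] at h1
    have hinj : Function.Injective (swapName (K := K) τ τ') :=
      Sum.map_injective.mpr ⟨Function.injective_id, (Equiv.swap τ τ').injective⟩
    have hat : ∀ l, st.IsAt y l → st.IsAt y (swapName τ τ' l) := by
      rintro (z | x) hl
      · exact hl
      · change st.att (Equiv.swap τ τ' x) = some y
        rw [Equiv.swap_apply_def]
        split_ifs
        exacts [hτ', hτ, hl]
    have e1 := hE.eq c hc a ha b hb hca hcb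
    have e2 := hE.eq _ (hat c hc) _ (hat a ha) _ (hat b hb) (hinj.ne hca) (hinj.ne hcb)
    rw [h1, e1] at e2
    linear_combination (norm := module) -(1 : ℝ) • e2
  have n12 : (Sum.inr τ₁ : K.S ⊕ ℤ) ≠ Sum.inr τ₂ := by simpa using h12
  have n13 : (Sum.inr τ₁ : K.S ⊕ ℤ) ≠ Sum.inr τ₃ := by simpa using h13
  have n23 : (Sum.inr τ₂ : K.S ⊕ ℤ) ≠ Sum.inr τ₃ := by simpa using h23
  have sl : ∀ τ τ' : ℤ, swapName (K := K) τ τ' (Sum.inr τ) = Sum.inr τ' := fun τ τ' =>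
    congrArg Sum.inr (Equiv.swap_apply_left τ τ')
  have sr : ∀ τ τ' : ℤ, swapName (K := K) τ τ' (Sum.inr τ') = Sum.inr τ := fun τ τ' =>
    congrArg Sum.inr (Equiv.swap_apply_right τ τ')
  have hs : ∀ i j, st.IsAt y i → st.IsAt y j → E i j = E j i := fun i j hi hj => hE.symm i hi j hj
  have i₁ : st.IsAt y (Sum.inr τ₁) := h₁
  have i₂ : st.IsAt y (Sum.inr τ₂) := h₂
  have i₃ : st.IsAt y (Sum.inr τ₃) := h₃
  have a1 := key τ₁ τ₂ h₁ h₂ h12 _ _ _ i₁ i₂ i₃ n12 n13 n23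
  have a2 := key τ₁ τ₃ h₁ h₃ h13 _ _ _ i₁ i₃ i₂ n13 n12 n23.symm
  rw [sl, sr, swapName_of_ne n13.symm n23.symm, hs _ _ i₁ i₂, hs _ _ i₃ i₂, hs _ _ i₃ i₁] at a1
  rw [sl, sr, swapName_of_ne n12.symm n23, hs _ _ i₂ i₁, hs _ _ i₃ i₁] at a2
  have a3 : E (Sum.inr τ₁) (Sum.inr τ₂) = E (Sum.inr τ₁) (Sum.inr τ₃) := by
    rw [hs _ _ i₂ i₁] at a1
    linear_combination (norm := module) (1 / 3 : ℝ) • a2 - (1 / 3 : ℝ) • a1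
  have a4 : E (Sum.inr τ₂) (Sum.inr τ₃) = E (Sum.inr τ₁) (Sum.inr τ₂) := by
    rw [hs _ _ i₂ i₁, ← a3] at a1
    linear_combination (norm := module) a1
  set ε := E (Sum.inr τ₁) (Sum.inr τ₂) with hε
  -- hence `E` is constant
  have b1 : ∀ l, st.IsAt y l → l ≠ Sum.inr τ₁ → l ≠ Sum.inr τ₂ → l ≠ Sum.inr τ₃ →
      E (Sum.inr τ₁) l = ε ∧ E (Sum.inr τ₂) l = ε ∧ E (Sum.inr τ₃) l = ε := by
    intro l hl n1 n2 n3
    have c1 := key τ₁ τ₂ h₁ h₂ h12 _ _ _ i₁ hl i₂ n1.symm n12 n2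
    have c2 := key τ₁ τ₃ h₁ h₃ h13 _ _ _ i₁ hl i₃ n1.symm n13 n3
    have c3 := key τ₂ τ₃ h₂ h₃ h23 _ _ _ i₂ hl i₃ n2.symm n23 n3
    rw [sl, sr, swapName_of_ne n1 n2, hs _ _ i₂ i₁, hs _ _ hl i₂, hs _ _ hl i₁, ← hε] at c1
    rw [sl, sr, swapName_of_ne n1 n3, hs _ _ i₃ i₁, hs _ _ hl i₃, hs _ _ hl i₁, ← a3] at c2
    rw [sl, sr, swapName_of_ne n2 n3, hs _ _ i₃ i₂, hs _ _ hl i₃, hs _ _ hl i₂, a4] at c3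
    refine ⟨?_, ?_, ?_⟩
    · linear_combination (norm := module) -(1 / 2 : ℝ) • c1 - (1 / 2 : ℝ) • c2 + (1 / 2 : ℝ) • c3
    · linear_combination (norm := module) -(1 / 2 : ℝ) • c1 + (1 / 2 : ℝ) • c2 - (1 / 2 : ℝ) • c3
    · linear_combination (norm := module) (1 / 2 : ℝ) • c1 - (1 / 2 : ℝ) • c2 - (1 / 2 : ℝ) • c3
  have b2 : ∀ i j, st.IsAt y i → st.IsAt y j → i ≠ j → E i j = ε := by
    have b3 : ∀ j, st.IsAt y j → (Sum.inr τ₁ ≠ j → E (Sum.inr τ₁) j = ε) ∧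
        (Sum.inr τ₂ ≠ j → E (Sum.inr τ₂) j = ε) ∧ (Sum.inr τ₃ ≠ j → E (Sum.inr τ₃) j = ε) := by
      intro j hj
      by_cases n1 : j = Sum.inr τ₁
      · subst n1
        exact ⟨fun h => absurd rfl h, fun _ => hs _ _ i₂ i₁, fun _ => by rw [hs _ _ i₃ i₁, ← a3]⟩
      by_cases n2 : j = Sum.inr τ₂
      · subst n2
        exact ⟨fun _ => hε.symm, fun h => absurd rfl h, fun _ => by rw [hs _ _ i₃ i₂, a4]⟩
      by_cases n3 : j = Sum.inr τ₃
      · subst n3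
        exact ⟨fun _ => a3.symm, fun _ => a4, fun h => absurd rfl h⟩
      · obtain ⟨c1, c2, c3⟩ := b1 j hj n1 n2 n3
        exact ⟨fun _ => c1, fun _ => c2, fun _ => c3⟩
    intro i j hi hj hij
    by_cases n1 : i = Sum.inr τ₁
    · subst n1
      exact (b3 j hj).1 hij
    by_cases n1' : j = Sum.inr τ₁
    · subst n1'
      rw [hs _ _ hi hj]
      exact (b3 i hi).1 hij.symm
    by_cases n2 : i = Sum.inr τ₂
    · subst n2
      exact (b3 j hj).2.1 hij
    by_cases n2' : j = Sum.inr τ₂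
    · subst n2'
      rw [hs _ _ hi hj]
      exact (b3 i hi).2.1 hij.symm
    · have c1 := key τ₁ τ₂ h₁ h₂ h12 _ _ _ hj i₁ hi n1' hij.symm (Ne.symm n1)
      rw [sl, swapName_of_ne n1 n2, swapName_of_ne n1' n2', (b3 j hj).1 (Ne.symm n1'),
        (b3 j hj).2.1 (Ne.symm n2')] at c1
      linear_combination (norm := module) (1 / 2 : ℝ) • c1
  obtain ⟨c, a, b⟩ := m
  obtain ⟨hc, ha, hb, hca, hcb, hab⟩ := hg.mark_at y c a b hm
  have h1 := hE.eq c hc a ha b hb hca hcb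
  rw [← hm, setMark_self, b2 b c hb hc hcb.symm, b2 a c ha hc hca.symm, sub_self] at h1
  exact h1

end Marking

/-! ### The homotopy formula for markings -/

section Linear

variable {X M N : Type*} [AddCommGroup M] [Module ℝ M] [AddCommGroup N] [Module ℝ N]

theorem map_extendBy (F : M →ₗ[ℝ] N) (J : Finset X) (u : X) (D : X → X → X → M) (c a b : X) :
    F (extendBy J u D c a b) = extendBy J u (fun c a b => F (D c a b)) c a b := by
  classical
  simp only [extendBy, avg, apply_ite F, map_zero, map_smul, map_sum, map_neg, map_sub]

theorem extendBy_mem {J : Finset X} {u : X} {D : X → X → X → M} {L : Set X} (W : Submodule ℝ M)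
    (hJ : ∀ j ∈ J, j ∈ L) (hD : ∀ c ∈ L, ∀ a ∈ L, ∀ b ∈ L, D c a b ∈ W) {c a b : X} (hc : c ∈ L)
    (ha : a ∈ L) (hb : b ∈ L) : extendBy J u D c a b ∈ W := by
  classical
  have havg : ∀ i k l, k ∈ L → l ∈ L → avg (J.erase i) (fun j => D k l j) ∈ W := fun i k l hk hl =>
    W.smul_mem _ (W.sum_mem fun j hj => hD k hk l hl j (hJ j (Finset.mem_erase.mp hj).2))
  rw [extendBy]
  split_ifs
  · exact W.zero_mem
  · exact havg _ _ _ hc ha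
  · exact W.neg_mem (havg _ _ _ hc hb)
  · exact W.sub_mem (havg _ _ _ hb ha) (havg _ _ _ ha hb)
  · exact hD c hc a ha b hb

namespace Marking

theorem map_hatWith (F : M →ₗ[ℝ] N) (st : Marking K) (Φ : Marking K → M) (τ : ℤ) :
    F (st.hatWith Φ τ) = st.hatWith (fun st => F (Φ st)) τ := by
  cases hτ : st.att τ with
  | none => rw [hatWith_of_none hτ, hatWith_of_none hτ, map_zero]
  | some y =>
    cases hm : st.mark y with
    | none => rw [hatWith_of_mark_none hτ hm, hatWith_of_mark_none hτ hm, map_zero]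
    | some m =>
      obtain ⟨c, a, b⟩ := m
      rw [hatWith_of_some hτ hm, hatWith_of_some hτ hm, hatAt, hatAt, apply_ite F, map_extendBy,
        map_smul]

theorem hatWith_sum {ι : Type*} [Fintype ι] (st : Marking K) (Φ : ι → Marking K → M) (τ : ℤ) :
    st.hatWith (fun st => ∑ i, Φ i st) τ = ∑ i, st.hatWith (Φ i) τ := by
  have h1 := map_hatWith (∑ i, LinearMap.proj i : (ι → M) →ₗ[ℝ] M) st (fun st i => Φ i st) τ
  have h2 := fun i => map_hatWith (LinearMap.proj i : (ι → M) →ₗ[ℝ] M) st (fun st i => Φ i st) τ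
  simp only [LinearMap.coe_sum, Finset.sum_apply, LinearMap.coe_proj, Function.eval] at h1 h2
  rw [← h1]
  exact Finset.sum_congr rfl fun i _ => h2 i

theorem hatWith_sub (st : Marking K) (Φ Φ' : Marking K → M) (τ : ℤ) :
    st.hatWith (fun st => Φ st - Φ' st) τ = st.hatWith Φ τ - st.hatWith Φ' τ := by
  have h1 := map_hatWith (LinearMap.fst ℝ M M - LinearMap.snd ℝ M M) st (fun st => (Φ st, Φ' st)) τ
  have h2 := map_hatWith (LinearMap.fst ℝ M M) st (fun st => (Φ st, Φ' st)) τ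
  have h3 := map_hatWith (LinearMap.snd ℝ M M) st (fun st => (Φ st, Φ' st)) τ
  simp only [LinearMap.sub_apply, LinearMap.fst_apply, LinearMap.snd_apply] at h1 h2 h3
  rw [← h1, h2, h3]

theorem hatWith_mem {st : Marking K} {Φ : Marking K → M} {τ z : ℤ} (W : Submodule ℝ M)
    (hf : st.Fresh z)
    (hΦ : ∀ y m, st.att τ = some y → ((st.del τ).setMark y m).Fresh z →
      Φ ((st.del τ).setMark y m) ∈ W) : st.hatWith Φ τ ∈ W := by
  cases hτ : st.att τ with
  | none =>
    rw [hatWith_of_none hτ]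
    exact W.zero_mem
  | some y =>
    cases hm : st.mark y with
    | none =>
      rw [hatWith_of_mark_none hτ hm]
      exact W.zero_mem
    | some m =>
      obtain ⟨c, a, b⟩ := m
      have hfr : ∀ m' : Option ((K.S ⊕ ℤ) × (K.S ⊕ ℤ) × (K.S ⊕ ℤ)),
          (∀ c a b, m' = some (c, a, b) → c ≠ Sum.inr z ∧ a ≠ Sum.inr z ∧ b ≠ Sum.inr z) →
          ((st.del τ).setMark y m').Fresh z := by
        intro m' hm'
        refine ⟨hf.lt_pos, fun τ' hτ' => hf.lt_att τ' ?_, fun y' c' a' b' h' => ?_⟩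
        · by_cases e : τ' = τ
          · subst e
            exact absurd (del_att_self st τ') hτ'
          · exact (del_att_ne st e) ▸ hτ'
        · by_cases e : y' = y
          · subst e
            rw [setMark_mark_self] at h'
            exact hm' c' a' b' h'
          · rw [setMark_mark_ne _ e] at h'
            exact hf.mark_ne y' c' a' b' h'
      rw [hatWith_of_some hτ hm, hatAt]
      by_cases h2 : 2 ≤ (K.slotsAt y).card
      · rw [if_pos h2]
        obtain ⟨n1, n2, n3⟩ := hf.mark_ne y c a b hm
        refine extendBy_mem (L := {l | l ≠ Sum.inr z}) W (fun j hj => ?_)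
          (fun c' hc a' ha b' hb => hΦ y _ hτ (hfr _ fun c a b h => ?_)) n1 n2 n3
        · obtain ⟨x, -, rfl⟩ := Finset.mem_map.mp hj
          simp
        · simp only [Option.some.injEq, Prod.mk.injEq] at h
          obtain ⟨rfl, rfl, rfl⟩ := h
          exact ⟨hc, ha, hb⟩
      · rw [if_neg h2]
        exact W.smul_mem _ (hΦ y none hτ (hfr _ fun c a b h => by cases h))

theorem hatAt_congr {st st' : Marking K} {Φ Φ' : Marking K → M} {t : ℝ} {τ : ℤ} {y : K.V}
    (h2 : 2 ≤ (K.slotsAt y).card → ∀ m, Φ ((st.del τ).setMark y (some m)) =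
      t • Φ' ((st'.del τ).setMark y (some m)))
    (h1 : ¬ 2 ≤ (K.slotsAt y).card → Φ ((st.del τ).setMark y none) =
      t • Φ' ((st'.del τ).setMark y none)) (c a b : K.S ⊕ ℤ) :
    st.hatAt Φ τ y c a b = t • st'.hatAt Φ' τ y c a b := by
  rw [hatAt, hatAt]
  by_cases h : 2 ≤ (K.slotsAt y).card
  · rw [if_pos h, if_pos h]
    have := map_extendBy (LinearMap.lsmul ℝ M t) (K.base y) (Sum.inr τ : K.S ⊕ ℤ)
      (fun c a b => Φ' ((st'.del τ).setMark y (some (c, a, b)))) c a b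
    simp only [LinearMap.lsmul_apply] at this
    rw [this]
    simp only [h2 h]
  · rw [if_neg h, if_neg h, h1 h, smul_comm]

end Marking

end Linear

namespace Marking

open Classical in
/-- The terms of the differential that preserve the skeleton, at the vertex `y`. -/
def dAt (z : ℤ) (y : K.V) (st : Marking K) : Space p q :=
  if h : K.black y = false ∧ ∃ m t, st.InsMark y z m t then
    h.2.choose_spec.choose • (st.ins y z h.2.choose).cls else 0

/-- The terms of the differential that preserve the skeleton. -/
def dnet (z : ℤ) (st : Marking K) : Space p q := ∑ y, st.dAt z y

variable {st : Marking K} {z : ℤ} {y : K.V}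

theorem dAt_eq (hy : K.black y = false) {m t} (hm : st.InsMark y z m t) :
    st.dAt z y = t • (st.ins y z m).cls := by
  have h : K.black y = false ∧ ∃ m t, st.InsMark y z m t := ⟨hy, m, t, hm⟩
  rw [dAt, dif_pos h]
  obtain ⟨h1, h2⟩ := hm.unique h.2.choose_spec.choose_spec
  rw [← h2, ← h1]

theorem dAt_of_black (hy : K.black y = true) : st.dAt z y = 0 :=
  dif_neg fun h => by rw [hy] at h; cases h.1

theorem dAt_of_not (h : ¬ ∃ m t, st.InsMark y z m t) : st.dAt z y = 0 :=
  dif_neg fun h' => h h'.2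

theorem dAt_of_not_good (hf : st.Fresh z) (h : ¬ st.Good) : st.dAt z y = 0 := by
  cases hy : K.black y with
  | true => exact dAt_of_black hy
  | false =>
    by_cases hm : ∃ m t, st.InsMark y z m t
    · obtain ⟨m, t, hm⟩ := hm
      rw [dAt_eq hy hm, cls_of_not_good ((ins_good_iff hf hy hm).not.mpr h), smul_zero]
    · exact dAt_of_not hm

theorem Good.exists_insMark (h : st.Good) (hy : K.black y = false) (z : ℤ) :
    ∃ m t, st.InsMark y z m t := by
  cases hm : st.mark y with
  | some m => exact ⟨m, 1, InsMark.white m hm⟩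
  | none =>
    obtain ⟨x, hx⟩ := h.q_slot y hy hm
    obtain ⟨τ, hτ⟩ := h.q_att y hy hm
    exact ⟨_, _, InsMark.black x τ hm ⟨hx, hτ⟩⟩

open Classical in
/-- The parts of the homotopy at other vertices commute with the differential at `y`. -/
theorem hatWith_dAt_of_ne (hf : st.Fresh z) (hy : K.black y = false) {m t}
    (hm : st.InsMark y z m t) {τ : ℤ} {y' : K.V} (hτ : st.att τ = some y') (hne : y' ≠ y) :
    st.hatWith (dAt z y) τ = t • (st.ins y z m).hat τ := by
  have hτz : τ ≠ z := fun e => by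
    rw [e, hf.att_eq] at hτ
    cases hτ
  have hτ' : (st.ins y z m).att τ = some y' := by rw [ins_att_ne st y hτz, hτ]
  cases hm' : st.mark y' with
  | none =>
    rw [hatWith_of_mark_none hτ hm', hat_of_mark_none hτ' (by rw [ins_mark_ne st hne, hm']), smul_zero]
  | some m' =>
    obtain ⟨c, a, b⟩ := m'
    rw [hatWith_of_some hτ hm', hat_of_some hτ' (by rw [ins_mark_ne st hne, hm'])]
    have key : ∀ m', dAt z y ((st.del τ).setMark y' m') =
        t • (((st.ins y z m).del τ).setMark y' m').cls := by
      intro m'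
      have hins : ((st.del τ).setMark y' m').ins y z m = ((st.ins y z m).del τ).setMark y' m' := by
        ext1
        · simp only [ins, setMark, del]
          exact Function.update_comm hτz.symm (some y) none st.att |>.symm ▸ rfl
        · simp only [ins, setMark, del]
          exact Function.update_comm hne m' (some m) st.mark
      rw [← hins]
      refine dAt_eq hy ?_
      cases hm with
      | white m hm =>
        refine InsMark.white m ?_
        rw [setMark_mark_ne _ hne.symm]
        exact hm
      | black x τ₀ hm hq =>
        refine InsMark.black x τ₀ ?_ ⟨hq.1, fun τ' => ?_⟩
        · rw [setMark_mark_ne _ hne.symm]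
          exact hm
        · rw [← hq.2]
          by_cases e : τ' = τ
          · rw [e]
            change (st.del τ).att τ = some y ↔ st.att τ = some y
            rw [del_att_self, hτ]
            simp [hne]
          · change (st.del τ).att τ' = some y ↔ _
            rw [del_att_ne st e]
    exact hatAt_congr (fun _ m' => key (some m')) (fun _ => key none) c a b

open Classical in
theorem hatWith_dAt_of_eq (hf : st.Fresh z) (hy : K.black y = false)
    (h2 : 2 ≤ (K.slotsAt y).card) {c a b : K.S ⊕ ℤ} (hm : st.mark y = some (c, a, b)) {τ : ℤ}
    (hτ : st.att τ = some y) : st.hatWith (dAt z y) τ = (st.ins y z (c, a, b)).hat τ := by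
  have hτz : τ ≠ z := fun e => by
    rw [e, hf.att_eq] at hτ
    cases hτ
  have hτ' : (st.ins y z (c, a, b)).att τ = some y := by rw [ins_att_ne st y hτz, hτ]
  rw [hatWith_of_some hτ hm, hat_of_some hτ' (ins_mark_self _ _ _ _)]
  refine (hatAt_congr (t := 1) (fun _ m' => ?_) (fun h => absurd h2 h) c a b).trans (one_smul ℝ _)
  have hins : ((st.del τ).setMark y (some m')).ins y z m' =
      ((st.ins y z (c, a, b)).del τ).setMark y (some m') := by
    ext1
    · simp only [ins, setMark, del]
      exact Function.update_comm hτz.symm (some y) none st.att |>.symm ▸ rfl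
    · simp only [ins, setMark, del, Function.update_idem]
  rw [← hins]
  exact dAt_eq hy (InsMark.white m' (setMark_mark_self _ _ _))

theorem ins_del (hf : st.Fresh z) (m) (m') (hm : st.mark y = m') :
    ((st.ins y z m).del z).setMark y m' = st := by
  ext1
  · simp only [ins, setMark, del, Function.update_idem]
    rw [← hf.att_eq]
    exact Function.update_eq_self _ _
  · simp only [ins, setMark, del, Function.update_idem]
    rw [← hm]
    classical
    convert Function.update_eq_self y st.mark

/-- The homotopy formula at a white vertex with at least two slots that are not fed by univalent
black vertices. -/
theorem homotopy_white (hst : st.Good) (hf : st.Fresh z) (hy : K.black y = false)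
    (h2 : 2 ≤ (K.slotsAt y).card) {c a b : K.S ⊕ ℤ} (hm : st.mark y = some (c, a, b)) :
    (1 : ℝ) • (st.ins y z (c, a, b)).hat z + ∑ τ ∈ st.active, toFront st.labels id τ •
      (st.hatWith (dAt z y) τ - (1 : ℝ) • (st.ins y z (c, a, b)).hat τ) = st.cls := by
  rw [Finset.sum_eq_zero, add_zero, one_smul,
    hat_of_some (ins_att_self _ _ _ _) (ins_mark_self _ _ _ _), hatAt, if_pos h2, extendBy]
  · obtain ⟨n1, n2, n3⟩ := hf.mark_ne y c a b hm
    rw [if_neg (hst.mark_at y c a b hm).2.2.2.2.2, if_neg n3, if_neg n2, if_neg n1,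
      ins_del hf _ _ hm]
  · intro τ hτ
    obtain ⟨y', hy'⟩ := Option.ne_none_iff_exists'.mp (hst.mem_active.mp hτ)
    by_cases e : y' = y
    · subst e
      rw [hatWith_dAt_of_eq hf hy h2 hm hy', one_smul, sub_self, smul_zero]
    · rw [hatWith_dAt_of_ne hf hy (InsMark.white _ hm) hy' e, sub_self, smul_zero]

/-- The homotopy formula at a bivalent black vertex. -/
theorem homotopy_black (hst : st.Good) (hf : st.Fresh z) (hy : K.black y = false) {x : K.S}
    {τ₀ : ℤ} (hm : st.mark y = none) (hq : st.QAt y x τ₀) :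
    (1 / 2 : ℝ) • (st.ins y z (Sum.inl x, Sum.inr z, Sum.inr τ₀)).hat z +
      ∑ τ ∈ st.active, toFront st.labels id τ • (st.hatWith (dAt z y) τ -
        (1 / 2 : ℝ) • (st.ins y z (Sum.inl x, Sum.inr z, Sum.inr τ₀)).hat τ) = st.cls := by
  have hτ₀ := (hq.2 τ₀).mpr rfl
  have hne : τ₀ ≠ z := fun e => by
    rw [e, hf.att_eq] at hτ₀
    cases hτ₀
  have hact : τ₀ ∈ st.active := hst.mem_active.mpr (by simp [hτ₀])
  have hcard : ¬ 2 ≤ (K.slotsAt y).card := by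
    have : K.slotsAt y = {x} := by
      ext z'
      rw [Skeleton.mem_slotsAt, hq.1, Finset.mem_singleton]
    simp [this]
  rw [Finset.sum_eq_single τ₀]
  · rw [hatWith_of_mark_none hτ₀ hm, hat_of_some (ins_att_self _ _ _ _) (ins_mark_self _ _ _ _),
      hat_of_some ((ins_att_ne _ _ hne _).trans hτ₀) (ins_mark_self _ _ _ _), hatAt, hatAt,
      if_neg hcard, if_neg hcard, ins_del hf _ _ hm]
    have h1 : (((st.ins y z (Sum.inl x, Sum.inr z, Sum.inr τ₀)).del τ₀).setMark y none).cls =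
        toFront st.labels id τ₀ • st.cls := by
      refine hst.cls_relabel hτ₀ hf ?_ ?_ ?_ ?_ ?_
      · exact (del_att_ne _ hne.symm).trans (ins_att_self _ _ _ _)
      · exact del_att_self _ _
      · exact fun x' h1 h2 => (del_att_ne _ h1).trans (ins_att_ne _ _ h2 _)
      · exact fun y' hy' => (setMark_mark_ne _ hy' _).trans (ins_mark_ne st hy' z _)
      · rw [setMark_mark_self, hm]
        rfl
    rw [h1]
    simp only [Sum.inr.injEq, hne, hne.symm, if_true, if_false]
    have h2 := toFront_mul_self st.labels id τ₀
    generalize toFront st.labels id τ₀ = ε at *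
    have h3 : ε • ε • st.cls = st.cls := by rw [smul_smul, h2, one_smul]
    linear_combination (norm := module) (1 / 2 : ℝ) • h3
  · intro τ hτ hne'
    obtain ⟨y', hy'⟩ := Option.ne_none_iff_exists'.mp (hst.mem_active.mp hτ)
    have e : y' ≠ y := fun e => hne' ((hq.2 τ).mp (e ▸ hy'))
    rw [hatWith_dAt_of_ne hf hy (InsMark.black x τ₀ hm hq) hy' e, sub_self, smul_zero]
  · exact fun h => absurd hact h

open Classical in
/-- The homotopy formula at a white vertex with three slots, two of them fed by univalent black
vertices. -/
theorem homotopy_bivalent (hst : st.Good) (hf : st.Fresh z) (hy : K.black y = false)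
    {c a b : K.S ⊕ ℤ} (hm : st.mark y = some (c, a, b)) {x : K.S} {τ₁ τ₂ : ℤ} (h12 : τ₁ ≠ τ₂)
    (hx : ∀ z', K.tgt z' = y ↔ z' = x) (hτ : ∀ τ, st.att τ = some y ↔ τ = τ₁ ∨ τ = τ₂) :
    (1 : ℝ) • (st.ins y z (c, a, b)).hat z + ∑ τ ∈ st.active, toFront st.labels id τ •
      (st.hatWith (dAt z y) τ - (1 : ℝ) • (st.ins y z (c, a, b)).hat τ) = st.cls := by
  have h₁ := (hτ τ₁).mpr (Or.inl rfl)
  have h₂ := (hτ τ₂).mpr (Or.inr rfl)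
  have hz₁ : τ₁ ≠ z := fun e => by
    rw [e, hf.att_eq] at h₁
    cases h₁
  have hz₂ : τ₂ ≠ z := fun e => by
    rw [e, hf.att_eq] at h₂
    cases h₂
  have hcard : ¬ 2 ≤ (K.slotsAt y).card := by
    have : K.slotsAt y = {x} := by
      ext z'
      rw [Skeleton.mem_slotsAt, hx, Finset.mem_singleton]
    simp [this]
  obtain ⟨n1, n2, n3⟩ := hf.mark_ne y c a b hm
  have hgm : (st.setMark y (some (c, a, b))).Good := by
    rw [← hm, setMark_self]
    exact hst
  have i₁ : st.IsAt y (Sum.inr τ₁) := h₁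
  have i₂ : st.IsAt y (Sum.inr τ₂) := h₂
  have i₀ : st.IsAt y (Sum.inl x) := (hx x).mpr rfl
  have m12 : (Sum.inr τ₁ : K.S ⊕ ℤ) ≠ Sum.inr τ₂ := by simpa using h12
  -- the contribution of one of the two univalent vertices
  have hT : ∀ τ τ', st.att τ = some y → st.att τ' = some y → τ ≠ τ' → τ ≠ z →
      (∀ x, st.att x = some y ↔ x = τ ∨ x = τ') → toFront st.labels id τ •
      (st.hatWith (dAt z y) τ - (1 : ℝ) • (st.ins y z (c, a, b)).hat τ) =
      (((if a = Sum.inr τ then 1 else 0) - (if b = Sum.inr τ then 1 else 0) : ℝ) * (1 / 2)) •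
        (st.setMark y (some (Sum.inl x, Sum.inr τ, Sum.inr τ'))).cls := by
    intro τ τ' h h' hne hz hall
    have hz' : τ' ≠ z := fun e => by
      rw [e, hf.att_eq] at h'
      cases h'
    have e1 : (st.ins y z (c, a, b)).hat τ = 0 := by
      rw [hat_of_some ((ins_att_ne _ _ hz _).trans h) (ins_mark_self _ _ _ _), hatAt, if_neg hcard,
        cls_of_not_good, smul_zero]
      intro hg
      obtain ⟨τ₃, h₃⟩ := hg.q_att y hy (setMark_mark_self _ _ _)
      have e1 := (h₃ z).mp ((del_att_ne _ hz.symm).trans (ins_att_self _ _ _ _))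
      have e2 := (h₃ τ').mp ((del_att_ne _ hne.symm).trans ((ins_att_ne _ _ hz' _).trans h'))
      exact hz' (e2.trans e1.symm)
    have e2 : dAt z y ((st.del τ).setMark y none) = (1 / 2 : ℝ) •
        (((st.del τ).setMark y none).ins y z (Sum.inl x, Sum.inr z, Sum.inr τ')).cls := by
      refine dAt_eq hy (InsMark.black x τ' (setMark_mark_self _ _ _) ⟨hx, fun τ₃ => ?_⟩)
      change (st.del τ).att τ₃ = some y ↔ _
      by_cases e : τ₃ = τ
      · rw [e, del_att_self]
        simp [hne]
      · rw [del_att_ne _ e, hall]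
        simp [e]
    have hgx : (st.setMark y (some (Sum.inl x, Sum.inr τ, Sum.inr τ'))).Good :=
      hgm.setMark i₀ h h' (by simp) (by simp) (by simpa using hne)
    have hfx : (st.setMark y (some (Sum.inl x, Sum.inr τ, Sum.inr τ'))).Fresh z := by
      refine ⟨hf.lt_pos, hf.lt_att, fun y' c' a' b' hm' => ?_⟩
      by_cases e : y' = y
      · subst e
        simp only [setMark_mark_self, Option.some.injEq, Prod.mk.injEq] at hm'
        obtain ⟨rfl, rfl, rfl⟩ := hm'
        simp [hz, hz']
      · rw [setMark_mark_ne _ e] at hm'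
        exact hf.mark_ne y' c' a' b' hm'
    have e3 : (((st.del τ).setMark y none).ins y z (Sum.inl x, Sum.inr z, Sum.inr τ')).cls =
        toFront st.labels id τ • (st.setMark y (some (Sum.inl x, Sum.inr τ, Sum.inr τ'))).cls := by
      refine hgx.cls_relabel h hfx ?_ ?_ ?_ ?_ ?_
      · exact ins_att_self _ _ _ _
      · exact (ins_att_ne _ _ hz _).trans (del_att_self _ _)
      · exact fun x' h1 h2 => (ins_att_ne _ _ h2 _).trans (del_att_ne _ h1)
      · intro y' hy'
        rw [ins_mark_ne _ hy', setMark_mark_ne _ hy', setMark_mark_ne _ hy']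
        rfl
      · rw [ins_mark_self, setMark_mark_self, Option.map_some]
        congr 1
        refine Prod.ext rfl (Prod.ext ?_ ?_)
        · exact congrArg Sum.inr (Equiv.swap_apply_left τ z).symm
        · exact congrArg Sum.inr (Equiv.swap_apply_of_ne_of_ne hne.symm hz').symm
    rw [hatWith_of_some h hm, hatAt, if_neg hcard, e1, e2, e3, smul_zero, sub_zero, smul_smul,
      smul_smul, smul_smul]
    congr 1
    have h2 := toFront_mul_self st.labels id τ
    linear_combination (((if a = Sum.inr τ then 1 else 0) - (if b = Sum.inr τ then 1 else 0) : ℝ) *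
      (1 / 2)) * h2
  have ez : (st.ins y z (c, a, b)).hat z = 0 := by
    rw [hat_of_some (ins_att_self _ _ _ _) (ins_mark_self _ _ _ _), hatAt, if_neg hcard,
      if_neg n2, if_neg n3, sub_self, zero_smul]
  have hsum : ∑ τ ∈ st.active, toFront st.labels id τ •
      (st.hatWith (dAt z y) τ - (1 : ℝ) • (st.ins y z (c, a, b)).hat τ) =
      (((if a = Sum.inr τ₁ then 1 else 0) - (if b = Sum.inr τ₁ then 1 else 0) : ℝ) * (1 / 2)) •
        (st.setMark y (some (Sum.inl x, Sum.inr τ₁, Sum.inr τ₂))).cls +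
      (((if a = Sum.inr τ₂ then 1 else 0) - (if b = Sum.inr τ₂ then 1 else 0) : ℝ) * (1 / 2)) •
        (st.setMark y (some (Sum.inl x, Sum.inr τ₂, Sum.inr τ₁))).cls := by
    rw [Finset.sum_eq_add τ₁ τ₂ h12, hT τ₁ τ₂ h₁ h₂ h12 hz₁ hτ,
      hT τ₂ τ₁ h₂ h₁ h12.symm hz₂ fun x => (hτ x).trans or_comm]
    · rintro τ hτ' ⟨g1, g2⟩
      obtain ⟨y', hy'⟩ := Option.ne_none_iff_exists'.mp (hst.mem_active.mp hτ')
      have e : y' ≠ y := fun e => by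
        rw [e, hτ] at hy'
        exact hy'.elim g1 g2
      rw [hatWith_dAt_of_ne hf hy (InsMark.white _ hm) hy' e, sub_self, smul_zero]
    · exact fun h => absurd (hst.mem_active.mpr (by simp [h₁])) h
    · exact fun h => absurd (hst.mem_active.mpr (by simp [h₂])) h
  rw [ez, hsum, smul_zero, zero_add]
  obtain ⟨E, hE⟩ := exists_setMark_potential st y
  have hR : ∀ c a b, st.IsAt y c → st.IsAt y a → st.IsAt y b → c ≠ a → c ≠ b →
      (st.setMark y (some (c, a, b))).cls = E b c - E a c :=
    fun c a b hc ha hb h1 h2 => hE.eq c hc a ha b hb h1 h2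
  have s12 := hE.symm (Sum.inr τ₁) i₁ (Sum.inr τ₂) i₂
  have s01 := hE.symm (Sum.inl x) i₀ (Sum.inr τ₁) i₁
  have s02 := hE.symm (Sum.inl x) i₀ (Sum.inr τ₂) i₂
  have hswap := (hgm.setMark i₁ i₀ i₂ (by simp) m12 (by simp)).cls_swap (τ := τ₁) (τ' := τ₂) h₁ h₂
    h12 (setMark_mark_self st y _)
  have sl : swapName (K := K) τ₁ τ₂ (Sum.inr τ₁) = Sum.inr τ₂ :=
    congrArg Sum.inr (Equiv.swap_apply_left τ₁ τ₂)
  have sr : swapName (K := K) τ₁ τ₂ (Sum.inr τ₂) = Sum.inr τ₁ :=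
    congrArg Sum.inr (Equiv.swap_apply_right τ₁ τ₂)
  have s0 : swapName (K := K) τ₁ τ₂ (Sum.inl x) = Sum.inl x := rfl
  rw [setMark_setMark, sl, sr, s0, hR _ _ _ i₁ i₀ i₂ (by simp) m12,
    hR _ _ _ i₂ i₀ i₁ (by simp) m12.symm, s12, s01, s02] at hswap
  have hcls : st.cls = (st.setMark y (some (c, a, b))).cls := by rw [← hm, setMark_self]
  obtain ⟨hc, ha, hb, hca, hcb, hab⟩ := hst.mark_at y c a b hm
  rw [hcls, hR c a b hc ha hb hca hcb, hR _ _ _ i₀ i₁ i₂ (by simp) (by simp),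
    hR _ _ _ i₀ i₂ i₁ (by simp) (by simp)]
  have hl : ∀ l, st.IsAt y l → l = Sum.inl x ∨ l = Sum.inr τ₁ ∨ l = Sum.inr τ₂ := by
    rintro (z' | τ) hl
    · exact Or.inl (congrArg Sum.inl ((hx z').mp hl))
    · rcases (hτ τ).mp hl with rfl | rfl
      · exact Or.inr (Or.inl rfl)
      · exact Or.inr (Or.inr rfl)
  rcases hl c hc with rfl | rfl | rfl <;> rcases hl a ha with rfl | rfl | rfl <;>
    rcases hl b hb with rfl | rfl | rfl <;>
    first
    | exact absurd rfl hca
    | exact absurd rfl hcb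
    | exact absurd rfl hab
    | (simp only [Sum.inr.injEq, h12, h12.symm, reduceCtorEq, if_true, if_false]
       try rw [s01]
       try rw [s02]
       try rw [s12]
       first
       | module
       | linear_combination (norm := module) (1 / 2 : ℝ) • hswap
       | linear_combination (norm := module) -(1 / 2 : ℝ) • hswap)

/-- No white vertex has three univalent black vertices attached to it. -/
def Reduced (st : Marking K) : Prop := ∀ y m, st.mark y = some m → 2 ≤ (K.slotsAt y).card ∨
  ∃ x τ₁ τ₂, τ₁ ≠ τ₂ ∧ (∀ z', K.tgt z' = y ↔ z' = x) ∧ ∀ τ, st.att τ = some y ↔ τ = τ₁ ∨ τ = τ₂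

theorem Good.reduced_or (h : st.Good) : st.Reduced ∨ st.cls = 0 := by
  by_contra! hcon
  obtain ⟨h1, h0⟩ := hcon
  rw [Reduced] at h1
  push Not at h1
  obtain ⟨y, ⟨c, a, b⟩, hm, hr, hno⟩ := h1
  have hthree : ∀ τ₁ τ₂ τ₃, st.att τ₁ = some y → st.att τ₂ = some y → st.att τ₃ = some y →
      τ₁ ≠ τ₂ → τ₁ ≠ τ₃ → τ₂ ≠ τ₃ → False := fun τ₁ τ₂ τ₃ g1 g2 g3 n1 n2 n3 =>
    h0 (cls_eq_zero_of_three g1 g2 g3 n1 n2 n3 hm)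
  have hone : ∀ x x', K.tgt x = y → K.tgt x' = y → x = x' := by
    have h2 : (K.slotsAt y).card ≤ 1 := by omega
    exact fun x x' h h' => Finset.card_le_one.mp h2 x (Skeleton.mem_slotsAt.mpr h) x'
      (Skeleton.mem_slotsAt.mpr h')
  have hgen : ∀ x τ₁ τ₂, K.tgt x = y → st.att τ₁ = some y → st.att τ₂ = some y → τ₁ ≠ τ₂ → False := by
    intro x τ₁ τ₂ hx g1 g2 n
    obtain ⟨τ, hτ⟩ := hno x τ₁ τ₂ n fun z' => ⟨fun h => hone _ _ h hx, fun h => h ▸ hx⟩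
    rcases hτ with ⟨g3, n1, n2⟩ | ⟨g3, rfl | rfl⟩
    · exact hthree _ _ _ g1 g2 g3 n (Ne.symm n1) (Ne.symm n2)
    · exact g3 g1
    · exact g3 g2
  obtain ⟨hc, ha, hb, hca, hcb, hab⟩ := h.mark_at y c a b hm
  rcases c with c | c <;> rcases a with a | a <;> rcases b with b | b
  · exact hca (congrArg Sum.inl (hone _ _ hc ha))
  · exact hca (congrArg Sum.inl (hone _ _ hc ha))
  · exact hcb (congrArg Sum.inl (hone _ _ hc hb))
  · exact hgen c a b hc ha hb fun e => hab (by rw [e])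
  · exact hab (congrArg Sum.inl (hone _ _ ha hb))
  · exact hgen a c b ha hc hb fun e => hcb (by rw [e])
  · exact hgen b c a hb hc ha fun e => hca (by rw [e])
  · exact hthree c a b hc ha hb (fun e => hca (by rw [e])) (fun e => hcb (by rw [e]))
      fun e => hab (by rw [e])

open Classical in
/-- The number of white and bivalent black vertices. -/
def _root_.GraphComplex.Skeleton.weight (K : Skeleton p q) : ℕ :=
  (Finset.univ.filter fun y => K.black y = false).card

/-- The homotopy formula for markings. -/
theorem Good.homotopy (hst : st.Good) (hf : st.Fresh z) (hr : st.Reduced) :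
    hSpace p q (st.dnet z) + ∑ τ ∈ st.active, toFront st.labels id τ • st.hatWith (dnet z) τ =
      (K.weight : ℝ) • st.cls := by
  classical
  have h1 : ∀ y, hSpace p q (st.dAt z y) + ∑ τ ∈ st.active, toFront st.labels id τ •
      st.hatWith (dAt z y) τ = if K.black y = false then st.cls else 0 := by
    intro y
    cases hy : K.black y with
    | true =>
      have h0 : dAt (K := K) z y = fun _ => 0 := funext fun st => dAt_of_black hy
      have h2 : ∀ τ, st.hatWith (fun _ => (0 : Space p q)) τ = 0 := fun τ =>
        (map_hatWith (0 : Space p q →ₗ[ℝ] Space p q) st (fun _ => 0) τ).symm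
      simp [h0, h2]
    | false =>
      obtain ⟨m, t, hm⟩ := hst.exists_insMark hy z
      rw [if_pos rfl, dAt_eq hy hm, map_smul, ((ins_good_iff hf hy hm).mpr hst).hSpace_cls,
        hf.hnet_ins hst, smul_sub, sub_add_eq_add_sub, add_sub_assoc, Finset.smul_sum,
        ← Finset.sum_sub_distrib]
      have h3 : ∀ τ ∈ st.active, toFront st.labels id τ • st.hatWith (dAt z y) τ -
          t • toFront st.labels id τ • (st.ins y z m).hat τ = toFront st.labels id τ •
          (st.hatWith (dAt z y) τ - t • (st.ins y z m).hat τ) := fun τ _ => by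
        rw [smul_sub, smul_comm t]
      rw [Finset.sum_congr rfl h3]
      cases hm with
      | white m hm =>
        obtain ⟨c, a, b⟩ := m
        rcases hr y _ hm with h2 | ⟨x, τ₁, τ₂, h12, hx, hτ⟩
        · exact homotopy_white hst hf hy h2 hm
        · exact homotopy_bivalent hst hf hy hm h12 hx hτ
      | black x τ hm hq => exact homotopy_black hst hf hy hm hq
  have h2 : dnet (K := K) z = fun st => ∑ y, dAt z y st := rfl
  simp only [h2, hatWith_sum, map_sum, Finset.smul_sum]
  rw [Finset.sum_comm, ← Finset.sum_add_distrib, Finset.sum_congr rfl fun y _ => h1 y,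
    ← Finset.sum_filter, Finset.sum_const, Skeleton.weight, Nat.cast_smul_eq_nsmul ℝ]

end Marking

end

noncomputable section

variable {p q n m : ℕ} {K : Skeleton p q}

/-! ### The terms of the differential that preserve the skeleton -/

section Signs

variable {α : Type*} {s : Finset α} {f g : α → ℤ}

theorem toFront_of_le {x : α} (h : ∀ y ∈ s, f x ≤ f y) : toFront s f x = 1 := by
  classical
  exact Finset.prod_eq_one fun y hy => if_neg (not_lt.mpr (h y hy))

end Signs

namespace Pres

variable {Γ : Diagram p q} {st : Marking K}

/-- The label `z`, if it precedes all labels in use, is not the label of a black vertex. -/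
theorem lt_t (P : Pres Γ K st) {z : ℤ} (hf : st.Fresh z) {x : Γ.V} (hx : Γ.black x = true) :
    z < P.t x := by
  by_cases h : Γ.ar x ≤ 1
  · exact hf.lt_att _ ((P.t_att _).mpr ⟨x, hx, h, rfl⟩)
  · obtain ⟨y, rfl⟩ := (P.v_range x).mpr fun hu => h (by rw [hu.2]; omega)
    have hy := (P.black_iff y).mpr ⟨hx, by omega⟩
    rw [P.t_black y hy]
    exact hf.lt_pos y hy

/-- The graph `g`, to be put in the place of the vertex `y`, consists of a white vertex
and univalent black vertices attached to it. In addition to the labels already attached to `y`,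
`tg` uses the label `z`. After the replacement the last three slots are `m`. -/
structure Corolla (P : Pres Γ K st) (y : K.V) (z : ℤ)
    (m : (K.S ⊕ ℤ) × (K.S ⊕ ℤ) × (K.S ⊕ ℤ)) (g : Diagram (Γ.ar (P.v y)) 1) (tg : g.V → ℤ) :
    Prop where
  white : g.black (g.out 0) = false
  univ : ∀ x, x ≠ g.out 0 → g.IsUnivalentBlack x
  inj : ∀ x x', g.black x = true → g.black x' = true → tg x = tg x' → x = x'
  labels : ∀ τ, (∃ x, g.black x = true ∧ tg x = τ) ↔
    τ = z ∨ (Γ.black (P.v y) = true ∧ τ = P.t (P.v y))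
  inp_inj : Function.Injective (g.inp (g.out 0))
  inp_leg : ∀ l, ∃ i, g.inp (g.out 0) i = Sum.inr l
  inp_vert : ∀ x, g.black x = true ↔ ∃ i, g.inp (g.out 0) i = Sum.inl x
  mark : ∀ i : Fin (g.ar (g.out 0)),
    ((i : ℕ) + 3 = g.ar (g.out 0) →
      Sum.elim (fun x => Sum.inr (tg x)) (P.lab (P.v y)) (g.inp (g.out 0) i) = m.1) ∧
    ((i : ℕ) + 2 = g.ar (g.out 0) →
      Sum.elim (fun x => Sum.inr (tg x)) (P.lab (P.v y)) (g.inp (g.out 0) i) = m.2.1) ∧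
    ((i : ℕ) + 1 = g.ar (g.out 0) →
      Sum.elim (fun x => Sum.inr (tg x)) (P.lab (P.v y)) (g.inp (g.out 0) i) = m.2.2)

/-- The description of the graph in which a vertex is replaced by a white one with additional
univalent black vertices. -/
theorem Corolla.exists_pres {P : Pres Γ K st} {y : K.V} {z : ℤ}
    {m : (K.S ⊕ ℤ) × (K.S ⊕ ℤ) × (K.S ⊕ ℤ)} {g : Diagram (Γ.ar (P.v y)) 1} {tg : g.V → ℤ}
    (hg : P.Corolla y z m g tg) (hst : st.Good) (hf : st.Fresh z) (hy : K.black y = false) :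
    ∃ P' : Pres (Γ.subst (P.v y) g) K (st.ins y z m), P'.t = Sum.elim tg (P.t ∘ Subtype.val) := by
  classical
  have hz := hf.att_eq
  have hq : Γ.black (P.v y) = true → Γ.ar (P.v y) = 1 := fun h => by
    have h1 := P.black_iff y
    have h2 := P.not_univ y
    rw [hy, h] at h1
    simp only [IsUnivalentBlack, h, true_and] at h1 h2
    simp at h1
    omega
  have hqt : Γ.black (P.v y) = true → st.att (P.t (P.v y)) = some y := fun h =>
    P.att_one y h (hq h)
  have hqu : Γ.black (P.v y) = true → ∀ τ, st.att τ = some y → τ = P.t (P.v y) := fun h τ hτ => by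
    obtain ⟨h1, h2⟩ := (P.q_iff y).mpr ⟨h, hq h⟩
    obtain ⟨τ', h3⟩ := hst.q_att y h1 h2
    rw [(h3 _).mp hτ, (h3 _).mp (hqt h)]
  have hatt : ∀ {τ y'}, st.att τ = some y' → τ ≠ z := fun h e => by
    rw [e, hz] at h
    cases h
  have hblack : ∀ x, g.black x = true → x ≠ g.out 0 := fun x hx e => by
    rw [e, hg.white] at hx
    cases hx
  have htg : ∀ x, g.black x = true → (st.ins y z m).att (tg x) = some y := fun x hx => by
    rcases (hg.labels (tg x)).mp ⟨x, hx, rfl⟩ with h | ⟨h1, h2⟩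
    · rw [h, Marking.ins_att_self]
    · rw [h2, Marking.ins_att_ne st y (hatt (hqt h1)), hqt h1]
  -- it suffices to look at `y` and at the other vertices
  have key : ∀ Q : K.V → g.V ⊕ {u : Γ.V // u ≠ P.v y} → Prop, Q y (Sum.inl (g.out 0)) →
      (∀ y' (h : P.v y' ≠ P.v y), y' ≠ y → Q y' (Sum.inr ⟨P.v y', h⟩)) →
      ∀ y', Q y' (Γ.vert (P.v y) g (P.v y')) := by
    intro Q h1 h2 y'
    by_cases e : y' = y
    · rw [e, vert_self]
      exact h1
    · have h : P.v y' ≠ P.v y := fun h => e (P.v_inj h)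
      rw [vert_ne _ _ _ h]
      exact h2 y' h e
  let lab : ∀ x : g.V ⊕ {u : Γ.V // u ≠ P.v y}, Fin ((Γ.subst (P.v y) g).ar x) → K.S ⊕ ℤ := fun x =>
    match x with
    | Sum.inl x => fun i => Sum.elim (fun x => Sum.inr (tg x)) (P.lab (P.v y)) (g.inp x i)
    | Sum.inr u => fun i => P.lab u i
  have hmap : ∀ s : K.V ⊕ Fin p, Sum.map (Γ.vert (P.v y) g) id (Sum.map P.v id s) =
      Sum.map (fun y' => Γ.vert (P.v y) g (P.v y')) id s := by
    rintro (_ | _) <;> rfl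
  refine ⟨{ v := fun y' => Γ.vert (P.v y) g (P.v y')
            t := Sum.elim tg (P.t ∘ Subtype.val)
            lab := lab
            v_inj := ?_, v_range := ?_, t_inj := ?_, t_att := ?_, t_black := ?_, black_iff := ?_
            mark_iff := ?_, att_one := ?_, lab_inl := ?_, lab_inr := ?_, lab_inj := ?_
            surj_inl := ?_, surj_inr := ?_, mark_eq := ?_
            out_eq := fun j => congrArg (Γ.vert (P.v y) g) (P.out_eq j) }, rfl⟩
  · refine fun a b hab => P.v_inj ?_
    dsimp only at hab
    by_cases ha : P.v a = P.v y <;> by_cases hb : P.v b = P.v y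
    · rw [ha, hb]
    · rw [ha, vert_self, vert_ne _ _ _ hb] at hab
      cases hab
    · rw [hb, vert_self, vert_ne _ _ _ ha] at hab
      cases hab
    · rw [vert_ne _ _ _ ha, vert_ne _ _ _ hb] at hab
      exact congrArg Subtype.val (Sum.inr_injective hab)
  · rintro (x | u)
    · by_cases hx : x = g.out 0
      · subst hx
        refine ⟨fun _ h => ?_, fun _ => ⟨y, vert_self _ _ _⟩⟩
        have := h.1
        change g.black (g.out 0) = true at this
        rw [hg.white] at this
        cases this
      · refine ⟨fun ⟨y', hy'⟩ => ?_, fun h => absurd (hg.univ x hx) h⟩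
        revert hy'
        refine key (fun y' x' => x' = Sum.inl x → _) (fun h => ?_) (fun y' h _ h' => ?_) y'
        · exact absurd (Sum.inl_injective h).symm hx
        · cases h'
    · refine Iff.trans ?_ (P.v_range u.1)
      constructor
      · rintro ⟨y', hy'⟩
        refine ⟨y', ?_⟩
        revert hy'
        refine key (fun y' x' => x' = Sum.inr u → P.v y' = u) (fun h => ?_) (fun y' h _ h' => ?_) y'
        · cases h
        · exact congrArg Subtype.val (Sum.inr_injective h')
      · rintro ⟨y', hy'⟩
        refine ⟨y', ?_⟩
        rw [vert_ne _ _ _ (by rw [hy']; exact u.2)]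
        exact congrArg Sum.inr (Subtype.ext hy')
  · have cross : ∀ (x : g.V) (u : {u : Γ.V // u ≠ P.v y}), g.black x = true → Γ.black u = true →
        tg x ≠ P.t u := by
      intro x u hx hu e
      rcases (hg.labels (tg x)).mp ⟨x, hx, rfl⟩ with h | ⟨h1, h2⟩
      · exact (P.lt_t hf hu).ne (h.symm.trans e)
      · exact u.2 (P.t_inj _ _ hu h1 (e.symm.trans h2))
    rintro (x | u) (x' | u') hb hb' h
    · exact congrArg Sum.inl (hg.inj x x' hb hb' h)
    · exact absurd h (cross x u' hb hb')
    · exact absurd h.symm (cross x' u hb' hb)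
    · exact congrArg Sum.inr (Subtype.ext (P.t_inj _ _ hb hb' h))
  · intro τ
    constructor
    · intro h
      by_cases hτ : τ = z ∨ (Γ.black (P.v y) = true ∧ τ = P.t (P.v y))
      · obtain ⟨x, h1, h2⟩ := (hg.labels τ).mpr hτ
        refine ⟨Sum.inl x, h1, ?_, h2⟩
        exact ((hg.univ x (hblack x h1)).2.trans_le (by omega) : g.ar x ≤ 1)
      · push Not at hτ
        rw [Marking.ins_att_ne st y hτ.1] at h
        obtain ⟨x, h1, h2, h3⟩ := (P.t_att τ).mp h
        refine ⟨Sum.inr ⟨x, ?_⟩, h1, h2, h3⟩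
        rintro rfl
        exact hτ.2 h1 h3.symm
    · rintro ⟨x | u, h1, h2, rfl⟩
      · change (st.ins y z m).att (tg x) ≠ none
        rw [htg x h1]
        simp
      · have h3 : st.att (P.t u) ≠ none := (P.t_att _).mpr ⟨u, h1, h2, rfl⟩
        change (st.ins y z m).att (P.t u) ≠ none
        rwa [Marking.ins_att_ne st y fun e => h3 (by rw [e, hz])]
  · refine key (fun y' x => K.black y' = true → Sum.elim tg (P.t ∘ Subtype.val) x = K.pos y')
      (fun h => ?_) (fun y' _ _ h => P.t_black y' h)
    rw [hy] at h
    cases h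
  · refine key (fun y' x => K.black y' = true ↔ (Γ.subst (P.v y) g).black x = true ∧
      2 ≤ (Γ.subst (P.v y) g).ar x) ?_ (fun y' _ _ => P.black_iff y')
    rw [hy]
    change false = true ↔ g.black (g.out 0) = true ∧ _
    rw [hg.white]
    simp
  · refine key (fun y' x => (st.ins y z m).mark y' = none ↔ (Γ.subst (P.v y) g).black x = true) ?_
      (fun y' _ h => ?_)
    · rw [Marking.ins_mark_self]
      change _ ↔ g.black (g.out 0) = true
      rw [hg.white]
      simp
    · rw [Marking.ins_mark_ne st h]
      exact P.mark_iff y'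
  · refine key (fun y' x => (Γ.subst (P.v y) g).black x = true → (Γ.subst (P.v y) g).ar x = 1 →
      (st.ins y z m).att (Sum.elim tg (P.t ∘ Subtype.val) x) = some y') (fun h => ?_)
      (fun y' h _ h1 h2 => ?_)
    · exact absurd (h.symm.trans hg.white) (by simp)
    · have := P.att_one y' h1 h2
      exact (Marking.ins_att_ne st y (hatt this) _).trans this
  · refine key (fun y' x => ∀ i z', lab x i = Sum.inl z' → K.tgt z' = y' ∧
      (Γ.subst (P.v y) g).inp x i = Sum.map (fun y' => Γ.vert (P.v y) g (P.v y')) id (K.src z'))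
      (fun i z' h => ?_) (fun y' h _ i z' h1 => ?_)
    · change Sum.elim _ _ (g.inp (g.out 0) i) = _ at h
      have e : (Γ.subst (P.v y) g).inp (Sum.inl (g.out 0)) i =
        Γ.glue (P.v y) g (g.inp (g.out 0) i) := rfl
      rw [e]
      cases hi : g.inp (g.out 0) i with
      | inl x =>
        rw [hi] at h
        cases h
      | inr l =>
        rw [hi] at h
        obtain ⟨h1, h2⟩ := P.lab_inl y l z' h
        refine ⟨h1, ?_⟩
        change Sum.map (Γ.vert (P.v y) g) id (Γ.inp (P.v y) l) = _
        rw [h2, hmap]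
    · obtain ⟨h2, h3⟩ := P.lab_inl y' i z' h1
      refine ⟨h2, ?_⟩
      change Sum.map (Γ.vert (P.v y) g) id (Γ.inp (P.v y') i) = _
      rw [h3, hmap]
  · refine key (fun y' x => ∀ i τ, lab x i = Sum.inr τ → (Γ.subst (P.v y) g).black x = false ∧
      (st.ins y z m).att τ = some y' ∧ ∃ x', (Γ.subst (P.v y) g).IsUnivalentBlack x' ∧
        (Γ.subst (P.v y) g).inp x i = Sum.inl x' ∧ Sum.elim tg (P.t ∘ Subtype.val) x' = τ)
      (fun i τ h => ?_) (fun y' h hne i τ h1 => ?_)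
    · change Sum.elim _ _ (g.inp (g.out 0) i) = _ at h
      refine ⟨hg.white, ?_⟩
      have e : (Γ.subst (P.v y) g).inp (Sum.inl (g.out 0)) i =
        Γ.glue (P.v y) g (g.inp (g.out 0) i) := rfl
      rw [e]
      cases hi : g.inp (g.out 0) i with
      | inl x =>
        rw [hi] at h
        obtain rfl := Sum.inr_injective h
        have hx := (hg.inp_vert x).mpr ⟨i, hi⟩
        exact ⟨htg x hx, Sum.inl x, hg.univ x (hblack x hx), rfl, rfl⟩
      | inr l =>
        rw [hi] at h
        obtain ⟨h1, h2, x, h3, h4, h5⟩ := P.lab_inr y l τ h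
        have hxv : x ≠ P.v y := fun e => P.not_univ y (e ▸ h3)
        refine ⟨(Marking.ins_att_ne st y (hatt h2) _).trans h2, Sum.inr ⟨x, hxv⟩, h3, ?_, h5⟩
        change Sum.map (Γ.vert (P.v y) g) id (Γ.inp (P.v y) l) = _
        rw [h4, Sum.map_inl, vert_ne _ _ _ hxv]
    · obtain ⟨h2, h3, x, h4, h5, h6⟩ := P.lab_inr y' i τ h1
      have hxv : x ≠ P.v y := fun e => P.not_univ y (e ▸ h4)
      refine ⟨h2, (Marking.ins_att_ne st y (hatt h3) _).trans h3, Sum.inr ⟨x, hxv⟩, h4, ?_, h6⟩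
      change Sum.map (Γ.vert (P.v y) g) id (Γ.inp (P.v y') i) = _
      rw [h5, Sum.map_inl, vert_ne _ _ _ hxv]
  · refine key (fun y' x => Function.Injective (lab x)) (fun i i' h => hg.inp_inj ?_)
      (fun y' _ _ => P.lab_inj y')
    change Sum.elim _ _ (g.inp (g.out 0) i) = Sum.elim _ _ (g.inp (g.out 0) i') at h
    have cross : ∀ i x l, g.inp (g.out 0) i = Sum.inl x →
        (Sum.inr (tg x) : K.S ⊕ ℤ) ≠ P.lab (P.v y) l := by
      intro i x l hi e
      obtain ⟨h1, h2, -⟩ := P.lab_inr y l _ e.symm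
      rcases (hg.labels (tg x)).mp ⟨x, (hg.inp_vert x).mpr ⟨i, hi⟩, rfl⟩ with h3 | ⟨h3, -⟩
      · exact hatt h2 h3
      · rw [h3] at h1
        cases h1
    cases hi : g.inp (g.out 0) i with
    | inl x => cases hi' : g.inp (g.out 0) i' with
      | inl x' =>
        rw [hi, hi'] at h
        exact congrArg Sum.inl (hg.inj x x' ((hg.inp_vert x).mpr ⟨i, hi⟩)
          ((hg.inp_vert x').mpr ⟨i', hi'⟩) (Sum.inr_injective h))
      | inr l =>
        rw [hi, hi'] at h
        exact absurd h (cross i x l hi)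
    | inr l => cases hi' : g.inp (g.out 0) i' with
      | inl x' =>
        rw [hi, hi'] at h
        exact absurd h.symm (cross i' x' l hi')
      | inr l' =>
        rw [hi, hi'] at h
        exact congrArg Sum.inr (P.lab_inj y h)
  · refine key (fun y' x => ∀ z', K.tgt z' = y' → ∃ i, lab x i = Sum.inl z') (fun z' h => ?_)
      (fun y' _ _ => P.surj_inl y')
    obtain ⟨l, hl⟩ := P.surj_inl y z' h
    obtain ⟨i, hi⟩ := hg.inp_leg l
    refine ⟨i, ?_⟩
    change Sum.elim _ _ (g.inp (g.out 0) i) = _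
    rw [hi, Sum.elim_inr, hl]
  · refine key (fun y' x => ∀ τ, (Γ.subst (P.v y) g).black x = false →
      (st.ins y z m).att τ = some y' → ∃ i, lab x i = Sum.inr τ) (fun τ _ h => ?_)
      (fun y' h hne τ h1 h2 => ?_)
    · by_cases hτ : τ = z ∨ (Γ.black (P.v y) = true ∧ τ = P.t (P.v y))
      · obtain ⟨x, h1, h2⟩ := (hg.labels τ).mpr hτ
        obtain ⟨i, hi⟩ := (hg.inp_vert x).mp h1
        refine ⟨i, ?_⟩
        change Sum.elim _ _ (g.inp (g.out 0) i) = _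
        rw [hi, Sum.elim_inl, h2]
      · push Not at hτ
        rw [Marking.ins_att_ne st y hτ.1] at h
        have hw : Γ.black (P.v y) = false := by
          by_contra hb
          rw [Bool.not_eq_false] at hb
          exact hτ.2 hb (hqu hb τ h)
        obtain ⟨l, hl⟩ := P.surj_inr y τ hw h
        obtain ⟨i, hi⟩ := hg.inp_leg l
        refine ⟨i, ?_⟩
        change Sum.elim _ _ (g.inp (g.out 0) i) = _
        rw [hi, Sum.elim_inr, hl]
    · refine P.surj_inr y' τ h1 ?_
      rwa [Marking.ins_att_ne st y fun e => ?_] at h2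
      rw [e, Marking.ins_att_self] at h2
      exact hne (Option.some_injective _ h2).symm
  · refine key (fun y' x => ∀ c a b, (st.ins y z m).mark y' = some (c, a, b) →
      ∀ i : Fin ((Γ.subst (P.v y) g).ar x),
      ((i : ℕ) + 3 = (Γ.subst (P.v y) g).ar x → lab x i = c) ∧
      ((i : ℕ) + 2 = (Γ.subst (P.v y) g).ar x → lab x i = a) ∧
      ((i : ℕ) + 1 = (Γ.subst (P.v y) g).ar x → lab x i = b)) (fun c a b h i => ?_)
      (fun y' h hne c a b hm => ?_)
    · rw [Marking.ins_mark_self] at h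
      obtain rfl := Option.some_injective _ h
      exact hg.mark i
    · rw [Marking.ins_mark_ne st hne] at hm
      exact P.mark_eq y' c a b hm

theorem Corolla.cls_eq {P : Pres Γ K st} {y : K.V} {z : ℤ}
    {m : (K.S ⊕ ℤ) × (K.S ⊕ ℤ) × (K.S ⊕ ℤ)} {g : Diagram (Γ.ar (P.v y)) 1} {tg : g.V → ℤ}
    (hg : P.Corolla y z m g tg) (hst : st.Good) (hA : Γ.IsAGraph) (hgp : Function.Injective g.pos)
    (hf : st.Fresh z) (hy : K.black y = false) {t : ℝ} (hm : st.InsMark y z m t) :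
    cls (Γ.subst (P.v y) g) = invSign (Γ.subst (P.v y) g).blacks (Γ.subst (P.v y) g).zpos
      (Sum.elim tg (P.t ∘ Subtype.val)) • (st.ins y z m).cls := by
  obtain ⟨P', hP'⟩ := hg.exists_pres hst hf hy
  have h1 := P'.cls_eq ((Marking.ins_good_iff hf hy hm).mpr hst) (subst_pos_injective hA.2 hgp)
  rw [← hP', h1, smul_smul]
  exact (one_smul ℝ _).symm.trans (congrArg (· • _) P'.sgn_mul_self.symm)

theorem corolla_whiteQ (P : Pres Γ K st) {y : K.V} (z : ℤ) {c a b : K.S ⊕ ℤ}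
    (hm : st.mark y = some (c, a, b)) (h3 : 3 ≤ Γ.ar (P.v y)) :
    P.Corolla y z (c, a, b) (whiteQ (Γ.ar (P.v y))) fun _ => z := by
  have hw : Γ.black (P.v y) = false := by
    by_contra h
    rw [Bool.not_eq_false, ← P.mark_iff, hm] at h
    cases h
  have hcons : ∀ i : Fin (Γ.ar (P.v y) + 1), (whiteQ (Γ.ar (P.v y))).inp true i =
    Fin.cons (α := fun _ => Bool ⊕ Fin (Γ.ar (P.v y))) (Sum.inl false) (fun i => Sum.inr i) i :=
    fun _ => rfl
  refine ⟨rfl, fun x hx => ?_, fun x x' hx hx' _ => ?_, fun τ => ?_, ?_, fun l => ?_, fun x => ?_,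
    ?_⟩
  · cases x with
    | false => exact ⟨rfl, rfl⟩
    | true => exact absurd rfl hx
  · cases x <;> cases x' <;>
      first | rfl | exact absurd hx Bool.false_ne_true | exact absurd hx' Bool.false_ne_true
  · simp only [hw, Bool.false_eq_true, false_and, or_false]
    exact ⟨fun ⟨x, _, h⟩ => h.symm, fun h => ⟨false, rfl, h.symm⟩⟩
  · change Function.Injective (Fin.cons (α := fun _ => Bool ⊕ Fin (Γ.ar (P.v y)))
      (Sum.inl false) (fun i => Sum.inr i))
    refine Fin.cons_injective_iff.mpr ⟨by simp, Sum.inr_injective⟩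
  · exact ⟨Fin.succ l, rfl⟩
  · cases x with
    | false => exact ⟨fun _ => ⟨(0 : Fin (Γ.ar (P.v y) + 1)), rfl⟩, fun _ => rfl⟩
    | true =>
      refine ⟨fun h => absurd h Bool.false_ne_true, fun ⟨i, hi⟩ => ?_⟩
      change Fin (Γ.ar (P.v y) + 1) at i
      induction i using Fin.cases with
      | zero => cases hi
      | succ i => cases hi
  · change ∀ i : Fin (Γ.ar (P.v y) + 1), ((i : ℕ) + 3 = Γ.ar (P.v y) + 1 → _) ∧
      ((i : ℕ) + 2 = Γ.ar (P.v y) + 1 → _) ∧ ((i : ℕ) + 1 = Γ.ar (P.v y) + 1 → _)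
    intro i
    induction i using Fin.cases with
    | zero => exact ⟨fun h => by simp at h; omega, fun h => by simp at h; omega,
        fun h => by simp at h; omega⟩
    | succ i =>
      obtain ⟨h1, h2, h3⟩ := P.mark_eq y c a b hm i
      exact ⟨fun h => h1 (by simp at h; omega), fun h => h2 (by simp at h; omega),
        fun h => h3 (by simp at h; omega)⟩

theorem corolla_curvatureGraph (P : Pres Γ K st) {y : K.V} {z : ℤ} (hf : st.Fresh z) {x : K.S} {τ : ℤ}
    (hy : K.black y = false) (hm : st.mark y = none) (hq : st.QAt y x τ) (h1 : 1 = Γ.ar (P.v y)) :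
    P.Corolla y z (Sum.inl x, Sum.inr z, Sum.inr τ) (curvatureGraph.relabelE (finCongr h1))
      ![τ, z, z] := by
  obtain ⟨hb, ha⟩ := (P.q_iff y).mp ⟨hy, hm⟩
  have hτ : P.t (P.v y) = τ := (hq.2 _).mp (P.att_one y hb ha)
  have hτz : τ ≠ z := fun e => by
    have := (hq.2 τ).mpr rfl
    rw [e, hf.att_eq] at this
    cases this
  have hlab : ∀ i, P.lab (P.v y) i = Sum.inl x := by
    intro i
    cases h : P.lab (P.v y) i with
    | inl z' => rw [(hq.1 z').mp (P.lab_inl y i z' h).1]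
    | inr τ' =>
      have := (P.lab_inr y i τ' h).1
      rw [hb] at this
      cases this
  have hi : ∀ i : Fin 3, (curvatureGraph.relabelE (finCongr h1)).inp (2 : Fin 3) i =
    (![Sum.inr (finCongr h1 0), Sum.inl 1, Sum.inl 0] : Fin 3 → Fin 3 ⊕ Fin (Γ.ar (P.v y))) i := by
    intro i
    fin_cases i <;> rfl
  refine ⟨rfl, ?_, ?_, fun τ' => ?_, ?_, fun l => ?_, ?_, ?_⟩
  · change ∀ x : Fin 3, x ≠ 2 → _
    intro x hx
    fin_cases x
    · exact ⟨rfl, rfl⟩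
    · exact ⟨rfl, rfl⟩
    · exact absurd rfl hx
  · change ∀ x x' : Fin 3, (![true, true, false] : Fin 3 → Bool) x = true →
      (![true, true, false] : Fin 3 → Bool) x' = true →
      (![τ, z, z] : Fin 3 → ℤ) x = (![τ, z, z] : Fin 3 → ℤ) x' → x = x'
    intro x x' hx hx' h
    fin_cases x <;> fin_cases x' <;>
      first
      | rfl
      | exact absurd hx Bool.false_ne_true
      | exact absurd hx' Bool.false_ne_true
      | exact absurd h hτz
      | exact absurd h hτz.symm
  · change (∃ x : Fin 3, (![true, true, false] : Fin 3 → Bool) x = true ∧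
      (![τ, z, z] : Fin 3 → ℤ) x = τ') ↔ _
    rw [hb, hτ]
    constructor
    · rintro ⟨x, hx, rfl⟩
      fin_cases x
      · exact Or.inr ⟨rfl, rfl⟩
      · exact Or.inl rfl
      · exact absurd hx Bool.false_ne_true
    · rintro (rfl | ⟨-, rfl⟩)
      · exact ⟨1, rfl, rfl⟩
      · exact ⟨0, rfl, rfl⟩
  · change Function.Injective fun i : Fin 3 => (curvatureGraph.relabelE (finCongr h1)).inp (2 : Fin 3) i
    rw [funext hi]
    intro i i' h
    fin_cases i <;> fin_cases i' <;>
      first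
      | rfl
      | cases h
  · refine ⟨(0 : Fin 3), (hi 0).trans (congrArg Sum.inr (Fin.ext ?_))⟩
    have := l.2
    simp
    omega
  · change ∀ x : Fin 3, (![true, true, false] : Fin 3 → Bool) x = true ↔ ∃ i : Fin 3,
      (curvatureGraph.relabelE (finCongr h1)).inp (2 : Fin 3) i = Sum.inl x
    intro x
    fin_cases x
    · exact ⟨fun _ => ⟨2, hi 2⟩, fun _ => rfl⟩
    · exact ⟨fun _ => ⟨1, hi 1⟩, fun _ => rfl⟩
    · refine ⟨fun h => absurd h Bool.false_ne_true, fun ⟨i, h⟩ => ?_⟩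
      rw [hi] at h
      fin_cases i
      · cases h
      · exact absurd (Sum.inl_injective h) (by decide)
      · exact absurd (Sum.inl_injective h) (by decide)
  · change ∀ i : Fin 3, ((i : ℕ) + 3 = 3 → Sum.elim _ _
        ((curvatureGraph.relabelE (finCongr h1)).inp (2 : Fin 3) i) = _) ∧
      ((i : ℕ) + 2 = 3 → Sum.elim _ _
        ((curvatureGraph.relabelE (finCongr h1)).inp (2 : Fin 3) i) = _) ∧
      ((i : ℕ) + 1 = 3 → Sum.elim _ _
        ((curvatureGraph.relabelE (finCongr h1)).inp (2 : Fin 3) i) = _)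
    intro i
    rw [hi]
    fin_cases i
    · exact ⟨fun _ => hlab _, by simp, by simp⟩
    · exact ⟨by simp, fun _ => rfl, by simp⟩
    · exact ⟨by simp, by simp, fun _ => rfl⟩

section SubstSigns

variable (v : Γ.V) (g : Diagram (Γ.ar v) 1)

theorem _root_.GraphComplex.Diagram.invSign_subst_inr (S : Finset (Γ.subst v g).V)
    (hS : ∀ x, x ∈ S ↔ ∃ u : {u : Γ.V // u ≠ v}, Γ.black u = true ∧ Sum.inr u = x)
    (tg : g.V → ℤ) (t : Γ.V → ℤ) [DecidableEq Γ.V] :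
    invSign S (Γ.subst v g).zpos (Sum.elim tg (t ∘ Subtype.val)) =
      invSign (Γ.blacks.erase v) Γ.zpos t := by
  classical
  have h : S = (Finset.univ.filter fun u : {u : Γ.V // u ≠ v} => Γ.black u = true).image Sum.inr := by
    ext x
    rw [hS]
    simp
  have h' : Γ.blacks.erase v = (Finset.univ.filter
      fun u : {u : Γ.V // u ≠ v} => Γ.black u = true).image Subtype.val := by
    convert blacks_erase_eq Γ v
  rw [h]
  erw [invSign_image Sum.inr_injective.injOn]
  have h2 : invSign (Γ.blacks.erase v) Γ.zpos t = invSign (Finset.univ.filter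
      fun u : {u : Γ.V // u ≠ v} => Γ.black u = true) (Γ.zpos ∘ Subtype.val) (t ∘ Subtype.val) := by
    rw [h', invSign_image Subtype.val_injective.injOn]
  rw [h2]
  refine invSign_mono_left fun x _ y _ => ?_
  erw [Function.comp, Function.comp, subst_zpos_inr, subst_zpos_inr]
  exact add_lt_add_iff_left _

theorem _root_.GraphComplex.Diagram.toFront_subst_inr (S : Finset (Γ.subst v g).V)
    (hS : ∀ x, x ∈ S ↔ ∃ u : {u : Γ.V // u ≠ v}, Γ.black u = true ∧ Sum.inr u = x)
    (tg : g.V → ℤ) (t : Γ.V → ℤ) (x : g.V) (hx : tg x = t v) [DecidableEq Γ.V] :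
    toFront S (Sum.elim tg (t ∘ Subtype.val)) (Sum.inl x) = toFront (Γ.blacks.erase v) t v := by
  classical
  have h : S = (Finset.univ.filter fun u : {u : Γ.V // u ≠ v} => Γ.black u = true).image Sum.inr := by
    ext x
    rw [hS]
    simp
  have h' : Γ.blacks.erase v = (Finset.univ.filter
      fun u : {u : Γ.V // u ≠ v} => Γ.black u = true).image Subtype.val := by
    convert blacks_erase_eq Γ v
  have h2 : toFront (Γ.blacks.erase v) t v = ∏ u ∈ Finset.univ.filter
      (fun u : {u : Γ.V // u ≠ v} => Γ.black u = true), if t u < t v then (-1 : ℝ) else 1 := by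
    rw [toFront, h', Finset.prod_image Subtype.val_injective.injOn]
  rw [h2, h, toFront]
  erw [Finset.prod_image Sum.inr_injective.injOn]
  simp only [Sum.elim_inl, Sum.elim_inr, Function.comp, hx]

end SubstSigns

theorem sign_whiteQ (P : Pres Γ K st) {v : Γ.V} (hv : Γ.black v = false) (hA : Γ.IsAGraph) {z : ℤ}
    (hf : st.Fresh z) (ht : Set.InjOn (Sum.elim (fun _ : Bool => z) (P.t ∘ Subtype.val) :
      (Γ.subst v (whiteQ (Γ.ar v))).V → ℤ) (Γ.subst v (whiteQ (Γ.ar v))).blacks) :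
    Γ.frontSign v * invSign (Γ.subst v (whiteQ (Γ.ar v))).blacks
      (Γ.subst v (whiteQ (Γ.ar v))).zpos (Sum.elim (fun _ => z) (P.t ∘ Subtype.val)) = P.sgn := by
  classical
  have hp : Function.Injective (Γ.subst v (whiteQ (Γ.ar v))).zpos := fun a b h =>
    subst_pos_injective hA.2 (fun a b h => by cases a <;> cases b <;> simp_all [whiteQ])
      (Int.ofNat_inj.mp h)
  have h0 : (Sum.inl false : (Γ.subst v (whiteQ (Γ.ar v))).V) ∈
      (Γ.subst v (whiteQ (Γ.ar v))).blacks := mem_blacks.mpr rfl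
  rw [frontSign_eq, hv, if_neg Bool.false_ne_true, one_mul, invSign_erase h0 hp.injOn ht,
    toFront_of_le, toFront_of_le, one_mul, one_mul, invSign_subst_inr,
    Finset.erase_eq_of_notMem (fun h => by rw [mem_blacks, hv] at h; cases h), sgn]
  · rintro ((_ | _) | u)
    · exact ⟨fun h => absurd rfl (Finset.mem_erase.mp h).1, fun ⟨u, _, h⟩ => (Sum.inr_ne_inl h).elim⟩
    · exact ⟨fun h => absurd (mem_blacks.mp (Finset.mem_erase.mp h).2) Bool.false_ne_true,
        fun ⟨u, _, h⟩ => (Sum.inr_ne_inl h).elim⟩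
    · rw [Finset.mem_erase, mem_blacks]
      exact ⟨fun h => ⟨u, h.2, rfl⟩, fun ⟨u', h, e⟩ => ⟨Sum.inr_ne_inl, Sum.inr_injective e ▸ h⟩⟩
  · rintro (_ | u) h
    · exact le_rfl
    · exact (P.lt_t hf (x := u.1) (mem_blacks.mp (Finset.mem_erase.mp h).2 :)).le
  · exact fun x _ => Int.natCast_nonneg _

theorem sign_curvatureGraph (P : Pres Γ K st) {v : Γ.V} (hv : Γ.black v = true) (hA : Γ.IsAGraph)
    {z : ℤ} (hf : st.Fresh z) (h1 : 1 = Γ.ar v)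
    (ht : Set.InjOn (Sum.elim ![P.t v, z, z] (P.t ∘ Subtype.val) :
      (Γ.subst v (curvatureGraph.relabelE (finCongr h1))).V → ℤ)
      (Γ.subst v (curvatureGraph.relabelE (finCongr h1))).blacks) :
    Γ.frontSign v * invSign (Γ.subst v (curvatureGraph.relabelE (finCongr h1))).blacks
      (Γ.subst v (curvatureGraph.relabelE (finCongr h1))).zpos
      (Sum.elim ![P.t v, z, z] (P.t ∘ Subtype.val)) = - P.sgn := by
  classical
  set Γ' := Γ.subst v (curvatureGraph.relabelE (finCongr h1)) with hΓ'
  have hp : Function.Injective Γ'.zpos := fun a b h =>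
    subst_pos_injective hA.2 Fin.val_injective (Int.ofNat_inj.mp h)
  let x₀ : Γ'.V := Sum.inl (0 : Fin 3)
  let x₁ : Γ'.V := Sum.inl (1 : Fin 3)
  have hne : x₀ ≠ x₁ := fun h => absurd (Sum.inl_injective h : (0 : Fin 3) = 1) (by decide)
  have hx₁ : x₁ ∈ Γ'.blacks := mem_blacks.mpr rfl
  have hx₀ : x₀ ∈ Γ'.blacks.erase x₁ := Finset.mem_erase.mpr ⟨hne, mem_blacks.mpr rfl⟩
  have hS : ∀ x, x ∈ (Γ'.blacks.erase x₁).erase x₀ ↔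
      ∃ u : {u : Γ.V // u ≠ v}, Γ.black u = true ∧ Sum.inr u = x := by
    rintro (x | u)
    · rw [Finset.mem_erase, Finset.mem_erase, mem_blacks]
      refine ⟨fun ⟨h0, h1, h2⟩ => ?_, fun ⟨u, _, h⟩ => (Sum.inr_ne_inl h).elim⟩
      change Fin 3 at x
      change (![true, true, false] : Fin 3 → Bool) x = true at h2
      fin_cases x
      · exact absurd rfl h0
      · exact absurd rfl h1
      · cases h2
    · rw [Finset.mem_erase, Finset.mem_erase, mem_blacks]
      exact ⟨fun h => ⟨u, h.2.2, rfl⟩, fun ⟨u', h, e⟩ => ⟨Sum.inr_ne_inl, Sum.inr_ne_inl,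
        Sum.inr_injective e ▸ h⟩⟩
  have e1 : toFront (Γ'.blacks.erase x₁) Γ'.zpos x₁ = -1 := by
    rw [toFront, ← Finset.mul_prod_erase _ _ hx₀, if_pos (show Γ'.zpos x₀ < Γ'.zpos x₁ from Int.ofNat_lt.mpr (zero_lt_one : 0 < 1)), Finset.prod_eq_one, mul_one]
    intro x hx
    obtain ⟨u, -, rfl⟩ := (hS x).mp hx
    exact if_neg (subst_zpos_lt Γ v (curvatureGraph.relabelE (finCongr h1)) (1 : Fin 3) u).not_gt
  have e2 : toFront (Γ'.blacks.erase x₁) (Sum.elim ![P.t v, z, z] (P.t ∘ Subtype.val)) x₁ = 1 := by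
    refine toFront_of_le ?_
    rintro (x | u) hx
    · change Fin 3 at x
      change z ≤ ![P.t v, z, z] x
      fin_cases x
      · exact (P.lt_t hf hv).le
      · exact le_rfl
      · exact le_rfl
    · exact (P.lt_t hf (x := u.1) (mem_blacks.mp (Finset.mem_erase.mp hx).2 :)).le
  have e3 : toFront ((Γ'.blacks.erase x₁).erase x₀) Γ'.zpos x₀ = 1 :=
    toFront_of_le fun x _ => Int.natCast_nonneg _
  rw [invSign_erase hx₁ hp.injOn ht, e1, e2, invSign_erase hx₀ hp.injOn
    (ht.mono (Finset.coe_subset.mpr (Finset.erase_subset _ _))), e3,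
    toFront_subst_inr v _ _ hS _ _ (0 : Fin 3) rfl, invSign_subst_inr v _ _ hS, sgn,
    invSign_erase (mem_blacks.mpr hv) hA.zpos_injective.injOn P.t_injOn, frontSign_eq, if_pos hv]
  ring_nf

end Pres

/-- The part of the image of a vertex that does not change the number of vertices other than the
univalent black ones. -/
def leading : (black : Bool) → (n : ℕ) → Diagram n 1 →₀ ℝ
  | true, 1 => - Finsupp.single curvatureGraph (1 / 2)
  | true, _ => 0
  | false, n => Finsupp.single (whiteQ n) 1

theorem leading_one {n : ℕ} (h : 1 = n) : leading true n =
    - Finsupp.single (curvatureGraph.relabelE (finCongr h)) (1 / 2) := by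
  subst h
  exact congrArg (fun g => - Finsupp.single g (1 / 2 : ℝ)) (relabelE_refl _).symm

theorem leading_ne {n : ℕ} (h : n ≠ 1) : leading true n = 0 := by
  match n with
  | 0 => rfl
  | 1 => exact absurd rfl h
  | n + 2 => rfl

namespace Pres

variable {Γ : Diagram p q} {st : Marking K}

theorem leading_eq_dAt (P : Pres Γ K st) (hst : st.Good) (hA : Γ.IsAGraph) {z : ℤ}
    (hf : st.Fresh z) (y : K.V) :
    (P.sgn * Γ.frontSign (P.v y)) • substL Γ (P.v y) (leading (Γ.black (P.v y)) (Γ.ar (P.v y))) =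
      st.dAt z y := by
  cases hy : K.black y with
  | true =>
    obtain ⟨h1, h2⟩ := (P.black_iff y).mp hy
    rw [h1, leading_ne (by omega), map_zero, smul_zero, Marking.dAt_of_black hy]
  | false =>
    obtain ⟨m, t, hm⟩ := hst.exists_insMark hy z
    rw [Marking.dAt_eq hy hm]
    cases hm with
    | white m h =>
      obtain ⟨c, a, b⟩ := m
      have hw : Γ.black (P.v y) = false := by
        by_contra h'
        rw [Bool.not_eq_false, ← P.mark_iff, h] at h'
        cases h'
      have hc := P.corolla_whiteQ z h (hA.3 _ hw)
      have hgp : Function.Injective (whiteQ (Γ.ar (P.v y))).pos := fun a b h => by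
        cases a <;> cases b <;> simp_all [whiteQ]
      obtain ⟨P', hP'⟩ := hc.exists_pres hst hf hy
      have ht := P'.t_injOn
      rw [hP'] at ht
      have h1 := P.sign_whiteQ hw hA hf ht
      rw [hw, leading, substL_single, one_smul,
        hc.cls_eq hst hA hgp hf hy (Marking.InsMark.white _ h), smul_smul, mul_assoc]
      refine congrArg (· • _) ((congrArg (P.sgn * ·) h1).trans P.sgn_mul_self)
    | black x τ h hq =>
      obtain ⟨hb, ha⟩ := (P.q_iff y).mp ⟨hy, h⟩
      have hτ : P.t (P.v y) = τ := (hq.2 _).mp (P.att_one y hb ha)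
      have hc := P.corolla_curvatureGraph hf hy h hq ha.symm
      rw [← hτ] at hc hq ⊢
      obtain ⟨P', hP'⟩ := hc.exists_pres hst hf hy
      have ht := P'.t_injOn
      rw [hP'] at ht
      have h1 := P.sign_curvatureGraph hb hA hf ha.symm ht
      rw [hb, leading_one ha.symm, map_neg, substL_single,
        hc.cls_eq hst hA Fin.val_injective hf hy (Marking.InsMark.black _ _ h hq), smul_smul,
        ← neg_smul, smul_smul]
      refine congrArg (· • _) ?_
      generalize invSign _ _ _ = s at *
      linear_combination (-(1 / 2 : ℝ) * P.sgn) * h1 + (1 / 2 : ℝ) * P.sgn_mul_self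

/-- The sum of the terms of the differential that preserve the skeleton. -/
theorem sum_leading (P : Pres Γ K st) (hst : st.Good) (hA : Γ.IsAGraph) {z : ℤ}
    (hf : st.Fresh z) : P.sgn • ∑ v, Γ.frontSign v • substL Γ v (leading (Γ.black v) (Γ.ar v)) =
      st.dnet z := by
  classical
  rw [Marking.dnet, Finset.smul_sum]
  simp only [smul_smul]
  rw [← Finset.sum_congr rfl fun y _ => P.leading_eq_dAt hst hA hf y,
    ← Finset.sum_image (s := Finset.univ) (g := P.v) (f := fun v => (P.sgn * Γ.frontSign v) •
      substL Γ v (leading (Γ.black v) (Γ.ar v))) P.v_inj.injOn]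
  symm
  refine Finset.sum_subset (Finset.subset_univ _) fun x _ hx => ?_
  have hu : Γ.IsUnivalentBlack x := by
    by_contra h
    obtain ⟨y, rfl⟩ := (P.v_range x).mpr h
    exact hx (Finset.mem_image_of_mem _ (Finset.mem_univ y))
  rw [hu.1, leading_ne (by rw [hu.2]; omega), map_zero, smul_zero]

end Pres

/-! ### The other terms of the differential -/

/-- Connectedness is inherited along a map that preserves edges and reaches all vertices. -/
theorem connected_of_map {V W : Type*} {r : V → V → Prop} {r' : W → W → Prop} (f : V → W)
    (hf : ∀ u w, r u w → (SimpleGraph.fromRel r').Reachable (f u) (f w))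
    (hs : ∀ w, ∃ u, (SimpleGraph.fromRel r').Reachable (f u) w)
    (h : (SimpleGraph.fromRel r).Connected) : (SimpleGraph.fromRel r').Connected := by
  have key : ∀ u w, (SimpleGraph.fromRel r).Reachable u w →
      (SimpleGraph.fromRel r').Reachable (f u) (f w) := by
    rintro u w ⟨c⟩
    induction c with
    | nil => exact SimpleGraph.Reachable.refl _
    | cons h' _ ih =>
      rw [SimpleGraph.fromRel_adj] at h'
      rcases h'.2 with h' | h'
      · exact (hf _ _ h').trans ih
      · exact (hf _ _ h').symm.trans ih
  have := h.nonempty.map f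
  refine ⟨fun w w' => ?_⟩
  obtain ⟨u, hu⟩ := hs w
  obtain ⟨u', hu'⟩ := hs w'
  exact hu.symm.trans ((key _ _ (h.preconnected u u')).trans hu')

theorem reachable_of_rel {V : Type*} {r : V → V → Prop} {u w : V} (h : r u w) :
    (SimpleGraph.fromRel r).Reachable u w := by
  by_cases e : u = w
  · rw [e]
  · exact SimpleGraph.Adj.reachable ((SimpleGraph.fromRel_adj _ _ _).mpr ⟨e, Or.inl h⟩)

namespace Diagram

/-- The number of vertices other than the univalent black ones. -/
def numCore (Γ : Diagram p q) : ℕ := Nat.card {x : Γ.V // ¬ Γ.IsUnivalentBlack x}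

/-- The graph has a white or bivalent black vertex, and there is a vertex, not a univalent black one,
for which the number of incoming edges that do not come from univalent black vertices is not one. -/
structure Mixed (Γ : Diagram p q) : Prop where
  light : ∃ x, ¬ Γ.IsUnivalentBlack x ∧ ¬ (Γ.black x = true ∧ 2 ≤ Γ.ar x)
  branch : ¬ ∀ x, ¬ Γ.IsUnivalentBlack x → ∃! i, Γ.Thick x i

/-- In a connected graph with at least two vertices a univalent black vertex is joined to some
vertex. -/
theorem Connected.exists_inp {Γ : Diagram p q} (h : Γ.Connected) {u x : Γ.V}
    (hu : Γ.IsUnivalentBlack u) (hx : x ≠ u) : ∃ w i, Γ.inp w i = Sum.inl u := by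
  have : Nontrivial Γ.V := ⟨⟨x, u, hx⟩⟩
  obtain ⟨w, hw⟩ := h.preconnected.exists_adj_of_nontrivial u
  rw [SimpleGraph.fromRel_adj] at hw
  rcases hw.2 with ⟨i, hi⟩ | ⟨i, hi⟩
  · exact ⟨w, i, hi⟩
  · exact Fin.elim0 (hu.2 ▸ i)

theorem Connected.proper {Γ : Diagram p q} (h : Γ.Connected) (hA : Γ.IsAGraph) {x : Γ.V}
    (hx : ¬ Γ.IsUnivalentBlack x) : Γ.Proper := by
  refine ⟨hA, fun j hj => ?_⟩
  obtain ⟨w, i, hi⟩ := h.exists_inp (x := x) hj fun e => hx (e ▸ hj)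
  have : Γ.feed (Sum.inl ⟨w, i⟩) = Γ.feed (Sum.inr j) := hi
  cases hA.feed_bijective.1 this

/-- The graph `g` consists of at least two vertices, not counting univalent black vertices, and may
be put in the place of a vertex with `n` incoming edges, black if `b` is true: it has the properties
that are needed for the numbers of vertices of various kinds to change as expected. -/
structure Heavy (b : Bool) (g : Diagram n 1) : Prop where
  connected : g.Connected
  leg : ∀ l, ∃ x i, g.inp x i = Sum.inr l
  numBlack : g.numBlack = b.toNat + 1
  numCore : 2 ≤ g.numCore
  out_not : ¬ g.IsUnivalentBlack (g.out 0)
  light : b = false ∨ n ≤ 1 → ∃ x, ¬ g.IsUnivalentBlack x ∧ ¬ (g.black x = true ∧ 2 ≤ g.ar x)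

section Heavy

theorem connected_of_root {Γ : Diagram p q} (r : Γ.V) (h : ∀ x, x ≠ r → ∃ i, Γ.inp r i = Sum.inl x) :
    Γ.Connected := by
  have : Nonempty Γ.V := ⟨r⟩
  have key : ∀ x, (SimpleGraph.fromRel fun u w : Γ.V => ∃ i, Γ.inp w i = Sum.inl u).Reachable x r := by
    intro x
    by_cases e : x = r
    · rw [e]
    · exact reachable_of_rel (h x e)
  exact ⟨fun x y => (key x).trans (key y).symm⟩

theorem numCore_eq_card {Γ : Diagram p q} (h : ∀ x, ¬ Γ.IsUnivalentBlack x) :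
    Γ.numCore = Nat.card Γ.V := by
  rw [numCore]
  exact Nat.card_congr (Equiv.subtypeUnivEquiv h)

theorem heavy_blackString : Heavy true blackString := by
  have h : ∀ x, ¬ blackString.IsUnivalentBlack x := fun x hx => by cases hx.2
  refine ⟨connected_of_root (1 : Fin 2) ?_, fun l => ⟨(0 : Fin 2), (0 : Fin 1), ?_⟩, ?_, ?_, h _,
    fun _ => ⟨(0 : Fin 2), h _, fun h => absurd h.2 (by decide)⟩⟩
  · change ∀ x : Fin 2, x ≠ 1 → ∃ i, blackString.inp (1 : Fin 2) i = Sum.inl x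
    intro x hx
    fin_cases x
    · exact ⟨(0 : Fin 1), rfl⟩
    · exact absurd rfl hx
  · exact congrArg Sum.inr (Subsingleton.elim _ _)
  · rw [Diagram.numBlack, Nat.card_congr (Equiv.subtypeUnivEquiv fun _ => rfl)]
    exact Nat.card_fin 2
  · rw [numCore_eq_card h]
    exact (Nat.card_fin 2).ge

theorem numBlack_bool {g : Diagram n 1} (e : Bool ≃ g.V) (x : Bool) (h1 : g.black (e x) = true)
    (h2 : g.black (e !x) = false) : g.numBlack = 1 := by
  rw [numBlack_eq_card, Finset.card_eq_one]
  refine ⟨e x, ?_⟩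
  ext y
  obtain ⟨y, rfl⟩ := e.surjective y
  rw [mem_blacks, Finset.mem_singleton, e.injective.eq_iff]
  by_cases hy : y = x
  · simp [hy, h1]
  · rw [Bool.eq_not.mpr hy, h2]
    simp

theorem heavy_blackSplit {I : Finset (Fin n)} (h2 : 2 ≤ I.card) :
    Heavy true (blackSplit n I) := by
  have h : ∀ x, ¬ (blackSplit n I).IsUnivalentBlack x := by
    rintro (_ | _) hx
    · cases hx.2
    · have h0 : I.card = 0 := hx.2
      omega
  refine ⟨connected_of_root false ?_, fun l => ?_, ?_, ?_, h _, fun hn => ?_⟩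
  · rintro (_ | _) hx
    · exact absurd rfl hx
    · exact ⟨Fin.last Iᶜ.card, Fin.snoc_last (α := fun _ => Bool ⊕ Fin n) (Sum.inl true)
        fun i => Sum.inr (Iᶜ.orderEmbOfFin rfl i)⟩
  · by_cases hl : l ∈ I
    · obtain ⟨i, hi⟩ : l ∈ Set.range (I.orderEmbOfFin rfl) := by simpa using hl
      exact ⟨true, i, congrArg Sum.inr hi⟩
    · obtain ⟨i, hi⟩ : l ∈ Set.range (Iᶜ.orderEmbOfFin rfl) := by simpa using hl
      exact ⟨false, i.castSucc, (Fin.snoc_castSucc (α := fun _ => Bool ⊕ Fin n) (Sum.inl true)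
        (fun i => Sum.inr (Iᶜ.orderEmbOfFin rfl i)) i).trans (congrArg Sum.inr hi)⟩
  · rw [Diagram.numBlack, Nat.card_congr (Equiv.subtypeUnivEquiv fun _ => rfl)]
    exact (Nat.card_eq_fintype_card (α := Bool)).trans Fintype.card_bool
  · rw [numCore_eq_card h]
    exact ((Nat.card_eq_fintype_card (α := Bool)).trans Fintype.card_bool).ge
  · have := Finset.card_le_univ I
    rw [Fintype.card_fin] at this
    rcases hn with hn | hn
    · cases hn
    · omega

theorem heavy_whiteOut (n : ℕ) : Heavy false (whiteOut n) := by
  have h : ∀ x, ¬ (whiteOut n).IsUnivalentBlack x := by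
    rintro (_ | _) hx
    · exact Bool.false_ne_true hx.1
    · cases hx.2
  refine ⟨connected_of_root true ?_, fun l => ⟨false, l, rfl⟩,
    numBlack_bool (Equiv.refl Bool) true rfl rfl, ?_, h _,
    fun _ => ⟨false, h _, fun h => Bool.false_ne_true h.1⟩⟩
  · rintro (_ | _) hx
    · exact ⟨(0 : Fin 1), rfl⟩
    · exact absurd rfl hx
  · rw [numCore_eq_card h]
    exact ((Nat.card_eq_fintype_card (α := Bool)).trans Fintype.card_bool).ge

theorem heavy_whiteIn (n : ℕ) (k : Fin n) : Heavy false (whiteIn n k) := by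
  have h : ∀ x, ¬ (whiteIn n k).IsUnivalentBlack x := by
    rintro (_ | _) hx
    · cases hx.2
    · exact Bool.false_ne_true hx.1
  refine ⟨connected_of_root true ?_, fun l => ?_,
    numBlack_bool (Equiv.refl Bool) false rfl rfl, ?_, h _,
    fun _ => ⟨true, h _, fun h => Bool.false_ne_true h.1⟩⟩
  · rintro (_ | _) hx
    · exact ⟨k, if_pos rfl⟩
    · exact absurd rfl hx
  · by_cases hl : l = k
    · exact ⟨false, (0 : Fin 1), congrArg Sum.inr hl.symm⟩
    · exact ⟨true, l, if_neg hl⟩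
  · rw [numCore_eq_card h]
    exact ((Nat.card_eq_fintype_card (α := Bool)).trans Fintype.card_bool).ge

theorem heavy_of_numWhite {g : Diagram n 1} (hA : g.IsAGraph) (hc : g.Connected)
    (hb : g.numBlack = 1) (hw : 2 ≤ g.numWhite) : Heavy false g := by
  have hwu : ∀ x, g.black x = false → ¬ g.IsUnivalentBlack x := fun x hx h => by
    rw [h.1] at hx
    cases hx
  have hne : Nonempty {v : g.V // g.black v = false} := by
    by_contra h
    rw [not_nonempty_iff] at h
    rw [numWhite, Nat.card_of_isEmpty] at hw
    omega
  obtain ⟨x, hx⟩ := hne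
  refine ⟨hc, fun l => ?_, hb, hw.trans (Nat.card_mono (Set.toFinite _) hwu),
    (hc.proper hA (hwu x hx)).out_not 0, fun _ => ⟨x, hwu x hx, fun h => by rw [hx] at h; cases h.1⟩⟩
  obtain ⟨⟨y, i⟩ | j, h⟩ := hA.feed_bijective.2 (Sum.inr l)
  · exact ⟨y, i, h⟩
  · cases h

/-- The terms in the image of a vertex, other than the leading ones. -/
theorem vertexDiff_sub_leading_mem {C : (n : ℕ) → Diagram n 1 →₀ ℝ} (hC : IsCompletion C) :
    ∀ (b : Bool) (n : ℕ), (b = false → 3 ≤ n) →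
      vertexDiff C b n - leading b n ∈ Submodule.span ℝ
        {x | ∃ g : Diagram n 1, Heavy b g ∧ x = Finsupp.single g 1}
  | true, 0, _ => by
    rw [vertexDiff, leading, sub_zero]
    · exact zero_mem _
    · omega
  | true, 1, _ => by
    rw [vertexDiff, leading, sub_neg_eq_add, sub_add_cancel]
    exact Submodule.subset_span ⟨_, heavy_blackString, rfl⟩
  | true, 2, _ => by
    rw [vertexDiff, leading, sub_zero]
    · exact zero_mem _
    · omega
  | true, n + 3, _ => by
    rw [vertexDiff, leading, sub_zero]
    · refine Submodule.sum_mem _ fun I hI => Submodule.subset_span ⟨_, ?_, rfl⟩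
      obtain ⟨h1, -⟩ := (Finset.mem_filter.mp hI).2
      exact heavy_blackSplit h1
    · omega
  | false, n, h => by
    have e : vertexDiff C false n - leading false n = - Finsupp.single (whiteOut n) 1 +
        ∑ k : Fin n, Finsupp.single (whiteIn n k) 1 + C n := by
      rw [vertexDiff, leading]
      abel
    rw [e]
    refine Submodule.add_mem _ (Submodule.add_mem _ (Submodule.neg_mem _
      (Submodule.subset_span ⟨_, heavy_whiteOut n, rfl⟩)) (Submodule.sum_mem _ fun k _ =>
        Submodule.subset_span ⟨_, heavy_whiteIn n k, rfl⟩)) ?_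
    rw [← Finsupp.sum_single (C n)]
    refine Submodule.sum_mem _ fun g hg => ?_
    obtain ⟨h1, h2, h3, h4⟩ := hC.supported n (h rfl) g hg
    have : Finsupp.single g (C n g) = C n g • Finsupp.single g 1 := by
      rw [Finsupp.smul_single, smul_eq_mul, mul_one]
    rw [this]
    exact Submodule.smul_mem _ _ (Submodule.subset_span ⟨g, heavy_of_numWhite h1 h2 h3 h4, rfl⟩)

end Heavy

section Subst

variable {Γ : Diagram p q} {v : Γ.V} {g : Diagram (Γ.ar v) 1}

theorem subst_connected (hΓ : Γ.Connected) (hg : g.Connected)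
    (hl : ∀ l, ∃ x i, g.inp x i = Sum.inr l) : (Γ.subst v g).Connected := by
  have hin : ∀ x x', (SimpleGraph.fromRel fun u w : (Γ.subst v g).V =>
      ∃ i, (Γ.subst v g).inp w i = Sum.inl u).Reachable (Sum.inl x) (Sum.inl x') := by
    intro x x'
    have key : ∀ x x' : g.V, (SimpleGraph.fromRel fun u w : g.V =>
        ∃ i, g.inp w i = Sum.inl u).Reachable x x' →
        (SimpleGraph.fromRel fun u w : (Γ.subst v g).V =>
          ∃ i, (Γ.subst v g).inp w i = Sum.inl u).Reachable (Sum.inl x) (Sum.inl x') := by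
      rintro x x' ⟨c⟩
      induction c with
      | nil => exact SimpleGraph.Reachable.refl _
      | cons h' _ ih =>
        rw [SimpleGraph.fromRel_adj] at h'
        have hr : ∀ a b : g.V, (∃ i, g.inp b i = Sum.inl a) →
            ∃ i, (Γ.subst v g).inp (Sum.inl b) i = Sum.inl (Sum.inl a) :=
          fun a b ⟨i, hi⟩ => ⟨i, congrArg (Γ.glue v g) hi⟩
        rcases h'.2 with h' | h'
        · exact SimpleGraph.Reachable.trans (reachable_of_rel (hr _ _ h')) ih
        · exact SimpleGraph.Reachable.trans (reachable_of_rel (hr _ _ h')).symm ih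
    exact key x x' (hg.preconnected x x')
  refine connected_of_map (Γ.vert v g) (fun u w => ?_) (fun w => ?_) hΓ
  · rintro ⟨i, hi⟩
    by_cases e : w = v
    · subst e
      obtain ⟨x, j, hj⟩ := hl i
      rw [vert_self]
      have hr : ∃ i, (Γ.subst w g).inp (Sum.inl x) i = Sum.inl (Γ.vert w g u) :=
        ⟨j, (congrArg (Γ.glue w g) hj).trans (congrArg (Sum.map (Γ.vert w g) id) hi)⟩
      exact SimpleGraph.Reachable.trans (reachable_of_rel hr) (hin x _)
    · rw [vert_ne Γ v g e]
      have hr : ∃ i, (Γ.subst v g).inp (Sum.inr ⟨w, e⟩) i = Sum.inl (Γ.vert v g u) :=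
        ⟨i, congrArg (Sum.map (Γ.vert v g) id) hi⟩
      exact reachable_of_rel hr
  · rcases w with x | u
    · exact ⟨v, by rw [vert_self]; exact hin _ _⟩
    · exact ⟨u, by rw [vert_ne Γ v g u.2]⟩

theorem subst_numBlack : (Γ.subst v g).numBlack + (Γ.black v).toNat = g.numBlack + Γ.numBlack := by
  classical
  have h1 : (Γ.subst v g).blacks.card = g.blacks.card + (Γ.blacks.erase v).card := by
    rw [subst_blacks, Finset.card_union_of_disjoint, Finset.card_image_of_injective _ Sum.inl_injective,
      Finset.card_image_of_injective _ Sum.inr_injective]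
    · congr 1
      have h' : Γ.blacks.erase v = (Finset.univ.filter
          fun u : {u : Γ.V // u ≠ v} => Γ.black u = true).image Subtype.val := by
        convert blacks_erase_eq Γ v
      rw [h', Finset.card_image_of_injective _ Subtype.val_injective]
    · rw [Finset.disjoint_left]
      simp
  rw [numBlack_eq_card, numBlack_eq_card, numBlack_eq_card, h1, add_assoc]
  congr 1
  cases hb : Γ.black v with
  | true => exact Finset.card_erase_add_one (mem_blacks.mpr hb)
  | false =>
    rw [Finset.erase_eq_of_notMem fun h => by rw [mem_blacks, hb] at h; cases h]
    rfl

theorem subst_numCore (hv : ¬ Γ.IsUnivalentBlack v) :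
    (Γ.subst v g).numCore + 1 = g.numCore + Γ.numCore := by
  classical
  have e1 : {x : (Γ.subst v g).V // ¬ (Γ.subst v g).IsUnivalentBlack x} ≃
      {x : g.V // ¬ g.IsUnivalentBlack x} ⊕
        {u : {u : Γ.V // u ≠ v} // ¬ Γ.IsUnivalentBlack u} := Equiv.subtypeSum
  have e2 : {x : Γ.V // ¬ Γ.IsUnivalentBlack x} ≃
      Option {u : {u : Γ.V // u ≠ v} // ¬ Γ.IsUnivalentBlack u} :=
    { toFun := fun x => if h : x.1 = v then none else some ⟨⟨x.1, h⟩, x.2⟩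
      invFun := fun o => o.elim ⟨v, hv⟩ fun u => ⟨u.1.1, u.2⟩
      left_inv := fun x => by
        by_cases h : x.1 = v
        · simp [h, Subtype.ext_iff]
        · simp [h]
      right_inv := fun o => by
        rcases o with _ | u
        · simp
        · simp [u.1.2] }
  rw [numCore, Nat.card_congr e1, Nat.card_sum, numCore, numCore, Nat.card_congr e2,
    Finite.card_option, add_assoc]

theorem subst_thick_inr (hv : ¬ Γ.IsUnivalentBlack v) (hg : ¬ g.IsUnivalentBlack (g.out 0))
    (u : {u : Γ.V // u ≠ v}) (i : Fin (Γ.ar u)) :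
    (Γ.subst v g).Thick (Sum.inr u) i ↔ Γ.Thick u i := by
  change (∀ w, Sum.map (Γ.vert v g) id (Γ.inp u i) = Sum.inl w → _) ↔ ∀ w, Γ.inp u i = Sum.inl w → _
  cases Γ.inp u i with
  | inr l => simp
  | inl w =>
    simp only [Sum.map_inl, Sum.inl.injEq, forall_eq']
    by_cases e : w = v
    · subst e
      rw [vert_self]
      exact ⟨fun _ => hv, fun _ => hg⟩
    · rw [vert_ne Γ v g e]
      exact Iff.rfl

theorem subst_light (h : Heavy (Γ.black v) g) (hΓ : Γ.Mixed) :
    ∃ x, ¬ (Γ.subst v g).IsUnivalentBlack x ∧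
      ¬ ((Γ.subst v g).black x = true ∧ 2 ≤ (Γ.subst v g).ar x) := by
  obtain ⟨x, hx1, hx2⟩ := hΓ.light
  by_cases hv : Γ.black v = true ∧ 2 ≤ Γ.ar v
  · have e : x ≠ v := fun e => hx2 (e ▸ hv)
    exact ⟨Sum.inr ⟨x, e⟩, hx1, hx2⟩
  · obtain ⟨y, h1, h2⟩ := h.light (by
      by_cases hb : Γ.black v = false
      · exact Or.inl hb
      · rw [Bool.not_eq_false] at hb
        exact Or.inr (by simp only [hb, true_and] at hv; omega))
    exact ⟨Sum.inl y, h1, h2⟩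

end Subst

end Diagram

/-! ### Properties of graphs that are determined by the skeleton -/

namespace Skeleton

/-- Connected skeletons. -/
def Connected (K : Skeleton p q) : Prop :=
  (SimpleGraph.fromRel fun u w : K.V => ∃ z, K.tgt z = w ∧ K.src z = Sum.inl u).Connected

/-- The skeletons of graphs with `Diagram.Mixed`. -/
structure Mixed (K : Skeleton p q) : Prop where
  light : ∃ y, K.black y = false
  branch : ¬ Function.Bijective K.tgt

end Skeleton

namespace Pres

variable {Γ : Diagram p q} {st : Marking K}

/-- The vertices of the skeleton are the vertices of the graph that are not univalent and black. -/
def vEquiv (P : Pres Γ K st) : K.V ≃ {x : Γ.V // ¬ Γ.IsUnivalentBlack x} :=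
  Equiv.ofBijective (fun y => ⟨P.v y, P.not_univ y⟩)
    ⟨fun _ _ h => P.v_inj (congrArg Subtype.val h), fun x => by
      obtain ⟨y, hy⟩ := (P.v_range x.1).mpr x.2
      exact ⟨y, Subtype.ext hy⟩⟩

theorem numCore_eq (P : Pres Γ K st) : Γ.numCore = Nat.card K.V := (Nat.card_congr P.vEquiv).symm

theorem numBlack_eq (P : Pres Γ K st) (hst : st.Good) : Γ.numBlack = st.labels.card := by
  classical
  rw [numBlack_eq_card, ← P.image_blacks hst, Finset.card_image_of_injOn P.t_injOn]

theorem existsUnique_thick_iff (P : Pres Γ K st) (y : K.V) :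
    (∃! i, Γ.Thick (P.v y) i) ↔ ∃! z, K.tgt z = y := by
  have hthick : ∀ i, Γ.Thick (P.v y) i ↔ ∃ z, P.lab (P.v y) i = Sum.inl z := by
    intro i
    cases h : P.lab (P.v y) i with
    | inl z => exact ⟨fun _ => ⟨z, rfl⟩, fun _ => P.thick_of_lab_inl h⟩
    | inr τ => exact ⟨fun h' => absurd h' (P.univ_of_lab_inr h), fun ⟨_, h'⟩ => by cases h'⟩
  constructor
  · rintro ⟨i, hi, hu⟩
    obtain ⟨z, hz⟩ := (hthick i).mp hi
    refine ⟨z, (P.lab_inl y i z hz).1, fun z' hz' => ?_⟩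
    obtain ⟨i', hi'⟩ := P.surj_inl y z' hz'
    rw [hu i' ((hthick i').mpr ⟨z', hi'⟩), hz] at hi'
    exact (Sum.inl_injective hi').symm
  · rintro ⟨z, hz, hu⟩
    obtain ⟨i, hi⟩ := P.surj_inl y z hz
    refine ⟨i, (hthick i).mpr ⟨z, hi⟩, fun i' hi' => ?_⟩
    obtain ⟨z', hz'⟩ := (hthick i').mp hi'
    rw [hu z' (P.lab_inl y i' z' hz').1, ← hi] at hz'
    exact P.lab_inj y hz'

theorem branch_iff (P : Pres Γ K st) :
    (∀ x, ¬ Γ.IsUnivalentBlack x → ∃! i, Γ.Thick x i) ↔ Function.Bijective K.tgt := by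
  rw [Function.bijective_iff_existsUnique]
  constructor
  · exact fun h y => (P.existsUnique_thick_iff y).mp (h _ (P.not_univ y))
  · intro h x hx
    obtain ⟨y, rfl⟩ := (P.v_range x).mpr hx
    exact (P.existsUnique_thick_iff y).mpr (h y)

theorem mixed_iff (P : Pres Γ K st) : Γ.Mixed ↔ K.Mixed := by
  have h : (∃ x, ¬ Γ.IsUnivalentBlack x ∧ ¬ (Γ.black x = true ∧ 2 ≤ Γ.ar x)) ↔
      ∃ y, K.black y = false := by
    constructor
    · rintro ⟨x, hx, h⟩
      obtain ⟨y, rfl⟩ := (P.v_range x).mpr hx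
      rw [← P.black_iff, Bool.not_eq_true] at h
      exact ⟨y, h⟩
    · rintro ⟨y, hy⟩
      refine ⟨P.v y, P.not_univ y, ?_⟩
      rw [← P.black_iff, hy]
      simp
  exact ⟨fun ⟨h1, h2⟩ => ⟨h.mp h1, fun h' => h2 (P.branch_iff.mpr h')⟩,
    fun ⟨h1, h2⟩ => ⟨h.mpr h1, fun h' => h2 (P.branch_iff.mp h')⟩⟩

/-- Edges of the skeleton are edges of the graph. -/
theorem exists_inp_iff (P : Pres Γ K st) (u w : K.V) :
    (∃ z, K.tgt z = w ∧ K.src z = Sum.inl u) ↔ ∃ i, Γ.inp (P.v w) i = Sum.inl (P.v u) := by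
  constructor
  · rintro ⟨z, hz, hs⟩
    obtain ⟨i, hi⟩ := P.surj_inl w z hz
    exact ⟨i, by rw [(P.lab_inl w i z hi).2, hs]; rfl⟩
  · rintro ⟨i, hi⟩
    cases h : P.lab (P.v w) i with
    | inl z =>
      obtain ⟨h1, h2⟩ := P.lab_inl w i z h
      refine ⟨z, h1, ?_⟩
      rw [hi] at h2
      cases hs : K.src z with
      | inl u' =>
        rw [hs] at h2
        rw [P.v_inj (Sum.inl_injective h2)]
      | inr l =>
        rw [hs] at h2
        cases h2
    | inr τ =>
      obtain ⟨-, -, x, h1, h2, -⟩ := P.lab_inr w i τ h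
      rw [hi] at h2
      exact absurd (Sum.inl_injective h2 ▸ h1) (P.not_univ u)

theorem exists_attached (P : Pres Γ K st) (hst : st.Good) {x : Γ.V} (hx : Γ.IsUnivalentBlack x) :
    ∃ y i, Γ.inp (P.v y) i = Sum.inl x := by
  have h1 : st.att (P.t x) ≠ none := (P.t_att _).mpr ⟨x, hx.1, by rw [hx.2]; omega, rfl⟩
  obtain ⟨y, hy⟩ := Option.ne_none_iff_exists'.mp h1
  obtain ⟨x', h2, h3, h4⟩ := (P.att_iff hst _ y).mp hy
  obtain rfl := P.t_inj _ _ h2 hx.1 h3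
  rcases h4 with ⟨rfl, -⟩ | ⟨-, h4⟩
  · exact absurd hx (P.not_univ y)
  · exact ⟨y, h4⟩

theorem connected_iff (P : Pres Γ K st) (hst : st.Good) : Γ.Connected ↔ K.Connected := by
  classical
  have hf : ∀ x, ∃ y, P.v y = x ∨ ∃ i, Γ.IsUnivalentBlack x ∧ Γ.inp (P.v y) i = Sum.inl x := by
    intro x
    by_cases hx : Γ.IsUnivalentBlack x
    · obtain ⟨y, i, h⟩ := P.exists_attached hst hx
      exact ⟨y, Or.inr ⟨i, hx, h⟩⟩
    · obtain ⟨y, hy⟩ := (P.v_range x).mpr hx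
      exact ⟨y, Or.inl hy⟩
  choose f hf using hf
  have hfv : ∀ y, f (P.v y) = y := fun y => by
    rcases hf (P.v y) with h | ⟨i, h, -⟩
    · exact P.v_inj h
    · exact absurd h (P.not_univ y)
  constructor
  · intro h
    refine connected_of_map f (fun u w => ?_) (fun y => ⟨P.v y, by rw [hfv]⟩) h
    rintro ⟨i, hi⟩
    obtain ⟨w, rfl⟩ := (P.v_range w).mpr fun hw => Fin.elim0 (hw.2 ▸ i)
    rw [hfv]
    by_cases hu : Γ.IsUnivalentBlack u
    · have hu' : f u = w := by
        rcases hf u with h | ⟨j, -, hj⟩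
        · exact absurd (by rw [h]; exact hu) (P.not_univ (f u))
        · have key : ∀ {y j}, Γ.inp (P.v y) j = Sum.inl u → st.att (P.t u) = some y := fun h =>
            (P.att_iff hst _ _).mpr ⟨u, hu.1, rfl, Or.inr ⟨hu, _, h⟩⟩
          have h1 := key hi
          rw [key hj] at h1
          exact Option.some_injective _ h1
      rw [hu']
    · obtain ⟨u, rfl⟩ := (P.v_range u).mpr hu
      rw [hfv]
      exact reachable_of_rel ((P.exists_inp_iff u w).mpr ⟨i, hi⟩)
  · intro h
    refine connected_of_map P.v (fun u w h => reachable_of_rel ((P.exists_inp_iff u w).mp h))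
      (fun x => ⟨f x, ?_⟩) h
    rcases hf x with h | ⟨i, -, h⟩
    · rw [h]
    · exact (reachable_of_rel ⟨i, h⟩).symm

end Pres

/-- A map between finite sets of equal size is bijective if all elements but one have exactly one
preimage. -/
theorem bijective_of_existsUnique {S V : Type*} [Finite S] [Finite V] {f : S → V}
    (hc : Nat.card S = Nat.card V) (v : V) (h : ∀ y, y ≠ v → ∃! s, f s = y) :
    Function.Bijective f := by
  have hs : Function.Surjective f := by
    by_contra hs
    have hv : ∀ s, f s ≠ v := fun s hsv => hs fun y => by
      by_cases e : y = v
      · exact ⟨s, hsv.trans e.symm⟩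
      · exact (h y e).exists
    have hi : Function.Injective f := fun s s' e => (h (f s') (hv s')).unique e rfl
    exact hs ((Function.Injective.bijective_of_nat_card_le hi hc.ge).2)
  exact (Nat.bijective_iff_surjective_and_card f).mpr ⟨hs, hc⟩

namespace Diagram

variable {Γ : Diagram p q} {v : Γ.V} {g : Diagram (Γ.ar v) 1}

theorem Proper.card_slots (h : Γ.Proper) :
    Nat.card (Γ.skel h.out_not).S + q = Nat.card (Γ.skel h.out_not).V + p := by
  have := Nat.card_congr (Equiv.ofBijective _ (skel_good h.out_not h).feed)
  simpa only [Nat.card_sum, Nat.card_fin] using this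

theorem subst_branch (hΓ : Γ.Proper) (hΓ' : (Γ.subst v g).Proper) (hv : ¬ Γ.IsUnivalentBlack v)
    (hg : ¬ g.IsUnivalentBlack (g.out 0))
    (h : ∀ x, ¬ (Γ.subst v g).IsUnivalentBlack x → ∃! i, (Γ.subst v g).Thick x i) (x : Γ.V)
    (hx : ¬ Γ.IsUnivalentBlack x) : ∃! i, Γ.Thick x i := by
  have h1 := (skelPres hΓ'.out_not hΓ').branch_iff.mp h
  have h2 := Nat.card_congr (Equiv.ofBijective _ h1)
  have h3 := hΓ'.card_slots
  have h4 := hΓ.card_slots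
  refine (skelPres hΓ.out_not hΓ).branch_iff.mpr
    (bijective_of_existsUnique (by omega) ⟨v, hv⟩ fun y hy => ?_) x hx
  rw [← (skelPres hΓ.out_not hΓ).existsUnique_thick_iff]
  have hyv : y.1 ≠ v := fun e => hy (Subtype.ext e)
  obtain ⟨i, hi, hu⟩ := h (Sum.inr ⟨y.1, hyv⟩) y.2
  exact ⟨i, (subst_thick_inr hv hg ⟨y.1, hyv⟩ i).mp hi,
    fun i' hi' => hu i' ((subst_thick_inr hv hg ⟨y.1, hyv⟩ i').mpr hi')⟩

theorem subst_mixed (hΓ : Γ.Proper) (hΓ' : (Γ.subst v g).Proper) (hv : ¬ Γ.IsUnivalentBlack v)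
    (h : Heavy (Γ.black v) g) (hm : Γ.Mixed) : (Γ.subst v g).Mixed :=
  ⟨subst_light h hm, fun h' => hm.branch (subst_branch hΓ hΓ' hv h.out_not h')⟩

end Diagram

/-! ### The filtration by the number of vertices -/

/-- The part of degree `k` of the complex that is spanned by the graphs with at least `s` vertices,
not counting the univalent black ones. -/
def filtration (p q s k : ℕ) : Submodule ℝ (Space p q) :=
  Submodule.span ℝ {x | ∃ Γ : Diagram p q, Γ.IsAGraph ∧ Γ.Connected ∧ Γ.numBlack = k ∧ Γ.Mixed ∧
    s ≤ Γ.numCore ∧ x = cls Γ}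

theorem filtration_anti {s s' k : ℕ} (h : s ≤ s') : filtration p q s' k ≤ filtration p q s k :=
  Submodule.span_mono fun _ ⟨Γ, h1, h2, h3, h4, h5, h6⟩ => ⟨Γ, h1, h2, h3, h4, h.trans h5, h6⟩

namespace Marking

theorem cls_mem {st : Marking K} (hK : K.Connected) (hm : K.Mixed) {s k : ℕ}
    (hk : st.labels.card = k) (hs : s ≤ Nat.card K.V) : st.cls ∈ filtration p q s k := by
  by_cases hst : st.Good
  · obtain ⟨Γ, hA, ⟨P⟩⟩ := hst.exists_pres
    rw [P.cls_eq hst hA.pos_injective]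
    exact Submodule.smul_mem _ _ (Submodule.subset_span ⟨Γ, hA, (P.connected_iff hst).mpr hK,
      (P.numBlack_eq hst).trans hk, P.mixed_iff.mpr hm, hs.trans P.numCore_eq.ge, rfl⟩)
  · rw [cls_of_not_good hst]
    exact zero_mem _

theorem Good.setMark_del_labels {st : Marking K} (hst : st.Good) {τ : ℤ} {y : K.V}
    (hτ : st.att τ = some y) (y') (m) :
    ((st.del τ).setMark y' m).labels.card + 1 = st.labels.card := by
  have h : st.att τ ≠ none := by simp [hτ]
  rw [setMark_labels, hst.del_labels h]
  exact Finset.card_erase_add_one (hst.mem_labels.mpr (Or.inr h))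

theorem Good.hnet_mem {st : Marking K} (hst : st.Good) (hK : K.Connected) (hm : K.Mixed) {s k : ℕ}
    (hk : st.labels.card = k + 1) (hs : s ≤ Nat.card K.V) : st.hnet ∈ filtration p q s k := by
  obtain ⟨z, hf⟩ := hst.exists_fresh
  refine Submodule.sum_mem _ fun τ _ => Submodule.smul_mem _ _ (hatWith_mem _ hf fun y m h _ => ?_)
  exact cls_mem hK hm (by have := hst.setMark_del_labels h y m; omega) hs

theorem Good.hnet_eq_zero {st : Marking K} (hst : st.Good) (hk : st.labels.card = 0) :
    st.hnet = 0 := by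
  refine Finset.sum_eq_zero fun τ hτ => ?_
  have := hst.mem_labels.mpr (Or.inr (hst.mem_active.mp hτ))
  rw [Finset.card_eq_zero.mp hk] at this
  exact absurd this (Finset.notMem_empty τ)

end Marking

/-- A graph among the generators of `filtration`, as a marking of its skeleton. -/
theorem exists_marking {Γ : Diagram p q} (hA : Γ.IsAGraph) (hc : Γ.Connected) (hm : Γ.Mixed) :
    ∃ (K : Skeleton p q) (st : Marking K), st.Good ∧ K.Connected ∧ K.Mixed ∧
      st.labels.card = Γ.numBlack ∧ Nat.card K.V = Γ.numCore ∧ st.cls = cls Γ := by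
  obtain ⟨x, hx, -⟩ := hm.light
  have hp := hc.proper hA hx
  have hg := skel_good hp.out_not hp
  have P := skelPres hp.out_not hp
  exact ⟨_, _, hg, (P.connected_iff hg).mp hc, P.mixed_iff.mp hm, (P.numBlack_eq hg).symm,
    P.numCore_eq.symm, skelMark_cls hp.out_not hp⟩

theorem hSpace_mem {s k : ℕ} {x : Space p q} (hx : x ∈ filtration p q s (k + 1)) :
    hSpace p q x ∈ filtration p q s k := by
  induction hx using Submodule.span_induction with
  | mem x h =>
    obtain ⟨Γ, h1, h2, h3, h4, h5, rfl⟩ := h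
    obtain ⟨K, st, g1, g2, g3, g4, g5, g6⟩ := exists_marking h1 h2 h4
    rw [← g6, g1.hSpace_cls]
    exact g1.hnet_mem g2 g3 (g4.trans h3) (h5.trans g5.ge)
  | zero => rw [map_zero]; exact zero_mem _
  | add x y _ _ hx hy => rw [map_add]; exact add_mem hx hy
  | smul t x _ hx => rw [map_smul]; exact Submodule.smul_mem _ _ hx

theorem hSpace_eq_zero {s : ℕ} {x : Space p q} (hx : x ∈ filtration p q s 0) :
    hSpace p q x = 0 := by
  induction hx using Submodule.span_induction with
  | mem x h =>
    obtain ⟨Γ, h1, h2, h3, h4, h5, rfl⟩ := h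
    obtain ⟨K, st, g1, g2, g3, g4, g5, g6⟩ := exists_marking h1 h2 h4
    rw [← g6, g1.hSpace_cls]
    exact g1.hnet_eq_zero (g4.trans h3)
  | zero => rw [map_zero]
  | add x y _ _ hx hy => rw [map_add, hx, hy, add_zero]
  | smul t x _ hx => rw [map_smul, hx, smul_zero]

variable {C : (n : ℕ) → Diagram n 1 →₀ ℝ} (hC : IsCompletion C)
include hC

/-- The terms of the differential other than the leading ones increase the number of vertices. -/
theorem substL_mem {Γ : Diagram p q} (hA : Γ.IsAGraph) (hc : Γ.Connected) (hm : Γ.Mixed) {s k : ℕ}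
    (hk : Γ.numBlack = k) (hs : s ≤ Γ.numCore) (v : Γ.V) :
    substL Γ v (vertexDiff C (Γ.black v) (Γ.ar v) - leading (Γ.black v) (Γ.ar v)) ∈
      filtration p q (s + 1) (k + 1) := by
  by_cases hv : Γ.IsUnivalentBlack v
  · have h0 : vertexDiff C (Γ.black v) (Γ.ar v) - leading (Γ.black v) (Γ.ar v) = 0 := by
      rw [hv.1, hv.2]
      exact sub_self _
    rw [h0, map_zero]
    exact zero_mem _
  have hmem := vertexDiff_sub_leading_mem hC (Γ.black v) (Γ.ar v) (hA.3 v)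
  generalize vertexDiff C (Γ.black v) (Γ.ar v) - leading (Γ.black v) (Γ.ar v) = x at hmem ⊢
  induction hmem using Submodule.span_induction with
  | mem x h =>
    obtain ⟨g, hg, rfl⟩ := h
    rw [substL_single, one_smul]
    by_cases hA' : (Γ.subst v g).IsAGraph
    · have hc' := subst_connected hc hg.connected hg.leg
      have h1 := subst_numBlack (Γ := Γ) (v := v) (g := g)
      have h2 := subst_numCore (g := g) hv
      have h3 := hg.numBlack
      have h4 := hg.numCore
      obtain ⟨x, hx, -⟩ := subst_light hg hm
      exact Submodule.subset_span ⟨_, hA', hc', by omega,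
        subst_mixed (hc.proper hA hv) (hc'.proper hA' hx) hv hg hm, by omega, rfl⟩
    · rw [cls_eq_zero hA']
      exact zero_mem _
  | zero => rw [map_zero]; exact zero_mem _
  | add x y _ _ hx hy => rw [map_add]; exact add_mem hx hy
  | smul t x _ hx => rw [map_smul]; exact Submodule.smul_mem _ _ hx

/-- Up to terms with more vertices, the differential is given by `Marking.dnet`. -/
theorem dSpace_sub_dnet_mem {st : Marking K} (hK : K.Connected) (hm : K.Mixed) {z : ℤ}
    (hf : st.Fresh z) {s k : ℕ} (hk : st.labels.card = k) (hs : s ≤ Nat.card K.V) :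
    dSpace hC p q st.cls - st.dnet z ∈ filtration p q (s + 1) (k + 1) := by
  by_cases hst : st.Good
  · obtain ⟨Γ, hA, ⟨P⟩⟩ := hst.exists_pres
    rw [P.cls_eq hst hA.pos_injective, map_smul, dSpace_cls, ← P.sum_leading hst hA hf, dGraph,
      if_pos hA, ← smul_sub, ← Finset.sum_sub_distrib]
    simp only [← smul_sub, ← map_sub]
    exact Submodule.smul_mem _ _ (Submodule.sum_mem _ fun v _ => Submodule.smul_mem _ _
      (substL_mem hC hA ((P.connected_iff hst).mpr hK) (P.mixed_iff.mpr hm)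
        ((P.numBlack_eq hst).trans hk) (hs.trans P.numCore_eq.ge) v))
  · have h0 : st.dnet z = 0 := Finset.sum_eq_zero fun y _ => Marking.dAt_of_not_good hf hst
    rw [Marking.cls_of_not_good hst, h0, map_zero, sub_zero]
    exact zero_mem _

end

noncomputable section

variable {p q n m : ℕ} {K : Skeleton p q}

/-! ### Acyclicity -/

theorem Skeleton.weight_le (K : Skeleton p q) : K.weight ≤ Nat.card K.V := by
  rw [Nat.card_eq_fintype_card]
  exact Finset.card_le_univ _

theorem Skeleton.Mixed.weight_pos (h : K.Mixed) : 1 ≤ K.weight := by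
  obtain ⟨y, hy⟩ := h.light
  exact Finset.card_pos.mpr ⟨y, Finset.mem_filter.mpr ⟨Finset.mem_univ y, hy⟩⟩

section Complex

variable {C : (n : ℕ) → Diagram n 1 →₀ ℝ} (hC : IsCompletion C)

/-- The anticommutator of the differential and the homotopy. -/
def laplace (p q : ℕ) : Space p q →ₗ[ℝ] Space p q :=
  dSpace hC p q ∘ₗ hSpace p q + hSpace p q ∘ₗ dSpace hC p q

theorem laplace_apply (x : Space p q) :
    laplace hC p q x = dSpace hC p q (hSpace p q x) + hSpace p q (dSpace hC p q x) := rfl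

theorem laplace_eq_of_cycle {x : Space p q} (hx : dSpace hC p q x = 0) :
    laplace hC p q x = dSpace hC p q (hSpace p q x) := by
  rw [laplace_apply, hx, map_zero, add_zero]

/-- Up to terms with more vertices, the classes of graphs are eigenvectors of `laplace`. -/
theorem laplace_cls {Γ : Diagram p q} (hA : Γ.IsAGraph) (hc : Γ.Connected) (hm : Γ.Mixed) {k : ℕ}
    (hk : Γ.numBlack = k) : ∃ w : ℕ, 1 ≤ w ∧ w ≤ Γ.numCore ∧
      laplace hC p q (cls Γ) - (w : ℝ) • cls Γ ∈ filtration p q (Γ.numCore + 1) k := by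
  obtain ⟨K, st, hst, hK, hKm, h4, h5, h6⟩ := exists_marking hA hc hm
  refine ⟨K.weight, hKm.weight_pos, h5 ▸ K.weight_le, ?_⟩
  rw [← h6]
  rcases hst.reduced_or with hr | h0
  · obtain ⟨z, hf⟩ := hst.exists_fresh
    have h1 : hSpace p q (dSpace hC p q st.cls) - hSpace p q (st.dnet z) ∈
        filtration p q (Γ.numCore + 1) k := by
      rw [← map_sub]
      exact hSpace_mem (dSpace_sub_dnet_mem hC hK hKm hf (h4.trans hk) h5.ge)
    have h2 : dSpace hC p q st.hnet - ∑ τ ∈ st.active, toFront st.labels id τ •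
        st.hatWith (Marking.dnet z) τ ∈ filtration p q (Γ.numCore + 1) k := by
      rw [Marking.hnet, map_sum, ← Finset.sum_sub_distrib]
      refine Submodule.sum_mem _ fun τ _ => ?_
      rw [map_smul, ← smul_sub, Marking.hat, Marking.map_hatWith, ← Marking.hatWith_sub]
      refine Submodule.smul_mem _ _ (Marking.hatWith_mem _ hf fun y m hτ hf' => ?_)
      have h3 := hst.setMark_del_labels hτ y m
      rw [← hk, ← h4, ← h3]
      exact dSpace_sub_dnet_mem hC hK hKm hf' rfl h5.ge
    have h3 := add_mem h1 h2
    rw [laplace_apply, hst.hSpace_cls, ← hst.homotopy hf hr]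
    convert h3 using 1
    abel
  · rw [h0, map_zero, smul_zero, sub_zero]
    exact zero_mem _

theorem dSpace_mem {s k : ℕ} {x : Space p q} (hx : x ∈ filtration p q s k) :
    dSpace hC p q x ∈ filtration p q s (k + 1) := by
  induction hx using Submodule.span_induction with
  | mem x h =>
    obtain ⟨Γ, h1, h2, h3, h4, h5, rfl⟩ := h
    obtain ⟨K, st, hst, hK, hKm, g4, g5, g6⟩ := exists_marking h1 h2 h4
    obtain ⟨z, hf⟩ := hst.exists_fresh
    rw [← g6, ← sub_add_cancel (dSpace hC p q st.cls) (st.dnet z)]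
    refine add_mem (filtration_anti (Nat.le_succ s) (dSpace_sub_dnet_mem hC hK hKm hf (g4.trans h3)
      (h5.trans g5.ge))) (Submodule.sum_mem _ fun y _ => ?_)
    cases hy : K.black y with
    | true =>
      rw [Marking.dAt_of_black hy]
      exact zero_mem _
    | false =>
      obtain ⟨m, t, hm⟩ := hst.exists_insMark hy z
      rw [Marking.dAt_eq hy hm]
      refine Submodule.smul_mem _ _ (Marking.cls_mem hK hKm ?_ (h5.trans g5.ge))
      classical
      rw [Marking.ins_labels hst.finite, Finset.card_insert_of_notMem, g4, h3]
      exact fun h => lt_irrefl _ (hf.lt_labels hst h)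
  | zero => rw [map_zero]; exact zero_mem _
  | add x y _ _ hx hy => rw [map_add]; exact add_mem hx hy
  | smul t x _ hx => rw [map_smul]; exact Submodule.smul_mem _ _ hx

/-- The part of degree `k - 1`, which is zero for `k = 0`. -/
def filtrationPred (p q s : ℕ) : ℕ → Submodule ℝ (Space p q)
  | 0 => ⊥
  | k + 1 => filtration p q s k

theorem hSpace_mem_pred {s : ℕ} : ∀ {k : ℕ} {x : Space p q}, x ∈ filtration p q s k →
    hSpace p q x ∈ filtrationPred p q s k
  | 0, _, hx => hSpace_eq_zero hx
  | _ + 1, _, hx => hSpace_mem hx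

theorem dSpace_mem_pred {s : ℕ} : ∀ {k : ℕ} {x : Space p q}, x ∈ filtrationPred p q s k →
    dSpace hC p q x ∈ filtration p q s k
  | 0, x, hx => by
    rw [(Submodule.mem_bot ℝ).mp hx, map_zero]
    exact zero_mem _
  | _ + 1, _, hx => dSpace_mem hC hx

theorem filtrationPred_anti {s s' : ℕ} (h : s ≤ s') :
    ∀ k, filtrationPred p q s' k ≤ filtrationPred p q s k
  | 0 => le_rfl
  | _ + 1 => filtration_anti h

theorem laplace_mem {s k : ℕ} {x : Space p q} (hx : x ∈ filtration p q s k) :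
    laplace hC p q x ∈ filtration p q s k := by
  rw [laplace_apply]
  exact add_mem (dSpace_mem_pred hC (hSpace_mem_pred hx)) (hSpace_mem (dSpace_mem hC hx))

/-- The product of `laplace - j` for `j = 1, …, i`. -/
def laplaceProd (p q : ℕ) : ℕ → Space p q →ₗ[ℝ] Space p q
  | 0 => LinearMap.id
  | i + 1 => (laplace hC p q - ((i + 1 : ℕ) : ℝ) • LinearMap.id) ∘ₗ laplaceProd p q i

theorem laplaceProd_succ (i : ℕ) (x : Space p q) : laplaceProd hC p q (i + 1) x =
    laplace hC p q (laplaceProd hC p q i x) - ((i + 1 : ℕ) : ℝ) • laplaceProd hC p q i x := rfl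

theorem laplaceProd_mem {s k : ℕ} {x : Space p q} (hx : x ∈ filtration p q s k) :
    ∀ i, laplaceProd hC p q i x ∈ filtration p q s k
  | 0 => hx
  | i + 1 => by
    rw [laplaceProd_succ]
    exact sub_mem (laplace_mem hC (laplaceProd_mem hx i))
      (Submodule.smul_mem _ _ (laplaceProd_mem hx i))

/-- On graphs with `s` vertices the eigenvalues of `laplace` are among `1, …, s`. -/
theorem laplaceProd_cls {Γ : Diagram p q} (hA : Γ.IsAGraph) (hc : Γ.Connected) (hm : Γ.Mixed)
    {k : ℕ} (hk : Γ.numBlack = k) :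
    laplaceProd hC p q Γ.numCore (cls Γ) ∈ filtration p q (Γ.numCore + 1) k := by
  obtain ⟨w, hw1, hw2, hw⟩ := laplace_cls hC hA hc hm hk
  have key : ∀ i, ∃ c : ℝ, laplaceProd hC p q i (cls Γ) - c • cls Γ ∈
      filtration p q (Γ.numCore + 1) k ∧ (w ≤ i → c = 0) := by
    intro i
    induction i with
    | zero =>
      refine ⟨1, ?_, fun h => by omega⟩
      rw [one_smul]
      exact (sub_self (cls Γ)).symm ▸ zero_mem _
    | succ i ih =>
      obtain ⟨c, h1, h2⟩ := ih
      refine ⟨c * (w - ((i + 1 : ℕ) : ℝ)), ?_, fun h => ?_⟩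
      · have h3 := sub_mem (laplace_mem hC h1) (Submodule.smul_mem _ ((i + 1 : ℕ) : ℝ) h1)
        have h4 := add_mem h3 (Submodule.smul_mem _ c hw)
        rw [laplaceProd_succ]
        convert h4 using 1
        rw [map_sub, map_smul]
        module
      · rcases h.lt_or_eq with h | h
        · rw [h2 (by omega), zero_mul]
        · rw [h, sub_self, mul_zero]
  obtain ⟨c, h1, h2⟩ := key Γ.numCore
  rwa [h2 hw2, zero_smul, sub_zero] at h1

theorem laplaceProd_mem_succ {s k : ℕ} {x : Space p q} (hx : x ∈ filtration p q s k) :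
    laplaceProd hC p q s x ∈ filtration p q (s + 1) k := by
  induction hx using Submodule.span_induction with
  | mem x h =>
    obtain ⟨Γ, h1, h2, h3, h4, h5, rfl⟩ := h
    rcases h5.lt_or_eq with h5 | rfl
    · exact laplaceProd_mem hC (Submodule.subset_span ⟨Γ, h1, h2, h3, h4, h5, rfl⟩) s
    · exact laplaceProd_cls hC h1 h2 h4 h3
  | zero => rw [map_zero]; exact zero_mem _
  | add x y _ _ hx hy => rw [map_add]; exact add_mem hx hy
  | smul t x _ hx => rw [map_smul]; exact Submodule.smul_mem _ _ hx

theorem dSpace_dSpace (x : Space p q) : dSpace hC p q (dSpace hC p q x) = 0 :=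
  LinearMap.congr_fun (dSpace_comp hC p q) x

/-- On cycles the product of the operators `laplace - j` is, up to boundaries, the multiplication by
a nonzero number. -/
theorem exists_laplaceProd_eq {s k : ℕ} {x : Space p q} (hx : x ∈ filtration p q s k)
    (hd : dSpace hC p q x = 0) (i : ℕ) : ∃ c : ℝ, c ≠ 0 ∧ ∃ b ∈ filtrationPred p q s k,
      laplaceProd hC p q i x = c • x + dSpace hC p q b := by
  induction i with
  | zero => exact ⟨1, one_ne_zero, 0, zero_mem _, by rw [map_zero, add_zero, one_smul]; rfl⟩
  | succ i ih =>
    obtain ⟨c, hc, b, hb, h⟩ := ih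
    have hcyc : dSpace hC p q (laplaceProd hC p q i x) = 0 := by
      rw [h, map_add, map_smul, hd, smul_zero, dSpace_dSpace, add_zero]
    refine ⟨-(((i + 1 : ℕ) : ℝ) * c), neg_ne_zero.mpr (mul_ne_zero (by positivity) hc),
      hSpace p q (laplaceProd hC p q i x) - ((i + 1 : ℕ) : ℝ) • b,
      sub_mem (hSpace_mem_pred (laplaceProd_mem hC hx i)) (Submodule.smul_mem _ _ hb), ?_⟩
    rw [laplaceProd_succ, laplace_eq_of_cycle hC hcyc, map_sub, map_smul]
    nth_rewrite 2 [h]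
    module

end Complex

/-- The number of vertices is bounded in each degree. -/
theorem numCore_le {Γ : Diagram p q} (hA : Γ.IsAGraph) : Γ.numCore ≤ 2 * Γ.numBlack + p := by
  classical
  have h1 := Fintype.card_congr (Equiv.ofBijective _ hA.feed_bijective)
  simp only [Fintype.card_sum, Fintype.card_sigma, Fintype.card_fin] at h1
  have h2 : Γ.numCore ≤ Fintype.card Γ.V := by
    rw [numCore, ← Nat.card_eq_fintype_card]
    exact Nat.card_le_card_of_injective _ Subtype.val_injective
  have h3 : ∑ v, (if Γ.black v = true then 0 else 3) ≤ ∑ v, Γ.ar v := by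
    refine Finset.sum_le_sum fun v _ => ?_
    split_ifs with hb
    · exact Nat.zero_le _
    · exact hA.three_le_ar v (by simpa using hb)
  have h4 := Finset.card_filter_add_card_filter_not (s := Finset.univ) fun v => Γ.black v = true
  rw [Finset.sum_ite, Finset.sum_const_zero, zero_add, Finset.sum_const, smul_eq_mul] at h3
  have h5 : Γ.numBlack = (Finset.univ.filter fun v => Γ.black v = true).card := by
    rw [numBlack_eq_card]
    rfl
  rw [Finset.card_univ] at h4
  omega

theorem filtration_eq_bot {s k : ℕ} (h : 2 * k + p < s) : filtration p q s k = ⊥ := by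
  refine Submodule.span_eq_bot.mpr ?_
  rintro x ⟨Γ, hA, -, hk, -, hs, -⟩
  have := numCore_le hA
  omega

/-- Every cycle is a boundary. -/
theorem exists_dSpace_eq {C : (n : ℕ) → Diagram n 1 →₀ ℝ} (hC : IsCompletion C) (k : ℕ) :
    ∀ (j s : ℕ), 2 * k + p < s + j → ∀ x ∈ filtration p q s k, dSpace hC p q x = 0 →
      ∃ y ∈ filtrationPred p q s k, dSpace hC p q y = x
  | 0, s, hs, x, hx, _ => by
    rw [filtration_eq_bot (by omega)] at hx
    exact ⟨0, zero_mem _, by rw [(Submodule.mem_bot ℝ).mp hx, map_zero]⟩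
  | j + 1, s, hs, x, hx, hd => by
    obtain ⟨c, hc, b, hb, h⟩ := exists_laplaceProd_eq hC hx hd s
    have hcyc : dSpace hC p q (laplaceProd hC p q s x) = 0 := by
      rw [h, map_add, map_smul, hd, smul_zero, dSpace_dSpace, add_zero]
    obtain ⟨y, hy, hyx⟩ := exists_dSpace_eq hC k j (s + 1) (by omega) _
      (laplaceProd_mem_succ hC hx) hcyc
    refine ⟨c⁻¹ • (y - b), Submodule.smul_mem _ _
      (sub_mem (filtrationPred_anti (Nat.le_succ s) k hy) hb), ?_⟩
    rw [map_smul, map_sub, hyx, h, add_sub_cancel_right, smul_smul, inv_mul_cancel₀ hc, one_smul]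

/-! ### The graphs of the fourth type -/

theorem existsUnique_iff_card {P : Fin n → Prop} :
    (∃! i, P i) ↔ Nat.card {i // ¬ P i} + 1 = n := by
  classical
  have h1 : Nat.card {i // P i} + Nat.card {i // ¬ P i} = n := by
    rw [← Nat.card_sum, Nat.card_congr (Equiv.sumCompl P), Nat.card_fin]
  have h2 : (∃! i, P i) ↔ Nat.card {i // P i} = 1 := by
    rw [Nat.card_eq_one_iff_unique, ← unique_subtype_iff_existsUnique, unique_iff_subsingleton_and_nonempty]
  rw [h2]
  omega

namespace Diagram

variable {Γ : Diagram p q}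

theorem not_thick_iff {x : Γ.V} {i : Fin (Γ.ar x)} :
    ¬ Γ.Thick x i ↔ ∃ u, Γ.inp x i = Sum.inl u ∧ Γ.IsUnivalentBlack u := by
  rw [Thick]
  push Not
  rfl

theorem IsAGraph.thick_of_black (hA : Γ.IsAGraph) {x : Γ.V} (hx : Γ.black x = true)
    (i : Fin (Γ.ar x)) : Γ.Thick x i := fun u hi hu => by
  rw [hA.not_black x i u hi hu] at hx
  cases hx

theorem Mixed.isType4 (hA : Γ.IsAGraph) (hm : Γ.Mixed) : Γ.IsType4 := by
  obtain ⟨x, hx1, hx2⟩ := hm.light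
  refine ⟨fun h => hx1 (h x), fun h => hm.branch fun y hy => ?_, fun h => hx2 (h x)⟩
  rcases h.2 y with ⟨hb, ha⟩ | hu | ⟨hw, ha, hc⟩
  · rw [existsUnique_iff_card, Nat.card_eq_zero.mpr (Or.inl ⟨fun i => i.2 (hA.thick_of_black hb i.1)⟩),
      ha]
  · exact absurd hu hy
  · rw [existsUnique_iff_card]
    simp only [not_thick_iff]
    rw [hc, ha]

/-- A connected graph of the fourth type is mixed, unless some white vertex has three univalent
black vertices attached to it. -/
theorem IsType4.mixed_or (h4 : Γ.IsType4) (hA : Γ.IsAGraph) (hc : Γ.Connected) :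
    Γ.Mixed ∨ cls Γ = 0 := by
  obtain ⟨h1, h2, h3⟩ := h4
  have h2' : ¬ ∀ v, (Γ.black v = true ∧ Γ.ar v = 1) ∨ Γ.IsUnivalentBlack v ∨
    (Γ.black v = false ∧ Γ.ar v = 3 ∧
      Nat.card {i : Fin (Γ.ar v) // ∃ u, Γ.inp v i = Sum.inl u ∧ Γ.IsUnivalentBlack u} = 2) :=
    fun h => h2 ⟨h1, h⟩
  rw [IsType1] at h1
  rw [IsType3] at h3
  push Not at h1
  obtain ⟨x, hx⟩ := h1
  have hp := hc.proper hA hx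
  rw [or_iff_not_imp_right]
  intro h0
  refine ⟨?_, fun hB => h2' fun v => ?_⟩
  · obtain ⟨v, hv⟩ := not_forall.mp h3
    by_cases hu : Γ.IsUnivalentBlack v
    · obtain ⟨w, i, hi⟩ := hc.exists_inp (x := x) hu fun e => hx (e ▸ hu)
      have hw := hA.not_black w i v hi hu
      have hw' : Γ.black w ≠ true := by simp [hw]
      exact ⟨w, fun h => hw' h.1, fun h => hw' h.1⟩
    · exact ⟨v, hu, hv⟩
  · by_cases hu : Γ.IsUnivalentBlack v
    · exact Or.inr (Or.inl hu)
    have hv := existsUnique_iff_card.mp (hB v hu)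
    cases hb : Γ.black v with
    | true =>
      rw [Nat.card_eq_zero.mpr (Or.inl ⟨fun i => i.2 (hA.thick_of_black hb i.1)⟩)] at hv
      exact Or.inl ⟨rfl, hv.symm⟩
    | false =>
      refine Or.inr (Or.inr ⟨rfl, ?_⟩)
      simp only [not_thick_iff] at hv
      have har : Γ.ar v = 3 := by
        have P := skelPres hp.out_not hp
        have hst := skel_good hp.out_not hp
        have hcls := skelMark_cls hp.out_not hp
        obtain ⟨y, rfl⟩ := (P.v_range v).mpr hu
        have hcard : ¬ 2 ≤ ((Γ.skel hp.out_not).slotsAt y).card := by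
          obtain ⟨z, hz, hzu⟩ := (P.existsUnique_thick_iff y).mp (hB _ hu)
          have : (Γ.skel hp.out_not).slotsAt y = {z} := by
            ext z'
            rw [Skeleton.mem_slotsAt, Finset.mem_singleton]
            exact ⟨hzu z', fun e => e ▸ hz⟩
          simp [this]
        obtain ⟨m, hm⟩ := Option.ne_none_iff_exists'.mp fun h : (Γ.skelMark hp.out_not).mark y = none => by
          rw [(P.mark_iff y).mp h] at hb
          cases hb
        rcases (hst.reduced_or.resolve_right (by rwa [hcls])) y m hm with h | ⟨z, τ₁, τ₂, -, -, hτ⟩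
        · exact absurd h hcard
        have hle : Nat.card {i : Fin (Γ.ar (P.v y)) // ∃ u, Γ.inp (P.v y) i = Sum.inl u ∧
            Γ.IsUnivalentBlack u} ≤ 2 := by
          have hlab : ∀ i : {i : Fin (Γ.ar (P.v y)) // ∃ u, Γ.inp (P.v y) i = Sum.inl u ∧
              Γ.IsUnivalentBlack u}, ∃ b : Bool, P.lab (P.v y) i = Sum.inr (bif b then τ₁ else τ₂) := by
            rintro ⟨i, hi⟩
            cases hl : P.lab (P.v y) i with
            | inl z => exact absurd (P.thick_of_lab_inl hl) (not_thick_iff.mpr hi)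
            | inr τ =>
              rcases (hτ τ).mp (P.lab_inr y i τ hl).2.1 with rfl | rfl
              · exact ⟨true, rfl⟩
              · exact ⟨false, rfl⟩
          choose F hF using hlab
          have := Nat.card_le_card_of_injective F fun i i' e => Subtype.ext (P.lab_inj y (by
            rw [hF, hF, e]))
          simpa using this
        have := hA.three_le_ar _ hb
        omega
      refine ⟨har, ?_⟩
      omega

end Diagram

theorem G4_eq (p q k : ℕ) : G4 p q k = filtration p q 0 k := by
  refine le_antisymm (Submodule.span_le.mpr ?_) (Submodule.span_mono ?_)
  · rintro x ⟨Γ, hA, hc, hk, h4, rfl⟩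
    rcases h4.mixed_or hA hc with hm | h0
    · exact Submodule.subset_span ⟨Γ, hA, hc, hk, hm, Nat.zero_le _, rfl⟩
    · rw [h0]
      exact zero_mem _
  · rintro x ⟨Γ, hA, hc, hk, hm, -, rfl⟩
    exact ⟨Γ, hA, hc, hk, hm.isType4 hA, rfl⟩

end

end GraphComplex

open GraphComplex in
theorem theorem2 (C : (n : ℕ) → Diagram n 1 →₀ ℝ) (hC : IsCompletion C) :
    ∃ d : (p q : ℕ) → Space p q →ₗ[ℝ] Space p q,
      (∀ p q x, d p q ((relations p q).mkQ x) = (relations p q).mkQ (graphDiff C p q x)) ∧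
      (∀ p q, d p q ∘ₗ d p q = 0) ∧
      ∀ p q : ℕ,
        (∀ k, ∀ x ∈ G4 p q k, d p q x ∈ G4 p q (k + 1)) ∧
        (∀ x ∈ G4 p q 0, d p q x = 0 → x = 0) ∧
        (∀ k, ∀ x ∈ G4 p q (k + 1), d p q x = 0 → ∃ y ∈ G4 p q k, d p q y = x) := by
  refine ⟨dSpace hC, fun _ _ => dSpace_mkQ hC, dSpace_comp hC, fun p q => ?_⟩
  simp only [G4_eq]
  refine ⟨fun k x hx => dSpace_mem hC hx, fun x hx hd => ?_, fun k x hx hd => ?_⟩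
  · obtain ⟨y, hy, rfl⟩ := exists_dSpace_eq hC 0 (2 * 0 + p + 1) 0 (by omega) x hx hd
    rw [(Submodule.mem_bot ℝ).mp hy, map_zero]
  · exact exists_dSpace_eq hC (k + 1) (2 * (k + 1) + p + 1) 0 (by omega) x hx hd
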